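/- \textbf{Setting.} Let $(M,g)$ be a smooth, Hausdorff, compact, $d$-dimensional Riemannian manifold (without boundary) with Riemannian density $d\mu$, Christoffel symbols $\Gamma^k_{ij}$ and $|g|=\det(g_{ij})$. Let $(x,\xi)\mapsto \mathfrak f_x(\xi)\in T_xM$ be $C^1$ on $M\times\mathbb R$ with $\mathfrak f_\cdot(\xi)$ a smooth vector field for every $\xi$. Let $(x,\xi)\mapsto A_x(\xi)$ and $(x,\xi)\mapsto\sigma_x(\xi)$ be of class $C^1$ and $C^2$ respectively, with values in the $(1,1)$-tensors (endomorphisms of $T_xM$), with $A_\cdot(\xi)$, $\sigma_\cdot(\xi)$ smooth tensor fields for every $\xi$, and $$A'_x(\xi)=\sigma_x(\xi)^\top\sigma_x(\xi),\qquad \mathrm{Div}\,\mathfrak f_x(\xi)=\mathrm{Div}\,\mathrm{Div}\,A_x(\xi)\quad\text{for every }\xi\in\mathbb R,$$ where $'=\partial_\xi$, $\top$ is the transpose with respect to $g$, and in coordinates (summation convention) $\mathrm{Div}\,X=\partial_kX^k+\Gamma^j_{kj}X^k$ for vector fields, $\mathrm{Div}\,\omega=g^{ij}\partial_i\omega_j-\Gamma^k_{il}g^{il}\omega_k$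 for one-forms, $(\mathrm{Div}\,T)_i=\partial_jT^j_i+\Gamma^j_{jl}T^l_i-\Gamma^l_{ji}T^j_l$ for $(1,1)$-tensors. The underlying equation is $\partial_tu+\mathrm{Div}\,\mathfrak f_x(u)=\mathrm{Div}\,\mathrm{Div}\,A_x(u)$, $u|_{t=0}=u_0$. \textbf{Mollifiers.} Fix non-negative $\omega_1,\omega_2\in C_c^\infty(\mathbb R)$ with integral $1$ and $\mathrm{supp}\,\omega_1\subseteq(-1,0)$, and put $$\rho_{\varepsilon,\delta}(t,x,\xi)=\frac1{\varepsilon^{d+1}\delta}\,\omega_1(\xi/\delta)\,\omega_1(t/\varepsilon)\prod_{j=1}^d\omega_2(x_j/\varepsilon).$$ Functions and measures on $[0,\infty)\times M\times[0,\infty)$ are identified with distributions via $dt\,d\mu(x)\,d\xi$. For a distribution $F$ on $[0,\infty)\times M\times[0,\infty)$ supported in a chart $(U_\alpha,\psi_\alpha)$, compactly in the $M$-direction, put $F^{\varepsilon,\delta}=((F\circ\psi_\alpha^{-1})\star\rho_{\varepsilon,\delta})\circ\psi_\alpha$, where $F\circ\psi_\alpha^{-1}$ is the pullback of $F$ as a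 generalized function and $(G\star\rho_{\varepsilon,\delta})(t,y,\xi)=\langle G,\rho_{\varepsilon,\delta}(t-\cdot,y-\cdot,\xi-\cdot)\rangle$. \textbf{Kinetically admissible sets.} Consider tuples $(\chi,u_0,m,n)$ where $\chi:[0,\infty)\times M\times[0,\infty)\to[0,1]$ is measurable, compactly supported in $\xi$ uniformly in $(t,x)$, and non-increasing in $\xi$; $u_0:M\to[0,1]$ is measurable; and $m,n$ are non-negative Radon measures on $[0,\infty)\times M\times[0,\infty)$. A set $\mathcal F$ of such tuples is \emph{kinetically admissible} if: (i) for every $(\chi,u_0,m,n)\in\mathcal F$, $$\partial_t\chi+\mathrm{Div}(\chi\,\mathfrak f'_x(\xi))=\mathrm{Div}\,\mathrm{Div}(\chi A'_x(\xi))+\partial_\xi(n+m)$$ in the sense of distributions on $(0,\infty)\times M\times(0,\infty)$, and $\chi(0,x,\xi)=\mathrm{sgn}_+(u_0(x)-\xi)$ in the weak sense: for every $\varphi\in C_c^\infty(M\times\mathbb R)$, $$\operatorname*{ess\,lim}_{t\to0+}\int_{M\times[0,\infty)}\chi(t,x,\xi)\varphi(x,\xi)\,d\mu\,d\xi=\int_{M\times[0,\infty)}\mathrm{sgn}_+(u_0(x)-\xi)\varphi(x,\xi)\,d\mu\,d\xi;$$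 (ii) for any two tuples $(\chi,u_0,m,n),(\tilde\chi,v_0,\tilde m,\tilde n)\in\mathcal F$ there are a finite atlas $(U_\alpha,\psi_\alpha)_{\alpha=1}^k$ of $M$, non-negative $\phi_\alpha\in C_c^\infty(U_\alpha)$ with $\sum_\alpha\phi_\alpha^2=1$, and constants $C_\alpha$ such that for every $\alpha$ and almost every $t\ge 0$, writing $Q_t=[0,t)\times M\times[0,\infty)$, $$\begin{aligned}\limsup_{\varepsilon\to0}\limsup_{\delta\to0}\Big[&\int_{Q_t}\Big((\phi_\alpha\partial_\xi(m+n))^{\varepsilon,\delta}(\phi_\alpha(1-\tilde\chi))^{\varepsilon,\delta}-(\phi_\alpha\partial_\xi(\tilde m+\tilde n))^{\varepsilon,\delta}(\phi_\alpha\chi)^{\varepsilon,\delta}\Big)dt\,d\mu\,d\xi\\&+\int_{Q_t}(\mathrm{Div}\,\mathrm{Div}(\phi_\alpha\chi A'))^{\varepsilon,\delta}(\phi_\alpha(1-\tilde\chi))^{\varepsilon,\delta}dt\,d\mu\,d\xi\\&+\int_{Q_t}(\mathrm{Div}\,\mathrm{Div}(\phi_\alpha(1-\tilde\chi)A'))^{\varepsilon,\delta}(\phi_\alpha\chi)^{\varepsilon,\delta}dt\,d\mu\,d\xi\Big]\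 \le\ C_\alpha\int_{Q_t}\chi(1-\tilde\chi)\,dt\,d\mu\,d\xi,\end{aligned}$$ where the integrands on the left are understood to vanish outside $U_\alpha$. \textbf{Theorem.} Let $\mathcal F$ be a kinetically admissible set and let $(\chi,u_0,m,n),(\tilde\chi,v_0,\tilde m,\tilde n)\in\mathcal F$ with $u_0=v_0$ almost everywhere. Then $\chi=\tilde\chi$ almost everywhere on $[0,\infty)\times M\times[0,\infty)$, and there is $u\in L^\infty([0,\infty)\times M)$ such that $\chi=\chi_u$ almost everywhere, where $\chi_u(t,x,\xi)=1$ if $0\le\xi\le u(t,x)$, $\chi_u=-1$ if $u(t,x)\le\xi\le0$ (and the first case does not hold), $\chi_u=0$ otherwise; that is, $\chi(t,x,\xi)=\mathrm{sgn}_+(u(t,x)-\xi)$ for almost every $(t,x,\xi)\in[0,\infty)\times M\times[0,\infty)$. -/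

import Mathlib

open Set Filter Topology MeasureTheory
open scoped Manifold ContDiff

noncomputable section

namespace KineticManifold

/-- The model space `ℝ^d`. -/
abbrev Eu (d : ℕ) := EuclideanSpace ℝ (Fin d)

/-- The `i`-th standard basis vector of `ℝ^d`. -/
def stdVec {d : ℕ} (i : Fin d) : Eu d := EuclideanSpace.single i (1 : ℝ)

/-- The partial derivative `∂_i h` of a function on (an open subset of) `ℝ^d`. -/
def pd {d : ℕ} (i : Fin d) (h : Eu d → ℝ) (y : Eu d) : ℝ := fderiv ℝ h y (stdVec i)

section Geometry

variable {d : ℕ} {M : Type*} [TopologicalSpace M] [ChartedSpace (Eu d) M]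

/-- A (1,1)-tensor field, as a field of endomorphisms of the tangent spaces
(`T = T^k_i ∂_k ⊗ dx^i` acts by `(T X)^k = T^k_i X^i`). -/
abbrev TensorField (d : ℕ) (M : Type*) [TopologicalSpace M] [ChartedSpace (Eu d) M] :=
  (x : M) → (TangentSpace (𝓡 d) x →L[ℝ] TangentSpace (𝓡 d) x)

/-- A vector field. -/
abbrev VecField (d : ℕ) (M : Type*) [TopologicalSpace M] [ChartedSpace (Eu d) M] :=
  (x : M) → TangentSpace (𝓡 d) x

variable (d M) in
/-- A smooth Riemannian metric on `M`. -/
abbrev Metric [IsManifold (𝓡 d) ∞ M] :=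
  Bundle.ContMDiffRiemannianMetric (𝓡 d) ∞ (Eu d) (fun x : M => TangentSpace (𝓡 d) x)

/-- The coordinate vector field `∂_i` of the chart `e`, at the point with coordinates `y`. -/
def coordVec (e : OpenPartialHomeomorph M (Eu d)) (i : Fin d) (y : Eu d) :
    TangentSpace (𝓡 d) (e.symm y) :=
  mfderiv (𝓡 d) (𝓡 d) e.symm y (stdVec i)

/-- The `k`-th component in the chart `e` of a tangent vector at the point with coordinates `y`. -/
def component (e : OpenPartialHomeomorph M (Eu d)) (k : Fin d) (y : Eu d)
    (v : TangentSpace (𝓡 d) (e.symm y)) : ℝ :=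
  (EuclideanSpace.proj k : Eu d →L[ℝ] ℝ) (mfderiv (𝓡 d) (𝓡 d) e (e.symm y) v)

/-- `X^k` in the chart `e`. -/
def vecComp (e : OpenPartialHomeomorph M (Eu d)) (X : VecField d M) (k : Fin d) (y : Eu d) : ℝ :=
  component e k y (X (e.symm y))

/-- `T^k_i` in the chart `e`. -/
def tensComp (e : OpenPartialHomeomorph M (Eu d)) (T : TensorField d M) (k i : Fin d)
    (y : Eu d) : ℝ :=
  component e k y (T (e.symm y) (coordVec e i y))

variable [IsManifold (𝓡 d) ∞ M] (g : Metric d M)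

/-- The matrix `g_{ij}` in the chart `e`. -/
def gram (e : OpenPartialHomeomorph M (Eu d)) (y : Eu d) : Matrix (Fin d) (Fin d) ℝ :=
  Matrix.of fun i j => g.inner (e.symm y) (coordVec e i y) (coordVec e j y)

/-- The inverse matrix `g^{ij}`. -/
def gramInv (e : OpenPartialHomeomorph M (Eu d)) (i j : Fin d) (y : Eu d) : ℝ :=
  (gram g e y)⁻¹ i j

/-- `√|g| = √|det g_{ij}|`. -/
def sqrtDet (e : OpenPartialHomeomorph M (Eu d)) (y : Eu d) : ℝ :=
  Real.sqrt |(gram g e y).det|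

/-- The Christoffel symbol `Γ^k_{ij}` of the Levi-Civita connection. -/
def christoffel (e : OpenPartialHomeomorph M (Eu d)) (k i j : Fin d) (y : Eu d) : ℝ :=
  (1 / 2) * ∑ l, gramInv g e k l y *
    (pd i (fun z => gram g e z j l) y + pd j (fun z => gram g e z i l) y
      - pd l (fun z => gram g e z i j) y)

/-- `Div X = ∂_k X^k + Γ^j_{kj} X^k`. -/
def divVec (e : OpenPartialHomeomorph M (Eu d)) (X : VecField d M) (y : Eu d) : ℝ :=
  ∑ k, (pd k (vecComp e X k) y + ∑ j, christoffel g e j k j y * vecComp e X k y)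

/-- `Div η = g^{ij} ∂_i η_j - Γ^k_{il} g^{il} η_k` for a one-form `η = η_i dx^i`. -/
def divForm (e : OpenPartialHomeomorph M (Eu d)) (η : Fin d → Eu d → ℝ) (y : Eu d) : ℝ :=
  (∑ i, ∑ j, gramInv g e i j y * pd i (η j) y)
    - ∑ k, ∑ i, ∑ l, christoffel g e k i l y * gramInv g e i l y * η k y

/-- `(Div T)_i = ∂_j T^j_i + Γ^j_{jl} T^l_i - Γ^l_{ji} T^j_l` for a (1,1)-tensor field. -/
def divTensor (e : OpenPartialHomeomorph M (Eu d)) (T : TensorField d M) (i : Fin d)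
    (y : Eu d) : ℝ :=
  (∑ j, pd j (tensComp e T j i) y)
    + (∑ j, ∑ l, christoffel g e j j l y * tensComp e T l i y)
    - ∑ j, ∑ l, christoffel g e l j i y * tensComp e T j l y

/-- `Div (Div T)` for a (1,1)-tensor field. -/
def divDiv (e : OpenPartialHomeomorph M (Eu d)) (T : TensorField d M) (y : Eu d) : ℝ :=
  divForm g e (divTensor g e T) y

/-- `(∇ h)^i = g^{ij} ∂_j h`, for a function `h` given in coordinates. -/
def gradComp (e : OpenPartialHomeomorph M (Eu d)) (h : Eu d → ℝ) (i : Fin d) (y : Eu d) : ℝ :=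
  ∑ j, gramInv g e i j y * pd j h y

/-- `(∇_k ∇ h)^i = ∂_k (∇ h)^i + Γ^i_{kl} (∇ h)^l`, for a function `h` given in coordinates. -/
def covHess (e : OpenPartialHomeomorph M (Eu d)) (h : Eu d → ℝ) (i k : Fin d) (y : Eu d) : ℝ :=
  pd k (gradComp g e h i) y + ∑ l, christoffel g e i k l y * gradComp g e h l y

/-- The Riemannian density `dμ = √|g| dx`. Each chart `e` carries the measure `√|g| dx` on its
domain, and these measures agree on overlaps; the Riemannian measure is obtained by glueing them,
i.e. it is the smallest measure that dominates all of them. -/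
def riemMeasure [MeasurableSpace M] : Measure M :=
  ⨆ e ∈ IsManifold.maximalAtlas (𝓡 d) ∞ M,
    Measure.map e.symm
      ((volume.restrict e.target).withDensity (fun y => ENNReal.ofReal (sqrtDet g e y)))

/-- The measure `dt dμ(x) dξ`. -/
def kinMeasure [MeasurableSpace M] : Measure (ℝ × M × ℝ) :=
  (volume : Measure ℝ).prod ((riemMeasure g).prod (volume : Measure ℝ))

end Geometry

/-! ### Standing assumptions on the equation -/

section Coefficients

variable {d : ℕ} {M : Type*} [TopologicalSpace M] [ChartedSpace (Eu d) M]
  [IsManifold (𝓡 d) ∞ M]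

/-- The standing assumptions on the flux `f`, the diffusion tensor `A` and its square root `σ`. -/
structure IsCoefficients (g : Metric d M) (f : (x : M) → ℝ → TangentSpace (𝓡 d) x)
    (A σ : (x : M) → ℝ → (TangentSpace (𝓡 d) x →L[ℝ] TangentSpace (𝓡 d) x)) : Prop where
  /-- `(x, ξ) ↦ f_x(ξ)` is `C^1`. -/
  flux_C1 : ContMDiff ((𝓡 d).prod 𝓘(ℝ, ℝ)) (𝓡 d).tangent 1
    (fun p : M × ℝ => (⟨p.1, f p.1 p.2⟩ : TangentBundle (𝓡 d) M))
  /-- `f_x(ξ)` is a smooth vector field for each `ξ`. -/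
  flux_smooth : ∀ ξ : ℝ, ContMDiff (𝓡 d) (𝓡 d).tangent ∞
    (fun x : M => (⟨x, f x ξ⟩ : TangentBundle (𝓡 d) M))
  /-- `(x, ξ) ↦ A_x(ξ)` is `C^1`. -/
  diff_C1 : ContMDiff ((𝓡 d).prod 𝓘(ℝ, ℝ)) ((𝓡 d).prod 𝓘(ℝ, Eu d →L[ℝ] Eu d)) 1
    (fun p : M × ℝ => (Bundle.TotalSpace.mk' (Eu d →L[ℝ] Eu d)
      (E := fun x : M => TangentSpace (𝓡 d) x →L[ℝ] TangentSpace (𝓡 d) x) p.1 (A p.1 p.2)))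
  /-- `A_x(ξ)` is a smooth (1,1)-tensor field for each `ξ`. -/
  diff_smooth : ∀ ξ : ℝ, ContMDiff (𝓡 d) ((𝓡 d).prod 𝓘(ℝ, Eu d →L[ℝ] Eu d)) ∞
    (fun x : M => (Bundle.TotalSpace.mk' (Eu d →L[ℝ] Eu d)
      (E := fun x : M => TangentSpace (𝓡 d) x →L[ℝ] TangentSpace (𝓡 d) x) x (A x ξ)))
  /-- `(x, ξ) ↦ σ_x(ξ)` is `C^2`. -/
  sigma_C2 : ContMDiff ((𝓡 d).prod 𝓘(ℝ, ℝ)) ((𝓡 d).prod 𝓘(ℝ, Eu d →L[ℝ] Eu d)) 2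
    (fun p : M × ℝ => (Bundle.TotalSpace.mk' (Eu d →L[ℝ] Eu d)
      (E := fun x : M => TangentSpace (𝓡 d) x →L[ℝ] TangentSpace (𝓡 d) x) p.1 (σ p.1 p.2)))
  /-- `σ_x(ξ)` is a smooth (1,1)-tensor field for each `ξ`. -/
  sigma_smooth : ∀ ξ : ℝ, ContMDiff (𝓡 d) ((𝓡 d).prod 𝓘(ℝ, Eu d →L[ℝ] Eu d)) ∞
    (fun x : M => (Bundle.TotalSpace.mk' (Eu d →L[ℝ] Eu d)
      (E := fun x : M => TangentSpace (𝓡 d) x →L[ℝ] TangentSpace (𝓡 d) x) x (σ x ξ)))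
  /-- `∂_ξ A = σ^⊤ σ`, where `σ^⊤` is the transpose with respect to `g`; equivalently
  `⟨A' v, w⟩ = ⟨σ v, σ w⟩` for all tangent vectors `v, w`. -/
  deriv_diff : ∀ (x : M) (ξ : ℝ) (v w : TangentSpace (𝓡 d) x),
    HasDerivAt (fun s : ℝ => g.inner x (A x s v) w) (g.inner x (σ x ξ v) (σ x ξ w)) ξ
  /-- The geometry compatibility condition `Div f_x(ξ) = Div Div A_x(ξ)` for every `ξ`. -/
  compatible : ∀ (ξ : ℝ), ∀ e ∈ IsManifold.maximalAtlas (𝓡 d) ∞ M, ∀ y ∈ e.target,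
    divVec g e (fun x => f x ξ) y = divDiv g e (fun x => A x ξ) y

end Coefficients

/-! ### Distributions in a chart

A distribution on `(0,∞) × U × (0,∞)`, `U` the domain of a chart `e`, is represented by its
coordinate expression (pullback under `e⁻¹`) acting on functions of `(t, y, ξ)`. A function `h`
acts by `θ ↦ ∫ h θ dt dy dξ`, and a measure `m` is identified with its density with respect to
`dt dμ dξ`, hence acts by `θ ↦ ∫ θ/√|g| dm`. -/

section Distributions

variable {d : ℕ} {M : Type*} [TopologicalSpace M] [ChartedSpace (Eu d) M]

/-- `[0,∞) × U × [0,∞)`. -/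
def phase {X : Type*} (U : Set X) : Set (ℝ × X × ℝ) := Ici 0 ×ˢ U ×ˢ Ici 0

/-- Test functions in `𝒟((0,∞) × U × (0,∞))`, for `U ⊆ ℝ^d` open. -/
structure IsTest (U : Set (Eu d)) (θ : ℝ × Eu d × ℝ → ℝ) : Prop where
  smooth : ContDiff ℝ ∞ θ
  compact : HasCompactSupport θ
  supp : tsupport θ ⊆ Ioi 0 ×ˢ U ×ˢ Ioi 0

/-- The distribution given by the function `h`. -/
def distFun (e : OpenPartialHomeomorph M (Eu d)) (h : ℝ × M × ℝ → ℝ)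
    (θ : ℝ × Eu d × ℝ → ℝ) : ℝ :=
  ∫ q in phase e.target, h (q.1, e.symm q.2.1, q.2.2) * θ q

/-- The distribution `∂_t h`. -/
def distDt (e : OpenPartialHomeomorph M (Eu d)) (h : ℝ × M × ℝ → ℝ)
    (θ : ℝ × Eu d × ℝ → ℝ) : ℝ :=
  - distFun e h (fun q => deriv (fun s => θ (s, q.2)) q.1)

variable [IsManifold (𝓡 d) ∞ M] (g : Metric d M)

/-- `θ(t, ·, ξ)/√|g|`. -/
def overDensity (e : OpenPartialHomeomorph M (Eu d)) (θ : ℝ × Eu d × ℝ → ℝ) (t ξ : ℝ)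
    (y : Eu d) : ℝ :=
  θ (t, y, ξ) / sqrtDet g e y

/-- The distribution `Div (h f'_x(ξ))`, where `f' = ∂_ξ f`: the divergence is minus the adjoint of
the differential with respect to `dμ`. -/
def distDiv (e : OpenPartialHomeomorph M (Eu d)) (f : (x : M) → ℝ → TangentSpace (𝓡 d) x)
    (h : ℝ × M × ℝ → ℝ) (θ : ℝ × Eu d × ℝ → ℝ) : ℝ :=
  - ∫ q in phase e.target, h (q.1, e.symm q.2.1, q.2.2) *
      (∑ k, deriv (fun s => vecComp e (fun x => f x s) k q.2.1) q.2.2 *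
        pd k (overDensity g e θ q.1 q.2.2) q.2.1) * sqrtDet g e q.2.1

/-- The distribution `Div Div (h A'_x(ξ))`, where `A' = ∂_ξ A`: the operator `Div Div` on
(1,1)-tensors is the adjoint, with respect to `dμ`, of `ϑ ↦ ∇∇ϑ`, so that
`⟨Div Div T, ϑ⟩ = ∫ T^k_i (∇_k ∇ϑ)^i dμ`. -/
def distDivDiv (e : OpenPartialHomeomorph M (Eu d))
    (A : (x : M) → ℝ → (TangentSpace (𝓡 d) x →L[ℝ] TangentSpace (𝓡 d) x))
    (h : ℝ × M × ℝ → ℝ) (θ : ℝ × Eu d × ℝ → ℝ) : ℝ :=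
  ∫ q in phase e.target, h (q.1, e.symm q.2.1, q.2.2) *
      (∑ k, ∑ i, deriv (fun s => tensComp e (fun x => A x s) k i q.2.1) q.2.2 *
        covHess g e (overDensity g e θ q.1 q.2.2) i k q.2.1) * sqrtDet g e q.2.1

/-- The distribution `∂_ξ m` for a measure `m`. -/
def distDxi [MeasurableSpace M] (e : OpenPartialHomeomorph M (Eu d)) (m : Measure (ℝ × M × ℝ))
    (θ : ℝ × Eu d × ℝ → ℝ) : ℝ :=
  - ∫ p in phase e.source,
      deriv (fun s => overDensity g e θ p.1 s (e p.2.1)) p.2.2 ∂m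

end Distributions

/-! ### Regularization -/

section Regularization

/-- The functions `ω₁, ω₂` that generate the mollifier. -/
structure IsMollifierPair (ω₁ ω₂ : ℝ → ℝ) : Prop where
  smooth₁ : ContDiff ℝ ∞ ω₁
  smooth₂ : ContDiff ℝ ∞ ω₂
  compact₁ : HasCompactSupport ω₁
  compact₂ : HasCompactSupport ω₂
  nonneg₁ : ∀ s, 0 ≤ ω₁ s
  nonneg₂ : ∀ s, 0 ≤ ω₂ s
  mass₁ : ∫ s, ω₁ s = 1
  mass₂ : ∫ s, ω₂ s = 1
  supp₁ : tsupport ω₁ ⊆ Ioo (-1) 0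

/-- `ρ_{ε,δ}(t,x,ξ) = ε^{-(d+1)} δ^{-1} ω₁(ξ/δ) ω₁(t/ε) ∏_j ω₂(x_j/ε)`. -/
def mollifier {d : ℕ} (ω₁ ω₂ : ℝ → ℝ) (ε δ : ℝ) (q : ℝ × Eu d × ℝ) : ℝ :=
  1 / (ε ^ (d + 1) * δ) * ω₁ (q.2.2 / δ) * ω₁ (q.1 / ε) * ∏ j, ω₂ (q.2.1 j / ε)

variable {d : ℕ} {M : Type*} [TopologicalSpace M] [ChartedSpace (Eu d) M]

/-- `F^{ε,δ} = (F ∘ e⁻¹ ⋆ ρ_{ε,δ}) ∘ e` for a distribution `F` in the chart `e`. -/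
def regularize (ω₁ ω₂ : ℝ → ℝ) (e : OpenPartialHomeomorph M (Eu d))
    (F : (ℝ × Eu d × ℝ → ℝ) → ℝ) (ε δ : ℝ) (p : ℝ × M × ℝ) : ℝ :=
  F (fun q => mollifier ω₁ ω₂ ε δ (p.1 - q.1, e p.2.1 - q.2.1, p.2.2 - q.2.2))

/-- `(φ h)^{ε,δ}`. -/
def regFun (ω₁ ω₂ : ℝ → ℝ) (e : OpenPartialHomeomorph M (Eu d)) (φ : M → ℝ)
    (h : ℝ × M × ℝ → ℝ) (ε δ : ℝ) : ℝ × M × ℝ → ℝ :=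
  regularize ω₁ ω₂ e (distFun e (fun p => φ p.2.1 * h p)) ε δ

variable [IsManifold (𝓡 d) ∞ M] (g : Metric d M)

/-- `(φ ∂_ξ m)^{ε,δ}`. -/
def regDxi [MeasurableSpace M] (ω₁ ω₂ : ℝ → ℝ) (e : OpenPartialHomeomorph M (Eu d)) (φ : M → ℝ)
    (m : Measure (ℝ × M × ℝ)) (ε δ : ℝ) : ℝ × M × ℝ → ℝ :=
  regularize ω₁ ω₂ e (fun θ => distDxi g e m (fun q => φ (e.symm q.2.1) * θ q)) ε δ

/-- `(Div Div (φ h A'))^{ε,δ}`. -/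
def regDivDiv (ω₁ ω₂ : ℝ → ℝ) (e : OpenPartialHomeomorph M (Eu d))
    (A : (x : M) → ℝ → (TangentSpace (𝓡 d) x →L[ℝ] TangentSpace (𝓡 d) x)) (φ : M → ℝ)
    (h : ℝ × M × ℝ → ℝ) (ε δ : ℝ) : ℝ × M × ℝ → ℝ :=
  regularize ω₁ ω₂ e (distDivDiv g e A (fun p => φ p.2.1 * h p)) ε δ

end Regularization

/-! ### Kinetically admissible sets -/

/-- `sgn₊`. -/
def sgnPlus (s : ℝ) : ℝ := if 0 < s then 1 else 0

open Classical in
/-- The function `χ_u(t,x,ξ)`. -/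
def chi {M : Type*} (u : ℝ × M → ℝ) (p : ℝ × M × ℝ) : ℝ :=
  if 0 ≤ p.2.2 ∧ p.2.2 ≤ u (p.1, p.2.1) then 1
  else if u (p.1, p.2.1) ≤ p.2.2 ∧ p.2.2 ≤ 0 then -1
  else 0

/-- A tuple `(χ, u₀, m, n)`. Functions of `(t, x, ξ)` are only considered for `t, ξ ≥ 0`. -/
structure KineticTuple (M : Type*) [MeasurableSpace M] where
  χ : ℝ × M × ℝ → ℝ
  u₀ : M → ℝ
  m : Measure (ℝ × M × ℝ)
  n : Measure (ℝ × M × ℝ)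

section Admissible

variable {d : ℕ} {M : Type*} [TopologicalSpace M] [ChartedSpace (Eu d) M]
  [IsManifold (𝓡 d) ∞ M] [MeasurableSpace M]

/-- The properties required of the entries of a tuple `(χ, u₀, m, n)`; `m` and `n` are Radon
measures on `[0,∞) × M × [0,∞)`, regarded as measures on `ℝ × M × ℝ` that vanish outside. -/
structure IsKineticData (g : Metric d M) (K : KineticTuple M) : Prop where
  measurable_χ : AEMeasurable K.χ ((kinMeasure g).restrict (phase univ))
  range_χ : ∀ p ∈ phase (univ : Set M), K.χ p ∈ Icc (0 : ℝ) 1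
  support_χ : ∃ R : ℝ, ∀ p ∈ phase (univ : Set M), R < p.2.2 → K.χ p = 0
  antitone_χ : ∀ t ≥ 0, ∀ x : M, AntitoneOn (fun ξ => K.χ (t, x, ξ)) (Ici 0)
  measurable_u₀ : AEMeasurable K.u₀ (riemMeasure g)
  range_u₀ : ∀ x, K.u₀ x ∈ Icc (0 : ℝ) 1
  radon_m : IsFiniteMeasureOnCompacts K.m
  radon_n : IsFiniteMeasureOnCompacts K.n
  support_m : K.m (phase univ)ᶜ = 0
  support_n : K.n (phase univ)ᶜ = 0

/-- The kinetic equation `∂_t χ + Div (χ f'_x(ξ)) = Div Div (χ A'_x(ξ)) + ∂_ξ (n + m)` in the sense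
of distributions on `(0,∞) × M × (0,∞)`, i.e. in the sense of distributions in every chart. -/
def KineticEquation (g : Metric d M) (f : (x : M) → ℝ → TangentSpace (𝓡 d) x)
    (A : (x : M) → ℝ → (TangentSpace (𝓡 d) x →L[ℝ] TangentSpace (𝓡 d) x))
    (K : KineticTuple M) : Prop :=
  ∀ e ∈ IsManifold.maximalAtlas (𝓡 d) ∞ M, ∀ θ : ℝ × Eu d × ℝ → ℝ, IsTest e.target θ →
    distDt e K.χ θ + distDiv g e f K.χ θ
      = distDivDiv g e A K.χ θ + distDxi g e (K.n + K.m) θ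

/-- The initial condition `χ(0,x,ξ) = sgn₊(u₀(x) - ξ)`, attained in the weak sense. Since `χ(t,·,·)`
matters only for almost every `t`, the limit `t → 0` is an essential limit. -/
def InitialCondition (g : Metric d M) (K : KineticTuple M) : Prop :=
  ∀ φ : M × ℝ → ℝ, ContMDiff ((𝓡 d).prod 𝓘(ℝ, ℝ)) 𝓘(ℝ, ℝ) ∞ φ → HasCompactSupport φ →
    Tendsto
      (fun t => ∫ z in univ ×ˢ Ici 0, K.χ (t, z.1, z.2) * φ z ∂((riemMeasure g).prod volume))
      (𝓝[>] (0 : ℝ) ⊓ ae volume)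
      (𝓝 (∫ z in univ ×ˢ Ici 0, sgnPlus (K.u₀ z.1 - z.2) * φ z ∂((riemMeasure g).prod volume)))

/-- The expression inside the iterated upper limit in the admissibility estimate, for the cutoff
`φ` supported in the chart `e`. -/
def secondOrderBracket (g : Metric d M) (ω₁ ω₂ : ℝ → ℝ)
    (A : (x : M) → ℝ → (TangentSpace (𝓡 d) x →L[ℝ] TangentSpace (𝓡 d) x))
    (K L : KineticTuple M) (e : OpenPartialHomeomorph M (Eu d)) (φ : M → ℝ) (t ε δ : ℝ) : ℝ :=
  (∫ p in Ico 0 t ×ˢ e.source ×ˢ Ici 0,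
      (regDxi g ω₁ ω₂ e φ (K.m + K.n) ε δ p * regFun ω₁ ω₂ e φ (fun q => 1 - L.χ q) ε δ p
        - regDxi g ω₁ ω₂ e φ (L.m + L.n) ε δ p * regFun ω₁ ω₂ e φ K.χ ε δ p) ∂(kinMeasure g))
  + (∫ p in Ico 0 t ×ˢ e.source ×ˢ Ici 0,
      regDivDiv g ω₁ ω₂ e A φ K.χ ε δ p
        * regFun ω₁ ω₂ e φ (fun q => 1 - L.χ q) ε δ p ∂(kinMeasure g))
  + (∫ p in Ico 0 t ×ˢ e.source ×ˢ Ici 0,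
      regDivDiv g ω₁ ω₂ e A φ (fun q => 1 - L.χ q) ε δ p
        * regFun ω₁ ω₂ e φ K.χ ε δ p ∂(kinMeasure g))

/-- The admissibility estimate for an ordered pair of tuples. The upper limits are taken in
`[-∞, ∞]`. -/
def SecondOrderEstimate (g : Metric d M) (ω₁ ω₂ : ℝ → ℝ)
    (A : (x : M) → ℝ → (TangentSpace (𝓡 d) x →L[ℝ] TangentSpace (𝓡 d) x))
    (K L : KineticTuple M) : Prop :=
  ∃ (N : ℕ) (e : Fin N → OpenPartialHomeomorph M (Eu d)) (φ : Fin N → M → ℝ) (C : Fin N → ℝ),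
    (∀ α, e α ∈ IsManifold.maximalAtlas (𝓡 d) ∞ M) ∧
    (⋃ α, (e α).source) = univ ∧
    (∀ α, ContMDiff (𝓡 d) 𝓘(ℝ, ℝ) ∞ (φ α)) ∧
    (∀ α x, 0 ≤ φ α x) ∧
    (∀ α, HasCompactSupport (φ α) ∧ tsupport (φ α) ⊆ (e α).source) ∧
    (∀ x, ∑ α, φ α x ^ 2 = 1) ∧
    ∀ α, ∀ᵐ t ∂(volume.restrict (Ici (0 : ℝ))),
      limsup (fun ε : ℝ => limsup (fun δ : ℝ =>
          ((secondOrderBracket g ω₁ ω₂ A K L (e α) (φ α) t ε δ : ℝ) : EReal)) (𝓝[>] 0)) (𝓝[>] 0)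
        ≤ ((C α * ∫ p in Ico 0 t ×ˢ univ ×ˢ Ici 0,
              K.χ p * (1 - L.χ p) ∂(kinMeasure g) : ℝ) : EReal)

/-- Kinetically admissible sets of tuples. -/
structure KineticallyAdmissible (g : Metric d M) (ω₁ ω₂ : ℝ → ℝ)
    (f : (x : M) → ℝ → TangentSpace (𝓡 d) x)
    (A : (x : M) → ℝ → (TangentSpace (𝓡 d) x →L[ℝ] TangentSpace (𝓡 d) x))
    (F : Set (KineticTuple M)) : Prop where
  data : ∀ K ∈ F, IsKineticData g K
  equation : ∀ K ∈ F, KineticEquation g f A K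
  initial : ∀ K ∈ F, InitialCondition g K
  estimate : ∀ K ∈ F, ∀ L ∈ F, SecondOrderEstimate g ω₁ ω₂ A K L

end Admissible

end KineticManifold

end

open Set Filter Topology MeasureTheory
open scoped Manifold ContDiff
open Finset (sum_congr sum_mul sum_comm mul_sum sum_add_distrib sum_sub_distrib)
open Function (uncurry notMem_support support_mul_subset_left support_mul_subset_right)
open Real (norm_eq_abs)
open Module (finrank)
open Metric (closedBall isClosed_closedBall cthickening)
open MeasureTheory.Measure (prod_restrict volume_eq_prod quasiMeasurePreserving_fst quasiMeasurePreserving_snd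
  restrict_restrict restrict_mono_set ae_ae_of_ae_prod restrict_univ map_apply_of_aemeasurable
  restrict_mono_measure restrict_le_self prod_prod restrict_apply restrict_apply_univ
  measurePreserving_swap)

noncomputable section

set_option linter.unusedSectionVars false

namespace KineticManifold

/-- The maximal smooth atlas. -/
notation "𝒜[" d ", " M "]" => IsManifold.maximalAtlas (𝓡 d) ∞ M
/-- Lebesgue measure. -/
notation "vol[" α "]" => (volume : Measure α)
notation "Y[" d "]" => Eu d × ℝ
notation "X[" d "]" => ℝ × Eu d × ℝ
notation "Mat[" d "]" => Fin d → Fin d → Eu d → ℝ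
notation "MatX[" d "]" => Fin d → Fin d → Eu d → ℝ → ℝ
notation "VecX[" d "]" => Fin d → Eu d → ℝ → ℝ

/-- Families of vector fields with a real parameter. -/
abbrev VecFam (d : ℕ) (M : Type*) [TopologicalSpace M] [ChartedSpace (Eu d) M] := (x : M) → ℝ → TangentSpace (𝓡 d) x

/-- Families of `(1,1)`-tensor fields with a real parameter. -/
abbrev EndFam (d : ℕ) (M : Type*) [TopologicalSpace M] [ChartedSpace (Eu d) M] :=
  (x : M) → ℝ → (TangentSpace (𝓡 d) x →L[ℝ] TangentSpace (𝓡 d) x)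

theorem integral_congr_fun {α E : Type*} [MeasurableSpace α] [NormedAddCommGroup E] [NormedSpace ℝ E]
    {μ : Measure α} {f g : α → E} (h : ∀ x, f x = g x) : ∫ x, f x ∂μ = ∫ x, g x ∂μ :=
  integral_congr_ae (ae_of_all _ h)

theorem eq_zero_off_tsupport {α β : Type*} [TopologicalSpace α] [Zero β] {f : α → β} {x : α}
    (h : x ∉ tsupport f) : f x = 0 :=
  image_eq_zero_of_notMem_tsupport h

theorem abs_integral_le_integral {α : Type*} [MeasurableSpace α] {μ : Measure α} {f g : α → ℝ}
    (hg : Integrable g μ) (h : ∀ᵐ x ∂μ, |f x| ≤ g x) : |∫ x, f x ∂μ| ≤ ∫ x, g x ∂μ :=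
  norm_integral_le_of_norm_le (f := f) hg h

/-! ### Lebesgue points and mollification -/

section Lebesgue

variable {E : Type*} [NormedAddCommGroup E] [NormedSpace ℝ E] [FiniteDimensional ℝ E]
  [MeasurableSpace E] [BorelSpace E] (μ : Measure E) [μ.IsAddHaarMeasure]

/-- `x` is a Lebesgue point of `G`. -/
def IsLebPt (G : E → ℝ) (x : E) : Prop :=
  Tendsto (fun r : ℝ => (r ^ finrank ℝ E)⁻¹ * ∫ z in closedBall x r, |G z - G x| ∂μ) (𝓝[>] 0) (𝓝 0)

/-- The volume of the closed ball of radius `r`. -/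
def ballVol (r : ℝ) : ℝ := μ.real (closedBall (0 : E) r)

variable {μ}

theorem real_closedBall (x : E) {r : ℝ} (hr : 0 ≤ r) {ε : ℝ} (hε : 0 ≤ ε) :
    μ.real (closedBall x (r * ε)) = ε ^ finrank ℝ E * ballVol μ r := by
  rw [mul_comm, ballVol, Measure.real, Measure.addHaar_closedBall_mul μ x hε hr,
    ENNReal.toReal_mul, ENNReal.toReal_ofReal (by positivity), Measure.real]

theorem ae_isLebPt {G : E → ℝ} (hG : LocallyIntegrable G μ) : ∀ᵐ x ∂μ, IsLebPt μ G x := by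
  filter_upwards [IsUnifLocDoublingMeasure.ae_tendsto_average_norm_sub μ hG 1] with x hx
  have h := (hx (fun _ : ℝ => x) (fun r => r) tendsto_id (by
        filter_upwards [self_mem_nhdsWithin] with r hr
        exact Metric.mem_closedBall_self (by simpa using le_of_lt hr))).const_mul (ballVol μ 1)
  rw [mul_zero] at h
  refine h.congr' ?_
  filter_upwards [self_mem_nhdsWithin] with r hr
  have hr : 0 < r := hr
  have h1 := real_closedBall (μ := μ) x zero_le_one hr.le
  rw [one_mul] at h1
  have hpos : ballVol μ 1 ≠ 0 := by
    have : 0 < μ (closedBall (0 : E) 1) := Metric.measure_closedBall_pos μ 0 one_pos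
    exact (ENNReal.toReal_pos this.ne' (isCompact_closedBall (0 : E) 1).measure_lt_top.ne).ne'
  rw [setAverage_eq, h1, smul_eq_mul]
  simp only [norm_eq_abs]
  field_simp

theorem IsLebPt.tendsto_kernel {G : E → ℝ} (hG : LocallyIntegrable G μ) {x : E}
    (hx : IsLebPt μ G x) {r C : ℝ} (hr : 0 < r) {k : ℝ → E → ℝ}
    (hk : ∀ᶠ ε in 𝓝[>] 0, ∀ z, |k ε z| ≤ C * (ε ^ finrank ℝ E)⁻¹)
    (hs : ∀ᶠ ε in 𝓝[>] 0, ∀ z, r * ε < dist z x → k ε z = 0) :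
    Tendsto (fun ε => ∫ z, k ε z * (G z - G x) ∂μ) (𝓝[>] 0) (𝓝 0) := by
  have hlim : Tendsto (fun ε : ℝ => r * ε) (𝓝[>] 0) (𝓝[>] 0) := by
    refine tendsto_nhdsWithin_iff.2 ⟨?_, ?_⟩
    · have : Tendsto (fun ε : ℝ => r * ε) (𝓝 0) (𝓝 (r * 0)) := (continuous_const.mul continuous_id).tendsto 0
      rw [mul_zero] at this
      exact this.mono_left nhdsWithin_le_nhds
    · filter_upwards [self_mem_nhdsWithin] with ε hε
      exact mul_pos hr hε
  have h := ((hx.comp hlim).const_mul (C * r ^ finrank ℝ E))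
  rw [mul_zero] at h
  refine squeeze_zero_norm' ?_ h
  filter_upwards [hk, hs, self_mem_nhdsWithin] with ε hk hs hε
  have hε : 0 < ε := hε
  have hint : IntegrableOn (fun z => |G z - G x|) (closedBall x (r * ε)) μ :=
    ((hG.integrableOn_isCompact (isCompact_closedBall _ _)).sub
      (integrableOn_const (isCompact_closedBall _ _).measure_lt_top.ne)).abs
  have h1 : ∫ z, k ε z * (G z - G x) ∂μ = ∫ z in closedBall x (r * ε), k ε z * (G z - G x) ∂μ := by
    refine (setIntegral_eq_integral_of_forall_compl_eq_zero fun z hz => ?_).symm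
    rw [hs z (by simpa using hz), zero_mul]
  rw [h1]
  refine (norm_integral_le_of_norm_le (hint.const_mul (C * (ε ^ finrank ℝ E)⁻¹))
    (ae_of_all _ fun z => ?_)).trans (le_of_eq ?_)
  · rw [norm_mul, norm_eq_abs, norm_eq_abs]
    exact mul_le_mul_of_nonneg_right (hk z) (abs_nonneg _)
  · rw [integral_const_mul]
    simp only [Function.comp, mul_pow]
    field_simp

theorem IsLebPt.tendsto_kernel' {G : E → ℝ} (hG : LocallyIntegrable G μ) {x : E}
    (hx : IsLebPt μ G x) {r C c : ℝ} (hr : 0 < r) {k : ℝ → E → ℝ}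
    (hm : ∀ ε, AEStronglyMeasurable (k ε) μ)
    (hk : ∀ᶠ ε in 𝓝[>] 0, ∀ z, |k ε z| ≤ C * (ε ^ finrank ℝ E)⁻¹)
    (hs : ∀ᶠ ε in 𝓝[>] 0, ∀ z, r * ε < dist z x → k ε z = 0)
    (hc : Tendsto (fun ε => ∫ z, k ε z ∂μ) (𝓝[>] 0) (𝓝 c)) :
    Tendsto (fun ε => ∫ z, k ε z * G z ∂μ) (𝓝[>] 0) (𝓝 (c * G x)) := by
  have h := (hx.tendsto_kernel hG hr hk hs).add (hc.mul_const (G x))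
  rw [zero_add] at h
  refine h.congr' ?_
  filter_upwards [hk, hs, self_mem_nhdsWithin] with ε hk hs hε
  have hsupp : Function.support (k ε) ⊆ closedBall x (r * ε) := by
    intro z hz
    by_contra hz'
    exact hz (hs z (by simpa using hz'))
  have hki : Integrable (k ε) μ := by
    rw [← integrableOn_iff_integrable_of_support_subset hsupp]
    exact Measure.integrableOn_of_bounded (isCompact_closedBall _ _).measure_lt_top.ne (hm ε) (ae_of_all _ hk)
  have hkG : Integrable (fun z => k ε z * G z) μ := by
    have hsupp' : Function.support (fun z => k ε z * G z) ⊆ closedBall x (r * ε) :=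
      (support_mul_subset_left _ _).trans hsupp
    rw [← integrableOn_iff_integrable_of_support_subset hsupp']
    exact (hG.integrableOn_isCompact (isCompact_closedBall _ _)).bdd_mul (hm ε).restrict (ae_of_all _ hk)
  simp only [mul_sub]
  rw [integral_sub hkG (hki.mul_const _), integral_mul_const]
  ring

variable (μ) in
/-- The (unnormalised) average of `G` over the ball of radius `r ε` around `x`. -/
def ballAvg (r ε : ℝ) (G : E → ℝ) (x : E) : ℝ := (ε ^ finrank ℝ E)⁻¹ * ∫ z in closedBall x (r * ε), G z ∂μ

theorem ballAvg_nonneg {r ε : ℝ} (hε : 0 ≤ ε) {G : E → ℝ} (hG : ∀ z, 0 ≤ G z) (x : E) : 0 ≤ ballAvg μ r ε G x :=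
  mul_nonneg (by positivity) (integral_nonneg hG)

theorem ballAvg_le {r ε : ℝ} (hr : 0 ≤ r) (hε : 0 < ε) {G : E → ℝ} (hG : ∀ z, |G z| ≤ 1) (x : E) :
    |ballAvg μ r ε G x| ≤ ballVol μ r := by
  have h1 : ‖∫ z in closedBall x (r * ε), G z ∂μ‖ ≤ 1 * μ.real (closedBall x (r * ε)) :=
    norm_setIntegral_le_of_norm_le_const (isCompact_closedBall _ _).measure_lt_top fun z _ => hG z
  rw [one_mul, real_closedBall x hr hε.le, norm_eq_abs] at h1
  rw [ballAvg, abs_mul, abs_of_nonneg (by positivity : 0 ≤ (ε ^ finrank ℝ E)⁻¹)]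
  calc _ ≤ (ε ^ finrank ℝ E)⁻¹ * (ε ^ finrank ℝ E * ballVol μ r) := by gcongr
    _ = ballVol μ r := by field_simp

theorem IsLebPt.tendsto_ballAvg {G : E → ℝ} (hG : LocallyIntegrable G μ) {x : E}
    (hx : IsLebPt μ G x) {r : ℝ} (hr : 0 < r) :
    Tendsto (fun ε => ballAvg μ r ε G x) (𝓝[>] 0) (𝓝 (ballVol μ r * G x)) := by
  have h := hx.tendsto_kernel' hG (r := r) (C := 1) (c := ballVol μ r) hr
    (k := fun ε => (closedBall x (r * ε)).indicator (fun _ => (ε ^ finrank ℝ E)⁻¹))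
    (fun ε => (aestronglyMeasurable_const.indicator isClosed_closedBall.measurableSet))
    (by
      filter_upwards [self_mem_nhdsWithin] with ε hε z
      have hε : 0 < ε := hε
      rw [one_mul, ← norm_eq_abs]
      refine (norm_indicator_le_norm_self _ _).trans (le_of_eq ?_)
      rw [norm_eq_abs, abs_of_nonneg (by positivity)])
    (by
      filter_upwards [self_mem_nhdsWithin] with ε hε z hz
      exact indicator_of_notMem (by simpa using hz) _)
    (by
      refine tendsto_const_nhds.congr' ?_
      filter_upwards [self_mem_nhdsWithin] with ε hε
      have hε : 0 < ε := hε
      rw [integral_indicator isClosed_closedBall.measurableSet, setIntegral_const,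
        real_closedBall x hr.le hε.le, smul_eq_mul]
      field_simp)
  refine h.congr fun ε => ?_
  rw [ballAvg, ← integral_const_mul, ← integral_indicator isClosed_closedBall.measurableSet]
  congr 1
  ext z
  by_cases hz : z ∈ closedBall x (r * ε) <;> simp [hz]

end Lebesgue

/-! ### Integrals of derivatives against monotone functions -/

theorem setIntegral_deriv_ordConnected_le {R η : ℝ} (hη : 0 ≤ η) {e e' : ℝ → ℝ}
    (he : ∀ ξ, HasDerivAt e (e' ξ) ξ) (hc : Continuous e') (hb : ∀ ξ ∈ Icc 0 R, |e ξ| ≤ η)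
    {S : Set ℝ} (hS : S.OrdConnected) (hSR : S ⊆ Icc 0 R) :
    |∫ ξ in S, e' ξ| ≤ 2 * η := by
  rcases S.eq_empty_or_nonempty with rfl | hne
  · simpa using hη
  · have hbb : BddBelow S := (bddBelow_Icc).mono hSR
    have hba : BddAbove S := (bddAbove_Icc).mono hSR
    have hle : sInf S ≤ sSup S := csInf_le_csSup hne hbb hba
    have h1 : Ioo (sInf S) (sSup S) ⊆ S := by
      intro ξ hξ
      obtain ⟨a, ha, haξ⟩ := exists_lt_of_csInf_lt hne hξ.1
      obtain ⟨b, hb, hbξ⟩ := exists_lt_of_lt_csSup hne hξ.2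
      exact hS.out ha hb ⟨haξ.le, hbξ.le⟩
    have h2 : S ⊆ Icc (sInf S) (sSup S) := fun ξ hξ => ⟨csInf_le hbb hξ, le_csSup hba hξ⟩
    have h3 : S =ᵐ[volume] Ioc (sInf S) (sSup S) := (h2.eventuallyLE.trans Ioc_ae_eq_Icc.symm.le).antisymm
        (Ioo_ae_eq_Ioc.symm.le.trans h1.eventuallyLE)
    rw [setIntegral_congr_set h3, ← intervalIntegral.integral_of_le hle,
      intervalIntegral.integral_eq_sub_of_hasDerivAt (fun ξ _ => he ξ) (hc.intervalIntegrable _ _)]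
    have hcl : closure S ⊆ Icc 0 R := closure_minimal hSR isClosed_Icc
    have h4 := hb _ (hcl (csInf_mem_closure hne hbb))
    have h5 := hb _ (hcl (csSup_mem_closure hne hba))
    calc _ ≤ |e (sSup S)| + |e (sInf S)| := abs_sub _ _
      _ ≤ 2 * η := by linarith

theorem abs_setIntegral_mul_le_of_superlevel {S : Set ℝ} (hS : MeasurableSet S) {p g : ℝ → ℝ} {c : ℝ}
    (hp : AEMeasurable p (volume.restrict S)) (hp01 : ∀ ξ ∈ S, p ξ ∈ Icc (0 : ℝ) 1)
    (hg : IntegrableOn g S)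
    (hc : ∀ l : ℝ, |∫ ξ in S ∩ {ξ | l < p ξ}, g ξ| ≤ c) :
    |∫ ξ in S, p ξ * g ξ| ≤ c := by
  set k : ℝ → ℝ → ℝ := fun ξ l => {z : ℝ × ℝ | z.2 < p z.1}.indicator (fun z => g z.1) (ξ, l)
  have hnull : NullMeasurableSet {z : ℝ × ℝ | z.2 < p z.1}
      ((volume.restrict S).prod (volume.restrict (Ioc (0 : ℝ) 1))) :=
    nullMeasurableSet_lt measurable_snd.aemeasurable (hp.comp_quasiMeasurePreserving quasiMeasurePreserving_fst)
  have hint : Integrable (uncurry k) ((volume.restrict S).prod (volume.restrict (Ioc (0 : ℝ) 1))) := by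
    have h1 : Integrable (fun z : ℝ × ℝ => g z.1) ((volume.restrict S).prod (volume.restrict (Ioc (0 : ℝ) 1))) :=
      Integrable.comp_fst hg _
    exact h1.indicator₀ hnull
  have h1 : ∀ ξ ∈ S, p ξ * g ξ = ∫ l in Ioc (0 : ℝ) 1, k ξ l := by
    intro ξ hξ
    have h2 : ∀ l, k ξ l = (Iio (p ξ)).indicator (fun _ => g ξ) l := fun l => by
      simp [k, indicator]
    simp only [h2]
    rw [setIntegral_indicator measurableSet_Iio, setIntegral_const, smul_eq_mul]
    have h3 : volume.real (Ioc (0 : ℝ) 1 ∩ Iio (p ξ)) = p ξ := by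
      have h4 : (Ioc (0 : ℝ) 1 ∩ Iio (p ξ) : Set ℝ) = Ioo 0 (p ξ) := by
        ext l
        have := (hp01 ξ hξ).2
        simp only [mem_inter_iff, mem_Ioc, mem_Iio, mem_Ioo]
        constructor
        · rintro ⟨⟨h1, h2⟩, h3⟩; exact ⟨h1, h3⟩
        · rintro ⟨h1, h3⟩; exact ⟨⟨h1, by linarith⟩, h3⟩
      rw [h4, Measure.real, Real.volume_Ioo, sub_zero, ENNReal.toReal_ofReal (hp01 ξ hξ).1]
    rw [h3]
  rw [setIntegral_congr_fun hS h1, integral_integral_swap hint]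
  have h5 : ‖∫ l in Ioc (0 : ℝ) 1, ∫ ξ in S, k ξ l‖ ≤ c * volume.real (Ioc (0 : ℝ) 1) := by
    refine norm_setIntegral_le_of_norm_le_const (by simp) fun l _ => ?_
    have hl : NullMeasurableSet {ξ | l < p ξ} (volume.restrict S) := nullMeasurableSet_lt aemeasurable_const hp
    have h6 : ∀ ξ, k ξ l = {ξ | l < p ξ}.indicator g ξ := fun ξ => by simp [k, indicator]
    simp only [h6]
    rw [integral_indicator₀ hl, Measure.restrict_restrict₀ hl, inter_comm]
    exact hc l
  simpa using h5

theorem abs_setIntegral_monotone_mul_deriv_le {R η : ℝ} (hη : 0 ≤ η) {p q e e' : ℝ → ℝ}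
    (hp : AntitoneOn p (Icc 0 R)) (hq : MonotoneOn q (Icc 0 R))
    (hp01 : ∀ ξ ∈ Icc 0 R, p ξ ∈ Icc 0 1) (hq01 : ∀ ξ ∈ Icc 0 R, q ξ ∈ Icc 0 1)
    (he : ∀ ξ, HasDerivAt e (e' ξ) ξ) (hc : Continuous e') (hb : ∀ ξ ∈ Icc 0 R, |e ξ| ≤ η) :
    |∫ ξ in Icc 0 R, p ξ * q ξ * e' ξ| ≤ 2 * η := by
  have hpm : AEMeasurable p (volume.restrict (Icc 0 R)) := aemeasurable_restrict_of_antitoneOn measurableSet_Icc hp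
  have hqm : AEMeasurable q (volume.restrict (Icc 0 R)) := aemeasurable_restrict_of_monotoneOn measurableSet_Icc hq
  have hei : IntegrableOn e' (Icc 0 R) := hc.continuousOn.integrableOn_compact isCompact_Icc
  simp only [mul_assoc]
  have hqi : IntegrableOn (fun ξ => q ξ * e' ξ) (Icc 0 R) := by
    refine Integrable.bdd_mul (c := 1) hei hqm.aestronglyMeasurable ?_
    filter_upwards [ae_restrict_mem measurableSet_Icc] with ξ hξ
    rw [norm_eq_abs, abs_of_nonneg (hq01 ξ hξ).1]
    exact (hq01 ξ hξ).2
  refine abs_setIntegral_mul_le_of_superlevel measurableSet_Icc hpm hp01 hqi fun l => ?_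
  have hS : (Icc 0 R ∩ {ξ | l < p ξ}).OrdConnected := by
    refine ⟨fun a ha b hb z hz => ?_⟩
    have hzR : z ∈ Icc 0 R := ⟨ha.1.1.trans hz.1, hz.2.trans hb.1.2⟩
    exact ⟨hzR, lt_of_lt_of_le hb.2 (hp hzR hb.1 hz.2)⟩
  refine abs_setIntegral_mul_le_of_superlevel hS.measurableSet
    (hqm.mono_measure (Measure.restrict_mono inter_subset_left le_rfl))
    (fun ξ hξ => hq01 ξ hξ.1) (hei.mono_set inter_subset_left) fun l' => ?_
  refine setIntegral_deriv_ordConnected_le hη he hc hb ?_ fun ξ hξ => hξ.1.1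
  refine ⟨fun a ha b hb z hz => ⟨hS.out ha.1 hb.1 hz, ?_⟩⟩
  have hzR := (hS.out ha.1 hb.1 hz).1
  exact lt_of_lt_of_le ha.2 (hq ha.1.1 hzR hz.1)

/-! ### Mollification in time and space -/

/-- Time-space `ℝ × ℝ^d`. -/
abbrev TX (d : ℕ) := ℝ × Eu d

/-- Functions of time, space and velocity. -/
notation "Den[" d "]" => TX d → ℝ → ℝ

instance (d : ℕ) : vol[TX d].IsAddHaarMeasure := inferInstanceAs ((vol[ℝ].prod vol[Eu d]).IsAddHaarMeasure)

/-- A mollification kernel in time and space, with bounds. -/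
structure MollKernel (d : ℕ) where
  Φ : TX d → ℝ
  r : ℝ
  C : ℝ
  smooth : ContDiff ℝ ∞ Φ
  nonneg : ∀ x, 0 ≤ Φ x
  r_pos : 0 < r
  C_nonneg : 0 ≤ C
  supp : ∀ x, r < ‖x‖ → Φ x = 0
  bound : ∀ x, |Φ x| ≤ C
  bound_fderiv : ∀ x, ‖fderiv ℝ Φ x‖ ≤ C
  mass : ∫ x, Φ x = 1

namespace MollKernel

variable {d : ℕ} (κ : MollKernel d)

/-- The rescaled kernel `ε^{-n} Φ(x/ε)`. -/
def scaled (ε : ℝ) (x : TX d) : ℝ := (ε ^ finrank ℝ (TX d))⁻¹ * κ.Φ (ε⁻¹ • x)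

theorem scaled_smooth (ε : ℝ) : ContDiff ℝ ∞ (κ.scaled ε) := contDiff_const.mul (κ.smooth.comp (contDiff_const_smul _))

theorem scaled_nonneg {ε : ℝ} (hε : 0 < ε) (x : TX d) : 0 ≤ κ.scaled ε x := mul_nonneg (by positivity) (κ.nonneg _)

theorem scaled_supp {ε : ℝ} (hε : 0 < ε) {x : TX d} (hx : κ.r * ε < ‖x‖) : κ.scaled ε x = 0 := by
  rw [scaled, κ.supp, mul_zero]
  rw [norm_smul, norm_inv, norm_eq_abs, abs_of_pos hε, inv_mul_eq_div, lt_div_iff₀ hε]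
  exact hx

theorem scaled_bound {ε : ℝ} (hε : 0 < ε) (x : TX d) :
    |κ.scaled ε x| ≤ κ.C * (ε ^ finrank ℝ (TX d))⁻¹ := by
  rw [scaled, abs_mul, abs_of_nonneg (by positivity : 0 ≤ (ε ^ finrank ℝ (TX d))⁻¹), mul_comm]
  exact mul_le_mul_of_nonneg_right (κ.bound _) (by positivity)

theorem fderiv_scaled (ε : ℝ) (x v : TX d) : fderiv ℝ (κ.scaled ε) x v =
    (ε ^ finrank ℝ (TX d))⁻¹ * (ε⁻¹ * fderiv ℝ κ.Φ (ε⁻¹ • x) v) := by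
  have h1 : HasFDerivAt κ.Φ (fderiv ℝ κ.Φ (ε⁻¹ • x)) (ε⁻¹ • x) := ((κ.smooth.differentiable (by simp)) _).hasFDerivAt
  have h2 : HasFDerivAt (fun y : TX d => ε⁻¹ • y) (ε⁻¹ • ContinuousLinearMap.id ℝ (TX d)) x :=
    (ε⁻¹ • ContinuousLinearMap.id ℝ (TX d)).hasFDerivAt
  have h3 := (h1.comp x h2).const_mul ((ε ^ finrank ℝ (TX d))⁻¹)
  have h4 : HasFDerivAt (κ.scaled ε) _ x := h3
  rw [h4.fderiv]
  simp

theorem fderiv_scaled_bound {ε : ℝ} (hε : 0 < ε) (x v : TX d) :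
    |fderiv ℝ (κ.scaled ε) x v| ≤ κ.C * ε⁻¹ * ‖v‖ * (ε ^ finrank ℝ (TX d))⁻¹ := by
  rw [fderiv_scaled, abs_mul, abs_mul, abs_of_pos (inv_pos.2 hε),
    abs_of_nonneg (by positivity : 0 ≤ (ε ^ finrank ℝ (TX d))⁻¹)]
  have h1 : |fderiv ℝ κ.Φ (ε⁻¹ • x) v| ≤ κ.C * ‖v‖ := ((fderiv ℝ κ.Φ (ε⁻¹ • x)).le_opNorm v).trans
      (mul_le_mul_of_nonneg_right (κ.bound_fderiv _) (norm_nonneg _))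
  calc _ ≤ (ε ^ finrank ℝ (TX d))⁻¹ * (ε⁻¹ * (κ.C * ‖v‖)) := by gcongr
    _ = _ := by ring

theorem tsupport_scaled {ε : ℝ} (hε : 0 < ε) : tsupport (κ.scaled ε) ⊆ closedBall 0 (κ.r * ε) := by
  refine closure_minimal (fun x hx => ?_) isClosed_closedBall
  by_contra h
  exact hx (κ.scaled_supp hε (by simpa using h))

theorem scaled_compact {ε : ℝ} (hε : 0 < ε) : HasCompactSupport (κ.scaled ε) :=
  (isCompact_closedBall _ _).of_isClosed_subset (isClosed_tsupport _) (κ.tsupport_scaled hε)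

theorem fderiv_scaled_supp {ε : ℝ} (hε : 0 < ε) {x : TX d} (hx : κ.r * ε < ‖x‖) : fderiv ℝ (κ.scaled ε) x = 0 := by
  by_contra h
  have := κ.tsupport_scaled hε (support_fderiv_subset ℝ h)
  simp at this
  linarith

theorem fderiv_scaled_continuous (ε : ℝ) : Continuous (fderiv ℝ (κ.scaled ε)) :=
  (κ.scaled_smooth ε).continuous_fderiv (by simp)

theorem integral_scaled {ε : ℝ} (hε : 0 < ε) : ∫ x, κ.scaled ε x = 1 := by
  simp only [scaled]
  rw [integral_const_mul, Measure.integral_comp_inv_smul, κ.mass, smul_eq_mul, mul_one, abs_of_pos (by positivity)]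
  field_simp

end MollKernel

/-! ### Integral operators in time and space -/

section Kint

variable {d : ℕ}

/-- The integral operator with kernel `k(x, x', ξ)`. -/
def kint (k : TX d → Den[d]) (H : Den[d]) (x : TX d) (ξ : ℝ) : ℝ := ∫ x', k x x' ξ * H x' ξ

/-- Measurable functions with values in `[0,1]`. -/
structure IsDensity (H : Den[d]) : Prop where
  meas : Measurable (uncurry H)
  nonneg : ∀ x ξ, 0 ≤ H x ξ
  le_one : ∀ x ξ, H x ξ ≤ 1

theorem IsDensity.meas_right {H : Den[d]} (hH : IsDensity H) (ξ : ℝ) : Measurable (fun x => H x ξ) :=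
  hH.meas.comp (measurable_id.prodMk measurable_const)

theorem IsDensity.abs_le_one {H : Den[d]} (hH : IsDensity H) (x : TX d) (ξ : ℝ) :
    |H x ξ| ≤ 1 := by
  rw [abs_of_nonneg (hH.nonneg x ξ)]
  exact hH.le_one x ξ

theorem IsDensity.locallyIntegrable {H : Den[d]} (hH : IsDensity H) (ξ : ℝ) :
    LocallyIntegrable (fun x => H x ξ) volume := by
  have h1 : LocallyIntegrable (fun _ : TX d => (1 : ℝ)) volume := locallyIntegrable_const 1
  refine h1.mono (hH.meas_right ξ).aestronglyMeasurable (ae_of_all _ fun x => ?_)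
  simpa using hH.abs_le_one x ξ

/-- A kernel concentrated at scale `ε`, of size `B ε^{-n}`. -/
structure KernelBound (r ε B : ℝ) (S : Set ℝ) (k : TX d → Den[d]) : Prop where
  cont : Continuous (fun p : TX d × TX d × ℝ => k p.1 p.2.1 p.2.2)
  bound : ∀ x x', ∀ ξ ∈ S, |k x x' ξ| ≤ B * (ε ^ finrank ℝ (TX d))⁻¹
  supp : ∀ x x' ξ, r * ε < dist x' x → k x x' ξ = 0

variable {r ε B : ℝ} {S : Set ℝ} {k : TX d → Den[d]} {H : Den[d]}

theorem measurable_kint (hk : Continuous (fun p : TX d × TX d × ℝ => k p.1 p.2.1 p.2.2))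
    (hH : IsDensity H) : Measurable (fun p : TX d × ℝ => kint k H p.1 p.2) := by
  have h : StronglyMeasurable (fun q : (TX d × ℝ) × TX d => k q.1.1 q.2 q.1.2 * H q.2 q.1.2) := by
    refine Measurable.stronglyMeasurable (Measurable.mul ?_ ?_)
    · exact hk.measurable.comp (measurable_fst.fst.prodMk (measurable_snd.prodMk measurable_fst.snd))
    · exact hH.meas.comp (measurable_snd.prodMk measurable_fst.snd)
  exact h.integral_prod_right.measurable

theorem KernelBound.integrable (hk : KernelBound r ε B S k) (hH : IsDensity H) (x : TX d) {ξ : ℝ} :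
    Integrable (fun x' => k x x' ξ * H x' ξ) := by
  have h1 : Continuous (fun x' => k x x' ξ) :=
    hk.cont.comp (continuous_const.prodMk (continuous_id.prodMk continuous_const))
  have h2 : HasCompactSupport (fun x' => k x x' ξ) := by
    refine HasCompactSupport.intro (isCompact_closedBall x (r * ε)) fun x' hx' => ?_
    exact hk.supp _ _ _ (by simpa using hx')
  refine Integrable.mul_bdd (c := 1) (h1.integrable_of_hasCompactSupport h2)
    (hH.meas_right ξ).aestronglyMeasurable (ae_of_all _ fun x' => hH.abs_le_one _ _)

theorem KernelBound.abs_kint_le (hk : KernelBound r ε B S k) (hH : IsDensity H) (x : TX d) {ξ : ℝ}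
    (hξ : ξ ∈ S) : |kint k H x ξ| ≤ B * ballAvg volume r ε (fun z => H z ξ) x := by
  have h1 : kint k H x ξ = ∫ x' in closedBall x (r * ε), k x x' ξ * H x' ξ := by
    refine (setIntegral_eq_integral_of_forall_compl_eq_zero fun z hz => ?_).symm
    rw [hk.supp _ _ _ (by simpa using hz), zero_mul]
  rw [h1, ballAvg, ← mul_assoc, ← integral_const_mul, ← norm_eq_abs]
  refine norm_integral_le_of_norm_le
    (((hH.locallyIntegrable ξ).integrableOn_isCompact (isCompact_closedBall _ _)).const_mul _)
    (ae_of_all _ fun z => ?_)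
  rw [norm_mul, norm_eq_abs, norm_eq_abs, abs_of_nonneg (hH.nonneg _ _)]
  exact mul_le_mul_of_nonneg_right (hk.bound _ _ _ hξ) (hH.nonneg _ _)

theorem KernelBound.kint_add {k' : TX d → Den[d]} {B' : ℝ} (hk : KernelBound r ε B S k)
    (hk' : KernelBound r ε B' S k') (hH : IsDensity H) (x : TX d) (ξ : ℝ) :
    kint (fun x x' ξ => k x x' ξ + k' x x' ξ) H x ξ = kint k H x ξ + kint k' H x ξ := by
  simp only [kint, add_mul]
  exact integral_add (hk.integrable hH x) (hk'.integrable hH x)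

theorem measurable_ballAvg (hH : IsDensity H) :
    Measurable (fun p : TX d × ℝ => ballAvg volume r ε (fun z => H z p.2) p.1) := by
  have h : StronglyMeasurable (fun q : (TX d × ℝ) × TX d =>
      (closedBall q.1.1 (r * ε)).indicator (fun z => H z q.1.2) q.2) := by
    have h1 : Measurable ({q : (TX d × ℝ) × TX d | dist q.2 q.1.1 ≤ r * ε}.indicator (fun q => H q.2 q.1.2)) :=
      Measurable.indicator (hH.meas.comp (measurable_snd.prodMk measurable_fst.snd))
        (isClosed_le (by fun_prop) (by fun_prop)).measurableSet
    exact h1.stronglyMeasurable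
  have h2 := (h.integral_prod_right' (ν := vol[TX d])).measurable.const_mul ((ε ^ finrank ℝ (TX d))⁻¹)
  simp only [ballAvg]
  simp_rw [← integral_indicator isClosed_closedBall.measurableSet]
  exact h2

end Kint

/-! ### Passage to the limit -/

theorem tendsto_integral_prod_of_bounded {α β : Type*} [MeasurableSpace α] [MeasurableSpace β]
    {μ : Measure α} {ν : Measure β} [IsFiniteMeasure μ] [IsFiniteMeasure ν]
    {l : Filter ℝ} [l.IsCountablyGenerated]
    {F : ℝ → α × β → ℝ} {F0 : α × β → ℝ} {C : ℝ} {S : Set β} (hS : ∀ᵐ b ∂ν, b ∈ S)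
    (hF : ∀ ε, Measurable (F ε)) (hF₀ : Integrable F0 (μ.prod ν))
    (hb : ∀ᶠ ε in l, ∀ b ∈ S, ∀ a, |F ε (a, b)| ≤ C)
    (hlim : ∀ b ∈ S, ∀ᵐ a ∂μ, Tendsto (fun ε => F ε (a, b)) l (𝓝 (F0 (a, b)))) :
    Tendsto (fun ε => ∫ z, F ε z ∂(μ.prod ν)) l (𝓝 (∫ z, F0 z ∂(μ.prod ν))) := by
  have hint : ∀ᶠ ε in l, Integrable (F ε) (μ.prod ν) := by
    filter_upwards [hb] with ε hb
    refine Integrable.of_bound (hF ε).aestronglyMeasurable C ?_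
    filter_upwards [(quasiMeasurePreserving_snd (μ := μ) (ν := ν)).ae hS] with z hz
    exact hb z.2 hz z.1
  rw [integral_prod_symm _ hF₀]
  refine Tendsto.congr' (f₁ := fun ε => ∫ b, ∫ a, F ε (a, b) ∂μ ∂ν) ?_ ?_
  · filter_upwards [hint] with ε hε
    rw [integral_prod_symm _ hε]
  refine tendsto_integral_filter_of_dominated_convergence (fun _ => C * μ.real univ) ?_ ?_ ?_ ?_
  · filter_upwards with ε
    exact (hF ε).stronglyMeasurable.integral_prod_left'.aestronglyMeasurable
  · filter_upwards [hb] with ε hb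
    filter_upwards [hS] with b hbS
    exact norm_integral_le_of_norm_le_const (f := fun a => F ε (a, b)) (ae_of_all _ (hb b hbS))
  · exact integrable_const _
  · filter_upwards [hS] with b hbS
    refine tendsto_integral_filter_of_dominated_convergence (fun _ => C) ?_ ?_ ?_ (hlim b hbS)
    · filter_upwards with ε
      exact ((hF ε).comp measurable_prodMk_right).aestronglyMeasurable
    · filter_upwards [hb] with ε hb
      exact ae_of_all _ fun a => hb b hbS a
    · exact integrable_const _

section

variable {d : ℕ}

/-- Lebesgue measure on `[0,T) × K × [0,R]`. -/
def slab (T R : ℝ) (K : Set (Eu d)) : Measure (TX d × ℝ) :=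
  (vol[TX d].restrict (Ico 0 T ×ˢ K)).prod (volume.restrict (Icc 0 R))

theorem volume_slab_lt_top (T : ℝ) {K : Set (Eu d)} (hK : IsCompact K) : vol[TX d] (Ico 0 T ×ˢ K) < ⊤ := by
  rw [volume_eq_prod, prod_prod]
  exact ENNReal.mul_lt_top measure_Ico_lt_top hK.measure_lt_top

theorem isFiniteMeasure_slab_left (T : ℝ) {K : Set (Eu d)} (hK : IsCompact K) :
    IsFiniteMeasure (vol[TX d].restrict (Ico 0 T ×ˢ K)) :=
  ⟨by rw [restrict_apply_univ]; exact volume_slab_lt_top T hK⟩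

theorem isFiniteMeasure_slab (T R : ℝ) {K : Set (Eu d)} (hK : IsCompact K) : IsFiniteMeasure (slab T R K) := by
  have := isFiniteMeasure_slab_left T hK
  unfold slab
  infer_instance

theorem ae_slab (T R : ℝ) (K : Set (Eu d)) : ∀ᵐ z ∂(slab T R K), z.2 ∈ Icc 0 R :=
  quasiMeasurePreserving_snd.ae (ae_restrict_mem measurableSet_Icc)

theorem IsDensity.measurable_mul {H1 H2 : Den[d]} (hH1 : IsDensity H1) (hH2 : IsDensity H2) :
    Measurable (fun z : TX d × ℝ => H1 z.1 z.2 * H2 z.1 z.2) :=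
  hH1.meas.mul hH2.meas

theorem IsDensity.integrable_mul {H1 H2 : Den[d]} (hH1 : IsDensity H1) (hH2 : IsDensity H2)
    (μ : Measure (TX d × ℝ)) [IsFiniteMeasure μ] :
    Integrable (fun z : TX d × ℝ => H1 z.1 z.2 * H2 z.1 z.2) μ := by
  refine Integrable.of_bound (hH1.measurable_mul hH2).aestronglyMeasurable 1 (ae_of_all _ fun z => ?_)
  rw [norm_mul, norm_eq_abs, norm_eq_abs]
  exact mul_le_one₀ (hH1.abs_le_one _ _) (abs_nonneg _) (hH2.abs_le_one _ _)

theorem ballVol_nonneg (r : ℝ) : 0 ≤ ballVol vol[TX d] r := measureReal_nonneg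

theorem tendsto_integral_ballAvg_mul {H1 H2 : Den[d]} (hH1 : IsDensity H1)
    (hH2 : IsDensity H2) {r : ℝ} (hr : 0 < r) (T R : ℝ) {K : Set (Eu d)} (hK : IsCompact K) :
    Tendsto (fun ε => ∫ z, ballAvg volume r ε (fun x => H1 x z.2) z.1
        * ballAvg volume r ε (fun x => H2 x z.2) z.1 ∂(slab T R K)) (𝓝[>] 0)
      (𝓝 (∫ z, (ballVol vol[TX d] r * H1 z.1 z.2) * (ballVol vol[TX d] r * H2 z.1 z.2) ∂(slab T R K))) := by
  have := isFiniteMeasure_slab_left T hK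
  have := isFiniteMeasure_slab T R hK
  refine tendsto_integral_prod_of_bounded (S := univ) (C := ballVol vol[TX d] r * ballVol vol[TX d] r)
    (ae_of_all _ fun _ => mem_univ _)
    (fun ε => (measurable_ballAvg hH1).mul (measurable_ballAvg hH2)) ?_ ?_ ?_
  · have := (hH1.integrable_mul hH2 (slab T R K)).const_mul (ballVol vol[TX d] r * ballVol vol[TX d] r)
    refine this.congr (ae_of_all _ fun z => ?_)
    simp only; ring
  · filter_upwards [self_mem_nhdsWithin] with ε hε ξ _ x
    rw [abs_mul]
    exact mul_le_mul (ballAvg_le hr.le hε (fun z => hH1.abs_le_one z ξ) x)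
      (ballAvg_le hr.le hε (fun z => hH2.abs_le_one z ξ) x) (abs_nonneg _) (ballVol_nonneg r)
  · intro ξ _
    refine ae_restrict_of_ae ?_
    filter_upwards [ae_isLebPt (hH1.locallyIntegrable ξ), ae_isLebPt (hH2.locallyIntegrable ξ)] with x hx1 hx2
    exact (hx1.tendsto_ballAvg (hH1.locallyIntegrable ξ) hr).mul (hx2.tendsto_ballAvg (hH2.locallyIntegrable ξ) hr)

/-- A quantity that is bounded by `C ∫ H1 H2` up to an error that vanishes as `ε → 0`. -/
def BoundedByOverlap (H1 H2 : Den[d]) (T R : ℝ) (K : Set (Eu d)) (C : ℝ) (N : ℝ → ℝ) : Prop :=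
  ∀ η > 0, ∀ᶠ ε in 𝓝[>] 0, |N ε| ≤ C * (∫ z, H1 z.1 z.2 * H2 z.1 z.2 ∂(slab T R K)) + η

theorem BoundedByOverlap.add {H1 H2 : Den[d]} {T R : ℝ} {K : Set (Eu d)} {C C' : ℝ}
    {N N' : ℝ → ℝ} (h : BoundedByOverlap H1 H2 T R K C N) (h' : BoundedByOverlap H1 H2 T R K C' N') :
    BoundedByOverlap H1 H2 T R K (C + C') (fun ε => N ε + N' ε) := by
  intro η hη
  filter_upwards [h (η / 2) (half_pos hη), h' (η / 2) (half_pos hη)] with ε h1 h2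
  calc _ ≤ |N ε| + |N' ε| := abs_add_le _ _
    _ ≤ _ := by linarith

theorem BoundedByOverlap.mono {H1 H2 : Den[d]} {T R : ℝ} {K : Set (Eu d)} {C : ℝ}
    {N N' : ℝ → ℝ} (h : BoundedByOverlap H1 H2 T R K C N)
    (h' : ∀ᶠ ε in 𝓝[>] 0, |N' ε| ≤ |N ε|) : BoundedByOverlap H1 H2 T R K C N' := by
  intro η hη
  filter_upwards [h η hη, h'] with ε h1 h2 using h2.trans h1

theorem BoundedByOverlap.swap {H1 H2 : Den[d]} {T R : ℝ} {K : Set (Eu d)} {C : ℝ}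
    {N : ℝ → ℝ} (h : BoundedByOverlap H1 H2 T R K C N) : BoundedByOverlap H2 H1 T R K C N := by
  intro η hη
  simp only [mul_comm (H2 _ _)]
  exact h η hη

theorem boundedByOverlap_ballAvg {H1 H2 : Den[d]} (hH1 : IsDensity H1) (hH2 : IsDensity H2)
    {r : ℝ} (hr : 0 < r) (T R : ℝ) {K : Set (Eu d)} (hK : IsCompact K) {A : ℝ} (hA : 0 ≤ A) :
    BoundedByOverlap H1 H2 T R K (A * ballVol vol[TX d] r ^ 2) (fun ε =>
      A * ∫ z, ballAvg volume r ε (fun x => H1 x z.2) z.1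
        * ballAvg volume r ε (fun x => H2 x z.2) z.1 ∂(slab T R K)) := by
  intro η hη
  have h := (tendsto_integral_ballAvg_mul hH1 hH2 hr T R hK).const_mul A
  have h2 := h.eventually (gt_mem_nhds (lt_add_of_pos_right _ hη))
  filter_upwards [h2, self_mem_nhdsWithin] with ε h3 hε
  have hε : 0 < ε := hε
  rw [abs_of_nonneg]
  · refine h3.le.trans (le_of_eq ?_)
    have e : ∀ z : TX d × ℝ, (ballVol vol[TX d] r * H1 z.1 z.2) * (ballVol vol[TX d] r * H2 z.1 z.2)
        = ballVol vol[TX d] r ^ 2 * (H1 z.1 z.2 * H2 z.1 z.2) := fun z => by ring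
    simp only [e, integral_const_mul, mul_assoc]
  · exact mul_nonneg hA (integral_nonneg fun z => mul_nonneg (ballAvg_nonneg hε.le (fun x => hH1.nonneg x _) _)
      (ballAvg_nonneg hε.le (fun x => hH2.nonneg x _) _))

theorem integrable_ballAvg_mul {H1 H2 : Den[d]} (hH1 : IsDensity H1) (hH2 : IsDensity H2)
    {r : ℝ} (hr : 0 < r) {ε : ℝ} (hε : 0 < ε) (μ : Measure (TX d × ℝ)) [IsFiniteMeasure μ] :
    Integrable (fun z : TX d × ℝ => ballAvg volume r ε (fun x => H1 x z.2) z.1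
        * ballAvg volume r ε (fun x => H2 x z.2) z.1) μ := by
  refine Integrable.of_bound ((measurable_ballAvg hH1).mul (measurable_ballAvg hH2)).aestronglyMeasurable
    (ballVol vol[TX d] r * ballVol vol[TX d] r)
    (ae_of_all _ fun z => ?_)
  rw [norm_mul, norm_eq_abs, norm_eq_abs]
  exact mul_le_mul (ballAvg_le hr.le hε (fun x => hH1.abs_le_one x z.2) z.1)
      (ballAvg_le hr.le hε (fun x => hH2.abs_le_one x z.2) z.1) (abs_nonneg _) (ballVol_nonneg r)

theorem boundedByOverlap_of_le {H1 H2 : Den[d]} (hH1 : IsDensity H1) (hH2 : IsDensity H2)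
    {r : ℝ} (hr : 0 < r) (T R : ℝ) {K : Set (Eu d)} (hK : IsCompact K) {A : ℝ} (hA : 0 ≤ A)
    {F : ℝ → TX d × ℝ → ℝ}
    (hF : ∀ᶠ ε in 𝓝[>] 0, ∀ x, ∀ ξ ∈ Icc 0 R, |F ε (x, ξ)|
      ≤ A * (ballAvg volume r ε (fun x => H1 x ξ) x * ballAvg volume r ε (fun x => H2 x ξ) x)) :
    BoundedByOverlap H1 H2 T R K (A * ballVol vol[TX d] r ^ 2) (fun ε => ∫ z, F ε z ∂(slab T R K)) := by
  refine (boundedByOverlap_ballAvg hH1 hH2 hr T R hK hA).mono ?_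
  have := isFiniteMeasure_slab T R hK
  filter_upwards [hF, self_mem_nhdsWithin] with ε hF hε
  refine le_trans ?_ (le_abs_self _)
  rw [← integral_const_mul]
  refine abs_integral_le_integral ((integrable_ballAvg_mul hH1 hH2 hr hε (slab T R K)).const_mul A) ?_
  filter_upwards [ae_slab T R K] with z hz using hF z.1 z.2 hz

/-! ### First-order fields -/

/-- The divergence of the field `W(·,ξ)` is bounded by `B` in the weak sense. -/
def WeakDivBound (R B : ℝ) (W : Eu d → ℝ → Eu d) : Prop :=
  ∀ ξ ∈ Icc 0 R, ∀ ψ : Eu d → ℝ, ContDiff ℝ ∞ ψ → HasCompactSupport ψ →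
    |∫ y, fderiv ℝ ψ y (W y ξ)| ≤ B * ∫ y, |ψ y|

/-- Compactly supported continuous fields with weakly bounded divergence that are, up to a small
error in a negative norm in `ξ`, Lipschitz in space. -/
structure AdmissibleField (R B : ℝ) (W : Eu d → ℝ → Eu d) : Prop where
  cont : Continuous (uncurry W)
  bdd : ∃ S, ∀ y, ∀ ξ ∈ Icc 0 R, ‖W y ξ‖ ≤ S
  div : WeakDivBound R B W
  approx : ∀ η > 0, ∃ (W' e : Eu d → ℝ → Eu d) (Λ : ℝ), Continuous (uncurry W') ∧
    (∀ ξ ∈ Icc 0 R, ∀ y z, ‖W' y ξ - W' z ξ‖ ≤ Λ * ‖y - z‖) ∧ WeakDivBound R B W' ∧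
    (∀ y ξ, HasDerivAt (e y) (W y ξ - W' y ξ) ξ) ∧
    ∀ ξ ∈ Icc 0 R, ∀ y z, ‖e y ξ - e z ξ‖ ≤ η * ‖y - z‖

namespace MollKernel

variable (κ : MollKernel d)

theorem continuous_scaled_sub (ε : ℝ) : Continuous (fun p : TX d × TX d × ℝ => κ.scaled ε (p.1 - p.2.1)) :=
  (κ.scaled_smooth ε).continuous.comp (continuous_fst.sub continuous_snd.fst)

/-- The kernel `Φ_ε(x - x') c(x', x, ξ)`. -/
theorem kernelBound_scaled {ε : ℝ} (hε : 0 < ε) {S : Set ℝ} {c : TX d → Den[d]} {A : ℝ}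
    (hc : Continuous (fun p : TX d × TX d × ℝ => c p.1 p.2.1 p.2.2))
    (hA : ∀ x x', ∀ ξ ∈ S, dist x' x ≤ κ.r * ε → |c x x' ξ| ≤ A) :
    KernelBound κ.r ε (κ.C * A) S (fun x x' ξ => κ.scaled ε (x - x') * c x x' ξ) where
  cont := (κ.continuous_scaled_sub ε).mul hc
  bound x x' ξ hξ := by
    have hpos : 0 ≤ (ε ^ finrank ℝ (TX d))⁻¹ := by positivity
    by_cases h : dist x' x ≤ κ.r * ε
    · rw [abs_mul]
      have h1 := κ.scaled_bound hε (x - x')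
      calc _ ≤ κ.C * (ε ^ finrank ℝ (TX d))⁻¹ * A := by
            refine mul_le_mul h1 (hA x x' ξ hξ h) (abs_nonneg _) (mul_nonneg κ.C_nonneg hpos)
        _ = _ := by ring
    · have h0 : 0 ≤ A := (abs_nonneg _).trans (hA x x ξ hξ (by simp [κ.r_pos.le, hε.le, mul_nonneg]))
      rw [κ.scaled_supp hε (by rw [← dist_eq_norm, dist_comm]; exact not_le.1 h), zero_mul, abs_zero]
      exact mul_nonneg (mul_nonneg κ.C_nonneg h0) hpos
  supp x x' ξ h := by
    rw [κ.scaled_supp hε (by rw [← dist_eq_norm, dist_comm]; exact h), zero_mul]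

/-- The kernel `DΦ_ε(x - x')(0, V(x, x', ξ))`. -/
theorem kernelBound_fderiv {ε : ℝ} (hε : 0 < ε) {S : Set ℝ} {V : TX d → TX d → ℝ → Eu d} {A : ℝ}
    (hV : Continuous (fun p : TX d × TX d × ℝ => V p.1 p.2.1 p.2.2))
    (hA : ∀ x x', ∀ ξ ∈ S, dist x' x ≤ κ.r * ε → ‖V x x' ξ‖ ≤ A) :
    KernelBound κ.r ε (κ.C * ε⁻¹ * A) S (fun x x' ξ => fderiv ℝ (κ.scaled ε) (x - x') (0, V x x' ξ)) where
  cont := ((κ.fderiv_scaled_continuous ε).comp (continuous_fst.sub continuous_snd.fst)).clm_apply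
    (continuous_const.prodMk hV)
  bound x x' ξ hξ := by
    have hpos : 0 ≤ (ε ^ finrank ℝ (TX d))⁻¹ := by positivity
    have hpos' : 0 ≤ κ.C * ε⁻¹ := mul_nonneg κ.C_nonneg (by positivity)
    by_cases h : dist x' x ≤ κ.r * ε
    · have h1 := κ.fderiv_scaled_bound hε (x - x') (0, V x x' ξ)
      refine h1.trans ?_
      have h2 : ‖((0 : ℝ), V x x' ξ)‖ ≤ A := by
        rw [Prod.norm_mk, norm_zero]
        exact max_le ((norm_nonneg _).trans (hA x x' ξ hξ h)) (hA x x' ξ hξ h)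
      gcongr
    · have h0 : 0 ≤ A := (norm_nonneg _).trans (hA x x ξ hξ (by simp [κ.r_pos.le, hε.le, mul_nonneg]))
      rw [κ.fderiv_scaled_supp hε (by rw [← dist_eq_norm, dist_comm]; exact not_le.1 h)]
      simp only [zero_apply, abs_zero]
      exact mul_nonneg (mul_nonneg hpos' h0) hpos
  supp x x' ξ h := by
    rw [κ.fderiv_scaled_supp hε (by rw [← dist_eq_norm, dist_comm]; exact h)]
    rfl

end MollKernel

end

section

variable {d : ℕ}

theorem integral_fderiv_apply_eq_zero {E : Type*} [NormedAddCommGroup E] [NormedSpace ℝ E]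
    [FiniteDimensional ℝ E] [MeasurableSpace E] [BorelSpace E] (μ : Measure E) [μ.IsAddHaarMeasure]
    {ψ : E → ℝ} (hψ : ContDiff ℝ 1 ψ) (hc : HasCompactSupport ψ) (v : E) :
    ∫ x, fderiv ℝ ψ x v ∂μ = 0 := by
  have hd : Integrable (fun x => fderiv ℝ ψ x v) μ :=
    ((hψ.continuous_fderiv (by simp)).clm_apply continuous_const).integrable_of_hasCompactSupport (hc.fderiv_apply ℝ v)
  have hi : Integrable ψ μ := hψ.continuous.integrable_of_hasCompactSupport hc
  have h := integral_mul_fderiv_eq_neg_fderiv_mul_of_integrable (μ := μ) (f := fun _ => 1)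
    (g := ψ) (v := v) (by simp) (by simpa using hd) (by simpa using hi)
    (fun x _ => differentiableAt_const _) (fun x _ => (hψ.differentiable (by simp)) x)
  simpa using h

namespace MollKernel

variable (κ : MollKernel d)

/-- The slice `z ↦ Φ_ε(t - s, y - z)`. -/
theorem slice_smooth (ε : ℝ) (x : TX d) (s : ℝ) : ContDiff ℝ ∞ (fun z : Eu d => κ.scaled ε (x - (s, z))) :=
  (κ.scaled_smooth ε).comp (by fun_prop)

theorem slice_compact {ε : ℝ} (hε : 0 < ε) (x : TX d) (s : ℝ) :
    HasCompactSupport (fun z : Eu d => κ.scaled ε (x - (s, z))) := by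
  refine HasCompactSupport.intro (isCompact_closedBall x.2 (κ.r * ε)) fun z hz => ?_
  refine κ.scaled_supp hε (lt_of_lt_of_le ?_ (norm_snd_le _))
  simpa [dist_eq_norm, norm_sub_rev] using hz

theorem fderiv_slice (ε : ℝ) (x : TX d) (s : ℝ) (z v : Eu d) : fderiv ℝ (fun z : Eu d => κ.scaled ε (x - (s, z))) z v
      = - fderiv ℝ (κ.scaled ε) (x - (s, z)) (0, v) := by
  have h1 : HasFDerivAt (κ.scaled ε) (fderiv ℝ (κ.scaled ε) (x - (s, z))) (x - (s, z)) :=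
    ((κ.scaled_smooth ε).differentiable (by simp) _).hasFDerivAt
  have h2 : HasFDerivAt (fun z => x - (s, z)) (-(ContinuousLinearMap.inr ℝ ℝ (Eu d))) z :=
    ((hasFDerivAt_prodMk_right s z)).const_sub x
  have h3 := h1.comp z h2
  have h4 : HasFDerivAt (fun z => κ.scaled ε (x - (s, z))) _ z := h3
  rw [h4.fderiv]
  simp

theorem integral_scaled_sub {ε : ℝ} (hε : 0 < ε) (x : TX d) : ∫ x', κ.scaled ε (x - x') = 1 := by
  rw [integral_sub_left_eq_self (fun u => κ.scaled ε u) volume x, κ.integral_scaled hε]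

theorem integral_fderiv_scaled_const {ε : ℝ} (hε : 0 < ε) (x v : TX d) :
    ∫ x', fderiv ℝ (κ.scaled ε) (x - x') v = 0 := by
  rw [integral_sub_left_eq_self (fun u => fderiv ℝ (κ.scaled ε) u v) volume x]
  exact integral_fderiv_apply_eq_zero _ ((κ.scaled_smooth ε).of_le (by simp)) (κ.scaled_compact hε) v

theorem integrable_fderiv_scaled {ε : ℝ} (hε : 0 < ε) (x : TX d) {V : TX d → Eu d}
    (hV : Continuous V) : Integrable (fun x' => fderiv ℝ (κ.scaled ε) (x - x') (0, V x')) := by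
  refine Continuous.integrable_of_hasCompactSupport ?_ ?_
  · exact ((κ.fderiv_scaled_continuous ε).comp (by fun_prop)).clm_apply (by fun_prop)
  · refine HasCompactSupport.intro (isCompact_closedBall x (κ.r * ε)) fun z hz => ?_
    rw [κ.fderiv_scaled_supp hε (by simpa [dist_eq_norm, norm_sub_rev] using hz)]
    rfl

theorem abs_integral_fderiv_scaled_le {ε : ℝ} (hε : 0 < ε) {R B : ℝ}
    {W : Eu d → ℝ → Eu d} (hW : Continuous (uncurry W)) (hdiv : WeakDivBound R B W)
    (x : TX d) {ξ : ℝ} (hξ : ξ ∈ Icc 0 R) :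
    |∫ x', fderiv ℝ (κ.scaled ε) (x - x') (0, W x'.2 ξ)| ≤ B := by
  have hWξ : Continuous (fun x' : TX d => W x'.2 ξ) := hW.comp (continuous_snd.prodMk continuous_const)
  have hint := κ.integrable_fderiv_scaled hε x hWξ
  have hint2 : Integrable (fun x' => κ.scaled ε (x - x')) := by
    have := ((κ.scaled_smooth ε).continuous.integrable_of_hasCompactSupport (κ.scaled_compact hε)
      (μ := volume)).comp_sub_left x
    exact this
  rw [volume_eq_prod] at hint hint2 ⊢
  rw [integral_prod _ hint]
  have h1 : ∀ s : ℝ, |∫ z : Eu d, fderiv ℝ (κ.scaled ε) (x - (s, z)) (0, W z ξ)|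
      ≤ B * ∫ z : Eu d, κ.scaled ε (x - (s, z)) := by
    intro s
    have h2 := hdiv ξ hξ _ (κ.slice_smooth ε x s) (κ.slice_compact hε x s)
    simp only [fderiv_slice, integral_neg, abs_neg] at h2
    simpa only [abs_of_nonneg (κ.scaled_nonneg hε _)] using h2
  refine (abs_integral_le_integral (hint2.integral_prod_left.const_mul B) (ae_of_all _ h1)).trans (le_of_eq ?_)
  rw [integral_const_mul, ← integral_prod _ hint2, ← volume_eq_prod, κ.integral_scaled_sub hε, mul_one]

/-- Regularisation of `W · ∇`. -/
def kD (ε : ℝ) (W : Eu d → ℝ → Eu d) (x x' : TX d) (ξ : ℝ) : ℝ := fderiv ℝ (κ.scaled ε) (x - x') (0, W x'.2 ξ)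

/-- The derivative of the regularisation in the direction `W`. -/
def kY (ε : ℝ) (W : Eu d → ℝ → Eu d) (x x' : TX d) (ξ : ℝ) : ℝ := fderiv ℝ (κ.scaled ε) (x - x') (0, W x.2 ξ)

/-- The commutator of the regularisation and `W · ∇`. -/
def kR (ε : ℝ) (W : Eu d → ℝ → Eu d) (x x' : TX d) (ξ : ℝ) : ℝ := fderiv ℝ (κ.scaled ε) (x - x') (0, W x'.2 ξ - W x.2 ξ)

/-- Regularisation of multiplication by `c`. -/
def kM (ε : ℝ) (c : Eu d → ℝ → ℝ) (x x' : TX d) (ξ : ℝ) : ℝ := κ.scaled ε (x - x') * c x'.2 ξ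

/-- The mollifier weighted by a cutoff. -/
notation "kC[" κ ", " ε "]" => MollKernel.kM κ ε (fun _ _ => 1)
notation "kC[" κ ", " ε ", " φ "]" => MollKernel.kM κ ε (fun y _ => φ y)

variable {κ} {ε : ℝ} {R B : ℝ} {W : Eu d → ℝ → Eu d}

theorem continuous_snd_left {G : Type*} [TopologicalSpace G] {W : Eu d → ℝ → G} (hW : Continuous (uncurry W)) :
    Continuous (fun p : TX d × TX d × ℝ => W p.1.2 p.2.2) :=
  hW.comp (continuous_fst.snd.prodMk continuous_snd.snd)

theorem continuous_snd_right {G : Type*} [TopologicalSpace G] {W : Eu d → ℝ → G} (hW : Continuous (uncurry W)) :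
    Continuous (fun p : TX d × TX d × ℝ => W p.2.1.2 p.2.2) :=
  hW.comp (continuous_snd.fst.snd.prodMk continuous_snd.snd)

theorem kernelBound_kD (hε : 0 < ε) (hW : Continuous (uncurry W)) {S : ℝ} {I : Set ℝ}
    (hS : ∀ y, ∀ ξ ∈ I, ‖W y ξ‖ ≤ S) : KernelBound κ.r ε (κ.C * ε⁻¹ * S) I (κ.kD ε W) :=
  κ.kernelBound_fderiv hε (by fun_prop) fun _ x' ξ hξ _ => hS x'.2 ξ hξ

theorem kernelBound_kY (hε : 0 < ε) (hW : Continuous (uncurry W)) {S : ℝ} {I : Set ℝ}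
    (hS : ∀ y, ∀ ξ ∈ I, ‖W y ξ‖ ≤ S) : KernelBound κ.r ε (κ.C * ε⁻¹ * S) I (κ.kY ε W) :=
  κ.kernelBound_fderiv hε (by fun_prop) fun x _ ξ hξ _ => hS x.2 ξ hξ

theorem kernelBound_kR (hε : 0 < ε) (hW : Continuous (uncurry W)) {Λ : ℝ} {I : Set ℝ}
    (hΛ : ∀ ξ ∈ I, ∀ y z, ‖W y ξ - W z ξ‖ ≤ Λ * ‖y - z‖) :
    KernelBound κ.r ε (κ.C * (|Λ| * κ.r)) I (κ.kR ε W) := by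
  have h := κ.kernelBound_fderiv hε (S := I) (V := fun x x' ξ => W x'.2 ξ - W x.2 ξ)
    (A := |Λ| * (κ.r * ε)) (by fun_prop)
    (fun x x' ξ hξ hd => by
      refine (hΛ ξ hξ _ _).trans ?_
      have h1 : ‖x'.2 - x.2‖ ≤ κ.r * ε := by
        refine le_trans ?_ hd
        rw [dist_eq_norm]
        exact norm_snd_le (x' - x)
      exact mul_le_mul (le_abs_self _) h1 (norm_nonneg _) (abs_nonneg _))
  have e : κ.C * ε⁻¹ * (|Λ| * (κ.r * ε)) = κ.C * (|Λ| * κ.r) := by field_simp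
  rwa [e] at h

theorem kernelBound_kM (hε : 0 < ε) {c : Eu d → ℝ → ℝ} (hc : Continuous (uncurry c))
    {A : ℝ} {I : Set ℝ} (hA : ∀ y, ∀ ξ ∈ I, |c y ξ| ≤ A) :
    KernelBound κ.r ε (κ.C * A) I (κ.kM ε c) :=
  κ.kernelBound_scaled hε (by fun_prop) fun _ x' ξ hξ _ => hA x'.2 ξ hξ

end MollKernel

/-- The function `1`. -/
theorem isDensity_one : IsDensity (fun (_ : TX d) (_ : ℝ) => 1) :=
  ⟨measurable_const, fun _ _ => zero_le_one, fun _ _ => le_rfl⟩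

open MollKernel

variable {κ : MollKernel d} {R B T : ℝ} {H1 H2 : Den[d]} {K : Set (Eu d)}

/-- The commutator with a Lipschitz field, measured by the bound on the divergence of the field. -/
theorem boundedByOverlap_commutator (hH1 : IsDensity H1) (hH2 : IsDensity H2) (hK : IsCompact K)
    (hB : 0 ≤ B) {W : Eu d → ℝ → Eu d} (hW : Continuous (uncurry W)) {Λ : ℝ}
    (hΛ : ∀ ξ ∈ Icc 0 R, ∀ y z, ‖W y ξ - W z ξ‖ ≤ Λ * ‖y - z‖) (hdiv : WeakDivBound R B W)
    {φ : Eu d → ℝ → ℝ} (hφ : Continuous (uncurry φ)) {A : ℝ}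
    (hA : ∀ y, ∀ ξ ∈ Icc 0 R, |φ y ξ| ≤ A) (hA0 : 0 ≤ A) {w : Eu d → ℝ} {A' : ℝ} (hw : ∀ y, |w y| ≤ A') :
    BoundedByOverlap H1 H2 T R K (A' * B * (κ.C * A) * ballVol vol[TX d] κ.r)
      (fun ε => ∫ z, w z.1.2 * (kint (κ.kR ε W) H1 z.1 z.2 * kint (κ.kM ε φ) H2 z.1 z.2) ∂slab T R K) := by
  have := isFiniteMeasure_slab_left T hK
  have := isFiniteMeasure_slab T R hK
  set V := ballVol vol[TX d] κ.r
  have hV : 0 ≤ V := ballVol_nonneg _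
  have hA' : 0 ≤ A' := (abs_nonneg _).trans (hw 0)
  set one : Den[d] := fun _ _ => 1
  have hcR : ∀ ε, Continuous (fun p : TX d × TX d × ℝ => κ.kR ε W p.1 p.2.1 p.2.2) := fun ε =>
    ((κ.fderiv_scaled_continuous ε).comp (by fun_prop)).clm_apply (by fun_prop)
  set err : ℝ → TX d × ℝ → ℝ := fun ε z =>
    |kint (κ.kR ε W) H1 z.1 z.2 - kint (κ.kR ε W) one z.1 z.2 * H1 z.1 z.2|
  have hone : ∀ ε, 0 < ε → ∀ x, ∀ ξ ∈ Icc 0 R, |kint (κ.kR ε W) one x ξ| ≤ B := by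
    intro ε hε x ξ hξ
    have e1 : kint (κ.kR ε W) one x ξ = ∫ x', fderiv ℝ (κ.scaled ε) (x - x') (0, W x'.2 ξ) := by
      have hWξ : Continuous (fun x' : TX d => W x'.2 ξ) := hW.comp (continuous_snd.prodMk continuous_const)
      have e2 : ∀ x' : TX d, κ.kR ε W x x' ξ * one x' ξ = fderiv ℝ (κ.scaled ε) (x - x') (0, W x'.2 ξ)
            - fderiv ℝ (κ.scaled ε) (x - x') (0, W x.2 ξ) := fun x' => by
        
        have e3 : ((0 : ℝ), W x'.2 ξ - W x.2 ξ) = (0, W x'.2 ξ) - (0, W x.2 ξ) := by simp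
        rw [mul_one, kR, e3, map_sub]
      simp only [kint, e2]
      rw [integral_sub (κ.integrable_fderiv_scaled hε x hWξ)
        (κ.integrable_fderiv_scaled hε x continuous_const), κ.integral_fderiv_scaled_const hε,
        sub_zero]
    rw [e1]
    exact κ.abs_integral_fderiv_scaled_le hε hW hdiv x hξ
  have hkR : ∀ ε, 0 < ε → ∀ x, ∀ ξ ∈ Icc 0 R, |kint (κ.kR ε W) H1 x ξ| ≤ κ.C * (|Λ| * κ.r) * V := by
    intro ε hε x ξ hξ
    refine ((kernelBound_kR hε hW hΛ).abs_kint_le hH1 x hξ).trans ?_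
    refine mul_le_mul_of_nonneg_left ((le_abs_self _).trans
      (ballAvg_le κ.r_pos.le hε (fun z => hH1.abs_le_one z ξ) x)) ?_
    exact mul_nonneg κ.C_nonneg (mul_nonneg (abs_nonneg _) κ.r_pos.le)
  have hbd : ∀ ε, 0 < ε → ∀ ξ ∈ Icc 0 R, ∀ x, |(B * H1 x ξ + err ε (x, ξ))
      * ballAvg volume κ.r ε (fun x => H2 x ξ) x| ≤ (B + (κ.C * (|Λ| * κ.r) * V + B)) * V := by
    intro ε hε ξ hξ x
    have e1 := hone ε hε x ξ hξ
    have e2 := hkR ε hε x ξ hξ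
    have e3 := hH1.abs_le_one x ξ
    have e4 : |err ε (x, ξ)| ≤ κ.C * (|Λ| * κ.r) * V + B := by
      rw [abs_abs]
      refine (abs_sub _ _).trans (add_le_add e2 ?_)
      rw [abs_mul]
      calc _ ≤ B * 1 := mul_le_mul e1 e3 (abs_nonneg _) hB
        _ = B := mul_one B
    rw [abs_mul]
    refine mul_le_mul ((abs_add_le _ _).trans (add_le_add ?_ e4))
      (ballAvg_le κ.r_pos.le hε (fun z => hH2.abs_le_one z ξ) x) (abs_nonneg _)
      (add_nonneg hB ((abs_nonneg _).trans e4))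
    rw [abs_mul, abs_of_nonneg hB]
    calc _ ≤ B * 1 := mul_le_mul_of_nonneg_left e3 hB
      _ = B := mul_one B
  have hlim : Tendsto (fun ε => ∫ z, (B * H1 z.1 z.2 + err ε z)
      * ballAvg volume κ.r ε (fun x => H2 x z.2) z.1 ∂slab T R K) (𝓝[>] 0)
      (𝓝 (∫ z, B * H1 z.1 z.2 * (V * H2 z.1 z.2) ∂slab T R K)) := by
    refine tendsto_integral_prod_of_bounded (S := Icc 0 R)
      (C := (B + (κ.C * (|Λ| * κ.r) * V + B)) * V) (ae_restrict_mem measurableSet_Icc) ?_ ?_ ?_ ?_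
    · intro ε
      refine Measurable.mul (Measurable.add (hH1.meas.const_mul B) ?_) (measurable_ballAvg hH2)
      exact ((measurable_kint (hcR ε) hH1).sub ((measurable_kint (hcR ε) isDensity_one).mul hH1.meas)).abs
    · have := (hH1.integrable_mul hH2 (slab T R K)).const_mul (B * V)
      refine this.congr (ae_of_all _ fun z => ?_)
      simp only; ring
    · filter_upwards [self_mem_nhdsWithin] with ε hε ξ hξ x
      exact hbd ε hε ξ hξ x
    · intro ξ hξ
      refine ae_restrict_of_ae ?_
      filter_upwards [ae_isLebPt (hH1.locallyIntegrable ξ), ae_isLebPt (hH2.locallyIntegrable ξ)] with x hx1 hx2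
      refine Tendsto.mul ?_ (hx2.tendsto_ballAvg (hH2.locallyIntegrable ξ) κ.r_pos)
      have e0 : Tendsto (fun ε => err ε (x, ξ)) (𝓝[>] 0) (𝓝 0) := by
        have e1 := hx1.tendsto_kernel (hH1.locallyIntegrable ξ) (k := fun ε x' => κ.kR ε W x x' ξ) κ.r_pos
          (by filter_upwards [self_mem_nhdsWithin] with ε hε z; exact (kernelBound_kR hε hW hΛ).bound x z ξ hξ)
          (by filter_upwards [self_mem_nhdsWithin] with ε hε z hz; exact (kernelBound_kR hε hW hΛ).supp x z ξ hz)
        have e2 := e1.abs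
        rw [abs_zero] at e2
        refine e2.congr' ?_
        filter_upwards [self_mem_nhdsWithin] with ε hε
        have i1 := (kernelBound_kR (κ := κ) hε hW hΛ).integrable hH1 x (ξ := ξ)
        have i2 := ((kernelBound_kR (κ := κ) hε hW hΛ).integrable isDensity_one x (ξ := ξ)).mul_const (H1 x ξ)
        simp only [err, kint, one, mul_sub]
        rw [← integral_mul_const, integral_sub i1 (by simpa using i2)]
        simp only [mul_one]
      simpa using e0.const_add (B * H1 x ξ)
  intro η hη
  have hcst : 0 ≤ A' * (κ.C * A) := mul_nonneg hA' (mul_nonneg κ.C_nonneg hA0)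
  have h2 := (hlim.const_mul (A' * (κ.C * A))).eventually (gt_mem_nhds (lt_add_of_pos_right _ hη))
  filter_upwards [h2, self_mem_nhdsWithin] with ε h3 hε
  have hε : 0 < ε := hε
  have h4 : |∫ z, w z.1.2 * (kint (κ.kR ε W) H1 z.1 z.2 * kint (κ.kM ε φ) H2 z.1 z.2) ∂slab T R K|
      ≤ ∫ z, A' * (κ.C * A) * ((B * H1 z.1 z.2 + err ε z)
      * ballAvg volume κ.r ε (fun x => H2 x z.2) z.1) ∂slab T R K := by
    refine abs_integral_le_integral (Integrable.const_mul ?_ _) ?_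
    · refine Integrable.of_bound (C := (B + (κ.C * (|Λ| * κ.r) * V + B)) * V) ?_ ?_
      · refine (Measurable.mul (Measurable.add (hH1.meas.const_mul B) ?_) (measurable_ballAvg hH2)).aestronglyMeasurable
        exact ((measurable_kint (hcR ε) hH1).sub ((measurable_kint (hcR ε) isDensity_one).mul hH1.meas)).abs
      · filter_upwards [ae_slab T R K] with z hz
        exact hbd ε hε z.2 hz z.1
    · filter_upwards [ae_slab T R K] with z hz
      have e1 := hone ε hε z.1 z.2 hz
      have e2 : |kint (κ.kR ε W) H1 z.1 z.2| ≤ B * H1 z.1 z.2 + err ε z := by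
        have e5 : |kint (κ.kR ε W) one z.1 z.2 * H1 z.1 z.2| ≤ B * H1 z.1 z.2 := by
          rw [abs_mul, abs_of_nonneg (hH1.nonneg _ _)]
          exact mul_le_mul_of_nonneg_right e1 (hH1.nonneg _ _)
        have e6 := abs_sub_abs_le_abs_sub (kint (κ.kR ε W) H1 z.1 z.2) (kint (κ.kR ε W) one z.1 z.2 * H1 z.1 z.2)
        simp only [err]
        linarith
      have e3 := (kernelBound_kM (κ := κ) hε hφ hA).abs_kint_le hH2 z.1 hz
      rw [abs_mul, abs_mul]
      calc _ ≤ A' * ((B * H1 z.1 z.2 + err ε z) * (κ.C * A * ballAvg volume κ.r ε (fun x => H2 x z.2) z.1)) := by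
            refine mul_le_mul (hw _) (mul_le_mul e2 e3 (abs_nonneg _) ((abs_nonneg _).trans e2)) (by positivity) hA'
        _ = _ := by ring
  refine h4.trans ?_
  rw [integral_const_mul]
  refine h3.le.trans (le_of_eq ?_)
  rw [← integral_const_mul, ← integral_const_mul]
  congr 1
  refine integral_congr_fun fun z => ?_
  ring

/-- The commutator with a field that is small in a negative norm in `ξ`. -/
theorem abs_integral_commutator_le (hH1 : IsDensity H1) (hH2 : IsDensity H2)
    (hbv : ∀ᵐ z ∂(vol[TX d].prod volume), ∀ (e e' : ℝ → ℝ) (η : ℝ), 0 ≤ η →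
      (∀ ξ, HasDerivAt e (e' ξ) ξ) → Continuous e' → (∀ ξ ∈ Icc 0 R, |e ξ| ≤ η) →
      |∫ ξ in Icc 0 R, H1 z.1 ξ * H2 z.2 ξ * e' ξ| ≤ 2 * η)
    {W e : Eu d → ℝ → Eu d} (hW : Continuous (uncurry W))
    (he : ∀ y ξ, HasDerivAt (e y) (W y ξ) ξ) {η : ℝ} (hη : 0 ≤ η)
    (heη : ∀ ξ ∈ Icc 0 R, ∀ y z, ‖e y ξ - e z ξ‖ ≤ η * ‖y - z‖)
    {φ : Eu d → ℝ} (hφ : Continuous φ) {A : ℝ} (hA : ∀ y, |φ y| ≤ A) {ε : ℝ} (hε : 0 < ε) (x : TX d) :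
    |∫ ξ in Icc 0 R, kint (κ.kR ε W) H1 x ξ * kint kC[κ, ε, φ] H2 x ξ|
      ≤ 2 * η * (κ.C * κ.C * κ.r * A) * ballVol vol[TX d] κ.r ^ 2 := by
  set n := finrank ℝ (TX d)
  set V := ballVol vol[TX d] κ.r
  have hA0 : 0 ≤ A := (abs_nonneg _).trans (hA 0)
  set b := closedBall x (κ.r * ε)
  have hbfin : volume b < ⊤ := (isCompact_closedBall _ _).measure_lt_top
  have : IsFiniteMeasure (vol[TX d].restrict b) := ⟨by rwa [restrict_apply_univ]⟩
  set ν := (volume.restrict b).prod (volume.restrict b)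
  set G : ℝ → TX d × TX d → ℝ := fun ξ z => (κ.kR ε W x z.1 ξ * H1 z.1 ξ) * (κ.scaled ε (x - z.2) * φ z.2.2 * H2 z.2 ξ)
  have hcM := κ.continuous_scaled_sub ε
  have hoff : ∀ k : TX d → Den[d], ∀ H : Den[d], ∀ ξ,
      (∀ x', x' ∉ b → k x x' ξ = 0) → kint k H x ξ = ∫ x' in b, k x x' ξ * H x' ξ := by
    intro k H ξ hk
    refine (setIntegral_eq_integral_of_forall_compl_eq_zero fun z hz => ?_).symm
    rw [hk z hz, zero_mul]
  have hs0 : ∀ x', x' ∉ b → κ.scaled ε (x - x') = 0 := fun x' hx' =>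
    κ.scaled_supp hε (by simpa [b, dist_eq_norm, norm_sub_rev] using hx')
  have hf0 : ∀ x', x' ∉ b → fderiv ℝ (κ.scaled ε) (x - x') = 0 := fun x' hx' =>
    κ.fderiv_scaled_supp hε (by simpa [b, dist_eq_norm, norm_sub_rev] using hx')
  have h1 : ∀ ξ, kint (κ.kR ε W) H1 x ξ * kint kC[κ, ε, φ] H2 x ξ = ∫ z, G ξ z ∂ν := by
    intro ξ
    rw [hoff _ H1 ξ (fun x' hx' => by rw [kR, hf0 x' hx']; rfl),
      hoff _ H2 ξ (fun x' hx' => by rw [kM, hs0 x' hx', zero_mul]), ← integral_prod_mul]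
    rfl
  obtain ⟨Λ, hΛ⟩ : ∃ Λ, ∀ x' ∈ b, ∀ ξ ∈ Icc 0 R, |κ.kR ε W x x' ξ| ≤ Λ := by
    have hc : ContinuousOn (fun p => κ.kR ε W x p.1 p.2) (b ×ˢ Icc 0 R) := by
      refine Continuous.continuousOn ?_
      exact ((κ.fderiv_scaled_continuous ε).comp (by fun_prop)).clm_apply (by fun_prop)
    obtain ⟨Λ, hΛ⟩ := ((isCompact_closedBall _ _).prod isCompact_Icc).exists_bound_of_continuousOn hc
    exact ⟨Λ, fun x' hx' ξ hξ => hΛ (x', ξ) ⟨hx', hξ⟩⟩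
  have hGm : Measurable (fun p : ℝ × (TX d × TX d) => G p.1 p.2) := by
    refine Measurable.mul (Measurable.mul ?_ ?_) (Measurable.mul (Measurable.mul ?_ ?_) ?_)
    · refine Continuous.measurable ?_
      exact ((κ.fderiv_scaled_continuous ε).comp (by fun_prop)).clm_apply (by fun_prop)
    · exact hH1.meas.comp (measurable_snd.fst.prodMk measurable_fst)
    · exact ((κ.scaled_smooth ε).continuous.comp (by fun_prop)).measurable
    · fun_prop
    · exact hH2.meas.comp (measurable_snd.snd.prodMk measurable_fst)
  have hN : 0 ≤ (ε ^ n)⁻¹ := by positivity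
  have hint : Integrable (uncurry G) ((volume.restrict (Icc 0 R)).prod ν) := by
    refine Integrable.of_bound hGm.aestronglyMeasurable (Λ * (κ.C * (ε ^ n)⁻¹ * A)) ?_
    have e1 : ∀ᵐ p ∂((volume.restrict (Icc 0 R)).prod ν), p.1 ∈ Icc 0 R :=
      quasiMeasurePreserving_fst.ae (ae_restrict_mem measurableSet_Icc)
    have e2 : ∀ᵐ p ∂((volume.restrict (Icc 0 R)).prod ν), p.2.1 ∈ b :=
      (quasiMeasurePreserving_fst.comp quasiMeasurePreserving_snd).ae
        (ae_restrict_mem isClosed_closedBall.measurableSet)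
    filter_upwards [e1, e2] with p hp1 hp2
    have e3 := hΛ p.2.1 hp2 p.1 hp1
    have e4 := κ.scaled_bound hε (x - p.2.2)
    simp only [uncurry, G, norm_eq_abs, abs_mul]
    have e5 := hH1.abs_le_one p.2.1 p.1
    have e6 := hH2.abs_le_one p.2.2 p.1
    have e7 := hA p.2.2.2
    have hΛ0 : 0 ≤ Λ := (abs_nonneg _).trans e3
    have hC := κ.C_nonneg
    calc _ ≤ (Λ * 1) * (κ.C * (ε ^ n)⁻¹ * A * 1) := by gcongr
      _ = _ := by ring
  simp only [h1]
  rw [integral_integral_swap hint]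
  have hν : ν.real univ = (ε ^ n * V) * (ε ^ n * V) := by
    rw [← univ_prod_univ, measureReal_prod_prod, measureReal_restrict_apply_univ, real_closedBall x κ.r_pos.le hε.le]
  have hbv' : ∀ᵐ z ∂ν, |∫ ξ in Icc 0 R, G ξ z|
      ≤ κ.C * (ε ^ n)⁻¹ * A * (2 * (κ.C * κ.r * η * (ε ^ n)⁻¹)) := by
    have hac : ν ≪ volume.prod volume := Measure.AbsolutelyContinuous.prod restrict_le_self.absolutelyContinuous
        restrict_le_self.absolutelyContinuous
    filter_upwards [hac.ae_le hbv] with z hz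
    have e0 := hz (fun ξ => fderiv ℝ (κ.scaled ε) (x - z.1) (0, e z.1.2 ξ - e x.2 ξ))
      (fun ξ => κ.kR ε W x z.1 ξ) (κ.C * κ.r * η * (ε ^ n)⁻¹)
      (by have := κ.C_nonneg; have := κ.r_pos.le; positivity) ?_ ?_ ?_
    · have e1 : ∀ ξ, G ξ z = (κ.scaled ε (x - z.2) * φ z.2.2)
          * (H1 z.1 ξ * H2 z.2 ξ * κ.kR ε W x z.1 ξ) := fun ξ => by simp only [G]; ring
      simp only [e1]
      rw [integral_const_mul, abs_mul, abs_mul]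
      have hC := κ.C_nonneg
      exact mul_le_mul (mul_le_mul (κ.scaled_bound hε _) (hA _) (abs_nonneg _) (by positivity)) e0
        (abs_nonneg _) (by positivity)
    · intro ξ
      have e2 : HasDerivAt (fun ξ => ((0 : ℝ), e z.1.2 ξ - e x.2 ξ)) (0, W z.1.2 ξ - W x.2 ξ) ξ :=
        (hasDerivAt_const ξ (0 : ℝ)).prodMk ((he _ ξ).sub (he _ ξ))
      exact (fderiv ℝ (κ.scaled ε) (x - z.1)).hasFDerivAt.comp_hasDerivAt ξ e2
    · exact continuous_const.clm_apply (by fun_prop)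
    · intro ξ hξ
      by_cases hzb : z.1 ∈ b
      · refine (κ.fderiv_scaled_bound hε _ _).trans ?_
        have e3 : ‖((0 : ℝ), e z.1.2 ξ - e x.2 ξ)‖ ≤ η * (κ.r * ε) := by
          rw [Prod.norm_mk, norm_zero]
          have e4 : ‖z.1.2 - x.2‖ ≤ κ.r * ε := by
            refine le_trans (norm_snd_le (z.1 - x)) ?_
            rw [← dist_eq_norm]
            exact hzb
          refine max_le (mul_nonneg hη (mul_nonneg κ.r_pos.le hε.le)) ?_
          exact (heη ξ hξ _ _).trans (mul_le_mul_of_nonneg_left e4 hη)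
        have hC := κ.C_nonneg
        calc _ ≤ κ.C * ε⁻¹ * (η * (κ.r * ε)) * (ε ^ n)⁻¹ := by gcongr
          _ = _ := by field_simp
      · rw [hf0 _ hzb]
        have := κ.C_nonneg; have := κ.r_pos.le
        simp only [zero_apply, abs_zero]
        positivity
  have h5 := norm_integral_le_of_norm_le_const (f := fun z => ∫ ξ in Icc 0 R, G ξ z) hbv'
  rw [hν] at h5
  refine h5.trans (le_of_eq ?_)
  field_simp

end

open MollKernel
variable {d : ℕ} {κ : MollKernel d} {ε δ R T A B S C η : ℝ} {ϖ : ℝ → ℝ} {H H1 H2 : Den[d]}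
  {K U : Set (Eu d)} {φ ψ w : Eu d → ℝ} {c : Eu d → ℝ → ℝ} {W : Eu d → ℝ → Eu d}

theorem kint_one_eq_convolution (ε ξ : ℝ) : (fun x => kint kC[κ, ε] H x ξ)
    = convolution (fun x => H x ξ) (κ.scaled ε) (ContinuousLinearMap.lsmul ℝ ℝ) volume := by
  ext x
  simp only [kint, kM, convolution, mul_one, ContinuousLinearMap.lsmul_apply, smul_eq_mul]
  exact integral_congr_fun (fun z => mul_comm _ _)

theorem contDiff_kint_one (hε : 0 < ε) (hH : IsDensity H) (ξ : ℝ) : ContDiff ℝ ∞ (fun x => kint kC[κ, ε] H x ξ) := by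
  rw [kint_one_eq_convolution]
  exact (κ.scaled_compact hε).contDiff_convolution_right _ (hH.locallyIntegrable ξ) (κ.scaled_smooth ε)

theorem fderiv_kint_one (hε : 0 < ε) (hH : IsDensity H) (ξ : ℝ) (x v : TX d) :
    fderiv ℝ (fun x => kint kC[κ, ε] H x ξ) x v = ∫ x', fderiv ℝ (κ.scaled ε) (x - x') v * H x' ξ := by
  rw [kint_one_eq_convolution, ((κ.scaled_compact hε).hasFDerivAt_convolution_right _
    (hH.locallyIntegrable ξ) ((κ.scaled_smooth ε).of_le (by simp)) x).fderiv,
    convolution_precompR_apply _ (hH.locallyIntegrable ξ) ((κ.scaled_compact hε).fderiv ℝ)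
      (κ.fderiv_scaled_continuous ε)]
  simp only [convolution, ContinuousLinearMap.lsmul_apply, smul_eq_mul]
  exact integral_congr_fun (fun z => mul_comm _ _)

/-- The transport term. -/
theorem boundedByOverlap_transport (hH1 : IsDensity H1) (hH2 : IsDensity H2) (hK : IsCompact K)
    (hB : 0 ≤ B) (hW : Continuous (uncurry W))
    (hS : ∀ y, ∀ ξ ∈ Icc 0 R, ‖W y ξ‖ ≤ S) (hdiv : WeakDivBound R B W)
    {g : Eu d → ℝ} (hg : ContDiff ℝ ∞ g) (hgK : tsupport g ⊆ K) {A' : ℝ} (hA : ∀ y, |g y| ≤ A)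
    (hA' : ∀ y, ‖fderiv ℝ g y‖ ≤ A') :
    BoundedByOverlap H1 H2 T R K ((B * A + A' * S) * (κ.C * κ.C) * ballVol vol[TX d] κ.r ^ 2)
      (fun ε => ∫ z, g z.1.2 * (kint (κ.kY ε W) H1 z.1 z.2 * kint kC[κ, ε] H2 z.1 z.2
        + kint kC[κ, ε] H1 z.1 z.2 * kint (κ.kY ε W) H2 z.1 z.2) ∂slab T R K) := by
  have := isFiniteMeasure_slab_left T hK
  have := isFiniteMeasure_slab T R hK
  have hA0 : 0 ≤ A := (abs_nonneg _).trans (hA 0)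
  have hA'0 : 0 ≤ A' := (norm_nonneg _).trans (hA' 0)
  have hC := κ.C_nonneg
  have hgc : HasCompactSupport g := hK.of_isClosed_subset (isClosed_tsupport _) hgK
  by_cases hR : (Icc (0 : ℝ) R).Nonempty
  swap
  · intro η hη
    have : slab T R K = 0 := by
      rw [slab, not_nonempty_iff_eq_empty.1 hR, Measure.restrict_empty, Measure.prod_zero]
    simp [this, hη.le]
  obtain ⟨ξ0, hξ₀⟩ := hR
  have hS0 : 0 ≤ S := (norm_nonneg _).trans (hS 0 ξ0 hξ₀)
  have hcst : 0 ≤ (B * A + A' * S) * (κ.C * κ.C) := by positivity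
  refine (boundedByOverlap_ballAvg hH1 hH2 κ.r_pos T R hK hcst).mono ?_
  filter_upwards [self_mem_nhdsWithin] with ε hε
  have hε : (0 : ℝ) < ε := hε
  set F : TX d × ℝ → ℝ := fun z => g z.1.2 * (kint (κ.kY ε W) H1 z.1 z.2 * kint kC[κ, ε] H2 z.1 z.2
        + kint kC[κ, ε] H1 z.1 z.2 * kint (κ.kY ε W) H2 z.1 z.2) with hF
  set Q : TX d × ℝ → ℝ := fun z => ballAvg volume κ.r ε (fun x => H1 x z.2) z.1
        * ballAvg volume κ.r ε (fun x => H2 x z.2) z.1 with hQ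
  have hQ0 : ∀ z, 0 ≤ Q z := fun z => mul_nonneg (ballAvg_nonneg hε.le (fun x => hH1.nonneg x _) _)
      (ballAvg_nonneg hε.le (fun x => hH2.nonneg x _) _)
  refine le_trans ?_ (le_abs_self _)
  have hcM : Continuous (uncurry (fun (_ : Eu d) (_ : ℝ) => (1 : ℝ))) := continuous_const
  have hbY := kernelBound_kY (κ := κ) hε hW hS
  have hbM := kernelBound_kM (κ := κ) hε hcM (A := 1) (I := Icc 0 R) (fun _ _ _ => by simp)
  have hFm : Measurable F := by
    refine Measurable.mul (hg.continuous.measurable.comp measurable_fst.snd) ?_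
    exact ((measurable_kint hbY.cont hH1).mul (measurable_kint hbM.cont hH2)).add
      ((measurable_kint hbM.cont hH1).mul (measurable_kint hbY.cont hH2))
  have hQm : Measurable Q := (measurable_ballAvg hH1).mul (measurable_ballAvg hH2)
  set D := A * (2 * (κ.C * ε⁻¹ * S * κ.C))
  have hFQ : ∀ x, ∀ ξ ∈ Icc 0 R, |F (x, ξ)| ≤ D * Q (x, ξ) := by
    intro x ξ hξ
    have e1 := hbY.abs_kint_le hH1 x hξ
    have e2 := hbY.abs_kint_le hH2 x hξ
    have e3 := hbM.abs_kint_le hH1 x hξ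
    have e4 := hbM.abs_kint_le hH2 x hξ
    have e5 : 0 ≤ ballAvg volume κ.r ε (fun x => H1 x ξ) x := ballAvg_nonneg hε.le (fun x => hH1.nonneg x _) _
    have e6 : 0 ≤ ballAvg volume κ.r ε (fun x => H2 x ξ) x := ballAvg_nonneg hε.le (fun x => hH2.nonneg x _) _
    simp only [hF, abs_mul]
    calc _ ≤ A * (κ.C * ε⁻¹ * S * ballAvg volume κ.r ε (fun x => H1 x ξ) x *
              (κ.C * 1 * ballAvg volume κ.r ε (fun x => H2 x ξ) x) +
            κ.C * 1 * ballAvg volume κ.r ε (fun x => H1 x ξ) x *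
              (κ.C * ε⁻¹ * S * ballAvg volume κ.r ε (fun x => H2 x ξ) x)) := by
          refine mul_le_mul (hA _) ((abs_add_le _ _).trans ?_) (abs_nonneg _) hA0
          rw [abs_mul, abs_mul]
          gcongr
      _ = _ := by simp only [D, hQ]; ring
  have hQbd : ∀ z, |Q z| ≤ ballVol vol[TX d] κ.r * ballVol vol[TX d] κ.r := by
    intro z
    rw [abs_mul]
    exact mul_le_mul (ballAvg_le κ.r_pos.le hε (fun x => hH1.abs_le_one x z.2) z.1)
      (ballAvg_le κ.r_pos.le hε (fun x => hH2.abs_le_one x z.2) z.1) (abs_nonneg _) (ballVol_nonneg κ.r)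
  have hQi : Integrable Q (slab T R K) := Integrable.of_bound hQm.aestronglyMeasurable _ (ae_of_all _ hQbd)
  have hFi : Integrable F (slab T R K) := by
    refine (hQi.const_mul D).mono' hFm.aestronglyMeasurable ?_
    filter_upwards [ae_slab T R K] with z hz using hFQ z.1 z.2 hz
  have hQi' : ∀ ξ, Integrable (fun x => Q (x, ξ)) (vol[TX d].restrict (Ico 0 T ×ˢ K)) :=
    fun ξ => Integrable.of_bound (hQm.comp measurable_prodMk_right).aestronglyMeasurable _
      (ae_of_all _ fun x => hQbd (x, ξ))
  have hFi' : ∀ ξ ∈ Icc 0 R, Integrable (fun x => F (x, ξ)) (vol[TX d].restrict (Ico 0 T ×ˢ K)) := fun ξ hξ =>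
    ((hQi' ξ).const_mul D).mono' (hFm.comp measurable_prodMk_right).aestronglyMeasurable
      (ae_of_all _ fun x => hFQ x ξ hξ)
  have key : ∀ ξ ∈ Icc 0 R, ∀ t, |∫ y in K, F ((t, y), ξ)|
      ≤ (B * A + A' * S) * (κ.C * κ.C) * ∫ y in K, Q ((t, y), ξ) := by
    intro ξ hξ t
    set a : Eu d → ℝ := fun y => kint kC[κ, ε] H1 (t, y) ξ
    set b : Eu d → ℝ := fun y => kint kC[κ, ε] H2 (t, y) ξ
    have ha : ContDiff ℝ ∞ a := (contDiff_kint_one hε hH1 ξ).comp (contDiff_const.prodMk contDiff_id)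
    have hb : ContDiff ℝ ∞ b := (contDiff_kint_one hε hH2 ξ).comp (contDiff_const.prodMk contDiff_id)
    have hda : ∀ {H : Den[d]}, IsDensity H → ∀ y, fderiv ℝ (fun y => kint kC[κ, ε] H (t, y) ξ) y (W y ξ)
          = kint (κ.kY ε W) H (t, y) ξ := by
      intro H hH y
      have e1 : HasFDerivAt (fun x => kint kC[κ, ε] H x ξ) _ (t, y) :=
        ((contDiff_kint_one hε hH ξ).differentiable (by simp) (t, y)).hasFDerivAt
      have e2 : HasFDerivAt (fun y => kint kC[κ, ε] H (t, y) ξ) _ y := e1.comp y (hasFDerivAt_prodMk_right t y)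
      rw [e2.fderiv]
      simp only [ContinuousLinearMap.comp_apply, ContinuousLinearMap.inr_apply]
      rw [fderiv_kint_one hε hH]
      rfl
    have hψ : ContDiff ℝ ∞ (fun y => g y * (a y * b y)) := hg.mul (ha.mul hb)
    have hψc : HasCompactSupport (fun y => g y * (a y * b y)) := hgc.mul_right
    have hWξ : Continuous (fun y => W y ξ) := hW.comp (continuous_id.prodMk continuous_const)
    have e1 : ∀ y, F ((t, y), ξ) = fderiv ℝ (fun y => g y * (a y * b y)) y (W y ξ)
        - (a y * b y) * fderiv ℝ g y (W y ξ) := by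
      intro y
      have d1 := ha.differentiable (by simp) y
      have d2 := hb.differentiable (by simp) y
      have d3 := hg.differentiable (by simp) y
      rw [fderiv_fun_mul d3 (d1.fun_mul d2), fderiv_fun_mul d1 d2]
      simp only [add_apply, smul_apply, smul_eq_mul]
      rw [show fderiv ℝ a y (W y ξ) = _ from hda hH1 y, show fderiv ℝ b y (W y ξ) = _ from hda hH2 y]
      simp only [hF, a, b]
      ring
    have i1 : Integrable (fun y => fderiv ℝ (fun y => g y * (a y * b y)) y (W y ξ)) := by
      refine Continuous.integrable_of_hasCompactSupport ((hψ.continuous_fderiv (by simp)).clm_apply hWξ) ?_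
      exact (hψc.fderiv ℝ).mono fun y hy => by
        contrapose! hy
        simp [notMem_support.1 hy]
    have i2 : Integrable (fun y => (a y * b y) * fderiv ℝ g y (W y ξ)) := by
      refine Continuous.integrable_of_hasCompactSupport
        ((ha.continuous.mul hb.continuous).mul ((hg.continuous_fderiv (by simp)).clm_apply hWξ)) ?_
      exact (hgc.fderiv ℝ).mono fun y hy => by
        contrapose! hy
        simp [notMem_support.1 hy]
    have hg0 : ∀ y, y ∉ K → g y = 0 := fun y hy => eq_zero_off_tsupport fun h => hy (hgK h)
    have hdg0 : ∀ y, y ∉ K → fderiv ℝ g y = 0 := fun y hy =>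
      eq_zero_off_tsupport fun h => hy (hgK (tsupport_fderiv_subset ℝ h))
    have e2 : ∫ y in K, F ((t, y), ξ) = ∫ y, F ((t, y), ξ) := by
      refine setIntegral_eq_integral_of_forall_compl_eq_zero fun y hy => ?_
      simp only [hF, hg0 y hy, zero_mul]
    have hab : ∀ y, |a y * b y| ≤ κ.C * κ.C * Q ((t, y), ξ) := by
      intro y
      have e3 := hbM.abs_kint_le hH1 (t, y) hξ
      have e4 := hbM.abs_kint_le hH2 (t, y) hξ
      rw [abs_mul]
      calc _ ≤ _ := mul_le_mul e3 e4 (abs_nonneg _) ((abs_nonneg _).trans e3)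
        _ = _ := by simp only [hQ]; ring
    have iQ : Integrable (fun y => Q ((t, y), ξ)) (volume.restrict K) := by
      have : IsFiniteMeasure (vol[Eu d].restrict K) := isFiniteMeasure_restrict.2 hK.measure_lt_top.ne
      exact Integrable.of_bound (hQm.comp (measurable_prodMk_right.comp measurable_prodMk_left)).aestronglyMeasurable _
        (ae_of_all _ fun y => hQbd _)
    have e3 : |∫ y, fderiv ℝ (fun y => g y * (a y * b y)) y (W y ξ)|
        ≤ B * (A * (κ.C * κ.C * ∫ y in K, Q ((t, y), ξ))) := by
      refine (hdiv ξ hξ _ hψ hψc).trans (mul_le_mul_of_nonneg_left ?_ hB)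
      rw [← setIntegral_eq_integral_of_forall_compl_eq_zero (s := K)
        (fun y hy => by rw [hg0 y hy, zero_mul, abs_zero]), ← integral_const_mul, ← integral_const_mul]
      refine integral_mono_of_nonneg (ae_of_all _ fun y => abs_nonneg _)
        ((iQ.const_mul _).const_mul _) (ae_of_all _ fun y => ?_)
      simp only [abs_mul (g y)]
      exact mul_le_mul (hA y) (hab y) (abs_nonneg _) hA0
    have e4 : |∫ y, (a y * b y) * fderiv ℝ g y (W y ξ)|
        ≤ (κ.C * κ.C * ∫ y in K, Q ((t, y), ξ)) * (A' * S) := by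
      rw [← setIntegral_eq_integral_of_forall_compl_eq_zero (s := K)
        (fun y hy => by rw [hdg0 y hy, zero_apply, mul_zero]), ← integral_const_mul,
        ← integral_mul_const]
      refine abs_integral_le_integral ((iQ.const_mul _).mul_const _) (ae_of_all _ fun y => ?_)
      rw [abs_mul]
      refine mul_le_mul (hab y) ?_ (abs_nonneg _) ((abs_nonneg _).trans (hab y))
      exact ((fderiv ℝ g y).le_opNorm _).trans (mul_le_mul (hA' y) (hS y ξ hξ) (norm_nonneg _) hA'0)
    rw [e2]
    simp only [e1]
    rw [integral_sub i1 i2]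
    refine (abs_sub _ _).trans ((add_le_add e3 e4).trans (le_of_eq ?_))
    ring
  have hprod : vol[TX d].restrict (Ico 0 T ×ˢ K) = (volume.restrict (Ico 0 T)).prod (volume.restrict K) := by
    rw [volume_eq_prod, prod_restrict]
  have hslab : ∀ f : TX d × ℝ → ℝ, Integrable f (slab T R K) →
      ∫ z, f z ∂slab T R K = ∫ ξ in Icc 0 R, ∫ x in Ico 0 T ×ˢ K, f (x, ξ) := fun f hf =>
    integral_prod_symm _ hf
  rw [← integral_const_mul, hslab F hFi, hslab _ (hQi.const_mul _)]
  refine abs_integral_le_integral (hQi.const_mul _).integral_prod_right ?_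
  filter_upwards [ae_restrict_mem measurableSet_Icc] with ξ hξ
  have f1 := hFi' ξ hξ
  have f2 := (hQi' ξ).const_mul ((B * A + A' * S) * (κ.C * κ.C))
  rw [hprod] at f1 f2 ⊢
  rw [integral_prod _ f1, integral_prod _ f2]
  refine abs_integral_le_integral f2.integral_prod_left (ae_of_all _ fun t => ?_)
  rw [integral_const_mul]
  exact key ξ hξ t

/-- The integrals of `H1 H2 e'` over `ξ` are controlled by the size of `e`. -/
def OppositelyMonotone (R : ℝ) (H1 H2 : Den[d]) : Prop :=
  ∀ᵐ z ∂(vol[TX d].prod volume), ∀ (e e' : ℝ → ℝ) (η : ℝ), 0 ≤ η →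
      (∀ ξ, HasDerivAt e (e' ξ) ξ) → Continuous e' → (∀ ξ ∈ Icc 0 R, |e ξ| ≤ η) →
      |∫ ξ in Icc 0 R, H1 z.1 ξ * H2 z.2 ξ * e' ξ| ≤ 2 * η

theorem OppositelyMonotone.swap (h : OppositelyMonotone R H1 H2) : OppositelyMonotone R H2 H1 := by
  have h1 := (measurePreserving_swap (μ := vol[TX d]) (ν := vol[TX d])).quasiMeasurePreserving.ae h
  filter_upwards [h1] with z hz e e' η h0 h1 h2 h3
  have := hz e e' η h0 h1 h2 h3
  simp only [Prod.fst_swap, Prod.snd_swap] at this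
  simpa only [mul_comm (H2 _ _)] using this

theorem BoundedByOverlap.of_small (hA : 0 ≤ A) {N : ℝ → ℝ}
    (h : ∀ η > 0, ∃ N1 N2 : ℝ → ℝ, (∀ ε > 0, N ε = N1 ε + N2 ε) ∧ BoundedByOverlap H1 H2 T R K C N1 ∧
      ∀ ε > 0, |N2 ε| ≤ A * η) : BoundedByOverlap H1 H2 T R K C N := by
  intro η hη
  obtain ⟨N1, N2, h1, h2, h3⟩ := h (η / (2 * (A + 1))) (by positivity)
  filter_upwards [h2 (η / 2) (half_pos hη), self_mem_nhdsWithin] with ε h4 hε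
  rw [h1 ε hε]
  refine (abs_add_le _ _).trans ?_
  have h5 := h3 ε hε
  have h6 : A * (η / (2 * (A + 1))) ≤ η / 2 := by
    rw [← mul_div_assoc, div_le_div_iff₀ (by positivity) (by positivity)]
    nlinarith
  linarith

/-- The commutator of mollification with an admissible field. -/
theorem boundedByOverlap_commutator_admissible (hH1 : IsDensity H1) (hH2 : IsDensity H2)
    (hbv : OppositelyMonotone R H1 H2) (hK : IsCompact K) (hB : 0 ≤ B)
    (hW : AdmissibleField R B W) (hφ : Continuous φ)
    (hA : ∀ y, |φ y| ≤ A) (hwc : Continuous w) {A' : ℝ} (hw : ∀ y, |w y| ≤ A') :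
    BoundedByOverlap H1 H2 T R K (A' * B * (κ.C * A) * ballVol vol[TX d] κ.r)
      (fun ε => ∫ z, w z.1.2 * (kint (κ.kR ε W) H1 z.1 z.2 * kint kC[κ, ε, φ] H2 z.1 z.2) ∂slab T R K) := by
  have := isFiniteMeasure_slab_left T hK
  have := isFiniteMeasure_slab T R hK
  have hA0 : 0 ≤ A := (abs_nonneg _).trans (hA 0)
  have hA'0 : 0 ≤ A' := (abs_nonneg _).trans (hw 0)
  have hC := κ.C_nonneg
  have hr := κ.r_pos.le
  set V := ballVol vol[TX d] κ.r
  have hV : 0 ≤ V := ballVol_nonneg _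
  have hφ' : Continuous (uncurry (fun y (_ : ℝ) => φ y)) := hφ.comp continuous_fst
  refine BoundedByOverlap.of_small (A := A' * (2 * (κ.C * κ.C * κ.r * A) * V ^ 2) *
    (vol[TX d].restrict (Ico 0 T ×ˢ K)).real univ) (by positivity) fun η hη => ?_
  obtain ⟨W', e, Λ, hW'c, hΛ, hW'd, he, heη⟩ := hW.approx η hη
  set E : Eu d → ℝ → Eu d := fun y ξ => W y ξ - W' y ξ
  have hEc : Continuous (uncurry E) := hW.cont.sub hW'c
  -- continuity of the kernels
  have hkRc : ∀ {W : Eu d → ℝ → Eu d}, Continuous (uncurry W) → ∀ ε,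
      Continuous (fun p : TX d × TX d × ℝ => κ.kR ε W p.1 p.2.1 p.2.2) := fun hW ε =>
    ((κ.fderiv_scaled_continuous ε).comp (continuous_fst.sub continuous_snd.fst)).clm_apply
      (continuous_const.prodMk ((continuous_snd_right hW).sub (continuous_snd_left hW)))
  set J : (Eu d → ℝ → Eu d) → ℝ → TX d × ℝ → ℝ := fun W ε z =>
    w z.1.2 * (kint (κ.kR ε W) H1 z.1 z.2 * kint kC[κ, ε, φ] H2 z.1 z.2)
  have hJm : ∀ {W : Eu d → ℝ → Eu d}, Continuous (uncurry W) → ∀ ε, Measurable (J W ε) := by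
    intro W hW ε
    refine (hwc.measurable.comp measurable_fst.snd).mul ((measurable_kint (hkRc hW ε) hH1).mul (measurable_kint ?_ hH2))
    exact (κ.continuous_scaled_sub ε).mul (continuous_snd_right hφ')
  have hkRi : ∀ {W : Eu d → ℝ → Eu d}, Continuous (uncurry W) → ∀ ε, 0 < ε → ∀ x ξ,
      Integrable (fun x' => κ.kR ε W x x' ξ * H1 x' ξ) := by
    intro W hW ε hε x ξ
    refine Integrable.mul_bdd (c := 1) ?_ (hH1.meas_right ξ).aestronglyMeasurable
      (ae_of_all _ fun x' => hH1.abs_le_one _ _)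
    refine κ.integrable_fderiv_scaled hε x (V := fun x' => W x'.2 ξ - W x.2 ξ) ?_
    exact (hW.comp (continuous_snd.prodMk continuous_const)).sub continuous_const
  have hJadd : ∀ ε, 0 < ε → ∀ z, J W ε z = J W' ε z + J E ε z := by
    intro ε hε z
    have e1 : ∀ x', κ.kR ε W z.1 x' z.2 = κ.kR ε W' z.1 x' z.2 + κ.kR ε E z.1 x' z.2 := by
      intro x'
      simp only [kR]
      rw [← map_add, Prod.mk_add_mk, add_zero]
      congr 2
      simp only [E]
      abel
    have e2 : kint (κ.kR ε W) H1 z.1 z.2 = kint (κ.kR ε W') H1 z.1 z.2 + kint (κ.kR ε E) H1 z.1 z.2 := by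
      simp only [kint, e1, add_mul]
      exact integral_add (hkRi hW'c ε hε _ _) (hkRi hEc ε hε _ _)
    simp only [J, e2]
    ring
  obtain ⟨S, hS⟩ := hW.bdd
  have hi : ∀ {W : Eu d → ℝ → Eu d} {Λ : ℝ}, Continuous (uncurry W) →
      ∀ ε, 0 < ε → (∀ y z, ∀ ξ ∈ Icc 0 R, ‖y - z‖ ≤ κ.r * ε → ‖W y ξ - W z ξ‖ ≤ Λ) →
      Integrable (J W ε) (slab T R K) := by
    intro W Λ hW ε hε hΛ
    have hb := κ.kernelBound_fderiv hε (S := Icc 0 R) (V := fun x x' ξ => W x'.2 ξ - W x.2 ξ)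
      (A := Λ) ((continuous_snd_right hW).sub (continuous_snd_left hW)) (fun x x' ξ hξ hd => hΛ _ _ ξ hξ (by
          refine le_trans (norm_snd_le (x' - x)) ?_
          rwa [← dist_eq_norm]))
    have hb2 := kernelBound_kM (κ := κ) hε hφ' (A := A) (I := Icc 0 R) (fun y _ _ => hA y)
    refine ((integrable_ballAvg_mul hH1 hH2 κ.r_pos hε (slab T R K)).const_mul
      (A' * ((κ.C * ε⁻¹ * Λ) * (κ.C * A)))).mono' (hJm hW ε).aestronglyMeasurable ?_
    filter_upwards [ae_slab T R K] with z hz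
    have e1 := hb.abs_kint_le hH1 z.1 hz
    have e2 := hb2.abs_kint_le hH2 z.1 hz
    rw [norm_eq_abs, abs_mul, abs_mul]
    refine (mul_le_mul (hw _) (mul_le_mul e1 e2 (abs_nonneg _) ((abs_nonneg _).trans e1))
      (by positivity) hA'0).trans (le_of_eq ?_)
    ring
  have hiW' : ∀ ε, 0 < ε → Integrable (J W' ε) (slab T R K) := fun ε hε =>
    hi (Λ := |Λ| * (κ.r * ε)) hW'c ε hε fun y z ξ hξ hyz =>
      (hΛ ξ hξ y z).trans (mul_le_mul (le_abs_self _) hyz (norm_nonneg _) (abs_nonneg _))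
  have hiE : ∀ ε, 0 < ε → Integrable (J E ε) (slab T R K) := fun ε hε =>
    hi (Λ := (S + S) + |Λ| * (κ.r * ε)) hEc ε hε fun y z ξ hξ hyz => by
      have e1 : E y ξ - E z ξ = (W y ξ - W z ξ) - (W' y ξ - W' z ξ) := by simp only [E]; abel
      rw [e1]
      refine (norm_sub_le _ _).trans (add_le_add ((norm_sub_le _ _).trans (add_le_add (hS y ξ hξ) (hS z ξ hξ))) ?_)
      exact (hΛ ξ hξ y z).trans (mul_le_mul (le_abs_self _) hyz (norm_nonneg _) (abs_nonneg _))
  refine ⟨fun ε => ∫ z, J W' ε z ∂slab T R K, fun ε => ∫ z, J E ε z ∂slab T R K, ?_,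
    boundedByOverlap_commutator hH1 hH2 hK hB hW'c hΛ hW'd hφ' (fun y _ _ => hA y) hA0 hw, ?_⟩
  · intro ε hε
    rw [← integral_add (hiW' ε hε) (hiE ε hε)]
    exact integral_congr_ae (ae_of_all _ (hJadd ε hε))
  · intro ε hε
    have hiE' := hiE ε hε
    beta_reduce
    rw [slab] at hiE' ⊢
    rw [integral_prod _ hiE']
    have h6 := norm_integral_le_of_norm_le_const (μ := vol[TX d].restrict (Ico 0 T ×ˢ K))
      (f := fun x => ∫ ξ in Icc 0 R, J E ε (x, ξ))
      (C := A' * (2 * η * (κ.C * κ.C * κ.r * A) * V ^ 2)) (ae_of_all _ fun x => by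
        simp only [J]
        rw [integral_const_mul, norm_mul, norm_eq_abs, norm_eq_abs]
        exact mul_le_mul (hw _) (abs_integral_commutator_le hH1 hH2 hbv hEc he hη.le heη hφ hA hε x)
          (abs_nonneg _) hA'0)
    refine h6.trans (le_of_eq ?_)
    ring

theorem KernelBound.integrable_mul_slab {r B1 B2 : ℝ} (hr : 0 < r) (hε : 0 < ε)
    {k₁ k₂ : TX d → Den[d]} (hk1 : KernelBound r ε B1 (Icc 0 R) k₁)
    (hk2 : KernelBound r ε B2 (Icc 0 R) k₂) (hH1 : IsDensity H1) (hH2 : IsDensity H2)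
    (hK : IsCompact K) (hwc : Continuous w) (hw : ∀ y, |w y| ≤ A) :
    Integrable (fun z => w z.1.2 * (kint k₁ H1 z.1 z.2 * kint k₂ H2 z.1 z.2)) (slab T R K) := by
  have := isFiniteMeasure_slab T R hK
  refine ((integrable_ballAvg_mul hH1 hH2 hr hε (slab T R K)).const_mul (A * (B1 * B2))).mono' ?_ ?_
  · exact ((hwc.measurable.comp measurable_fst.snd).mul ((measurable_kint hk1.cont hH1).mul
      (measurable_kint hk2.cont hH2))).aestronglyMeasurable
  · filter_upwards [ae_slab T R K] with z hz
    have e1 := hk1.abs_kint_le hH1 z.1 hz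
    have e2 := hk2.abs_kint_le hH2 z.1 hz
    rw [norm_eq_abs, abs_mul, abs_mul]
    refine (mul_le_mul (hw _) (mul_le_mul e1 e2 (abs_nonneg _) ((abs_nonneg _).trans e1))
      (by positivity) ((abs_nonneg _).trans (hw 0))).trans (le_of_eq ?_)
    ring

theorem boundedByOverlap_kernels (hH1 : IsDensity H1) (hH2 : IsDensity H2) (hK : IsCompact K)
    {r : ℝ} (hr : 0 < r) {k₁ k₂ : ℝ → TX d → Den[d]} {B1 B2 : ℝ → ℝ} (hB : 0 ≤ B)
    (hk1 : ∀ ε > 0, KernelBound r ε (B1 ε) (Icc 0 R) (k₁ ε))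
    (hk2 : ∀ ε > 0, KernelBound r ε (B2 ε) (Icc 0 R) (k₂ ε)) (hBB : ∀ ε > 0, B1 ε * B2 ε ≤ B)
    (hw : ∀ y, |w y| ≤ A) :
    BoundedByOverlap H1 H2 T R K (A * B * ballVol vol[TX d] r ^ 2)
      (fun ε => ∫ z, w z.1.2 * (kint (k₁ ε) H1 z.1 z.2 * kint (k₂ ε) H2 z.1 z.2) ∂slab T R K) := by
  have hA : 0 ≤ A := (abs_nonneg _).trans (hw 0)
  refine boundedByOverlap_of_le hH1 hH2 hr T R hK (by positivity) ?_
  filter_upwards [self_mem_nhdsWithin] with ε hε x ξ hξ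
  have e1 := (hk1 ε hε).abs_kint_le hH1 x hξ
  have e2 := (hk2 ε hε).abs_kint_le hH2 x hξ
  have hε' : 0 ≤ ε := le_of_lt hε
  have e3 := ballAvg_nonneg (μ := volume) (r := r) hε' (fun x => hH1.nonneg x ξ) x
  have e4 := ballAvg_nonneg (μ := volume) (r := r) hε' (fun x => hH2.nonneg x ξ) x
  rw [abs_mul, abs_mul, mul_assoc A]
  refine mul_le_mul (hw _) ?_ (by positivity) hA
  calc _ ≤ _ := mul_le_mul e1 e2 (abs_nonneg _) ((abs_nonneg _).trans e1)
    _ = (B1 ε * B2 ε) * (ballAvg volume r ε (fun x => H1 x ξ) x * ballAvg volume r ε (fun x => H2 x ξ) x) := by ring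
    _ ≤ _ := mul_le_mul_of_nonneg_right (hBB ε hε) (mul_nonneg e3 e4)

theorem exists_bound_of_hasCompactSupport {E F : Type*} [TopologicalSpace E] [NormedAddCommGroup F]
    {g : E → F} (hg : Continuous g) (hc : HasCompactSupport g) : ∃ A, 0 ≤ A ∧ ∀ y, ‖g y‖ ≤ A := by
  obtain ⟨A, hA⟩ := hg.bounded_above_of_compact_support hc
  exact ⟨max A 0, le_max_right _ _, fun y => (hA y).trans (le_max_left _ _)⟩

/-- The contribution of terms of order at most one. -/
theorem boundedByOverlap_field (hH1 : IsDensity H1) (hH2 : IsDensity H2)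
    (hbv : OppositelyMonotone R H1 H2) (hK : IsCompact K) (hB : 0 ≤ B)
    (hW : AdmissibleField R B W) (hc : Continuous (uncurry c)) {Sc : ℝ}
    (hSc : ∀ y, ∀ ξ ∈ Icc 0 R, |c y ξ| ≤ Sc) (hSc0 : 0 ≤ Sc)
    (hφ : ContDiff ℝ ∞ φ) (hφc : HasCompactSupport φ)
    (hw : ContDiff ℝ ∞ w) (hwK : tsupport w ⊆ K) :
    ∃ C, ∀ T, BoundedByOverlap H1 H2 T R K C (fun ε => ∫ z, w z.1.2 *
      ((kint (κ.kD ε W) H1 z.1 z.2 + kint (κ.kM ε c) H1 z.1 z.2) * kint kC[κ, ε, φ] H2 z.1 z.2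
        + (kint (κ.kD ε W) H2 z.1 z.2 + kint (κ.kM ε c) H2 z.1 z.2) * kint kC[κ, ε, φ] H1 z.1 z.2) ∂slab T R K) := by
  have hwc : HasCompactSupport w := hK.of_isClosed_subset (isClosed_tsupport _) hwK
  obtain ⟨A, hA0, hA⟩ := exists_bound_of_hasCompactSupport hφ.continuous hφc
  obtain ⟨A', hA'0, hA'⟩ := exists_bound_of_hasCompactSupport hw.continuous hwc
  obtain ⟨L, hL⟩ := (hφ.of_le (by simp) : ContDiff ℝ 1 φ).lipschitzWith_of_hasCompactSupport hφc (by simp)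
  obtain ⟨S', hS'⟩ := hW.bdd
  obtain ⟨S, hS0, hS⟩ : ∃ S, 0 ≤ S ∧ ∀ y, ∀ ξ ∈ Icc 0 R, ‖W y ξ‖ ≤ S :=
    ⟨max S' 0, le_max_right _ _, fun y ξ hξ => (hS' y ξ hξ).trans (le_max_left _ _)⟩
  set g : Eu d → ℝ := fun y => w y * φ y
  have hg : ContDiff ℝ ∞ g := hw.mul hφ
  have hgK : tsupport g ⊆ K := (closure_mono (support_mul_subset_left _ _)).trans hwK
  have hgc : HasCompactSupport g := hwc.mul_right
  obtain ⟨G, hG0, hG⟩ := exists_bound_of_hasCompactSupport hg.continuous hgc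
  obtain ⟨G', hG'0, hG'⟩ := exists_bound_of_hasCompactSupport (hg.continuous_fderiv (by simp)) (hgc.fderiv ℝ)
  have hφ' : Continuous (uncurry (fun y (_ : ℝ) => φ y)) := hφ.continuous.comp continuous_fst
  have hone : Continuous (uncurry (fun (_ : Eu d) (_ : ℝ) => (1 : ℝ))) := continuous_const
  have hC := κ.C_nonneg
  have hr := κ.r_pos
  -- kernel bounds
  have bY : ∀ ε > 0, KernelBound κ.r ε (κ.C * ε⁻¹ * S) (Icc 0 R) (κ.kY ε W) := fun ε hε => kernelBound_kY hε hW.cont hS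
  have bR : ∀ ε > 0, KernelBound κ.r ε (κ.C * ε⁻¹ * (S + S)) (Icc 0 R) (κ.kR ε W) := fun ε hε =>
    κ.kernelBound_fderiv hε ((continuous_snd_right hW.cont).sub (continuous_snd_left hW.cont))
      fun x x' ξ hξ _ => (norm_sub_le _ _).trans (add_le_add (hS _ ξ hξ) (hS _ ξ hξ))
  have bφ : ∀ ε > 0, KernelBound κ.r ε (κ.C * A) (Icc 0 R) kC[κ, ε, φ] := fun ε hε =>
    kernelBound_kM hε hφ' fun y _ _ => hA y
  have bc : ∀ ε > 0, KernelBound κ.r ε (κ.C * Sc) (Icc 0 R) (κ.kM ε c) := fun ε hε => kernelBound_kM hε hc hSc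
  have b1 : ∀ ε > 0, KernelBound κ.r ε (κ.C * 1) (Icc 0 R) kC[κ, ε] := fun ε hε =>
    kernelBound_kM hε hone fun _ _ _ => by simp
  set kd : ℝ → TX d → Den[d] := fun ε x x' _ => κ.scaled ε (x - x') * (φ x'.2 - φ x.2)
  have bd : ∀ ε > 0, KernelBound κ.r ε (κ.C * (L * (κ.r * ε))) (Icc 0 R) (kd ε) := fun ε hε =>
    κ.kernelBound_scaled hε ((hφ.continuous.comp continuous_snd.fst.snd).sub
      (hφ.continuous.comp continuous_fst.snd)) fun x x' ξ _ hd => by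
        have h1 := hL.dist_le_mul x'.2 x.2
        rw [Real.dist_eq] at h1
        refine h1.trans (mul_le_mul_of_nonneg_left ?_ L.2)
        refine le_trans ?_ hd
        rw [Prod.dist_eq]
        exact le_max_right _ _
  have hsplitD : ∀ {H}, IsDensity H → ∀ ε > 0, ∀ x ξ,
      kint (κ.kD ε W) H x ξ = kint (κ.kR ε W) H x ξ + kint (κ.kY ε W) H x ξ := by
    intro H hH ε hε x ξ
    rw [← (bR ε hε).kint_add (bY ε hε) hH]
    simp only [kint, kD, kR, kY]
    refine integral_congr_fun fun x' => ?_
    rw [← map_add, Prod.mk_add_mk, add_zero, sub_add_cancel]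
  have hsplitφ : ∀ {H}, IsDensity H → ∀ ε > 0, ∀ x ξ, kint kC[κ, ε, φ] H x ξ
      = φ x.2 * kint kC[κ, ε] H x ξ + kint (kd ε) H x ξ := by
    intro H hH ε hε x ξ
    have e1 : φ x.2 * kint kC[κ, ε] H x ξ
        = ∫ x', φ x.2 * (κ.kM ε (fun _ _ => 1) x x' ξ * H x' ξ) := (integral_const_mul _ _).symm
    rw [e1]
    simp only [kint]
    rw [← integral_add (((b1 ε hε).integrable hH x).const_mul _) ((bd ε hε).integrable hH x)]
    refine integral_congr_fun fun x' => ?_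
    simp only [kM, kd]
    ring
  apply Exists.intro
  intro T
  have n1 := boundedByOverlap_commutator_admissible (T := T) (κ := κ) hH1 hH2 hbv hK hB hW
    hφ.continuous hA hw.continuous hA'
  have n2 := (boundedByOverlap_commutator_admissible (T := T) (κ := κ) hH2 hH1 hbv.swap hK hB hW
    hφ.continuous hA hw.continuous hA').swap
  have n3 := boundedByOverlap_transport (T := T) (κ := κ) hH1 hH2 hK hB hW.cont hS hW.div hg hgK hG hG'
  have hBB : ∀ ε > 0, (κ.C * ε⁻¹ * S) * (κ.C * (L * (κ.r * ε))) ≤ κ.C * S * κ.C * (L * κ.r) := by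
    intro ε hε
    refine le_of_eq ?_
    field_simp
  have n4 := boundedByOverlap_kernels (T := T) hH1 hH2 hK hr (by positivity) bY bd hBB hA'
  have n5 := (boundedByOverlap_kernels (T := T) hH2 hH1 hK hr (by positivity) bY bd hBB hA').swap
  have n6 := boundedByOverlap_kernels (T := T) hH1 hH2 hK hr (B := κ.C * Sc * (κ.C * A)) (by positivity)
    bc bφ (fun _ _ => le_rfl) hA'
  have n7 := (boundedByOverlap_kernels (T := T) hH2 hH1 hK hr (B := κ.C * Sc * (κ.C * A)) (by positivity)
    bc bφ (fun _ _ => le_rfl) hA').swap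
  refine ((n1.add n2).add (n3.add ((n4.add n5).add (n6.add n7)))).mono ?_
  filter_upwards [self_mem_nhdsWithin] with ε hε
  refine le_of_eq (congrArg abs ?_)
  have hwc' := hw.continuous
  have i1 := (bR ε hε).integrable_mul_slab (T := T) hr hε (bφ ε hε) hH1 hH2 hK hwc' hA'
  have i2 := (bR ε hε).integrable_mul_slab (T := T) hr hε (bφ ε hε) hH2 hH1 hK hwc' hA'
  have i3 := (bY ε hε).integrable_mul_slab (T := T) hr hε (b1 ε hε) hH1 hH2 hK hg.continuous hG
  have i3' := (b1 ε hε).integrable_mul_slab (T := T) hr hε (bY ε hε) hH1 hH2 hK hg.continuous hG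
  have i4 := (bY ε hε).integrable_mul_slab (T := T) hr hε (bd ε hε) hH1 hH2 hK hwc' hA'
  have i5 := (bY ε hε).integrable_mul_slab (T := T) hr hε (bd ε hε) hH2 hH1 hK hwc' hA'
  have i6 := (bc ε hε).integrable_mul_slab (T := T) hr hε (bφ ε hε) hH1 hH2 hK hwc' hA'
  have i7 := (bc ε hε).integrable_mul_slab (T := T) hr hε (bφ ε hε) hH2 hH1 hK hwc' hA'
  have i33' : Integrable (fun z : TX d × ℝ => g z.1.2 * (kint (κ.kY ε W) H1 z.1 z.2 * kint kC[κ, ε] H2 z.1 z.2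
        + kint kC[κ, ε] H1 z.1 z.2 * kint (κ.kY ε W) H2 z.1 z.2)) (slab T R K) := by
    refine (i3.add i3').congr (ae_of_all _ fun z => ?_)
    simp only [Pi.add_apply]
    ring
  rw [← integral_add' i1 i2, ← integral_add' i4 i5, ← integral_add' i6 i7,
    ← integral_add' (i4.add i5) (i6.add i7), ← integral_add' i33' ((i4.add i5).add (i6.add i7)),
    ← integral_add' (i1.add i2) (i33'.add ((i4.add i5).add (i6.add i7)))]
  refine integral_congr_fun fun z => ?_
  simp only [Pi.add_apply, g]
  rw [hsplitD hH1 ε hε, hsplitD hH2 ε hε]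
  have s1 := hsplitφ hH1 ε hε z.1 z.2
  have s2 := hsplitφ hH2 ε hε z.1 z.2
  linear_combination (w z.1.2 * kint (κ.kY ε W) H2 z.1 z.2) * s1 + (w z.1.2 * kint (κ.kY ε W) H1 z.1 z.2) * s2

theorem exists_bound_of_compact_fst {G : Type*} [NormedAddCommGroup G] {F : Eu d → ℝ → G}
    (hF : Continuous (uncurry F)) (hK : IsCompact K)
    (h0 : ∀ y ∉ K, ∀ ξ, F y ξ = 0) (a b : ℝ) : ∃ S, 0 ≤ S ∧ ∀ y, ∀ ξ ∈ Icc a b, ‖F y ξ‖ ≤ S := by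
  obtain ⟨S, hS⟩ := (hK.prod (isCompact_Icc (a := a) (b := b))).exists_bound_of_continuousOn hF.continuousOn
  refine ⟨max S 0, le_max_right _ _, fun y ξ hξ => ?_⟩
  by_cases hy : y ∈ K
  · exact (hS (y, ξ) ⟨hy, hξ⟩).trans (le_max_left _ _)
  · rw [h0 y hy ξ, norm_zero]
    exact le_max_right _ _

/-- The derivative in the first variable. -/
theorem fderiv_fst {G : Type*} [NormedAddCommGroup G] [NormedSpace ℝ G] {F : Eu d → ℝ → G}
    (hF : ContDiff ℝ 1 (uncurry F)) (y : Eu d) (ξ : ℝ) :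
    HasFDerivAt (fun y => F y ξ) ((fderiv ℝ (uncurry F) (y, ξ)).comp (ContinuousLinearMap.inl ℝ (Eu d) ℝ)) y :=
  HasFDerivAt.comp (𝕜 := ℝ) (g := uncurry F) y
    (hF.differentiable (by simp) (y, ξ)).hasFDerivAt (hasFDerivAt_prodMk_left y ξ)

theorem hasDerivAt_snd {G : Type*} [NormedAddCommGroup G] [NormedSpace ℝ G] {F : Eu d → ℝ → G}
    (hF : ContDiff ℝ 1 (uncurry F)) (y : Eu d) (ξ : ℝ) :
    HasDerivAt (F y) (fderiv ℝ (uncurry F) (y, ξ) (0, 1)) ξ := by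
  have h := ((hF.differentiable (by simp) (y, ξ)).hasFDerivAt).comp ξ (hasFDerivAt_prodMk_right y ξ)
  have h2 : HasFDerivAt (F y) _ ξ := h
  simpa using h2.hasDerivAt

theorem continuous_deriv_snd {G : Type*} [NormedAddCommGroup G] [NormedSpace ℝ G] {F : Eu d → ℝ → G}
    (hF : ContDiff ℝ 1 (uncurry F)) :
    Continuous (uncurry (fun y ξ => deriv (F y) ξ)) := by
  have h : (uncurry (fun y ξ => deriv (F y) ξ)) = fun p => fderiv ℝ (uncurry F) p (0, 1) := by
    ext p
    exact (hasDerivAt_snd hF p.1 p.2).deriv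
  rw [h]
  exact (hF.continuous_fderiv (by simp)).clm_apply continuous_const

theorem fderiv_eq_zero_of_support {G : Type*} [NormedAddCommGroup G] [NormedSpace ℝ G]
    {F : Eu d → ℝ → G} (hK : IsClosed K) (h0 : ∀ y ∉ K, ∀ ξ, F y ξ = 0)
    {y : Eu d} (hy : y ∉ K) (ξ : ℝ) : fderiv ℝ (uncurry F) (y, ξ) = 0 := by
  have h : uncurry F =ᶠ[𝓝 (y, ξ)] fun _ => 0 := by
    have hU : {p : Y[d] | p.1 ∉ K} ∈ 𝓝 (y, ξ) := (hK.isOpen_compl.preimage continuous_fst).mem_nhds hy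
    filter_upwards [hU] with p hp using h0 p.1 hp p.2
  rw [h.fderiv_eq]
  simp

theorem sum_stdVec (v : Eu d) : v = ∑ k, v k • stdVec k := by
  ext i
  simp [stdVec, Finset.sum_apply, Pi.single_apply]

/-- A `C^1` field with compact support in space has bounded divergence. -/
theorem exists_weakDivBound {X : Eu d → ℝ → Eu d} (hX : ContDiff ℝ 1 (uncurry X))
    (hK : IsCompact K) (h0 : ∀ y ∉ K, ∀ ξ, X y ξ = 0) (R : ℝ) :
    ∃ B, 0 ≤ B ∧ WeakDivBound R B X := by
  obtain ⟨S, hS0, hS⟩ := exists_bound_of_compact_fst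
    (F := fun y ξ => fderiv ℝ (uncurry X) (y, ξ)) (hX.continuous_fderiv (by simp)) hK
    (fun y hy ξ => fderiv_eq_zero_of_support hK.isClosed h0 hy ξ) 0 R
  refine ⟨d * S, by positivity, fun ξ hξ ψ hψ hψc => ?_⟩
  have hXk : ∀ k, ContDiff ℝ 1 (fun y => X y ξ k) := fun k => (EuclideanSpace.proj k : Eu d →L[ℝ] ℝ).contDiff.comp
      (hX.comp (contDiff_id.prodMk contDiff_const))
  have hXc : ∀ k, HasCompactSupport (fun y => X y ξ k) := fun k =>
    HasCompactSupport.intro hK fun y hy => by rw [h0 y hy]; rfl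
  have hd : ∀ k y, |fderiv ℝ (fun y => X y ξ k) y (stdVec k)| ≤ S := by
    intro k y
    have e1 : HasFDerivAt (fun y => X y ξ k) _ y :=
      (EuclideanSpace.proj k : Eu d →L[ℝ] ℝ).hasFDerivAt.comp y (fderiv_fst hX y ξ)
    rw [e1.fderiv]
    simp only [ContinuousLinearMap.comp_apply, ContinuousLinearMap.inl_apply]
    have hn : ∀ v : Eu d, |(EuclideanSpace.proj k : Eu d →L[ℝ] ℝ) v| ≤ ‖v‖ := fun v => PiLp.norm_apply_le v k
    refine (hn _).trans ((ContinuousLinearMap.le_opNorm _ _).trans ?_)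
    have e2 : ‖(stdVec k, (0 : ℝ))‖ ≤ 1 := by simp [stdVec, Prod.norm_mk]
    calc _ ≤ S * 1 := mul_le_mul (hS y ξ hξ) e2 (norm_nonneg _) hS0
      _ = S := mul_one S
  have h1 : ∀ y, fderiv ℝ ψ y (X y ξ) = ∑ k, X y ξ k * fderiv ℝ ψ y (stdVec k) := by
    intro y
    conv_lhs => rw [sum_stdVec (X y ξ)]
    simp
  have hψd : ∀ k, Continuous (fun y => fderiv ℝ ψ y (stdVec k)) := fun k =>
    (hψ.continuous_fderiv (by simp)).clm_apply continuous_const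
  have i1 : ∀ k, Integrable (fun y => X y ξ k * fderiv ℝ ψ y (stdVec k)) := fun k =>
    ((hXk k).continuous.mul (hψd k)).integrable_of_hasCompactSupport (hXc k).mul_right
  have hXd : ∀ k, Continuous (fun y => fderiv ℝ (fun y => X y ξ k) y (stdVec k)) := fun k =>
    ((hXk k).continuous_fderiv (by simp)).clm_apply continuous_const
  have i2 : ∀ k, Integrable (fun y => fderiv ℝ (fun y => X y ξ k) y (stdVec k) * ψ y) := fun k =>
    ((hXd k).mul hψ.continuous).integrable_of_hasCompactSupport hψc.mul_left
  have i3 : Integrable (fun y => |ψ y|) := (hψ.continuous.integrable_of_hasCompactSupport hψc).abs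
  simp only [h1]
  rw [integral_finsetSum _ fun k _ => i1 k]
  calc _ ≤ ∑ k : Fin d, |∫ y, X y ξ k * fderiv ℝ ψ y (stdVec k)| := Finset.abs_sum_le_sum_abs _ _
    _ ≤ ∑ _k : Fin d, S * ∫ y, |ψ y| := by
        refine Finset.sum_le_sum fun k _ => ?_
        rw [integral_mul_fderiv_eq_neg_fderiv_mul_of_integrable (i2 k) (i1 k)
          (((hXk k).continuous.mul hψ.continuous).integrable_of_hasCompactSupport (hXc k).mul_right)
          (fun y _ => (hXk k).differentiable (by simp) y)
          (fun y _ => hψ.differentiable (by simp) y), abs_neg, ← integral_const_mul]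
        refine abs_integral_le_integral (i3.const_mul _) (ae_of_all _ fun y => ?_)
        rw [abs_mul]
        exact mul_le_mul_of_nonneg_right (hd k y) (abs_nonneg _)
    _ = _ := by simp; ring

/-- Differentiation of `∫ Dψ(F(y,ξ)) dy` in `ξ`. -/
theorem hasDerivAt_integral_fderiv {F : Eu d → ℝ → Eu d} (hF : ContDiff ℝ 1 (uncurry F))
    (hψ : ContDiff ℝ ∞ ψ) (hψc : HasCompactSupport ψ) (ξ0 : ℝ) :
    HasDerivAt (fun ξ => ∫ y, fderiv ℝ ψ y (F y ξ)) (∫ y, fderiv ℝ ψ y (deriv (F y) ξ0)) ξ0 := by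
  have hV := continuous_deriv_snd hF
  have hD := hψ.continuous_fderiv (by simp)
  have hcont : ∀ ξ, Continuous (fun y => fderiv ℝ ψ y (F y ξ)) := fun ξ =>
    hD.clm_apply (hF.continuous.comp (continuous_id.prodMk continuous_const))
  have hcs : ∀ G : Eu d → Eu d, HasCompactSupport (fun y => fderiv ℝ ψ y (G y)) := fun G =>
    (hψc.fderiv ℝ).mono fun y hy => by
      contrapose! hy
      simp [notMem_support.1 hy]
  obtain ⟨S, hS⟩ := ((hψc.isCompact).prod (isCompact_Icc (a := ξ0 - 1) (b := ξ0 + 1))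
    ).exists_bound_of_continuousOn (f := fun p : Y[d] => fderiv ℝ ψ p.1 (deriv (F p.1) p.2))
    ((hD.comp continuous_fst).clm_apply hV).continuousOn
  refine (hasDerivAt_integral_of_dominated_loc_of_deriv_le (s := Icc (ξ0 - 1) (ξ0 + 1))
    (bound := (tsupport ψ).indicator fun _ => S)
    (F' := fun ξ y => fderiv ℝ ψ y (deriv (F y) ξ)) (Icc_mem_nhds (by linarith) (by linarith)) ?_ ?_ ?_ ?_ ?_ ?_).2
  · exact Eventually.of_forall fun ξ => (hcont ξ).aestronglyMeasurable
  · exact (hcont ξ0).integrable_of_hasCompactSupport (hcs _)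
  · exact (hD.clm_apply (hV.comp (continuous_id.prodMk continuous_const))).aestronglyMeasurable
  · refine ae_of_all _ fun y ξ hξ => ?_
    by_cases hy : y ∈ tsupport ψ
    · rw [indicator_of_mem hy]
      exact hS (y, ξ) ⟨hy, hξ⟩
    · rw [indicator_of_notMem hy, eq_zero_off_tsupport
        (fun h => hy (tsupport_fderiv_subset ℝ h) : y ∉ tsupport (fderiv ℝ ψ))]
      simp
  · rw [integrable_indicator_iff (isClosed_tsupport ψ).measurableSet]
    exact integrableOn_const hψc.isCompact.measure_lt_top.ne
  · refine ae_of_all _ fun y ξ _ => ?_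
    exact (fderiv ℝ ψ y).hasFDerivAt.comp_hasDerivAt ξ ((hasDerivAt_snd hF y ξ).differentiableAt.hasDerivAt)

/-- The field `∂_ξ F + X` is admissible. -/
theorem admissibleField_deriv_add {F X : Eu d → ℝ → Eu d} (hF : ContDiff ℝ 1 (uncurry F))
    (hX : ContDiff ℝ 1 (uncurry X)) (hK : IsCompact K)
    (hF0 : ∀ y ∉ K, ∀ ξ, F y ξ = 0) (hX0 : ∀ y ∉ K, ∀ ξ, X y ξ = 0) {B1 B2 : ℝ}
    (hB1 : WeakDivBound (R + 1) B1 (fun y ξ => deriv (F y) ξ)) (hB₂ : WeakDivBound R B2 X) :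
    AdmissibleField R (B1 + B2) (fun y ξ => deriv (F y) ξ + X y ξ) := by
  have hV := continuous_deriv_snd hF
  have hV0 : ∀ y ∉ K, ∀ ξ, deriv (F y) ξ = 0 := fun y hy ξ => by
    have : F y = fun _ => 0 := funext (hF0 y hy)
    rw [this, deriv_const]
  have hDF0 := fun y (hy : y ∉ K) ξ => fderiv_eq_zero_of_support hK.isClosed hF0 hy ξ
  have hDX0 := fun y (hy : y ∉ K) ξ => fderiv_eq_zero_of_support hK.isClosed hX0 hy ξ
  have hDF := hF.continuous_fderiv (by simp)
  have hDX := hX.continuous_fderiv (by simp)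
  have hcs : ∀ (ψ : Eu d → ℝ), ContDiff ℝ ∞ ψ → HasCompactSupport ψ → ∀ G : Eu d → Eu d,
      Continuous G → Integrable (fun y => fderiv ℝ ψ y (G y)) := fun ψ hψ hψc G hG =>
    ((hψ.continuous_fderiv (by simp)).clm_apply hG).integrable_of_hasCompactSupport ((hψc.fderiv ℝ).mono fun y hy => by
        contrapose! hy
        simp [notMem_support.1 hy])
  have hsl : ∀ {G : Eu d → ℝ → Eu d}, Continuous (uncurry G) → ∀ ξ,
      Continuous (fun y => G y ξ) := fun hG ξ => hG.comp (continuous_id.prodMk continuous_const)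
  have hdivadd : ∀ {V : Eu d → ℝ → Eu d}, Continuous (uncurry V) → WeakDivBound R B1 V →
      WeakDivBound R (B1 + B2) (fun y ξ => V y ξ + X y ξ) := by
    intro V hVc hVd ξ hξ ψ hψ hψc
    simp only [map_add]
    rw [integral_add (hcs ψ hψ hψc _ (hsl hVc ξ)) (hcs ψ hψ hψc _ (hsl hX.continuous ξ)), add_mul]
    exact (abs_add_le _ _).trans (add_le_add (hVd ξ hξ ψ hψ hψc) (hB₂ ξ hξ ψ hψ hψc))
  have hB1' : WeakDivBound R B1 (fun y ξ => deriv (F y) ξ) := fun ξ hξ => hB1 ξ ⟨hξ.1, hξ.2.trans (by linarith)⟩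
  refine ⟨hV.add hX.continuous, ?_, hdivadd hV hB1', fun η hη => ?_⟩
  · obtain ⟨S, -, hS⟩ := exists_bound_of_compact_fst (F := fun y ξ => deriv (F y) ξ + X y ξ)
      (hV.add hX.continuous) hK (fun y hy ξ => by rw [hV0 y hy, hX0 y hy, add_zero]) 0 R
    exact ⟨S, hS⟩
  -- the scale of regularisation in `ξ`
  obtain ⟨δ, hδ, hunif⟩ := Metric.uniformContinuousOn_iff_le.1
    ((hK.prod (isCompact_Icc (a := 0) (b := R + 1))).uniformContinuousOn_of_continuous hDF.continuousOn) η hη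
  set s := min δ 1 with hs
  have hs0 : 0 < s := lt_min hδ one_pos
  have hs1 : s ≤ 1 := min_le_right _ _
  have hsδ : s ≤ δ := min_le_left _ _
  set V' : Eu d → ℝ → Eu d := fun y ξ => s⁻¹ • (F y (ξ + s) - F y ξ)
  have hFadd : ContDiff ℝ 1 (uncurry fun (y : Eu d) (ξ : ℝ) => F y (ξ + s)) :=
    hF.comp (contDiff_fst.prodMk (contDiff_snd.add contDiff_const))
  have hV'c : ContDiff ℝ 1 (uncurry V') := (hFadd.sub hF).const_smul s⁻¹
  have hW'c : ContDiff ℝ 1 (uncurry fun y ξ => V' y ξ + X y ξ) := hV'c.add hX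
  have hFξ : ∀ y, Continuous (F y) := fun y => hF.continuous.comp (continuous_const.prodMk continuous_id)
  obtain ⟨Λ, hΛ0, hΛ⟩ := exists_bound_of_compact_fst
    (F := fun y ξ => fderiv ℝ (uncurry fun y ξ => V' y ξ + X y ξ) (y, ξ))
    (hW'c.continuous_fderiv (by simp)) hK (fun y hy ξ => fderiv_eq_zero_of_support hK.isClosed
      (fun y hy ξ => by simp [V', hF0 y hy, hX0 y hy]) hy ξ) 0 R
  have hinl : ‖ContinuousLinearMap.inl ℝ (Eu d) ℝ‖ ≤ 1 := ContinuousLinearMap.norm_inl_le_one ℝ _ _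
  refine ⟨fun y ξ => V' y ξ + X y ξ,
    fun y ξ => F y ξ - s⁻¹ • ∫ r in ξ..(ξ + s), F y r, Λ, hW'c.continuous, ?_, hdivadd hV'c.continuous ?_, ?_, ?_⟩
  · intro ξ hξ y z
    refine convex_univ.norm_image_sub_le_of_norm_hasFDerivWithin_le (𝕜 := ℝ) (f := fun y => V' y ξ + X y ξ)
      (fun x _ => (fderiv_fst hW'c x ξ).hasFDerivWithinAt) (fun x _ => ?_) (mem_univ z) (mem_univ y)
    refine (ContinuousLinearMap.opNorm_comp_le _ _).trans ?_
    calc _ ≤ Λ * 1 := mul_le_mul (hΛ x ξ hξ) hinl (norm_nonneg _) hΛ0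
      _ = Λ := mul_one Λ
  · intro ξ hξ ψ hψ hψc
    have h1 : ∀ y, fderiv ℝ ψ y (V' y ξ) = s⁻¹ * (fderiv ℝ ψ y (F y (ξ + s)) - fderiv ℝ ψ y (F y ξ)) := fun y => by
      simp [V']
    simp only [h1]
    rw [integral_const_mul, integral_sub (hcs ψ hψ hψc _ (hsl hF.continuous _))
      (hcs ψ hψ hψc _ (hsl hF.continuous _)), abs_mul, abs_of_pos (inv_pos.2 hs0)]
    have h2 := (convex_Icc ξ (ξ + s)).norm_image_sub_le_of_norm_hasDerivWithin_le
      (f := fun ξ => ∫ y, fderiv ℝ ψ y (F y ξ)) (C := B1 * ∫ y, |ψ y|)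
      (fun r _ => (hasDerivAt_integral_fderiv hF hψ hψc r).hasDerivWithinAt)
      (fun r hr => hB1 r ⟨hξ.1.trans hr.1, hr.2.trans (by linarith [hξ.2])⟩ ψ hψ hψc)
      (left_mem_Icc.2 (by linarith)) (right_mem_Icc.2 (by linarith))
    rw [norm_eq_abs, norm_eq_abs, add_sub_cancel_left, abs_of_pos hs0] at h2
    calc _ ≤ s⁻¹ * ((B1 * ∫ y, |ψ y|) * s) := mul_le_mul_of_nonneg_left h2 (by positivity)
      _ = _ := by field_simp
  · intro y ξ
    have h1 : ∀ a, HasDerivAt (fun x => ∫ r in 0..x, F y r) (F y a) a := fun a =>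
      intervalIntegral.integral_hasDerivAt_right ((hFξ y).intervalIntegrable _ _)
        ((hFξ y).stronglyMeasurableAtFilter _ _) (hFξ y).continuousAt
    have h2 : (fun ξ => F y ξ - s⁻¹ • ∫ r in ξ..(ξ + s), F y r)
        = fun ξ => F y ξ - s⁻¹ • ((∫ r in 0..(ξ + s), F y r) - ∫ r in 0..ξ, F y r) := by
      ext1 ξ
      rw [intervalIntegral.integral_interval_sub_left ((hFξ y).intervalIntegrable _ _) ((hFξ y).intervalIntegrable _ _)]
    beta_reduce
    rw [h2]
    have h3 := (hasDerivAt_snd hF y ξ).differentiableAt.hasDerivAt.sub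
      ((((h1 (ξ + s)).comp_add_const ξ s).sub (h1 ξ)).const_smul s⁻¹)
    refine h3.congr_deriv ?_
    simp only [V']
    abel
  · intro ξ hξ y z
    have h1 : ∀ y, F y ξ - s⁻¹ • ∫ r in ξ..(ξ + s), F y r = s⁻¹ • ∫ r in ξ..(ξ + s), (F y ξ - F y r) := by
      intro y
      rw [intervalIntegral.integral_sub (by simp) ((hFξ y).intervalIntegrable _ _),
        intervalIntegral.integral_const, add_sub_cancel_left, smul_sub, smul_smul,
        inv_mul_cancel₀ hs0.ne', one_smul]
    have hii : ∀ y, IntervalIntegrable (fun r => F y ξ - F y r) volume ξ (ξ + s) := fun y =>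
      (continuous_const.sub (hFξ y)).intervalIntegrable _ _
    beta_reduce
    rw [h1, h1, ← smul_sub, ← intervalIntegral.integral_sub (hii y) (hii z), norm_smul,
      norm_eq_abs, abs_of_pos (inv_pos.2 hs0)]
    have h2 : ‖∫ r in ξ..(ξ + s), ((F y ξ - F y r) - (F z ξ - F z r))‖ ≤ (η * ‖y - z‖) * |ξ + s - ξ| := by
      refine intervalIntegral.norm_integral_le_of_norm_le_const fun r hr => ?_
      rw [uIoc_of_le (by linarith)] at hr
      refine convex_univ.norm_image_sub_le_of_norm_hasFDerivWithin_le (𝕜 := ℝ) (f := fun y => F y ξ - F y r)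
        (fun x _ => ((fderiv_fst hF x ξ).sub (fderiv_fst hF x r)).hasFDerivWithinAt)
        (fun x _ => ?_) (mem_univ z) (mem_univ y)
      rw [← ContinuousLinearMap.sub_comp]
      refine (ContinuousLinearMap.opNorm_comp_le _ _).trans ?_
      have h3 : ‖fderiv ℝ (uncurry F) (x, ξ) - fderiv ℝ (uncurry F) (x, r)‖ ≤ η := by
        by_cases hx : x ∈ K
        · rw [← dist_eq_norm]
          refine hunif (x, ξ) ⟨hx, hξ.1, by linarith [hξ.2]⟩ (x, r)
            ⟨hx, by linarith [hξ.1, hr.1], by linarith [hξ.2, hr.2]⟩ ?_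
          rw [Prod.dist_eq, dist_self, Real.dist_eq, abs_sub_comm, abs_of_pos (by linarith [hr.1])]
          exact max_le hδ.le (by linarith [hr.2])
        · rw [hDF0 x hx, hDF0 x hx, sub_zero, norm_zero]
          exact hη.le
      calc _ ≤ η * 1 := mul_le_mul h3 hinl (norm_nonneg _) hη.le
        _ = η := mul_one η
    rw [add_sub_cancel_left, abs_of_pos hs0] at h2
    calc _ ≤ s⁻¹ * (η * ‖y - z‖ * s) := mul_le_mul_of_nonneg_left h2 (by positivity)
      _ = _ := by field_simp

/-- Lebesgue measure on `K × [0,R]`. -/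
def sect (R : ℝ) (K : Set (Eu d)) : Measure (Y[d]) := (vol[Eu d].restrict K).prod (volume.restrict (Icc 0 R))

theorem isFiniteMeasure_sect (R : ℝ) (hK : IsCompact K) : IsFiniteMeasure (sect R K) := by
  have : IsFiniteMeasure (vol[Eu d].restrict K) := isFiniteMeasure_restrict.2 hK.measure_lt_top.ne
  unfold sect
  infer_instance

theorem measurePreserving_slab (T R : ℝ) (K : Set (Eu d)) :
    MeasurePreserving (MeasurableEquiv.prodAssoc (α := ℝ) (β := Eu d) (γ := ℝ)) (slab T R K)
      ((volume.restrict (Ico 0 T)).prod (sect R K)) := by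
  have h := measurePreserving_prodAssoc (volume.restrict (Ico 0 T)) (vol[Eu d].restrict K) (vol[ℝ].restrict (Icc 0 R))
  rw [prod_restrict] at h
  exact h

theorem integral_slab_symm (hK : IsCompact K) {F : TX d × ℝ → ℝ} (hF : Integrable F (slab T R K)) :
    ∫ z, F z ∂slab T R K = ∫ z, (∫ s in Ico 0 T, F ((s, z.1), z.2)) ∂(sect R K) := by
  have := isFiniteMeasure_sect R hK
  have h := (measurePreserving_slab T R K).symm
  rw [← h.integral_comp' (g := F), integral_prod_symm]
  · rfl
  · exact (h.integrable_comp_emb (MeasurableEquiv.measurableEmbedding _)).2 hF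

/-- Regularisation of the time derivative. -/
def MollKernel.kT (κ : MollKernel d) (ε : ℝ) (φ : Eu d → ℝ) (x x' : TX d) (_ : ℝ) : ℝ :=
  fderiv ℝ (κ.scaled ε) (x - x') (1, 0) * φ x'.2

theorem abs_le_one_of_mem_Icc {a : ℝ} (h : a ∈ Icc 0 1) : |a| ≤ 1 := by
  rw [abs_of_nonneg h.1]
  exact h.2

theorem tendsto_one_div_nhdsGT : Tendsto (fun k : ℕ => 1 / ((k : ℝ) + 1)) atTop (𝓝[>] 0) :=
  tendsto_nhdsWithin_iff.2 ⟨tendsto_one_div_add_atTop_nhds_zero_nat,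
    Eventually.of_forall fun k => by simp only [mem_Ioi]; positivity⟩

theorem kernelBound_cutoff (hε : 0 < ε) (hφ : Continuous φ) (hφ01 : ∀ y, φ y ∈ Icc 0 1) (S : Set ℝ) :
    KernelBound κ.r ε (κ.C * 1) S kC[κ, ε, φ] :=
  kernelBound_kM (c := fun y _ => φ y) hε (hφ.comp continuous_fst) fun y _ _ => abs_le_one_of_mem_Icc (hφ01 y)

theorem IsDensity.smul (hH : IsDensity H) (hφ : Continuous φ)
    (hφ01 : ∀ y, φ y ∈ Icc 0 1) : IsDensity (fun x ξ => φ x.2 * H x ξ) where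
  meas := (hφ.measurable.comp measurable_fst.snd).mul hH.meas
  nonneg _ _ := mul_nonneg (hφ01 _).1 (hH.nonneg _ _)
  le_one _ _ := mul_le_one₀ (hφ01 _).2 (hH.nonneg _ _) (hH.le_one _ _)

theorem kint_kM_eq (κ : MollKernel d) (ε : ℝ) (φ : Eu d → ℝ) (H : Den[d]) (x : TX d) (ξ : ℝ) : kint kC[κ, ε, φ] H x ξ
      = kint kC[κ, ε] (fun x ξ => φ x.2 * H x ξ) x ξ := by
  simp only [kint, kM, mul_one, mul_assoc]

theorem contDiff_kint_kM (hε : 0 < ε) (hH : IsDensity H) (hφ : Continuous φ) (hφ01 : ∀ y, φ y ∈ Icc 0 1) (ξ : ℝ) :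
    ContDiff ℝ ∞ (fun x => kint kC[κ, ε, φ] H x ξ) := by
  rw [show (fun x => kint kC[κ, ε, φ] H x ξ) = _ from funext fun x => kint_kM_eq κ ε φ H x ξ]
  exact contDiff_kint_one hε (hH.smul hφ hφ01) ξ

theorem hasDerivAt_kint_kM (hε : 0 < ε) (hH : IsDensity H) (hφ : Continuous φ)
    (hφ01 : ∀ y, φ y ∈ Icc 0 1) (y : Eu d) (ξ s : ℝ) :
    HasDerivAt (fun s => kint kC[κ, ε, φ] H (s, y) ξ) (kint (κ.kT ε φ) H (s, y) ξ) s := by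
  have h1 := (contDiff_kint_kM (κ := κ) hε hH hφ hφ01 ξ).differentiable (by simp) (s, y)
  have h2 := HasFDerivAt.comp (𝕜 := ℝ) (g := fun x => kint kC[κ, ε, φ] H x ξ) s
    h1.hasFDerivAt (hasFDerivAt_prodMk_left s y)
  have h3 := h2.hasDerivAt
  refine h3.congr_deriv ?_
  simp only [ContinuousLinearMap.comp_apply, ContinuousLinearMap.inl_apply]
  rw [show (fun x => kint kC[κ, ε, φ] H x ξ) = _ from
    funext fun x => kint_kM_eq κ ε φ H x ξ, fderiv_kint_one hε (hH.smul hφ hφ01)]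
  simp only [kint, kT, mul_assoc]

theorem kernelBound_kT (hε : 0 < ε) (hφ : Continuous φ)
    (hA : ∀ y, |φ y| ≤ A) (S : Set ℝ) : KernelBound κ.r ε (κ.C * ε⁻¹ * A) S (κ.kT ε φ) where
  cont := (((κ.fderiv_scaled_continuous ε).comp (continuous_fst.sub continuous_snd.fst)).clm_apply
    continuous_const).mul (hφ.comp continuous_snd.fst.snd)
  bound x x' ξ _ := by
    have h1 := κ.fderiv_scaled_bound hε (x - x') (1, 0)
    have h2 : ‖((1 : ℝ), (0 : Eu d))‖ = 1 := by simp [Prod.norm_mk]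
    rw [h2, mul_one] at h1
    rw [kT, abs_mul]
    calc _ ≤ κ.C * ε⁻¹ * (ε ^ finrank ℝ (TX d))⁻¹ * A :=
          mul_le_mul h1 (hA _) (abs_nonneg _) ((abs_nonneg _).trans h1)
      _ = _ := by ring
  supp x x' ξ h := by
    rw [kT, κ.fderiv_scaled_supp hε (by rw [← dist_eq_norm, dist_comm]; exact h)]
    simp

theorem KernelBound.abs_kint_le_const {r : ℝ} {S : Set ℝ} {k : TX d → Den[d]}
    (hk : KernelBound r ε B S k) (hr : 0 ≤ r) (hε : 0 < ε) (hB : 0 ≤ B) (hH : IsDensity H) (x : TX d)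
    {ξ : ℝ} (hξ : ξ ∈ S) : |kint k H x ξ| ≤ B * ballVol vol[TX d] r := by
  refine (hk.abs_kint_le hH x hξ).trans (mul_le_mul_of_nonneg_left ?_ hB)
  exact (le_abs_self _).trans (ballAvg_le hr hε (fun z => hH.abs_le_one z ξ) x)

/-- The overlap of the regularised densities at time `s`. -/
def MollKernel.overlap (κ : MollKernel d) (H1 H2 : Den[d]) (φ w : Eu d → ℝ) (R : ℝ) (K : Set (Eu d)) (ε s : ℝ) : ℝ :=
  ∫ z, w z.1 * (kint kC[κ, ε, φ] H1 (s, z.1) z.2 * kint kC[κ, ε, φ] H2 (s, z.1) z.2) ∂(sect R K)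

theorem abs_kint_kM_le_one (hε : 0 < ε) (hH : IsDensity H)
    (hφ : Continuous φ) (hφ01 : ∀ y, φ y ∈ Icc 0 1) (x : TX d) (ξ : ℝ) :
    0 ≤ kint kC[κ, ε, φ] H x ξ ∧ kint kC[κ, ε, φ] H x ξ ≤ 1 := by
  rw [kint_kM_eq]
  have h := hH.smul hφ hφ01
  refine ⟨integral_nonneg fun x' => ?_, ?_⟩
  · simp only [kM, mul_one]
    exact mul_nonneg (κ.scaled_nonneg hε _) (h.nonneg _ _)
  · have hk := (kernelBound_kM (κ := κ) hε (c := fun _ _ => 1) continuous_const (A := 1) (I := univ) (by simp))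
    have hi := hk.integrable isDensity_one x (ξ := ξ)
    simp only [kM, mul_one] at hi
    refine (integral_mono ?_ hi fun x' => ?_).trans_eq (κ.integral_scaled_sub hε x)
    · exact hk.integrable h x
    · simp only [kM, mul_one]
      exact mul_le_of_le_one_right (κ.scaled_nonneg hε _) (h.le_one _ _)

theorem abs_mul_kint_kM_mul_le (hε : 0 < ε) (hH1 : IsDensity H1) (hH2 : IsDensity H2)
    (hφ : Continuous φ) (hφ01 : ∀ y, φ y ∈ Icc 0 1) {a : ℝ} (hA : |a| ≤ A)
    (x : TX d) (ξ : ℝ) :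
    |a * (kint kC[κ, ε, φ] H1 x ξ * kint kC[κ, ε, φ] H2 x ξ)| ≤ A := by
  obtain ⟨p1, p2⟩ := abs_kint_kM_le_one (κ := κ) hε hH1 hφ hφ01 x ξ
  obtain ⟨q1, q2⟩ := abs_kint_kM_le_one (κ := κ) hε hH2 hφ hφ01 x ξ
  rw [abs_mul, abs_of_nonneg (mul_nonneg p1 q1)]
  exact (mul_le_of_le_one_right (abs_nonneg _) (mul_le_one₀ p2 q1 q2)).trans hA

/-- The time derivative of the overlap, integrated in time. -/
theorem integral_kT_mul_add (hε : 0 < ε) (hH1 : IsDensity H1) (hH2 : IsDensity H2)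
    (hφ : Continuous φ) (hφ01 : ∀ y, φ y ∈ Icc 0 1) (hK : IsCompact K)
    (hw : Continuous w) (hA : ∀ y, |w y| ≤ A) (hT : 0 ≤ T) :
    ∫ z, w z.1.2 * (kint (κ.kT ε φ) H1 z.1 z.2 * kint kC[κ, ε, φ] H2 z.1 z.2
        + kint (κ.kT ε φ) H2 z.1 z.2 * kint kC[κ, ε, φ] H1 z.1 z.2) ∂slab T R K
      = κ.overlap H1 H2 φ w R K ε T - κ.overlap H1 H2 φ w R K ε 0 := by
  have hkT := kernelBound_kT (κ := κ) hε hφ (fun y => abs_le_one_of_mem_Icc (hφ01 y)) (Icc 0 R)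
  have hkM := kernelBound_cutoff (κ := κ) hε hφ hφ01 (Icc 0 R)
  have hint : Integrable (fun z => w z.1.2 * (kint (κ.kT ε φ) H1 z.1 z.2 *
      kint kC[κ, ε, φ] H2 z.1 z.2 + kint (κ.kT ε φ) H2 z.1 z.2 *
      kint kC[κ, ε, φ] H1 z.1 z.2)) (slab T R K) := by
    simp only [mul_add]
    exact (hkT.integrable_mul_slab κ.r_pos hε hkM hH1 hH2 hK hw hA).add
      (hkT.integrable_mul_slab κ.r_pos hε hkM hH2 hH1 hK hw hA)
  rw [integral_slab_symm hK hint]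
  have := isFiniteMeasure_sect R hK
  have hov : ∀ s, Integrable (fun z : Y[d] => w z.1 * (kint kC[κ, ε, φ] H1 (s, z.1) z.2
      * kint kC[κ, ε, φ] H2 (s, z.1) z.2)) (sect R K) := by
    intro s
    have hm : Measurable (fun z : Y[d] => (((s, z.1) : TX d), z.2)) :=
      (measurable_const.prodMk measurable_fst).prodMk measurable_snd
    refine Integrable.of_bound (C := A) ((hw.measurable.comp measurable_fst).mul
      (((measurable_kint hkM.cont hH1).comp hm).mul
        ((measurable_kint hkM.cont hH2).comp hm))).aestronglyMeasurable (ae_of_all _ fun z =>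
      abs_mul_kint_kM_mul_le hε hH1 hH2 hφ hφ01 (hA _) _ _)
  rw [overlap, overlap, ← integral_sub (hov T) (hov 0)]
  refine integral_congr_fun fun z => ?_
  dsimp only
  have hc : ∀ {H}, IsDensity H → Continuous (fun s => kint kC[κ, ε, φ] H (s, z.1) z.2) :=
    fun hH => (contDiff_kint_kM hε hH hφ hφ01 z.2).continuous.comp (continuous_id.prodMk continuous_const)
  have hcT : ∀ {H}, IsDensity H → Continuous (fun s => kint (κ.kT ε φ) H (s, z.1) z.2) := by
    intro H hH
    have e : (fun s => kint (κ.kT ε φ) H (s, z.1) z.2) = fun s => fderiv ℝ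
        (fun x => kint kC[κ, ε] (fun x ξ => φ x.2 * H x ξ) x z.2) (s, z.1) (1, 0) := by
      ext s
      rw [fderiv_kint_one hε (hH.smul hφ hφ01)]
      simp only [kint, kT, mul_assoc]
    rw [e]
    exact (((contDiff_kint_one hε (hH.smul hφ hφ01) z.2).continuous_fderiv (by simp)).comp
      (continuous_id.prodMk continuous_const)).clm_apply continuous_const
  rw [integral_Ico_eq_integral_Ioc, ← intervalIntegral.integral_of_le hT,
    intervalIntegral.integral_eq_sub_of_hasDerivAt (f := fun s => w z.1 * (kint kC[κ, ε, φ] H1 (s, z.1) z.2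
        * kint kC[κ, ε, φ] H2 (s, z.1) z.2))]
  · intro s _
    refine (((hasDerivAt_kint_kM hε hH1 hφ hφ01 z.1 z.2 s).mul
      (hasDerivAt_kint_kM hε hH2 hφ hφ01 z.1 z.2 s)).const_mul (w z.1)).congr_deriv ?_
    ring
  · exact Continuous.intervalIntegrable (continuous_const.mul (((hcT hH1).mul (hc hH2)).add
      ((hcT hH2).mul (hc hH1)))) _ _

/-- Convergence of regularisations at Lebesgue points. -/
theorem tendsto_kint_kM (hH : IsDensity H) (hφ : Continuous φ) (hφ01 : ∀ y, φ y ∈ Icc 0 1) (ξ : ℝ) :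
    ∀ᵐ x : TX d, Tendsto (fun ε => kint kC[κ, ε, φ] H x ξ) (𝓝[>] 0) (𝓝 (φ x.2 * H x ξ)) := by
  have h := hH.smul hφ hφ01
  filter_upwards [ae_isLebPt (h.locallyIntegrable ξ)] with x hx
  simp only [kint, kM, mul_assoc]
  have h1 := hx.tendsto_kernel' (h.locallyIntegrable ξ) (r := κ.r) (C := κ.C) (c := 1) κ.r_pos
    (k := fun ε z => κ.scaled ε (x - z))
    (fun ε => ((κ.scaled_smooth ε).continuous.comp (continuous_const.sub continuous_id)).aestronglyMeasurable)
    (by filter_upwards [self_mem_nhdsWithin] with ε hε z using κ.scaled_bound hε _)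
    (by
      filter_upwards [self_mem_nhdsWithin] with ε hε z hz
      exact κ.scaled_supp hε (by rw [← dist_eq_norm, dist_comm]; exact hz))
    (by
      refine tendsto_const_nhds.congr' ?_
      filter_upwards [self_mem_nhdsWithin] with ε hε
      exact (κ.integral_scaled_sub hε x).symm)
  simpa using h1

theorem tendsto_overlap (hH1 : IsDensity H1) (hH2 : IsDensity H2) (hφ : Continuous φ)
    (hφ01 : ∀ y, φ y ∈ Icc 0 1) (hK : IsCompact K) (hw : Continuous w)
    (hA : ∀ y, |w y| ≤ A) :
    ∀ᵐ s : ℝ, Tendsto (fun k : ℕ => κ.overlap H1 H2 φ w R K (1 / ((k : ℝ) + 1)) s) atTop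
      (𝓝 (∫ z, w z.1 * (φ z.1 ^ 2 * (H1 (s, z.1) z.2 * H2 (s, z.1) z.2)) ∂(sect R K))) := by
  have hsec := isFiniteMeasure_sect R hK
  have hmeas : ∀ {H}, IsDensity H → ∀ k : ℕ, Measurable (fun p : TX d × ℝ =>
      kint (κ.kM (1 / ((k : ℝ) + 1)) (fun y _ => φ y)) H p.1 p.2) := fun hH k =>
    measurable_kint (kernelBound_cutoff (by positivity) hφ hφ01 univ).cont hH
  have key : ∀ {H}, IsDensity H → ∀ᵐ s : ℝ, ∀ᵐ z : Y[d], Tendsto (fun k : ℕ =>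
      kint (κ.kM (1 / ((k : ℝ) + 1)) (fun y _ => φ y)) H (s, z.1) z.2) atTop
      (𝓝 (φ z.1 * H (s, z.1) z.2)) := by
    intro H hH
    have hset : MeasurableSet {p : TX d × ℝ | Tendsto (fun k : ℕ =>
        kint (κ.kM (1 / ((k : ℝ) + 1)) (fun y _ => φ y)) H p.1 p.2) atTop (𝓝 (φ p.1.2 * H p.1 p.2))} := by
      have hg : Measurable (fun p : TX d × ℝ => φ p.1.2 * H p.1 p.2) := (hH.smul hφ hφ01).meas
      have h0 := measurableSet_tendsto (𝓝 0) (l := (atTop : Filter ℕ)) (fun k => (hmeas hH k).sub hg)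
      convert h0 using 2
      ext p
      exact tendsto_sub_nhds_zero_iff.symm
    have h1 : ∀ᵐ p ∂(vol[TX d].prod vol[ℝ]), Tendsto (fun k : ℕ =>
        kint (κ.kM (1 / ((k : ℝ) + 1)) (fun y _ => φ y)) H p.1 p.2) atTop (𝓝 (φ p.1.2 * H p.1 p.2)) := by
      have h2 : ∀ᵐ p ∂(vol[ℝ].prod vol[TX d]), Tendsto (fun k : ℕ =>
          kint (κ.kM (1 / ((k : ℝ) + 1)) (fun y _ => φ y)) H p.2 p.1) atTop (𝓝 (φ p.2.2 * H p.2 p.1)) := by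
        refine (Measure.ae_prod_iff_ae_ae (p := fun p : ℝ × TX d => Tendsto (fun k : ℕ =>
          kint (κ.kM (1 / ((k : ℝ) + 1)) (fun y _ => φ y)) H p.2 p.1) atTop
            (𝓝 (φ p.2.2 * H p.2 p.1))) (hset.preimage measurable_swap)).2 ?_
        refine ae_of_all _ fun ξ => ?_
        filter_upwards [tendsto_kint_kM (κ := κ) hH hφ hφ01 ξ] with x hx
        exact hx.comp tendsto_one_div_nhdsGT
      exact (measurePreserving_swap (μ := vol[TX d]) (ν := vol[ℝ])).quasiMeasurePreserving.ae h2
    have h3 := (measurePreserving_prodAssoc vol[ℝ] vol[Eu d] vol[ℝ]).symm.quasiMeasurePreserving.ae h1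
    exact ae_ae_of_ae_prod h3
  filter_upwards [key hH1, key hH2] with s hs₁ hs2
  have hle : sect R K ≪ vol[Y[d]] := by
    unfold sect
    rw [prod_restrict]
    exact Measure.absolutelyContinuous_of_le restrict_le_self
  have hm : Measurable (fun z : Y[d] => (((s, z.1) : TX d), z.2)) :=
    (measurable_const.prodMk measurable_fst).prodMk measurable_snd
  refine tendsto_integral_filter_of_dominated_convergence (fun _ => A) ?_ ?_ (integrable_const _) ?_
  · exact Eventually.of_forall fun k => ((hw.measurable.comp measurable_fst).mul
      (((hmeas hH1 k).comp hm).mul ((hmeas hH2 k).comp hm))).aestronglyMeasurable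
  · exact Eventually.of_forall fun k => ae_of_all _ fun z =>
      abs_mul_kint_kM_mul_le (by positivity) hH1 hH2 hφ hφ01 (hA _) _ _
  · filter_upwards [hle.ae_le hs₁, hle.ae_le hs2] with z hz1 hz2
    have e : w z.1 * (φ z.1 ^ 2 * (H1 (s, z.1) z.2 * H2 (s, z.1) z.2))
        = w z.1 * ((φ z.1 * H1 (s, z.1) z.2) * (φ z.1 * H2 (s, z.1) z.2)) := by ring
    rw [e]
    exact (hz1.mul hz2).const_mul _

theorem sect_eq_restrict (R : ℝ) : sect R K = (sect R (univ : Set (Eu d))).restrict (K ×ˢ univ) := by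
  rw [sect, sect, restrict_univ, ← prod_restrict, restrict_univ]

/-- The regularisation at time `0` of a density which is small at small times. -/
theorem integral_kint_kM_zero_le (hfw : ∀ x : TX d, 0 ≤ x.1 → κ.Φ x = 0) (hH : IsDensity H)
    (hφ : Continuous φ) (hφ01 : ∀ y, φ y ∈ Icc 0 1) {K0 : Set (Eu d)}
    (hK0 : IsCompact K0) (hφK : ∀ y ∉ K0, φ y = 0) (hK : IsCompact K) {τ : ℝ} (hε : 0 < ε)
    (hετ : κ.r * ε < τ)
    (hsmall : ∀ᵐ s : ℝ, s ∈ Ioo 0 τ → ∫ z, H (s, z.1) z.2 ∂(sect R K0) ≤ η) :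
    ∫ z, kint kC[κ, ε, φ] H (0, z.1) z.2 ∂(sect R K) ≤ η := by
  have := isFiniteMeasure_sect R hK
  have := isFiniteMeasure_sect R hK0
  have hD := hH.smul hφ hφ01
  have h1 : ∀ z : Y[d], kint kC[κ, ε, φ] H (0, z.1) z.2
      = ∫ u : TX d, κ.scaled ε u * (φ (z.1 - u.2) * H (-u.1, z.1 - u.2) z.2) := by
    intro z
    rw [kint, ← integral_sub_left_eq_self _ volume ((0, z.1) : TX d)]
    refine integral_congr_fun fun u => ?_
    simp only [kM, sub_sub_cancel, Prod.snd_sub, mul_assoc]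
    congr 3
    ext1 <;> simp
  have hint : Integrable (fun p => κ.scaled ε p.2 * (φ (p.1.1 - p.2.2) * H (-p.2.1, p.1.1 - p.2.2) p.1.2))
      ((sect R K).prod volume) := by
    have hi : Integrable (fun p => 1 * κ.scaled ε p.2) ((sect R K).prod volume) :=
      (integrable_const 1).mul_prod ((κ.scaled_smooth ε).continuous.integrable_of_hasCompactSupport
        (κ.scaled_compact hε))
    refine hi.mono' ?_ (ae_of_all _ fun p => ?_)
    · refine Measurable.aestronglyMeasurable (Measurable.mul
        ((κ.scaled_smooth ε).continuous.measurable.comp measurable_snd) ?_)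
      have hm : Measurable (fun p : (Y[d]) × TX d => (((-p.2.1, p.1.1 - p.2.2) : TX d), p.1.2)) :=
        (measurable_snd.fst.neg.prodMk (measurable_fst.fst.sub measurable_snd.snd)).prodMk measurable_fst.snd
      exact hD.meas.comp hm
    · rw [norm_eq_abs, abs_mul, abs_of_nonneg (κ.scaled_nonneg hε _), one_mul]
      exact mul_le_of_le_one_right (κ.scaled_nonneg hε _) (hD.abs_le_one (-p.2.1, p.1.1 - p.2.2) p.1.2)
  simp only [h1]
  rw [integral_integral_swap hint]
  have hb : ∀ᵐ u : TX d, ∫ z, κ.scaled ε u * (φ (z.1 - u.2) * H (-u.1, z.1 - u.2) z.2) ∂(sect R K)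
      ≤ κ.scaled ε u * η := by
    have hq : Measure.QuasiMeasurePreserving (fun u : TX d => -u.1) volume volume :=
      (Measure.measurePreserving_neg vol[ℝ]).quasiMeasurePreserving.comp quasiMeasurePreserving_fst
    filter_upwards [hq.ae hsmall] with u hu
    rw [integral_const_mul]
    by_cases h0 : κ.scaled ε u = 0
    · rw [h0, zero_mul, zero_mul]
    refine mul_le_mul_of_nonneg_left ?_ (κ.scaled_nonneg hε u)
    have hu1 : u.1 < 0 := by
      by_contra hc
      exact h0 (by rw [scaled, hfw _ (by
        simp only [Prod.smul_fst, smul_eq_mul]; have := not_lt.1 hc; positivity), mul_zero])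
    have hu2 : -u.1 < τ := by
      refine lt_of_le_of_lt ?_ hετ
      by_contra hc
      refine h0 (κ.scaled_supp hε ((not_le.1 hc).trans_le ?_))
      exact (neg_le_abs _).trans (norm_fst_le u)
    refine le_trans ?_ (hu ⟨by linarith, hu2⟩)
    set G : Y[d] → ℝ := fun z => φ z.1 * H (-u.1, z.1) z.2
    have hm : Measurable (fun z : Y[d] => (((-u.1, z.1) : TX d), z.2)) := by fun_prop
    have hGm : Measurable G := hD.meas.comp hm
    have hG0 : ∀ z, 0 ≤ G z := fun z => hD.nonneg (-u.1, z.1) z.2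
    have hG1 : ∀ z, ‖G z‖ ≤ 1 := fun z => hD.abs_le_one (-u.1, z.1) z.2
    have hGi : Integrable G (sect R K0) := Integrable.of_bound hGm.aestronglyMeasurable 1 (ae_of_all _ hG1)
    have hGs : Function.support G ⊆ K0 ×ˢ univ := fun z hz => by
      refine ⟨?_, mem_univ _⟩
      by_contra hc
      exact hz (by simp only [G, hφK _ hc, zero_mul])
    have hGu : Integrable G (sect R univ) := by
      rw [sect_eq_restrict] at hGi
      exact (integrableOn_iff_integrable_of_support_subset hGs).1 hGi
    have hmp : MeasurePreserving (fun z => (z.1 - u.2, z.2)) (sect R univ) (sect R univ) := by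
      unfold sect
      rw [restrict_univ]
      exact (measurePreserving_sub_right vol[Eu d] u.2).prod (MeasurePreserving.id _)
    have hemb : MeasurableEmbedding (fun z : Y[d] => (z.1 - u.2, z.2)) :=
      (MeasurableEquiv.prodCongr (MeasurableEquiv.subRight u.2) (MeasurableEquiv.refl ℝ)).measurableEmbedding
    calc ∫ z, G (z.1 - u.2, z.2) ∂(sect R K)
        ≤ ∫ z, G (z.1 - u.2, z.2) ∂(sect R univ) := by
          rw [sect_eq_restrict]
          exact setIntegral_le_integral (hmp.integrable_comp_of_integrable hGu) (ae_of_all _ fun z => hG0 _)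
      _ = ∫ z, G z ∂(sect R univ) := hmp.integral_comp hemb G
      _ = ∫ z, G z ∂(sect R K0) := by
          rw [sect_eq_restrict (K := K0), setIntegral_eq_integral_of_forall_compl_eq_zero]
          intro z hz
          by_contra hc
          exact hz (hGs hc)
      _ ≤ ∫ z, H (-u.1, z.1) z.2 ∂(sect R K0) := by
          refine integral_mono hGi (Integrable.of_bound (hH.meas.comp hm).aestronglyMeasurable 1
            (ae_of_all _ fun z => hH.abs_le_one _ _)) fun z => ?_
          exact mul_le_of_le_one_left (hH.nonneg _ _) (hφ01 _).2
  refine (integral_mono_ae hint.integral_prod_right (((κ.scaled_smooth ε).continuous.integrable_of_hasCompactSupport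
        (κ.scaled_compact hε)).mul_const η) hb).trans_eq ?_
  rw [integral_mul_const, κ.integral_scaled hε, one_mul]

theorem IsDensity.abs_sub (hH1 : IsDensity H1) (hH2 : IsDensity H2) : IsDensity (fun x ξ => |H1 x ξ - H2 x ξ|) where
  meas := (hH1.meas.sub hH2.meas).norm
  nonneg _ _ := abs_nonneg _
  le_one x ξ := abs_le.2 ⟨by linarith [hH1.nonneg x ξ, hH2.le_one x ξ], by linarith [hH2.nonneg x ξ, hH1.le_one x ξ]⟩

theorem kint_kM_le_add (hε : 0 < ε) (hH1 : IsDensity H1) (hH2 : IsDensity H2)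
    (hφ : Continuous φ) (hφ01 : ∀ y, φ y ∈ Icc 0 1) (x : TX d) (ξ : ℝ) :
    kint kC[κ, ε, φ] H1 x ξ ≤ kint kC[κ, ε, φ] (fun x ξ => |H1 x ξ - H2 x ξ|) x ξ + kint kC[κ, ε, φ] H2 x ξ := by
  have hk := kernelBound_cutoff (κ := κ) hε hφ hφ01 univ
  unfold kint
  rw [← integral_add (hk.integrable (hH1.abs_sub hH2) x) (hk.integrable hH2 x)]
  refine integral_mono (hk.integrable hH1 x)
    ((hk.integrable (hH1.abs_sub hH2) x).add (hk.integrable hH2 x)) fun x' => ?_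
  simp only
  rw [← mul_add]
  refine mul_le_mul_of_nonneg_left ?_ (mul_nonneg (κ.scaled_nonneg hε _) (hφ01 _).1)
  linarith [le_abs_self (H1 x' ξ - H2 x' ξ)]

/-- The overlap vanishes initially if the densities tend to complementary indicators. -/
theorem tendsto_overlap_zero (hfw : ∀ x : TX d, 0 ≤ x.1 → κ.Φ x = 0) (hH1 : IsDensity H1)
    (hH2 : IsDensity H2) (hφ : Continuous φ) (hφ01 : ∀ y, φ y ∈ Icc 0 1)
    {K0 : Set (Eu d)} (hK0 : IsCompact K0) (hφK : ∀ y ∉ K0, φ y = 0) (hK : IsCompact K)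
    (hA : ∀ y, |w y| ≤ A)
    {H0 : Eu d → ℝ → ℝ} (hm : Measurable (uncurry H0)) (h01 : ∀ y ξ, H0 y ξ = 0 ∨ H0 y ξ = 1)
    (hi₁ : ∀ η > 0, ∃ τ > 0, ∀ᵐ s : ℝ, s ∈ Ioo 0 τ → ∫ z, |H1 (s, z.1) z.2 - H0 z.1 z.2| ∂(sect R K0) ≤ η)
    (hi₂ : ∀ η > 0, ∃ τ > 0, ∀ᵐ s : ℝ, s ∈ Ioo 0 τ → ∫ z, |H2 (s, z.1) z.2 - (1 - H0 z.1 z.2)| ∂(sect R K0) ≤ η) :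
    Tendsto (fun ε => κ.overlap H1 H2 φ w R K ε 0) (𝓝[>] 0) (𝓝 0) := by
  have := isFiniteMeasure_sect R hK
  have hA0 : 0 ≤ A := (abs_nonneg _).trans (hA 0)
  have hp : IsDensity (fun (x : TX d) ξ => H0 x.2 ξ) := ⟨hm.comp (measurable_fst.snd.prodMk measurable_snd),
      fun x ξ => by rcases h01 x.2 ξ with h | h <;> simp [h],
      fun x ξ => by rcases h01 x.2 ξ with h | h <;> simp [h]⟩
  have hq : IsDensity (fun (x : TX d) ξ => 1 - H0 x.2 ξ) :=
    ⟨measurable_const.sub hp.meas, fun x ξ => by linarith [hp.le_one x ξ], fun x ξ => by linarith [hp.nonneg x ξ]⟩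
  set a : (Den[d]) → ℝ → Y[d] → ℝ := fun H ε z => kint kC[κ, ε, φ] H (0, z.1) z.2
  have ha0 : ∀ {H}, IsDensity H → ∀ ε > 0, ∀ z, 0 ≤ a H ε z := fun hH ε hε z => (abs_kint_kM_le_one hε hH hφ hφ01 _ _).1
  have ha1 : ∀ {H}, IsDensity H → ∀ ε > 0, ∀ z, a H ε z ≤ 1 := fun hH ε hε z => (abs_kint_kM_le_one hε hH hφ hφ01 _ _).2
  have ham : ∀ {H}, IsDensity H → ∀ ε > 0, Measurable (a H ε) := fun hH ε hε =>
    (measurable_kint (kernelBound_cutoff hε hφ hφ01 univ).cont hH).comp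
      ((measurable_const.prodMk measurable_fst).prodMk measurable_snd)
  have hai : ∀ {H}, IsDensity H → ∀ ε > 0, Integrable (a H ε) (sect R K) := fun hH ε hε =>
    Integrable.of_bound (ham hH ε hε).aestronglyMeasurable 1 (ae_of_all _ fun z => by
      rw [norm_eq_abs, abs_of_nonneg (ha0 hH ε hε z)]; exact ha1 hH ε hε z)
  -- the limit of the overlap of the initial values
  have h3 : Tendsto (fun ε => ∫ z, a (fun x ξ => H0 x.2 ξ) ε z * a (fun x ξ => 1 - H0 x.2 ξ) ε z
      ∂(sect R K)) (𝓝[>] 0) (𝓝 0) := by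
    have hinv : ∀ (F : Eu d → ℝ → ℝ) (ε s : ℝ) (y : Eu d) (ξ : ℝ), kint kC[κ, ε, φ] (fun x ξ => F x.2 ξ) (s, y) ξ
          = kint kC[κ, ε, φ] (fun x ξ => F x.2 ξ) (0, y) ξ := by
      intro F ε s y ξ
      rw [kint, ← integral_add_right_eq_self _ ((s, 0) : TX d), kint]
      refine integral_congr_fun fun x' => ?_
      simp only [kM, Prod.snd_add, add_zero]
      congr 3
      ext1 <;> simp
    have hlim : ∀ {F : Eu d → ℝ → ℝ}, IsDensity (fun (x : TX d) ξ => F x.2 ξ) → ∀ ξ, ∀ᵐ y : Eu d,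
        Tendsto (fun ε => kint kC[κ, ε, φ] (fun x ξ => F x.2 ξ) (0, y) ξ) (𝓝[>] 0) (𝓝 (φ y * F y ξ)) := by
      intro F hF ξ
      have h := tendsto_kint_kM (κ := κ) hF hφ hφ01 ξ
      rw [volume_eq_prod] at h
      have h' := ae_ae_of_ae_prod h
      obtain ⟨s, hs⟩ := h'.exists
      filter_upwards [hs] with y hy
      simpa only [hinv F] using hy
    have : IsFiniteMeasure (vol[Eu d].restrict K) := isFiniteMeasure_restrict.2 hK.measure_lt_top.ne
    have := tendsto_integral_prod_of_bounded (μ := vol[Eu d].restrict K)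
      (ν := volume.restrict (Icc 0 R)) (l := 𝓝[>] 0) (S := univ) (C := 1)
      (F := fun ε z => if 0 < ε then
        a (fun x ξ => H0 x.2 ξ) ε z * a (fun x ξ => 1 - H0 x.2 ξ) ε z else 0)
      (F0 := fun _ => 0) (ae_of_all _ fun _ => mem_univ _) ?_ (integrable_zero _ _ _) ?_ ?_
    · rw [integral_zero] at this
      refine this.congr' ?_
      filter_upwards [self_mem_nhdsWithin] with ε hε
      refine integral_congr_fun fun z => ?_
      exact if_pos hε
    · intro ε
      by_cases hε : 0 < ε
      · simp only [if_pos hε]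
        exact (ham hp ε hε).mul (ham hq ε hε)
      · simp only [if_neg hε]
        exact measurable_const
    · filter_upwards [self_mem_nhdsWithin] with ε hε ξ _ y
      have hε : 0 < ε := hε
      simp only [if_pos hε]
      rw [abs_of_nonneg (mul_nonneg (ha0 hp ε hε _) (ha0 hq ε hε _))]
      exact mul_le_one₀ (ha1 hp ε hε _) (ha0 hq ε hε _) (ha1 hq ε hε _)
    · intro ξ _
      refine ae_restrict_of_ae ?_
      filter_upwards [hlim hp ξ, hlim (F := fun y ξ => 1 - H0 y ξ) hq ξ] with y hy1 hy2
      have h0 : φ y * H0 y ξ * (φ y * (1 - H0 y ξ)) = 0 := by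
        rcases h01 y ξ with h | h <;> simp [h]
      have h5 := hy1.mul hy2
      rw [h0] at h5
      refine h5.congr' ?_
      filter_upwards [self_mem_nhdsWithin] with ε hε
      exact (if_pos hε).symm
  rw [Metric.tendsto_nhds]
  intro η hη
  obtain ⟨τ1, hτ1, ht1⟩ := hi₁ (η / (4 * (A + 1))) (by positivity)
  obtain ⟨τ2, hτ2, ht2⟩ := hi₂ (η / (4 * (A + 1))) (by positivity)
  have hsm : ∀ τ > 0, ∀ᶠ ε in 𝓝[>] 0, κ.r * ε < τ := fun τ hτ => by
    have : Tendsto (fun ε => κ.r * ε) (𝓝[>] 0) (𝓝 (κ.r * 0)) :=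
      ((continuous_const.mul continuous_id).tendsto 0).mono_left nhdsWithin_le_nhds
    rw [mul_zero] at this
    exact this.eventually (gt_mem_nhds hτ)
  have h3' := h3.eventually (gt_mem_nhds (show 0 < η / (4 * (A + 1)) by positivity))
  filter_upwards [self_mem_nhdsWithin, hsm τ1 hτ1, hsm τ2 hτ2, h3'] with ε hε e₁ e₂ e₃
  have hε : 0 < ε := hε
  have hd1 := hH1.abs_sub hp
  have hd2 := hH2.abs_sub hq
  have b₁ : ∫ z, a (fun x ξ => |H1 x ξ - H0 x.2 ξ|) ε z ∂(sect R K) ≤ _ :=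
    integral_kint_kM_zero_le hfw hd1 hφ hφ01 hK0 hφK hK hε e₁ ht1
  have b₂ : ∫ z, a (fun x ξ => |H2 x ξ - (1 - H0 x.2 ξ)|) ε z ∂(sect R K) ≤ _ :=
    integral_kint_kM_zero_le hfw hd2 hφ hφ01 hK0 hφK hK hε e₂ ht2
  have hi3 : Integrable (fun z => a (fun x ξ => H0 x.2 ξ) ε z * a (fun x ξ => 1 - H0 x.2 ξ) ε z)
      (sect R K) := (hai hq ε hε).bdd_mul (ham hp ε hε).aestronglyMeasurable (ae_of_all _ fun z => by
          rw [norm_eq_abs, abs_of_nonneg (ha0 hp ε hε z)]; exact ha1 hp ε hε z)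
  have hle : |κ.overlap H1 H2 φ w R K ε 0| ≤ A * ((∫ z, a (fun x ξ => |H1 x ξ - H0 x.2 ξ|) ε z ∂(sect R K))
      + (∫ z, a (fun x ξ => |H2 x ξ - (1 - H0 x.2 ξ)|) ε z ∂(sect R K))
      + ∫ z, a (fun x ξ => H0 x.2 ξ) ε z * a (fun x ξ => 1 - H0 x.2 ξ) ε z ∂(sect R K)) := by
    rw [← integral_add (hai hd1 ε hε) (hai hd2 ε hε),
      ← integral_add (f := fun z => a (fun x ξ => |H1 x ξ - H0 x.2 ξ|) ε z
        + a (fun x ξ => |H2 x ξ - (1 - H0 x.2 ξ)|) ε z) ((hai hd1 ε hε).add (hai hd2 ε hε)) hi3, ← integral_const_mul, overlap]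
    refine abs_integral_le_integral ((((hai hd1 ε hε).add (hai hd2 ε hε)).add hi3).const_mul A)
      (ae_of_all _ fun z => ?_)
    have c₁ : a H1 ε z ≤ a (fun x ξ => |H1 x ξ - H0 x.2 ξ|) ε z + a (fun x ξ => H0 x.2 ξ) ε z :=
      kint_kM_le_add hε hH1 hp hφ hφ01 _ _
    have c₂ : a H2 ε z ≤ a (fun x ξ => |H2 x ξ - (1 - H0 x.2 ξ)|) ε z + a (fun x ξ => 1 - H0 x.2 ξ) ε z :=
      kint_kM_le_add hε hH2 hq hφ hφ01 _ _
    have p1 := ha0 hH1 ε hε z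
    have p2 := ha0 hH2 ε hε z
    have q2 := ha1 hH2 ε hε z
    have p3 := ha0 hd1 ε hε z
    have p4 := ha0 hd2 ε hε z
    have p5 := ha0 hp ε hε z
    have q5 := ha1 hp ε hε z
    have p6 := ha0 hq ε hε z
    change |w z.1 * (a H1 ε z * a H2 ε z)| ≤ _
    rw [abs_mul, abs_of_nonneg (mul_nonneg p1 p2)]
    refine mul_le_mul (hA _) ?_ (mul_nonneg p1 p2) hA0
    have s1 := mul_le_mul_of_nonneg_right c₁ p2
    have s2 := mul_le_mul_of_nonneg_left c₂ p5
    have s3 := mul_le_mul_of_nonneg_left q2 p3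
    have s4 := mul_le_mul_of_nonneg_right q5 p4
    linarith
  rw [dist_zero_right, norm_eq_abs]
  have hA1 : 0 < A + 1 := by linarith
  calc _ ≤ A * (η / (4 * (A + 1)) + η / (4 * (A + 1)) + η / (4 * (A + 1))) :=
        hle.trans (mul_le_mul_of_nonneg_left (add_le_add (add_le_add b₁ b₂) e₃.le) hA0)
    _ = (A / (A + 1)) * (3 * η / 4) := by field_simp; ring
    _ ≤ 1 * (3 * η / 4) := mul_le_mul_of_nonneg_right ((div_le_one hA1).2 (by linarith)) (by positivity)
    _ < η := by linarith

/-! ### Regularisation in `ξ` -/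

/-- Convolution in `ξ` with the kernel `ϖ(·/δ)/δ`. -/
def xiReg (ϖ : ℝ → ℝ) (δ : ℝ) (G : Den[d]) (x : TX d) (ξ : ℝ) : ℝ := ∫ s, δ⁻¹ * ϖ ((ξ - s) / δ) * G x s

theorem measurable_xiReg (hϖ : Continuous ϖ) (δ : ℝ) {G : Den[d]}
    (hG : Measurable (uncurry G)) : Measurable (fun z : TX d × ℝ => xiReg ϖ δ G z.1 z.2) := by
  have h : StronglyMeasurable (fun q : (TX d × ℝ) × ℝ => δ⁻¹ * ϖ ((q.1.2 - q.2) / δ) * G q.1.1 q.2) := by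
    refine Measurable.stronglyMeasurable (Measurable.mul (measurable_const.mul
      (hϖ.measurable.comp ((measurable_fst.snd.sub measurable_snd).div_const _))) ?_)
    exact hG.comp (measurable_fst.fst.prodMk measurable_snd)
  exact h.integral_prod_right.measurable

theorem integral_xiKernel (hϖ1 : ∫ s, ϖ s = 1) (hδ : 0 < δ) (ξ : ℝ) : ∫ s, δ⁻¹ * ϖ ((ξ - s) / δ) = 1 := by
  rw [integral_const_mul, integral_sub_left_eq_self (fun s => ϖ (s / δ)) volume ξ,
    Measure.integral_comp_div, hϖ1, smul_eq_mul, mul_one, abs_of_pos hδ, inv_mul_cancel₀ hδ.ne']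

theorem mem_Ioo_of_mem_tsupport (hϖs : tsupport ϖ ⊆ Ioo (-1) 0) (hδ : 0 < δ)
    {ξ s : ℝ} (hs : (ξ - s) / δ ∈ tsupport ϖ) : s ∈ Ioo ξ (ξ + δ) := by
  obtain ⟨u1, u2⟩ := hϖs hs
  rw [lt_div_iff₀ hδ] at u1
  rw [div_lt_iff₀ hδ] at u2
  exact ⟨by linarith, by linarith⟩

theorem abs_xiReg_le (hϖ : Continuous ϖ) (hϖc : HasCompactSupport ϖ) (hϖ0 : ∀ s, 0 ≤ ϖ s)
    (hϖ1 : ∫ s, ϖ s = 1) (hϖs : tsupport ϖ ⊆ Ioo (-1) 0) (hδ : 0 < δ) (hδ1 : δ ≤ 1)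
    {G : Den[d]} {x : TX d} (hGC : ∀ ξ ∈ Icc 0 (R + 1), |G x ξ| ≤ C) {ξ : ℝ}
    (hξ : ξ ∈ Icc 0 R) : |xiReg ϖ δ G x ξ| ≤ C := by
  have hi : Integrable (fun s => δ⁻¹ * ϖ ((ξ - s) / δ)) :=
    (((hϖ.integrable_of_hasCompactSupport hϖc).comp_div hδ.ne').comp_sub_left ξ).const_mul _
  calc |xiReg ϖ δ G x ξ| ≤ ∫ s, δ⁻¹ * ϖ ((ξ - s) / δ) * C := by
        refine abs_integral_le_integral (hi.mul_const C) (ae_of_all _ fun s => ?_)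
        have h0 : 0 ≤ δ⁻¹ * ϖ ((ξ - s) / δ) := mul_nonneg (by positivity) (hϖ0 _)
        rw [abs_mul, abs_of_nonneg h0]
        by_cases hs : (ξ - s) / δ ∈ tsupport ϖ
        · obtain ⟨u1, u2⟩ := mem_Ioo_of_mem_tsupport hϖs hδ hs
          exact mul_le_mul_of_nonneg_left (hGC s ⟨by linarith [hξ.1], by linarith [hξ.2]⟩) h0
        · rw [eq_zero_off_tsupport hs]
          simp
    _ = C := by rw [integral_mul_const, integral_xiKernel hϖ1 hδ, one_mul]

theorem tendsto_xiReg (hϖ : Continuous ϖ) (hϖc : HasCompactSupport ϖ)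
    (hϖ1 : ∫ s, ϖ s = 1) (hϖs : tsupport ϖ ⊆ Ioo (-1) 0)
    {G : Den[d]} (hG : Measurable (uncurry G)) {x : TX d}
    (hGC : ∀ ξ ∈ Icc 0 (R + 1), |G x ξ| ≤ C) :
    ∀ᵐ ξ ∂(volume.restrict (Icc 0 R)), Tendsto (fun δ => xiReg ϖ δ G x ξ) (𝓝[>] 0) (𝓝 (G x ξ)) := by
  set G' : ℝ → ℝ := (Icc 0 (R + 1)).indicator (G x)
  have hm : Measurable G' := (hG.comp (measurable_const.prodMk measurable_id)).indicator measurableSet_Icc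
  have hloc : LocallyIntegrable G' volume := by
    have hc : LocallyIntegrable (fun _ : ℝ => |C|) volume := locallyIntegrable_const _
    refine hc.mono hm.aestronglyMeasurable (ae_of_all _ fun s => ?_)
    simp only [G']
    rw [norm_eq_abs, norm_eq_abs, abs_abs]
    by_cases hs : s ∈ Icc 0 (R + 1)
    · rw [indicator_of_mem hs]
      exact (hGC s hs).trans (le_abs_self C)
    · rw [indicator_of_notMem hs, abs_zero]
      exact abs_nonneg C
  obtain ⟨A, hA⟩ := hϖ.bounded_above_of_compact_support hϖc
  filter_upwards [ae_restrict_of_ae (ae_isLebPt hloc), ae_restrict_mem measurableSet_Icc] with ξ hξ hξR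
  have h1 := hξ.tendsto_kernel' hloc (r := 1) (C := A) (c := 1) one_pos (k := fun δ s => δ⁻¹ * ϖ ((ξ - s) / δ))
    (fun δ => (continuous_const.mul (hϖ.comp ((continuous_const.sub continuous_id).div_const _))).aestronglyMeasurable)
    (by
      filter_upwards [self_mem_nhdsWithin] with δ hδ z
      have hδ : 0 < δ := hδ
      rw [abs_mul, abs_of_pos (inv_pos.2 hδ), Module.finrank_self, pow_one, mul_comm]
      exact mul_le_mul_of_nonneg_right (hA _) (by positivity))
    (by
      filter_upwards [self_mem_nhdsWithin] with δ hδ z hz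
      suffices hs : (ξ - z) / δ ∉ tsupport ϖ by
        rw [eq_zero_off_tsupport hs, mul_zero]
      intro hs
      obtain ⟨u1, u2⟩ := mem_Ioo_of_mem_tsupport hϖs hδ hs
      rw [Real.dist_eq, lt_abs] at hz
      rcases hz with hz | hz <;> linarith)
    (by
      refine tendsto_const_nhds.congr' ?_
      filter_upwards [self_mem_nhdsWithin] with δ hδ
      exact (integral_xiKernel hϖ1 hδ ξ).symm)
  have hξR' : ξ ∈ Icc 0 (R + 1) := ⟨hξR.1, by linarith [hξR.2]⟩
  have hG' : G' ξ = G x ξ := indicator_of_mem hξR' _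
  rw [one_mul, hG'] at h1
  refine h1.congr' ?_
  filter_upwards [Ioo_mem_nhdsGT (show 0 < 1 by norm_num)] with δ hδ
  refine integral_congr_fun fun s => ?_
  by_cases hs : (ξ - s) / δ ∈ tsupport ϖ
  · obtain ⟨u1, u2⟩ := mem_Ioo_of_mem_tsupport hϖs hδ.1 hs
    have hsR : s ∈ Icc 0 (R + 1) := ⟨by linarith [hξR.1], by linarith [hξR.2, hδ.2]⟩
    simp only [G']
    rw [indicator_of_mem hsR]
  · rw [eq_zero_off_tsupport hs]
    simp

theorem tendsto_integral_xiReg_mul (hϖ : Continuous ϖ) (hϖc : HasCompactSupport ϖ)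
    (hϖ0 : ∀ s, 0 ≤ ϖ s) (hϖ1 : ∫ s, ϖ s = 1) (hϖs : tsupport ϖ ⊆ Ioo (-1) 0) (hK : IsCompact K)
    {G1 G2 : Den[d]} (hG₁ : Measurable (uncurry G1))
    (hG2 : Measurable (uncurry G2)) {C1 C2 : ℝ} (hC1 : 0 ≤ C1) (hC2 : 0 ≤ C2)
    (hGC1 : ∀ x, ∀ ξ ∈ Icc 0 (R + 1), |G1 x ξ| ≤ C1) (hGC2 : ∀ x, ∀ ξ ∈ Icc 0 (R + 1), |G2 x ξ| ≤ C2)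
    (hw : Continuous w) (hA : ∀ y, |w y| ≤ A) :
    Tendsto (fun δ => ∫ z, w z.1.2 * (xiReg ϖ δ G1 z.1 z.2 * xiReg ϖ δ G2 z.1 z.2) ∂slab T R K)
      (𝓝[>] 0) (𝓝 (∫ z, w z.1.2 * (G1 z.1 z.2 * G2 z.1 z.2) ∂slab T R K)) := by
  have hA0 : 0 ≤ A := (abs_nonneg _).trans (hA 0)
  have := isFiniteMeasure_slab_left T hK
  have hsw : ∀ F : TX d × ℝ → ℝ, ∫ z, F z ∂slab T R K = ∫ z, F z.swap ∂((volume.restrict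
      (Icc 0 R)).prod (vol[TX d].restrict (Ico 0 T ×ˢ K))) := fun F =>
    (integral_prod_swap F).symm
  simp only [hsw]
  have hwm : Measurable (fun z : ℝ × TX d => w z.2.2) := hw.measurable.comp measurable_snd.snd
  have hb : ∀ {u v : ℝ} (y : Eu d), |u| ≤ C1 → |v| ≤ C2 → |w y * (u * v)| ≤ A * (C1 * C2) := by
    intro u v y hu hv
    rw [abs_mul, abs_mul]
    exact mul_le_mul (hA y) (mul_le_mul hu hv (abs_nonneg _) hC1) (by positivity) hA0
  refine tendsto_integral_prod_of_bounded (S := univ) (C := A * (C1 * C2))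
    (F := fun δ z => (Icc 0 R).indicator 1 z.1 * (w z.2.2 * (xiReg ϖ δ G1 z.2 z.1 * xiReg ϖ δ G2 z.2 z.1)))
    (ae_of_all _ fun _ => mem_univ _) (fun δ => ?_) ?_ ?_ ?_ |>.congr' ?_
  · exact ((measurable_one.indicator measurableSet_Icc).comp measurable_fst).mul
      (hwm.mul (((measurable_xiReg hϖ δ hG₁).comp measurable_swap).mul
      ((measurable_xiReg hϖ δ hG2).comp measurable_swap)))
  · refine Integrable.of_bound (C := A * (C1 * C2)) (hwm.mul ((hG₁.comp measurable_swap).mul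
      (hG2.comp measurable_swap))).aestronglyMeasurable ?_
    filter_upwards [quasiMeasurePreserving_fst.ae (ae_restrict_mem (measurableSet_Icc))] with z hz
    have hz' : z.1 ∈ Icc 0 (R + 1) := ⟨hz.1, by linarith [hz.2]⟩
    exact hb _ (hGC1 z.2 _ hz') (hGC2 z.2 _ hz')
  · filter_upwards [Ioo_mem_nhdsGT (show 0 < 1 by norm_num)] with δ hδ x _ ξ
    by_cases hξ : ξ ∈ Icc 0 R
    · rw [indicator_of_mem hξ, Pi.one_apply, one_mul]
      exact hb _ (abs_xiReg_le hϖ hϖc hϖ0 hϖ1 hϖs hδ.1 hδ.2.le (hGC1 x) hξ)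
        (abs_xiReg_le hϖ hϖc hϖ0 hϖ1 hϖs hδ.1 hδ.2.le (hGC2 x) hξ)
    · rw [indicator_of_notMem hξ, zero_mul, abs_zero]
      positivity
  · intro x _
    filter_upwards [tendsto_xiReg hϖ hϖc hϖ1 hϖs hG₁ (hGC1 x), tendsto_xiReg hϖ hϖc hϖ1 hϖs hG2 (hGC2 x),
      ae_restrict_mem measurableSet_Icc] with ξ h1 h2 hξ
    simp only [indicator_of_mem hξ, Pi.one_apply, one_mul]
    exact (h1.mul h2).const_mul _
  · refine Eventually.of_forall fun δ => integral_congr_ae ?_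
    filter_upwards [quasiMeasurePreserving_fst.ae (ae_restrict_mem (measurableSet_Icc))] with z hz
    rw [indicator_of_mem hz, Pi.one_apply, one_mul]
    rfl

/-- Regularisation of the transport operator `∂_t + W · ∇ + c`. -/
def MollKernel.transport (κ : MollKernel d) (ε : ℝ) (φ : Eu d → ℝ) (W : Eu d → ℝ → Eu d)
    (c : Eu d → ℝ → ℝ) (H : Den[d]) (x : TX d) (ξ : ℝ) : ℝ :=
  kint (κ.kT ε φ) H x ξ + (kint (κ.kD ε W) H x ξ + kint (κ.kM ε c) H x ξ)

theorem measurable_transport (hε : 0 < ε) (hφ : Continuous φ) (hB : ∀ y, |φ y| ≤ B) (hW : Continuous (uncurry W))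
    (hS : ∀ y, ∀ ξ ∈ Icc 0 (R + 1), ‖W y ξ‖ ≤ S) (hc : Continuous (uncurry c)) {Sc : ℝ}
    (hSc : ∀ y, ∀ ξ ∈ Icc 0 (R + 1), |c y ξ| ≤ Sc) (hR : 0 ≤ R) (hH : IsDensity H) :
    Measurable (uncurry (κ.transport ε φ W c H)) ∧
        ∃ C, 0 ≤ C ∧ ∀ x, ∀ ξ ∈ Icc 0 (R + 1), |κ.transport ε φ W c H x ξ| ≤ C := by
  have hB0 : 0 ≤ B := (abs_nonneg _).trans (hB 0)
  have hS0 : 0 ≤ S := (norm_nonneg _).trans (hS 0 0 ⟨le_rfl, by linarith⟩)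
  have hSc0 : 0 ≤ Sc := (abs_nonneg _).trans (hSc 0 0 ⟨le_rfl, by linarith⟩)
  have kT := kernelBound_kT (κ := κ) hε hφ hB (Icc 0 (R + 1))
  have kD := kernelBound_kD (κ := κ) hε hW hS
  have kC := kernelBound_kM (κ := κ) hε hc hSc
  have hCC := κ.C_nonneg
  refine ⟨(measurable_kint kT.cont hH).add ((measurable_kint kD.cont hH).add
    (measurable_kint kC.cont hH)), _, ?_, fun x ξ hξ => (abs_add_le _ _).trans (add_le_add
      (kT.abs_kint_le_const κ.r_pos.le hε (by positivity) hH x hξ) ((abs_add_le _ _).trans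
      (add_le_add (kD.abs_kint_le_const κ.r_pos.le hε (by positivity) hH x hξ)
        (kC.abs_kint_le_const κ.r_pos.le hε (by positivity) hH x hξ))))⟩
  have := ballVol_nonneg (d := d) κ.r
  positivity

theorem measurable_kint_kM (hε : 0 < ε) (hφ : Continuous φ) (hφ01 : ∀ y, φ y ∈ Icc 0 1)
    (hH : IsDensity H) : Measurable (uncurry (kint kC[κ, ε, φ] H)) ∧ ∀ x ξ, |kint kC[κ, ε, φ] H x ξ| ≤ 1 := by
  refine ⟨measurable_kint (kernelBound_cutoff hε hφ hφ01 univ).cont hH, fun x ξ => ?_⟩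
  obtain ⟨p1, p2⟩ := abs_kint_kM_le_one (κ := κ) hε hH hφ hφ01 x ξ
  rwa [abs_of_nonneg p1]

theorem overlap_le_of_limsup_le (hfw : ∀ x : TX d, 0 ≤ x.1 → κ.Φ x = 0) (hH1 : IsDensity H1)
    (hH2 : IsDensity H2) (hbv : OppositelyMonotone R H1 H2)
    (hϖ : Continuous ϖ) (hϖc : HasCompactSupport ϖ)
    (hϖ0 : ∀ s, 0 ≤ ϖ s) (hϖ1 : ∫ s, ϖ s = 1) (hϖs : tsupport ϖ ⊆ Ioo (-1) 0)
    (hK : IsCompact K) (hB : 0 ≤ B) (hW : AdmissibleField R B W)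
    (hS : ∀ y, ∀ ξ ∈ Icc 0 (R + 1), ‖W y ξ‖ ≤ S)
    (hc : Continuous (uncurry c)) {Sc : ℝ}
    (hSc : ∀ y, ∀ ξ ∈ Icc 0 (R + 1), |c y ξ| ≤ Sc)
    (hφ : ContDiff ℝ ∞ φ) (hφ01 : ∀ y, φ y ∈ Icc 0 1)
    {K0 : Set (Eu d)} (hK0 : IsCompact K0) (hφK : ∀ y ∉ K0, φ y = 0)
    (hw : ContDiff ℝ ∞ w) (hwK : tsupport w ⊆ K) (hR : 0 ≤ R)
    {H0 : Eu d → ℝ → ℝ} (hm : Measurable (uncurry H0)) (h01 : ∀ y ξ, H0 y ξ = 0 ∨ H0 y ξ = 1)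
    (hi₁ : ∀ η > 0, ∃ τ > 0, ∀ᵐ s : ℝ, s ∈ Ioo 0 τ → ∫ z, |H1 (s, z.1) z.2 - H0 z.1 z.2| ∂(sect R K0) ≤ η)
    (hi₂ : ∀ η > 0, ∃ τ > 0, ∀ᵐ s : ℝ, s ∈ Ioo 0 τ → ∫ z, |H2 (s, z.1) z.2 - (1 - H0 z.1 z.2)| ∂(sect R K0) ≤ η)
    {Br : ℝ → ℝ → ℝ → ℝ}
    (hBr : ∀ᶠ ε in 𝓝[>] 0, ∀ᶠ δ in 𝓝[>] 0, ∀ T, 0 ≤ T → Br T ε δ = ∫ z, w z.1.2 *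
      (xiReg ϖ δ (κ.transport ε φ W c H1) z.1 z.2 * xiReg ϖ δ (kint kC[κ, ε, φ] H2) z.1 z.2
      + xiReg ϖ δ (κ.transport ε φ W c H2) z.1 z.2 * xiReg ϖ δ (kint kC[κ, ε, φ] H1) z.1 z.2) ∂slab T R K)
    {X : ℝ → ℝ} (hX : ∀ᵐ T ∂(volume.restrict (Ici 0)),
      limsup (fun ε : ℝ => limsup (fun δ : ℝ => ((Br T ε δ : ℝ) : EReal)) (𝓝[>] 0)) (𝓝[>] 0) ≤ (X T : EReal)) :
    ∃ C, 0 ≤ C ∧ ∀ᵐ T ∂(volume.restrict (Ici 0)),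
      ∫ z, w z.1 * (φ z.1 ^ 2 * (H1 (T, z.1) z.2 * H2 (T, z.1) z.2)) ∂(sect R K)
        ≤ X T + C * ∫ z, H1 z.1 z.2 * H2 z.1 z.2 ∂slab T R K := by
  have hS0 : 0 ≤ S := (norm_nonneg _).trans (hS 0 0 ⟨le_rfl, by linarith⟩)
  have hSc0 : 0 ≤ Sc := (abs_nonneg _).trans (hSc 0 0 ⟨le_rfl, by linarith⟩)
  have hφ1 : ∀ y, |φ y| ≤ 1 := fun y => abs_le_one_of_mem_Icc (hφ01 y)
  have hφc : HasCompactSupport φ := HasCompactSupport.intro hK0 hφK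
  have hwc : HasCompactSupport w := hK.of_isClosed_subset (isClosed_tsupport _) hwK
  obtain ⟨A, hA0, hA⟩ := exists_bound_of_hasCompactSupport hw.continuous hwc
  have hRR : Icc 0 R ⊆ Icc 0 (R + 1) := Icc_subset_Icc_right (by linarith)
  obtain ⟨C, hC⟩ := boundedByOverlap_field (κ := κ) hH1 hH2 hbv hK hB hW hc
    (fun y ξ hξ => hSc y ξ (hRR hξ)) hSc0 hφ hφc hw hwK
  refine ⟨|C|, abs_nonneg C, ?_⟩
  have hseq := tendsto_one_div_nhdsGT
  filter_upwards [hX, ae_restrict_of_ae (tendsto_overlap (κ := κ) (R := R) hH1 hH2 hφ.continuous hφ01 hK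
    hw.continuous hA), ae_restrict_mem measurableSet_Ici] with T hXT hlim hT
  have hT : 0 ≤ T := hT
  have hov0 := tendsto_overlap_zero (R := R) (A := A) (w := w) hfw hH1 hH2 hφ.continuous hφ01 hK0 hφK hK hA
    hm h01 hi₁ hi₂
  set N : ℝ → ℝ := fun ε => ∫ z, w z.1.2 * ((kint (κ.kD ε W) H1 z.1 z.2 + kint (κ.kM ε c) H1 z.1 z.2)
          * kint kC[κ, ε, φ] H2 z.1 z.2
        + (kint (κ.kD ε W) H2 z.1 z.2 + kint (κ.kM ε c) H2 z.1 z.2) * kint kC[κ, ε, φ] H1 z.1 z.2) ∂slab T R K with hN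
  -- the inner limit
  have hJ : ∀ᶠ ε in 𝓝[>] 0, limsup (fun δ : ℝ => ((Br T ε δ : ℝ) : EReal)) (𝓝[>] 0)
      = ((κ.overlap H1 H2 φ w R K ε T - κ.overlap H1 H2 φ w R K ε 0 + N ε : ℝ) : EReal) := by
    filter_upwards [hBr, self_mem_nhdsWithin] with ε hBrε hε
    have hε : 0 < ε := hε
    have := isFiniteMeasure_slab T R hK
    have hG {H} (hH : IsDensity H) := measurable_transport (κ := κ) hε hφ.continuous hφ1 hW.cont hS hc hSc hR hH
    have hM {H} (hH : IsDensity H) := measurable_kint_kM (κ := κ) hε hφ.continuous hφ01 hH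
    obtain ⟨g1, C1, hC1, b₁⟩ := hG hH1
    obtain ⟨g2, C2, hC2, b₂⟩ := hG hH2
    have l1 := tendsto_integral_xiReg_mul (T := T) hϖ hϖc hϖ0 hϖ1 hϖs hK g1 (hM hH2).1 hC1 zero_le_one b₁
      (fun x ξ _ => (hM hH2).2 x ξ) hw.continuous hA
    have l2 := tendsto_integral_xiReg_mul (T := T) hϖ hϖc hϖ0 hϖ1 hϖs hK g2 (hM hH1).1 hC2 zero_le_one b₂
      (fun x ξ _ => (hM hH1).2 x ξ) hw.continuous hA
    have hsplit : ∀ δ ∈ Ioo 0 1, ∫ z, w z.1.2 *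
        (xiReg ϖ δ (κ.transport ε φ W c H1) z.1 z.2 * xiReg ϖ δ (kint kC[κ, ε, φ] H2) z.1 z.2
        + xiReg ϖ δ (κ.transport ε φ W c H2) z.1 z.2 * xiReg ϖ δ (kint kC[κ, ε, φ] H1) z.1 z.2) ∂slab T R K =
        (∫ z, w z.1.2 * (xiReg ϖ δ (κ.transport ε φ W c H1) z.1 z.2
          * xiReg ϖ δ (kint kC[κ, ε, φ] H2) z.1 z.2) ∂slab T R K)
        + ∫ z, w z.1.2 * (xiReg ϖ δ (κ.transport ε φ W c H2) z.1 z.2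
          * xiReg ϖ δ (kint kC[κ, ε, φ] H1) z.1 z.2) ∂slab T R K := by
      intro δ hδ
      have hi : ∀ {G G' : Den[d]} {C C' : ℝ}, 0 ≤ C → Measurable (uncurry G) →
          Measurable (uncurry G') → (∀ x, ∀ ξ ∈ Icc 0 (R + 1), |G x ξ| ≤ C) →
          (∀ x, ∀ ξ ∈ Icc 0 (R + 1), |G' x ξ| ≤ C') →
          Integrable (fun z => w z.1.2 * (xiReg ϖ δ G z.1 z.2 * xiReg ϖ δ G' z.1 z.2)) (slab T R K) := by
        intro G G' C C' hC hG hG' hb hb'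
        refine Integrable.of_bound (C := A * (C * C'))
          ((hw.continuous.measurable.comp measurable_fst.snd).mul ((measurable_xiReg hϖ δ hG).mul
          (measurable_xiReg hϖ δ hG'))).aestronglyMeasurable ?_
        filter_upwards [ae_slab T R K] with z hz
        rw [norm_eq_abs, abs_mul, abs_mul]
        exact mul_le_mul (hA _) (mul_le_mul (abs_xiReg_le hϖ hϖc hϖ0 hϖ1 hϖs hδ.1 hδ.2.le (hb z.1) hz)
          (abs_xiReg_le hϖ hϖc hϖ0 hϖ1 hϖs hδ.1 hδ.2.le (hb' z.1) hz) (abs_nonneg _) hC)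
          (by positivity) hA0
      simp only [mul_add]
      exact integral_add (hi hC1 g1 (hM hH2).1 b₁ (fun x ξ _ => (hM hH2).2 x ξ)) (hi hC2 g2 (hM hH1).1 b₂ (fun x ξ _ => (hM hH1).2 x ξ))
    have e : (∫ z, w z.1.2 * (κ.transport ε φ W c H1 z.1 z.2 * kint kC[κ, ε, φ] H2 z.1 z.2) ∂slab T R K)
        + ∫ z, w z.1.2 * (κ.transport ε φ W c H2 z.1 z.2 * kint kC[κ, ε, φ] H1 z.1 z.2) ∂slab T R K
        = κ.overlap H1 H2 φ w R K ε T - κ.overlap H1 H2 φ w R K ε 0 + N ε := by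
      have kT' := kernelBound_kT (κ := κ) hε hφ.continuous hφ1 (Icc 0 R)
      have kD' := kernelBound_kD (κ := κ) hε hW.cont fun y ξ hξ => hS y ξ (hRR hξ)
      have kC' := kernelBound_kM (κ := κ) hε hc fun y ξ hξ => hSc y ξ (hRR hξ)
      have kP' := kernelBound_cutoff (κ := κ) hε hφ.continuous hφ01 (Icc 0 R)
      have iT1 := kT'.integrable_mul_slab (T := T) κ.r_pos hε kP' hH1 hH2 hK hw.continuous hA
      have iT2 := kT'.integrable_mul_slab (T := T) κ.r_pos hε kP' hH2 hH1 hK hw.continuous hA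
      have iD1 := kD'.integrable_mul_slab (T := T) κ.r_pos hε kP' hH1 hH2 hK hw.continuous hA
      have iD2 := kD'.integrable_mul_slab (T := T) κ.r_pos hε kP' hH2 hH1 hK hw.continuous hA
      have iC1 := kC'.integrable_mul_slab (T := T) κ.r_pos hε kP' hH1 hH2 hK hw.continuous hA
      have iC2 := kC'.integrable_mul_slab (T := T) κ.r_pos hε kP' hH2 hH1 hK hw.continuous hA
      rw [← integral_kT_mul_add hε hH1 hH2 hφ.continuous hφ01 hK hw.continuous hA hT, hN]
      simp only [transport, mul_add, add_mul]
      refine (integral_add (iT1.add (iD1.add iC1)) (iT2.add (iD2.add iC2))).symm.trans (Eq.trans ?_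
        (integral_add (iT1.add iT2) ((iD1.add iC1).add (iD2.add iC2))))
      refine integral_congr_fun fun z => ?_
      simp only [Pi.add_apply]
      ring
    have hfin : Tendsto (fun δ => Br T ε δ) (𝓝[>] 0) (𝓝 (κ.overlap H1 H2 φ w R K ε T
        - κ.overlap H1 H2 φ w R K ε 0 + N ε)) := by
      rw [← e]
      refine (l1.add l2).congr' ?_
      filter_upwards [hBrε, Ioo_mem_nhdsGT (show 0 < 1 by norm_num)] with δ hδ hδ1
      rw [hδ T hT, hsplit δ hδ1]
    exact ((continuous_coe_real_ereal.tendsto _).comp hfin).limsup_eq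
  have hkey : ∀ η > 0, (∫ z, w z.1 * (φ z.1 ^ 2 * (H1 (T, z.1) z.2 * H2 (T, z.1) z.2)) ∂(sect R K))
      - |C| * (∫ z, H1 z.1 z.2 * H2 z.1 z.2 ∂slab T R K) - 3 * η ≤ X T := by
    intro η hη
    have hI0 : 0 ≤ ∫ z, H1 z.1 z.2 * H2 z.1 z.2 ∂slab T R K :=
      integral_nonneg fun z => mul_nonneg (hH1.nonneg _ _) (hH2.nonneg _ _)
    have e1 := hC T η hη
    have e2 := hov0.eventually (gt_mem_nhds hη)
    have e3 := hlim.eventually (lt_mem_nhds (sub_lt_self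
      (∫ z, w z.1 * (φ z.1 ^ 2 * (H1 (T, z.1) z.2 * H2 (T, z.1) z.2)) ∂(sect R K)) hη))
    rw [← EReal.coe_le_coe_iff]
    refine le_trans ?_ hXT
    refine le_limsup_of_frequently_le ?_
    refine hseq.frequently (Eventually.frequently ?_)
    filter_upwards [hseq.eventually hJ, hseq.eventually e1, hseq.eventually e2, e3] with k k1 k2 k3 k4
    rw [k1, EReal.coe_le_coe_iff]
    have k5 := (abs_le.1 k2).1
    have k6 := mul_le_mul_of_nonneg_right (le_abs_self C) hI0
    change -_ ≤ N _ at k5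
    linarith
  refine le_of_forall_pos_le_add fun η hη => ?_
  have := hkey (η / 3) (by positivity)
  linarith

variable {Γ : Fin d → Mat[d]} {G : Mat[d]} {f : VecX[d]} {A D : MatX[d]} {y : Eu d}

/-- Difference of phase space points. -/
notation p " ⊖ " q => (Prod.fst p - Prod.fst q, Prod.fst (Prod.snd p) - Prod.fst (Prod.snd q), Prod.snd (Prod.snd p) - Prod.snd (Prod.snd q))
notation "vol₊" => Measure.restrict volume (Ici (0 : ℝ))
notation "μξ[" g "]" => Measure.prod (riemMeasure g) volume

/-! ### Tensor calculus in coordinates -/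

section PartialDerivatives

variable {u v : Eu d → ℝ}

theorem pd_mul (k : Fin d) (hd1 : DifferentiableAt ℝ u y) (hd2 : DifferentiableAt ℝ v y) :
    pd k (fun z => u z * v z) y = pd k u y * v y + u y * pd k v y := by
  unfold pd
  rw [fderiv_fun_mul hd1 hd2]
  simp only [add_apply, smul_apply, smul_eq_mul]
  ring

theorem pd_add (k : Fin d) (hd1 : DifferentiableAt ℝ u y) (hd2 : DifferentiableAt ℝ v y) :
    pd k (fun z => u z + v z) y = pd k u y + pd k v y := by
  unfold pd
  rw [fderiv_fun_add hd1 hd2, add_apply]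

theorem pd_sum {ι : Type*} [Fintype ι] (k : Fin d) {h : ι → Eu d → ℝ} (hd : ∀ i, DifferentiableAt ℝ (h i) y) :
    pd k (fun z => ∑ i, h i z) y = ∑ i, pd k (h i) y := by
  unfold pd
  rw [fderiv_fun_sum fun i _ => hd i]
  simp

theorem pd_sum_mul {ι : Type*} [Fintype ι] (k : Fin d) {a b : ι → Eu d → ℝ}
    (ha : ∀ i, DifferentiableAt ℝ (a i) y) (hb : ∀ i, DifferentiableAt ℝ (b i) y) :
    pd k (fun z => ∑ i, a i z * b i z) y = ∑ i, (pd k (a i) y * b i y + a i y * pd k (b i) y) := by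
  rw [pd_sum k (h := fun i z => a i z * b i z) fun i => (ha i).mul (hb i)]
  exact sum_congr rfl fun i _ => pd_mul k (ha i) (hb i)

theorem pd_congr (k : Fin d) (h : u =ᶠ[𝓝 y] v) : pd k u y = pd k v y := by
  unfold pd
  rw [h.fderiv_eq]

theorem pd_eq_zero_of_notMem (k : Fin d) (hy : y ∉ tsupport u) : pd k u y = 0 := by
  rw [pd_congr k (notMem_tsupport_iff_eventuallyEq.1 hy)]
  simp [pd]

theorem ContDiffOn.pd {n m : WithTop ℕ∞} (k : Fin d) (hU : IsOpen U) (h : ContDiffOn ℝ n u U)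
    (hmn : m + 1 ≤ n) : ContDiffOn ℝ m (fun y => pd k u y) U :=
  (h.fderiv_of_isOpen hU hmn).clm_apply contDiffOn_const

theorem ContDiffOn.differentiableAt' {n : WithTop ℕ∞} (hU : IsOpen U) (h : ContDiffOn ℝ n u U)
    (hn : 1 ≤ n) (hy : y ∈ U) : DifferentiableAt ℝ u y :=
  (h.contDiffAt (hU.mem_nhds hy)).differentiableAt (by intro h0; simp [h0] at hn)

theorem contDiff_of_contDiffOn_of_tsupport {E F : Type*} [NormedAddCommGroup E] [NormedSpace ℝ E]
    [NormedAddCommGroup F] [NormedSpace ℝ F] {V : Set E} {h : E → F}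
    {n : WithTop ℕ∞} (hV : IsOpen V) (hh : ContDiffOn ℝ n h V) (hs : tsupport h ⊆ V) :
    ContDiff ℝ n h := by
  rw [contDiff_iff_contDiffAt]
  intro x
  by_cases hx : x ∈ V
  · exact hh.contDiffAt (hV.mem_nhds hx)
  · exact contDiffAt_const.congr_of_eventuallyEq (notMem_tsupport_iff_eventuallyEq.1 fun hc => hx (hs hc))

end PartialDerivatives

/-- `(∇ h)^i = g^{ij} ∂_j h`. -/
def gradOf (G : Mat[d]) (h : Eu d → ℝ) (i : Fin d) (y : Eu d) : ℝ := ∑ j, G i j y * pd j h y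

/-- `(∇_k ∇ h)^i`. -/
def hessOf (G : Mat[d]) (Γ : Fin d → Mat[d]) (h : Eu d → ℝ) (i k : Fin d) (y : Eu d) : ℝ :=
  pd k (gradOf G h i) y + ∑ l, Γ i k l y * gradOf G h l y

/-- `Div X`. -/
def divVecOf (Γ : Fin d → Mat[d]) (X : Fin d → Eu d → ℝ) (y : Eu d) : ℝ := ∑ k, (pd k (X k) y + ∑ j, Γ j k j y * X k y)

/-- `Div η` for a one-form. -/
def divFormOf (G : Mat[d]) (Γ : Fin d → Mat[d]) (η : Fin d → Eu d → ℝ) (y : Eu d) : ℝ :=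
  (∑ i, ∑ j, G i j y * pd i (η j) y) - ∑ k, ∑ i, ∑ l, Γ k i l y * G i l y * η k y

/-- `(Div T)_i` for a (1,1)-tensor. -/
def divTensorOf (Γ : Fin d → Mat[d]) (T : Mat[d]) (i : Fin d) (y : Eu d) : ℝ :=
  (∑ j, pd j (T j i) y) + (∑ j, ∑ l, Γ j j l y * T l i y) - ∑ j, ∑ l, Γ l j i y * T j l y

/-- The metric quantities of a chart with domain `U`: the inverse metric, the Christoffel symbols
and the density. -/
structure ChartGeometry (U : Set (Eu d)) (G : Mat[d]) (Γ : Fin d → Mat[d]) (w : Eu d → ℝ) : Prop where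
  isOpen : IsOpen U
  smooth_G : ∀ i j, ContDiffOn ℝ ∞ (G i j) U
  smooth_Γ : ∀ i j k, ContDiffOn ℝ ∞ (Γ i j k) U
  smooth_w : ContDiffOn ℝ ∞ w U
  pos : ∀ y ∈ U, 0 < w y
  symm_G : ∀ i j y, G i j y = G j i y
  symm_Γ : ∀ i j k y, Γ i j k y = Γ i k j y
  pd_w : ∀ k, ∀ y ∈ U, pd k w y = w y * ∑ j, Γ j k j y
  pd_G : ∀ j, ∀ y ∈ U, ∑ k, (pd k (G k j) y + (∑ l, Γ l k l y) * G k j y) = - ∑ i, ∑ l, Γ j i l y * G i l y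

namespace ChartGeometry

variable (hg : ChartGeometry U G Γ w)

include hg

/-- The divergence theorem. -/
theorem integral_divVecOf_eq_zero {F : Fin d → Eu d → ℝ} (hF : ∀ k, ContDiff ℝ 1 (F k))
    (hFc : ∀ k, HasCompactSupport (F k)) (hFU : ∀ k, tsupport (F k) ⊆ U) :
    ∫ y, divVecOf Γ F y * w y = 0 := by
  have h1 : ∀ k, ContDiff ℝ 1 (fun y => w y * F k y) := fun k =>
    contDiff_of_contDiffOn_of_tsupport hg.isOpen ((hg.smooth_w.of_le (by simp)).mul (hF k).contDiffOn)
      ((closure_mono (support_mul_subset_right _ _)).trans (hFU k))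
  have h2 : ∀ k, HasCompactSupport (fun y => w y * F k y) := fun k => (hFc k).mul_left
  have h3 : ∀ y, divVecOf Γ F y * w y = ∑ k, pd k (fun y => w y * F k y) y := by
    intro y
    rw [divVecOf, sum_mul]
    refine sum_congr rfl fun k _ => ?_
    by_cases hy : y ∈ U
    · rw [pd_mul k (ContDiffOn.differentiableAt' hg.isOpen hg.smooth_w (by simp) hy)
        ((hF k).differentiable (by simp) y), hg.pd_w k y hy, ← sum_mul]
      ring
    · have hk : y ∉ tsupport (F k) := fun hc => hy (hFU k hc)
      rw [pd_eq_zero_of_notMem k hk, pd_eq_zero_of_notMem k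
        (fun hc => hk (closure_mono (support_mul_subset_right _ _) hc)),
        eq_zero_off_tsupport hk]
      simp
  simp only [h3]
  have h4 : ∀ k, Integrable (fun y => pd k (fun y => w y * F k y) y) := fun k =>
    (((h1 k).continuous_fderiv (by simp)).clm_apply continuous_const).integrable_of_hasCompactSupport
      (((h2 k).fderiv ℝ).mono fun y hy => by
        contrapose! hy
        simp [notMem_support.1 hy])
  rw [integral_finsetSum _ fun k _ => h4 k]
  exact Finset.sum_eq_zero fun k _ => integral_fderiv_apply_eq_zero volume (h1 k) (h2 k) _

theorem contDiffOn_gradOf {n m : WithTop ℕ∞} {h : Eu d → ℝ} (hh : ContDiffOn ℝ n h U)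
    (hmn : m + 1 ≤ n) (hm : m ≤ ∞) (i : Fin d) : ContDiffOn ℝ m (gradOf G h i) U :=
  ContDiffOn.sum fun j _ => ((hg.smooth_G i j).of_le hm).mul (ContDiffOn.pd j hg.isOpen hh hmn)

omit hg in
theorem tsupport_gradOf (h : Eu d → ℝ) (i : Fin d) : tsupport (gradOf G h i) ⊆ tsupport h := by
  refine closure_minimal (fun y hy => ?_) (isClosed_tsupport h)
  by_contra hc
  exact hy (by simp [gradOf, pd_eq_zero_of_notMem _ hc])

theorem contDiffOn_divTensorOf {T : Mat[d]} (hT : ∀ k i, ContDiffOn ℝ 2 (T k i) U)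
    (i : Fin d) : ContDiffOn ℝ 1 (divTensorOf Γ T i) U := by
  have h1 : ∀ k i, ContDiffOn ℝ 1 (T k i) U := fun k i => (hT k i).of_le one_le_two
  have h2 : ∀ i j k, ContDiffOn ℝ 1 (Γ i j k) U := fun i j k => (hg.smooth_Γ i j k).of_le (by simp)
  refine ((ContDiffOn.sum fun j _ => ContDiffOn.pd j hg.isOpen (hT j i) (by norm_num)).add
    (ContDiffOn.sum fun j _ => ContDiffOn.sum fun l _ => (h2 j j l).mul (h1 l i))).sub
    (ContDiffOn.sum fun j _ => ContDiffOn.sum fun l _ => (h2 l j i).mul (h1 j l))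

/-- The operator `Div` on vector fields is minus the adjoint of the gradient. -/
theorem integral_divVecOf_mul {X : Fin d → Eu d → ℝ} (hX : ∀ k, ContDiffOn ℝ 1 (X k) U)
    (hψ : ContDiff ℝ 1 ψ) (hψc : HasCompactSupport ψ) (hψU : tsupport ψ ⊆ U) :
    ∫ y, divVecOf Γ X y * ψ y * w y = - ∫ y, (∑ k, X k y * pd k ψ y) * w y := by
  have hs : ∀ k, tsupport (fun y => X k y * ψ y) ⊆ tsupport ψ := fun k => closure_mono (support_mul_subset_right _ _)
  have h1 : ∀ k, ContDiff ℝ 1 (fun y => X k y * ψ y) := fun k =>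
    contDiff_of_contDiffOn_of_tsupport hg.isOpen ((hX k).mul hψ.contDiffOn) ((hs k).trans hψU)
  have h0 := hg.integral_divVecOf_eq_zero h1 (fun k => hψc.mul_left) (fun k => (hs k).trans hψU)
  have h2 : ∀ y, divVecOf Γ (fun k y => X k y * ψ y) y * w y
      = divVecOf Γ X y * ψ y * w y + (∑ k, X k y * pd k ψ y) * w y := by
    intro y
    rw [← add_mul]
    congr 1
    rw [divVecOf, divVecOf, sum_mul, ← sum_add_distrib]
    refine sum_congr rfl fun k _ => ?_
    by_cases hy : y ∈ U
    · rw [pd_mul k (ContDiffOn.differentiableAt' hg.isOpen (hX k) le_rfl hy)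
        (hψ.differentiable (by simp) y), ← sum_mul, ← sum_mul]
      ring
    · have hk : y ∉ tsupport ψ := fun hc => hy (hψU hc)
      rw [pd_eq_zero_of_notMem k hk, pd_eq_zero_of_notMem k (fun hc => hk (hs k hc)), eq_zero_off_tsupport hk]
      simp
  simp only [h2] at h0
  have hcont : ContinuousOn (fun y => divVecOf Γ X y * w y) U := by
    refine ContinuousOn.mul (continuousOn_finsetSum _ fun k _ => ContinuousOn.add
      (ContDiffOn.pd (m := 0) k hg.isOpen (hX k) (by norm_num)).continuousOn
      (continuousOn_finsetSum _ fun j _ => (hg.smooth_Γ j k j).continuousOn.mul (hX k).continuousOn))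
      hg.smooth_w.continuousOn
  have hcont2 : ∀ {a : Eu d → ℝ}, ContinuousOn a U → ∀ {b : Eu d → ℝ}, Continuous b → tsupport b ⊆ tsupport ψ →
      Integrable (fun y => a y * b y) := by
    intro a ha b hb hbs
    refine Continuous.integrable_of_hasCompactSupport ?_ ?_
    · rw [← contDiff_zero (𝕜 := ℝ)] at hb ⊢
      rw [← contDiffOn_zero (𝕜 := ℝ)] at ha
      exact contDiff_of_contDiffOn_of_tsupport hg.isOpen (ha.mul hb.contDiffOn)
        ((closure_mono (support_mul_subset_right _ _)).trans (hbs.trans hψU))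
    · exact hψc.of_isClosed_subset (isClosed_tsupport _) ((closure_mono (support_mul_subset_right _ _)).trans hbs)
  rw [integral_add] at h0
  · linarith
  · have := hcont2 hcont hψ.continuous subset_rfl
    refine this.congr (ae_of_all _ fun y => ?_)
    simp only
    ring
  · have : Integrable (fun y => ∑ k, (X k y * w y) * pd k ψ y) := by
      refine integrable_finsetSum _ fun k _ => hcont2 ((hX k).continuousOn.mul hg.smooth_w.continuousOn)
        ((hψ.continuous_fderiv (by simp)).clm_apply continuous_const) ?_
      refine closure_minimal (fun y hy => ?_) (isClosed_tsupport _)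
      by_contra hc
      exact hy (pd_eq_zero_of_notMem k hc)
    refine this.congr (ae_of_all _ fun y => ?_)
    simp only [sum_mul]
    exact sum_congr rfl fun k _ => by ring

/-- The operator `Div Div` on (1,1)-tensors is the adjoint of the Hessian. -/
theorem integral_hessOf_mul {T : Mat[d]} (hT : ∀ k i, ContDiffOn ℝ 2 (T k i) U)
    (hψ : ContDiff ℝ 2 ψ) (hψc : HasCompactSupport ψ) (hψU : tsupport ψ ⊆ U) :
    ∫ y, (∑ k, ∑ i, T k i y * hessOf G Γ ψ i k y) * w y = ∫ y, divFormOf G Γ (divTensorOf Γ T) y * ψ y * w y := by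
  have hT1 : ∀ k i, ContDiffOn ℝ 1 (T k i) U := fun k i => (hT k i).of_le one_le_two
  have hη := hg.contDiffOn_divTensorOf hT
  set η := divTensorOf Γ T with hηdef
  have hgr : ∀ i, ContDiffOn ℝ 1 (gradOf G ψ i) U := fun i =>
    hg.contDiffOn_gradOf hψ.contDiffOn (by norm_num) (by simp) i
  have hgs : ∀ i, tsupport (gradOf G ψ i) ⊆ tsupport ψ := tsupport_gradOf ψ
  have hψ1 : ContDiff ℝ 1 ψ := hψ.of_le one_le_two
  set X : Fin d → Eu d → ℝ := fun k y => ∑ j, G k j y * η j y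
  have hX : ∀ k, ContDiffOn ℝ 1 (X k) U := fun k =>
    ContDiffOn.sum fun j _ => ((hg.smooth_G k j).of_le (by simp)).mul (hη j)
  set F : Fin d → Eu d → ℝ := fun k y => ∑ i, T k i y * gradOf G ψ i y
  have hFs : ∀ k, tsupport (F k) ⊆ tsupport ψ := fun k => by
    refine closure_minimal (fun y hy => ?_) (isClosed_tsupport ψ)
    by_contra hc
    refine hy (Finset.sum_eq_zero fun i _ => ?_)
    rw [eq_zero_off_tsupport fun h => hc (hgs i h), mul_zero]
  have hFO : ∀ k, ContDiffOn ℝ 1 (F k) U := fun k => ContDiffOn.sum fun i _ => (hT1 k i).mul (hgr i)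
  have hF : ∀ k, ContDiff ℝ 1 (F k) := fun k => contDiff_of_contDiffOn_of_tsupport hg.isOpen (hFO k) ((hFs k).trans hψU)
  have h0 := hg.integral_divVecOf_eq_zero hF
    (fun k => hψc.of_isClosed_subset (isClosed_tsupport _) (hFs k)) (fun k => (hFs k).trans hψU)
  have h1 := hg.integral_divVecOf_mul hX hψ1 hψc hψU
  have e1 : ∀ y ∈ U, divVecOf Γ X y = divFormOf G Γ η y := by
    intro y hy
    have hGd : ∀ k j, DifferentiableAt ℝ (G k j) y := fun k j =>
      ContDiffOn.differentiableAt' hg.isOpen (hg.smooth_G k j) (by simp) hy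
    have hηd : ∀ j, DifferentiableAt ℝ (η j) y := fun j => ContDiffOn.differentiableAt' hg.isOpen (hη j) le_rfl hy
    have a1 : ∀ k, pd k (X k) y = ∑ j, (pd k (G k j) y * η j y + G k j y * pd k (η j) y) := fun k =>
      pd_sum_mul k (hGd k) hηd
    have a2 : ∀ j, (∑ i, ∑ l, Γ j i l y * G i l y) * η j y
        = - ∑ k, (pd k (G k j) y + (∑ l, Γ l k l y) * G k j y) * η j y := fun j => by
      rw [← sum_mul, hg.pd_G j y hy]
      ring
    rw [divVecOf, divFormOf]
    have a3 : ∑ k, ∑ i, ∑ l, Γ k i l y * G i l y * η k y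
        = - ∑ k, ∑ j, (pd k (G k j) y + (∑ l, Γ l k l y) * G k j y) * η j y := by
      conv_rhs => rw [sum_comm]
      rw [← Finset.sum_neg_distrib]
      refine sum_congr rfl fun j _ => ?_
      rw [← a2, sum_mul]
      exact sum_congr rfl fun i _ => by rw [sum_mul]
    rw [a3, sub_neg_eq_add, ← sum_add_distrib]
    refine sum_congr rfl fun k _ => ?_
    rw [a1, ← sum_mul, mul_sum, ← sum_add_distrib, ← sum_add_distrib]
    exact sum_congr rfl fun j _ => by ring
  have e2 : ∀ y ∈ U, divVecOf Γ F y = (∑ k, X k y * pd k ψ y) + ∑ k, ∑ i, T k i y * hessOf G Γ ψ i k y := by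
    intro y hy
    have hTd : ∀ k j, DifferentiableAt ℝ (T k j) y := fun k j =>
      ContDiffOn.differentiableAt' hg.isOpen (hT1 k j) le_rfl hy
    have hgd : ∀ j, DifferentiableAt ℝ (gradOf G ψ j) y := fun j =>
      ContDiffOn.differentiableAt' hg.isOpen (hgr j) le_rfl hy
    have a1 : ∀ k, pd k (F k) y = ∑ i, (pd k (T k i) y * gradOf G ψ i y + T k i y * pd k (gradOf G ψ i) y) := fun k =>
      pd_sum_mul k (hTd k) hgd
    have a2 : ∑ k, X k y * pd k ψ y = ∑ i, η i y * gradOf G ψ i y := by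
      simp only [X, gradOf, sum_mul, mul_sum]
      rw [sum_comm]
      refine sum_congr rfl fun i _ => sum_congr rfl fun j _ => ?_
      rw [hg.symm_G j i]
      ring
    rw [a2]
    set g := fun i => gradOf G ψ i y with hgdef
    have a3 : ∑ i, η i y * g i = (∑ i, ∑ j, pd j (T j i) y * g i)
        + (∑ i, ∑ j, ∑ l, Γ j j l y * T l i y * g i) - ∑ i, ∑ j, ∑ l, Γ l j i y * T j l y * g i := by
      rw [← sum_add_distrib, ← sum_sub_distrib]
      refine sum_congr rfl fun i _ => ?_
      simp only [hηdef, divTensorOf, add_mul, sub_mul, sum_mul]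
    have a4 : ∑ i, ∑ j, ∑ l, Γ j j l y * T l i y * g i = ∑ k, ∑ j, ∑ i, Γ j k j y * (T k i y * g i) := by
      calc _ = ∑ j, ∑ i, ∑ l, Γ j j l y * T l i y * g i := sum_comm
        _ = ∑ j, ∑ l, ∑ i, Γ j j l y * T l i y * g i := sum_congr rfl fun j _ => sum_comm
        _ = ∑ l, ∑ j, ∑ i, Γ j j l y * T l i y * g i := sum_comm
        _ = _ := sum_congr rfl fun l _ => sum_congr rfl fun j _ =>
            sum_congr rfl fun i _ => by rw [hg.symm_Γ j j l]; ring
    have a5 : ∑ i, ∑ j, ∑ l, Γ l j i y * T j l y * g i = ∑ k, ∑ i, ∑ l, T k i y * (Γ i k l y * g l) := by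
      calc _ = ∑ j, ∑ i, ∑ l, Γ l j i y * T j l y * g i := sum_comm
        _ = ∑ j, ∑ l, ∑ i, Γ l j i y * T j l y * g i := sum_congr rfl fun j _ => sum_comm
        _ = _ := sum_congr rfl fun l _ => sum_congr rfl fun j _ => sum_congr rfl fun i _ => by ring
    have a6 : ∑ i, ∑ j, pd j (T j i) y * g i = ∑ k, ∑ i, pd k (T k i) y * g i := sum_comm
    rw [a3, a4, a5, a6, divVecOf]
    simp only [a1, F, hessOf, mul_add, mul_sum, sum_add_distrib]
    simp only [hgdef]
    ring
  have e3 : ∀ y, divVecOf Γ F y * w y = (∑ k, X k y * pd k ψ y) * w y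
      + (∑ k, ∑ i, T k i y * hessOf G Γ ψ i k y) * w y := by
    intro y
    rw [← add_mul]
    by_cases hy : y ∈ U
    · rw [e2 y hy]
    · have hk : y ∉ tsupport ψ := fun hc => hy (hψU hc)
      have b1 : ∀ i, gradOf G ψ i y = 0 := fun i => eq_zero_off_tsupport fun h => hk (hgs i h)
      have b2 : ∀ i k, pd k (gradOf G ψ i) y = 0 := fun i k => pd_eq_zero_of_notMem k fun h => hk (hgs i h)
      have b3 : ∀ k, pd k (F k) y = 0 := fun k => pd_eq_zero_of_notMem k fun h => hk (hFs k h)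
      have b4 : ∀ k, F k y = 0 := fun k => eq_zero_off_tsupport fun h => hk (hFs k h)
      simp [divVecOf, hessOf, b1, b2, b3, b4, pd_eq_zero_of_notMem _ hk]
  have e4 : ∫ y, divFormOf G Γ η y * ψ y * w y = ∫ y, divVecOf Γ X y * ψ y * w y := by
    refine integral_congr_fun fun y => ?_
    by_cases hy : y ∈ U
    · rw [e1 y hy]
    · rw [eq_zero_off_tsupport fun hc => hy (hψU hc)]
      simp
  have hint : ∀ {a : Eu d → ℝ}, ContinuousOn a U → tsupport a ⊆ tsupport ψ → Integrable a := by
    intro a ha has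
    refine Continuous.integrable_of_hasCompactSupport ?_ (hψc.of_isClosed_subset (isClosed_tsupport _) has)
    rw [← contDiff_zero (𝕜 := ℝ)]
    rw [← contDiffOn_zero (𝕜 := ℝ)] at ha
    exact contDiff_of_contDiffOn_of_tsupport hg.isOpen ha (has.trans hψU)
  rw [e4, h1]
  simp only [e3] at h0
  have hsup : ∀ {a : Eu d → ℝ}, (∀ y ∉ tsupport ψ, a y = 0) → tsupport a ⊆ tsupport ψ := fun ha =>
    closure_minimal (fun y hy => by_contra fun hc => hy (ha y hc)) (isClosed_tsupport ψ)
  rw [integral_add] at h0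
  · linarith
  · refine hint (ContinuousOn.mul (continuousOn_finsetSum _ fun k _ => (hX k).continuousOn.mul
      (ContDiffOn.pd (m := 0) k hg.isOpen hψ1.contDiffOn (by norm_num)).continuousOn)
      hg.smooth_w.continuousOn) (hsup fun y hy => ?_)
    simp [pd_eq_zero_of_notMem _ hy]
  · refine hint (ContinuousOn.mul (continuousOn_finsetSum _ fun k _ => continuousOn_finsetSum _ fun i _ =>
      (hT k i).continuousOn.mul (ContinuousOn.add
        (ContDiffOn.pd (m := 0) k hg.isOpen (hgr i) (by norm_num)).continuousOn
        (continuousOn_finsetSum _ fun l _ => (hg.smooth_Γ i k l).continuousOn.mul (hgr l).continuousOn)))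
      hg.smooth_w.continuousOn) (hsup fun y hy => ?_)
    have b1 : ∀ i, gradOf G ψ i y = 0 := fun i => eq_zero_off_tsupport fun h => hy (hgs i h)
    have b2 : ∀ i k, pd k (gradOf G ψ i) y = 0 := fun i k => pd_eq_zero_of_notMem k fun h => hy (hgs i h)
    simp [hessOf, b1, b2]

/-- The Leibniz rule for the Hessian. -/
theorem hessOf_mul (hφ : ContDiffOn ℝ 2 φ U) (hψ : ContDiffOn ℝ 2 ψ U)
    (hy : y ∈ U) (i k : Fin d) : hessOf G Γ (fun z => φ z * ψ z) i k y
      = φ y * hessOf G Γ ψ i k y + pd k φ y * gradOf G ψ i y + pd k ψ y * gradOf G φ i y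
        + ψ y * hessOf G Γ φ i k y := by
  have hd : ∀ {h : Eu d → ℝ}, ContDiffOn ℝ 2 h U → ∀ z ∈ U, DifferentiableAt ℝ h z := fun hh z hz =>
    ContDiffOn.differentiableAt' hg.isOpen hh one_le_two hz
  have h1 : ∀ z ∈ U, ∀ i, gradOf G (fun z => φ z * ψ z) i z = φ z * gradOf G ψ i z + ψ z * gradOf G φ i z := by
    intro z hz i
    simp only [gradOf, pd_mul _ (hd hφ z hz) (hd hψ z hz), mul_sum]
    rw [← sum_add_distrib]
    exact sum_congr rfl fun j _ => by ring
  have hgd : ∀ {h : Eu d → ℝ}, ContDiffOn ℝ 2 h U → DifferentiableAt ℝ (gradOf G h i) y := fun hh =>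
    ContDiffOn.differentiableAt' hg.isOpen (hg.contDiffOn_gradOf hh (by norm_num) (by simp) i) le_rfl hy
  have h2 : pd k (gradOf G (fun z => φ z * ψ z) i) y
      = pd k (fun z => φ z * gradOf G ψ i z + ψ z * gradOf G φ i z) y := by
    refine pd_congr k ?_
    filter_upwards [hg.isOpen.mem_nhds hy] with z hz using h1 z hz i
  rw [hessOf, h2, pd_add k ((hd hφ y hy).fun_mul (hgd hψ)) ((hd hψ y hy).fun_mul (hgd hφ)),
    pd_mul k (hd hφ y hy) (hgd hψ), pd_mul k (hd hψ y hy) (hgd hφ), hessOf, hessOf]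
  simp only [h1 y hy, mul_add, sum_add_distrib, mul_sum]
  have h3 : ∀ (a : ℝ) (b c : Fin d → ℝ), ∑ l, b l * (a * c l) = ∑ l, a * (b l * c l) := fun a b c =>
    sum_congr rfl fun l _ => by ring
  rw [h3, h3]
  ring

end ChartGeometry

/-! ### Metric quantities -/

section Det

variable {M : Eu d → Matrix (Fin d) (Fin d) ℝ}

theorem contDiffOn_det {n : WithTop ℕ∞} (hM : ∀ i j, ContDiffOn ℝ n (fun y => M y i j) U) :
    ContDiffOn ℝ n (fun y => (M y).det) U := by
  simp only [Matrix.det_apply]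
  exact ContDiffOn.sum fun σ _ => (contDiffOn_prod fun i _ => hM (σ i) i).const_smul _

theorem contDiffOn_inv {n : WithTop ℕ∞} (hM : ∀ i j, ContDiffOn ℝ n (fun y => M y i j) U)
    (hdet : ∀ y ∈ U, (M y).det ≠ 0) (i j : Fin d) : ContDiffOn ℝ n (fun y => (M y)⁻¹ i j) U := by
  have h : ∀ y, (M y)⁻¹ i j = ((M y).det)⁻¹ * ((M y).updateRow j (Pi.single i 1)).det := by
    intro y
    rw [Matrix.inv_def, Matrix.smul_apply, Matrix.adjugate_apply, Ring.inverse_eq_inv', smul_eq_mul]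
  simp only [h]
  refine ((contDiffOn_det hM).inv hdet).mul (contDiffOn_det fun a b => ?_)
  by_cases ha : a = j
  · subst ha
    simp only [Matrix.updateRow_self]
    exact contDiffOn_const
  · simp only [Matrix.updateRow_ne ha]
    exact hM a b

theorem pd_det (hM : ∀ i j, DifferentiableAt ℝ (fun y => M y i j) y) (k : Fin d) :
    pd k (fun z => (M z).det) y = ∑ i, ∑ a, (M y).adjugate i a * pd k (fun z => M z a i) y := by
  have h1 : HasFDerivAt (fun z => (M z).det) (∑ σ : Equiv.Perm (Fin d), Equiv.Perm.sign σ •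
      ∑ i, (∏ j ∈ Finset.univ.erase i, M y (σ j) j) • fderiv ℝ (fun z => M z (σ i) i) y) y := by
    simp only [Matrix.det_apply]
    exact HasFDerivAt.fun_sum fun σ _ => (HasFDerivAt.finsetProd fun i _ => (hM (σ i) i).hasFDerivAt).const_smul _
  have h2 : ∀ i, ∑ a, (M y).adjugate i a * pd k (fun z => M z a i) y = ∑ σ : Equiv.Perm (Fin d), Equiv.Perm.sign σ •
        ((∏ j ∈ Finset.univ.erase i, M y (σ j) j) * pd k (fun z => M z (σ i) i) y) := by
    intro i
    have := congrFun (Matrix.cramer_eq_adjugate_mulVec (M y) (fun a => pd k (fun z => M z a i) y)) i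
    rw [Matrix.cramer_apply, Matrix.mulVec, dotProduct] at this
    rw [← this, Matrix.det_apply]
    refine sum_congr rfl fun σ _ => ?_
    congr 1
    rw [← Finset.prod_erase_mul Finset.univ _ (Finset.mem_univ i), Matrix.updateCol_self]
    congr 1
    refine Finset.prod_congr rfl fun j hj => ?_
    rw [Matrix.updateCol_ne (Finset.ne_of_mem_erase hj)]
  unfold pd at h2 ⊢
  rw [h1.fderiv]
  simp only [h2]
  rw [sum_comm]
  simp [Finset.smul_sum]

/-- The Christoffel symbols of a metric given in coordinates. -/
def christoffelOf (M : Eu d → Matrix (Fin d) (Fin d) ℝ) (k i j : Fin d) (y : Eu d) : ℝ := (1 / 2) * ∑ l, (M y)⁻¹ k l *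
    (pd i (fun z => M z j l) y + pd j (fun z => M z i l) y - pd l (fun z => M z i j) y)

theorem ChartGeometry.of_gram (hU : IsOpen U) (hM : ∀ i j, ContDiffOn ℝ ∞ (fun y => M y i j) U)
    (hdet : ∀ y ∈ U, 0 < (M y).det) (hsymm : ∀ y i j, M y i j = M y j i) :
    ChartGeometry U (fun i j y => (M y)⁻¹ i j) (christoffelOf M) (fun y => Real.sqrt |(M y).det|) := by
  have hMd : ∀ y ∈ U, ∀ i j, DifferentiableAt ℝ (fun y => M y i j) y := fun y hy i j =>
    ContDiffOn.differentiableAt' hU (hM i j) (by simp) hy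
  have hGs := fun i j => contDiffOn_inv hM (fun y hy => (hdet y hy).ne') i j
  have hGd : ∀ y ∈ U, ∀ i j, DifferentiableAt ℝ (fun y => (M y)⁻¹ i j) y := fun y hy i j =>
    ContDiffOn.differentiableAt' hU (hGs i j) (by simp) hy
  have hsymmG : ∀ y i j, (M y)⁻¹ i j = (M y)⁻¹ j i := fun y i j => by
    have h : (M y).transpose = M y := Matrix.ext fun a b => hsymm y b a
    conv_lhs => rw [← h, ← Matrix.transpose_nonsing_inv, Matrix.transpose_apply]
  have hsymmf : ∀ i j, (fun z => M z i j) = fun z => M z j i := fun i j => funext fun z => hsymm z i j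
  have htr : ∀ y k, ∑ j, christoffelOf M j k j y = (1 / 2) * ∑ j, ∑ l, (M y)⁻¹ j l * pd k (fun z => M z j l) y := by
    intro y k
    simp only [christoffelOf]
    rw [← mul_sum]
    congr 1
    have h1 : ∑ j, ∑ l, (M y)⁻¹ j l * pd j (fun z => M z k l) y
        = ∑ j, ∑ l, (M y)⁻¹ j l * pd l (fun z => M z k j) y := by
      rw [sum_comm]
      exact sum_congr rfl fun j _ => sum_congr rfl fun l _ => by rw [hsymmG y l j]
    simp only [mul_add, mul_sub, sum_add_distrib, sum_sub_distrib]
    linarith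
  have hw : ∀ y ∈ U, ∀ k, pd k (fun y => Real.sqrt |(M y).det|) y
      = Real.sqrt |(M y).det| * ∑ j, christoffelOf M j k j y := by
    intro y hy k
    have hp := hdet y hy
    have h1 : pd k (fun y => Real.sqrt |(M y).det|) y = pd k (fun y => Real.sqrt (M y).det) y := by
      refine pd_congr k ?_
      filter_upwards [hU.mem_nhds hy] with z hz
      rw [abs_of_pos (hdet z hz)]
    have hdd : DifferentiableAt ℝ (fun y => (M y).det) y :=
      ContDiffOn.differentiableAt' hU (contDiffOn_det hM) (by simp) hy
    have h2 : pd k (fun y => Real.sqrt (M y).det) y = 1 / (2 * Real.sqrt (M y).det) * pd k (fun y => (M y).det) y := by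
      unfold pd
      rw [(hdd.hasFDerivAt.sqrt hp.ne').fderiv]
      simp
    have hs := Real.sq_sqrt hp.le
    have hsp := Real.sqrt_pos.2 hp
    rw [h1, h2, pd_det (hMd y hy), htr, abs_of_pos hp]
    have h3 : ∑ i, ∑ a, (M y).adjugate i a * pd k (fun z => M z a i) y
        = (M y).det * ∑ j, ∑ l, (M y)⁻¹ j l * pd k (fun z => M z j l) y := by
      simp only [mul_sum]
      refine sum_congr rfl fun i _ => sum_congr rfl fun a _ => ?_
      rw [Matrix.inv_def, Matrix.smul_apply, Ring.inverse_eq_inv', smul_eq_mul, hsymmf a i]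
      field_simp
    rw [h3]
    set s := Real.sqrt (M y).det
    rw [← hs]
    field_simp
  refine ⟨hU, hGs, fun i j k => ?_, ?_, fun y hy => Real.sqrt_pos.2 (abs_pos.2 (hdet y hy).ne'),
    fun i j y => hsymmG y i j, fun i j k y => ?_, fun k y hy => hw y hy k, fun j y hy => ?_⟩
  · refine contDiffOn_const.mul (ContDiffOn.sum fun l _ => (hGs i l).mul ?_)
    exact ((ContDiffOn.pd j hU (hM k l) (by simp)).add (ContDiffOn.pd k hU (hM j l) (by simp))).sub
      (ContDiffOn.pd l hU (hM j k) (by simp))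
  · refine ContDiffOn.congr (ContDiffOn.sqrt (contDiffOn_det hM) fun y hy => (hdet y hy).ne') fun y hy => ?_
    rw [abs_of_pos (hdet y hy)]
  · simp only [christoffelOf]
    congr 1
    refine sum_congr rfl fun l _ => ?_
    rw [hsymmf k j]
    ring
  · have hpG : ∀ k a b, pd k (fun z => (M z)⁻¹ a b) y
        = - ∑ l, ∑ m, (M y)⁻¹ a l * pd k (fun z => M z l m) y * (M y)⁻¹ m b := by
      intro k a b
      set P : Matrix (Fin d) (Fin d) ℝ := Matrix.of fun a b => pd k (fun z => (M z)⁻¹ a b) y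
      set D : Matrix (Fin d) (Fin d) ℝ := Matrix.of fun a b => pd k (fun z => M z a b) y
      have hu : IsUnit (M y).det := (hdet y hy).ne'.isUnit
      have h1 : P * M y + (M y)⁻¹ * D = 0 := by
        ext a b
        have h2 : pd k (fun z => ∑ l, (M z)⁻¹ a l * M z l b) y = 0 := by
          have h3 : (fun z => ∑ l, (M z)⁻¹ a l * M z l b) =ᶠ[𝓝 y] fun _ => (1 : Matrix (Fin d) (Fin d) ℝ) a b := by
            filter_upwards [hU.mem_nhds hy] with z hz
            rw [← Matrix.mul_apply, Matrix.nonsing_inv_mul _ (hdet z hz).ne'.isUnit]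
          rw [pd_congr k h3]
          simp [pd]
        rw [pd_sum_mul k (fun l => hGd y hy a l) (fun l => hMd y hy l b), sum_add_distrib] at h2
        rw [Matrix.add_apply, Matrix.mul_apply, Matrix.mul_apply]
        exact h2
      have h4 : P = -((M y)⁻¹ * D * (M y)⁻¹) := by
        have := congrArg (· * (M y)⁻¹) h1
        simp only [add_mul, Matrix.mul_assoc, Matrix.mul_nonsing_inv _ hu, mul_one, zero_mul] at this
        rw [Matrix.mul_assoc]
        exact eq_neg_of_add_eq_zero_left this
      have h5 := congrFun (congrFun h4 a) b
      rw [Matrix.neg_apply, Matrix.mul_apply] at h5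
      simp only [Matrix.mul_apply, sum_mul] at h5
      rw [sum_comm] at h5
      exact h5
    have hGG : ∑ i, ∑ l, christoffelOf M j i l y * (M y)⁻¹ i l
        = ∑ m, (M y)⁻¹ j m * ∑ i, ∑ l, (M y)⁻¹ i l * pd i (fun z => M z l m) y
          - ∑ m, (M y)⁻¹ j m * ((1 / 2) * ∑ i, ∑ l, (M y)⁻¹ i l * pd m (fun z => M z i l) y) := by
      have h1 : ∑ i, ∑ l, christoffelOf M j i l y * (M y)⁻¹ i l
          = ∑ m, (M y)⁻¹ j m * ((1 / 2) * ∑ i, ∑ l, (M y)⁻¹ i l * (pd i (fun z => M z l m) y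
            + pd l (fun z => M z i m) y - pd m (fun z => M z i l) y)) := by
        simp only [christoffelOf, mul_sum, sum_mul]
        rw [sum_congr rfl fun i _ => sum_comm, sum_comm]
        exact sum_congr rfl fun m _ => sum_congr rfl fun i _ => sum_congr rfl fun l _ => by ring
      rw [h1, ← sum_sub_distrib]
      refine sum_congr rfl fun m _ => ?_
      have h2 : ∑ i, ∑ l, (M y)⁻¹ i l * pd l (fun z => M z i m) y
          = ∑ i, ∑ l, (M y)⁻¹ i l * pd i (fun z => M z l m) y := by
        rw [sum_comm]
        exact sum_congr rfl fun i _ => sum_congr rfl fun l _ => by rw [hsymmG y l i]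
      simp only [mul_add, mul_sub, sum_add_distrib, sum_sub_distrib]
      rw [h2]
      simp only [mul_sum]
      simp only [← mul_sum]
      ring
    have h1 : ∑ k, pd k (fun z => (M z)⁻¹ k j) y
        = - ∑ m, (M y)⁻¹ j m * ∑ i, ∑ l, (M y)⁻¹ i l * pd i (fun z => M z l m) y := by
      simp only [hpG, Finset.sum_neg_distrib, mul_sum]
      rw [sum_congr rfl fun i _ => sum_comm, sum_comm]
      congr 1
      exact sum_congr rfl fun m _ => sum_congr rfl fun i _ => sum_congr rfl fun l _ => by rw [hsymmG y j m]; ring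
    rw [hGG, sum_add_distrib, h1]
    simp only [htr]
    have h2 : ∀ m, (M y)⁻¹ m j = (M y)⁻¹ j m := fun m => hsymmG y m j
    simp only [h2]
    have h3 : ∀ (a b : Fin d → ℝ), ∑ m, a m * b m = ∑ m, b m * a m := fun a b => sum_congr rfl fun m _ => mul_comm _ _
    rw [h3 (fun m => 1 / 2 * ∑ i, ∑ l, (M y)⁻¹ i l * pd m (fun z => M z i l) y)]
    ring

end Det

variable {M : Type*} [TopologicalSpace M] [ChartedSpace (Eu d) M] [IsManifold (𝓡 d) ∞ M]
  {e : OpenPartialHomeomorph M (Eu d)}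

/-! ### Smoothness of components -/

section Components

theorem contMDiffOn_coordVec (he : e ∈ 𝒜[d, M]) (i : Fin d) : ContMDiffOn (𝓡 d) (𝓡 d).tangent ∞
      (fun y => (⟨e.symm y, coordVec e i y⟩ : TangentBundle (𝓡 d) M)) e.target := by
  have h1 : ContMDiffOn (𝓡 d).tangent (𝓡 d).tangent ∞ (tangentMapWithin (𝓡 d) (𝓡 d) e.symm e.target) _ :=
    (contMDiffOn_symm_of_mem_maximalAtlas he).contMDiffOn_tangentMapWithin (m := ∞) (by simp)
      e.open_target.uniqueMDiffOn
  have h2 : ContMDiffOn (𝓡 d) (𝓡 d).tangent ∞ (fun y => (⟨y, stdVec i⟩ : TangentBundle (𝓡 d) (Eu d))) e.target :=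
    contMDiffOn_vectorSpace_iff_contDiffOn.2 contDiffOn_const
  refine (h1.comp h2 fun y hy => hy).congr fun y hy => ?_
  simp only [Function.comp_apply, tangentMapWithin, coordVec]
  rw [mfderivWithin_of_isOpen e.open_target hy]

theorem contDiffOn_component {P : Type*} [NormedAddCommGroup P] [NormedSpace ℝ P]
    (he : e ∈ 𝒜[d, M]) {n : WithTop ℕ∞} (hn : n ≤ ∞) {s : Set P} {b : P → Eu d}
    (hb : MapsTo b s e.target) {v : (p : P) → TangentSpace (𝓡 d) (e.symm (b p))}
    (hv : ContMDiffOn 𝓘(ℝ, P) (𝓡 d).tangent n (fun p => (⟨e.symm (b p), v p⟩ : TangentBundle (𝓡 d) M)) s) (k : Fin d) :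
    ContDiffOn ℝ n (fun p => component e k (b p) (v p)) s := by
  have h1 : ContMDiffOn (𝓡 d).tangent (𝓡 d).tangent n (tangentMapWithin (𝓡 d) (𝓡 d) e e.source) _ :=
    ((contMDiffOn_of_mem_maximalAtlas he).contMDiffOn_tangentMapWithin (m := ∞) (by simp)
      e.open_source.uniqueMDiffOn).of_le hn
  have h2 := h1.comp hv fun p hp => e.map_target (hb hp)
  have h3 : ContMDiff (𝓡 d).tangent 𝓘(ℝ, Eu d) n (fun p : TangentBundle (𝓡 d) (Eu d) => p.2) :=
    contMDiff_snd_tangentBundle_modelSpace (Eu d) (𝓡 d)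
  have h4 := h3.comp_contMDiffOn h2
  have h5 : ContDiffOn ℝ n (fun p => (EuclideanSpace.proj k : Eu d →L[ℝ] ℝ)
      ((tangentMapWithin (𝓡 d) (𝓡 d) e e.source ⟨e.symm (b p), v p⟩).2)) s :=
    (EuclideanSpace.proj k : Eu d →L[ℝ] ℝ).contDiff.comp_contDiffOn (contMDiffOn_iff_contDiffOn.1 h4)
  refine h5.congr fun p hp => ?_
  simp only [component, tangentMapWithin]
  rw [mfderivWithin_of_isOpen e.open_source (e.map_target (hb hp))]

theorem contMDiffOn_symm_prod (he : e ∈ 𝒜[d, M]) {n : WithTop ℕ∞} (hn : n ≤ ∞) :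
    ContMDiffOn 𝓘(ℝ, Y[d]) ((𝓡 d).prod 𝓘(ℝ, ℝ)) n (fun p : Y[d] => (e.symm p.1, p.2)) (e.target ×ˢ univ) := by
  refine ContMDiffOn.prodMk ?_ contDiff_snd.contMDiff.contMDiffOn
  exact ((contMDiffOn_symm_of_mem_maximalAtlas he).of_le hn).comp contDiff_fst.contMDiff.contMDiffOn fun _ hp => hp.1

theorem contDiffOn_vecComp_prod (he : e ∈ 𝒜[d, M]) {n : WithTop ℕ∞} (hn : n ≤ ∞) {f : VecFam d M}
    (hf : ContMDiff ((𝓡 d).prod 𝓘(ℝ, ℝ)) (𝓡 d).tangent n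
      (fun p : M × ℝ => (⟨p.1, f p.1 p.2⟩ : TangentBundle (𝓡 d) M))) (k : Fin d) :
    ContDiffOn ℝ n (fun p : Y[d] => vecComp e (fun x => f x p.2) k p.1) (e.target ×ˢ univ) :=
  contDiffOn_component he hn (b := Prod.fst) (fun _ hp => hp.1) (hf.comp_contMDiffOn (contMDiffOn_symm_prod he hn)) k

theorem contDiffOn_tensComp (he : e ∈ 𝒜[d, M]) {T : TensorField d M}
    (hT : ContMDiff (𝓡 d) ((𝓡 d).prod 𝓘(ℝ, Eu d →L[ℝ] Eu d)) ∞ (fun x : M => (Bundle.TotalSpace.mk' (Eu d →L[ℝ] Eu d)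
        (E := fun x : M => TangentSpace (𝓡 d) x →L[ℝ] TangentSpace (𝓡 d) x) x (T x))))
    (k i : Fin d) : ContDiffOn ℝ ∞ (tensComp e T k i) e.target :=
  contDiffOn_component he le_rfl (mapsTo_id _)
    ((hT.comp_contMDiffOn (contMDiffOn_symm_of_mem_maximalAtlas he)).clm_bundle_apply (contMDiffOn_coordVec he i)) k

theorem contDiffOn_tensComp_prod (he : e ∈ 𝒜[d, M]) {n : WithTop ℕ∞} (hn : n ≤ ∞) {T : EndFam d M}
    (hT : ContMDiff ((𝓡 d).prod 𝓘(ℝ, ℝ)) ((𝓡 d).prod 𝓘(ℝ, Eu d →L[ℝ] Eu d)) n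
      (fun p : M × ℝ => (Bundle.TotalSpace.mk' (Eu d →L[ℝ] Eu d)
        (E := fun x : M => TangentSpace (𝓡 d) x →L[ℝ] TangentSpace (𝓡 d) x) p.1 (T p.1 p.2))))
    (k i : Fin d) :
    ContDiffOn ℝ n (fun p : Y[d] => tensComp e (fun x => T x p.2) k i p.1) (e.target ×ˢ univ) := by
  have h1 : ContMDiffOn 𝓘(ℝ, Y[d]) (𝓡 d) n (fun p : Y[d] => p.1) (e.target ×ˢ univ) :=
    contDiff_fst.contMDiff.contMDiffOn
  exact contDiffOn_component he hn (b := Prod.fst) (fun p hp => hp.1)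
    ((hT.comp_contMDiffOn (contMDiffOn_symm_prod he hn)).clm_bundle_apply
      (((contMDiffOn_coordVec he i).of_le hn).comp h1 fun p hp => hp.1)) k

variable (g : Metric d M)

theorem contDiffOn_gram (he : e ∈ 𝒜[d, M]) (i j : Fin d) : ContDiffOn ℝ ∞ (fun y => gram g e y i j) e.target := by
  have h : ContMDiffOn (𝓡 d) ((𝓡 d).prod 𝓘(ℝ, ℝ)) ∞
      (fun y => Bundle.TotalSpace.mk' ℝ (E := Bundle.Trivial M ℝ) (e.symm y)
        (g.inner (e.symm y) (coordVec e i y) (coordVec e j y))) e.target := by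
    apply ContMDiffOn.clm_bundle_apply₂ (F₁ := Eu d) (F₂ := Eu d)
    · exact g.contMDiff.comp_contMDiffOn (contMDiffOn_symm_of_mem_maximalAtlas he)
    · exact contMDiffOn_coordVec he i
    · exact contMDiffOn_coordVec he j
  refine contMDiffOn_iff_contDiffOn.1 fun y hy => ?_
  have h2 := h y hy
  rw [Bundle.contMDiffWithinAt_totalSpace] at h2
  exact h2.2

theorem gram_symm (e : OpenPartialHomeomorph M (Eu d)) (y : Eu d) (i j : Fin d) :
    gram g e y i j = gram g e y j i := g.symm _ _ _

theorem mfderiv_comp_mfderiv_symm (he : e ∈ 𝒜[d, M]) (hy : y ∈ e.target) (v : Eu d) : (mfderiv (𝓡 d) (𝓡 d) e (e.symm y))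
      (mfderiv (𝓡 d) (𝓡 d) e.symm y v) = v := by
  have h1 : MDifferentiableAt (𝓡 d) (𝓡 d) e (e.symm y) :=
    (contMDiffAt_of_mem_maximalAtlas he (e.map_target hy)).mdifferentiableAt (by simp)
  have h2 : MDifferentiableAt (𝓡 d) (𝓡 d) e.symm y :=
    (contMDiffAt_symm_of_mem_maximalAtlas he hy).mdifferentiableAt (by simp)
  have h3 := mfderiv_comp_apply y h1 h2 v
  rw [← h3]
  have h4 : (e ∘ e.symm) =ᶠ[𝓝 y] id := by
    filter_upwards [e.open_target.mem_nhds hy] with z hz using e.right_inv hz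
  rw [h4.mfderiv_eq, mfderiv_id]
  rfl

theorem mfderiv_symm_comp_mfderiv (he : e ∈ 𝒜[d, M])
    (hy : y ∈ e.target) (v : TangentSpace (𝓡 d) (e.symm y)) : (mfderiv (𝓡 d) (𝓡 d) e.symm y)
      (mfderiv (𝓡 d) (𝓡 d) e (e.symm y) v) = v := by
  let T : Eu d →ₗ[ℝ] Eu d := (mfderiv (𝓡 d) (𝓡 d) e.symm y : Eu d →L[ℝ] Eu d).toLinearMap
  have hinj : Function.Injective T := by
    intro a b hab
    have h := congrArg (fun u : Eu d => (mfderiv (𝓡 d) (𝓡 d) e (e.symm y) u : Eu d)) hab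
    exact (mfderiv_comp_mfderiv_symm he hy a).symm.trans (h.trans (mfderiv_comp_mfderiv_symm he hy b))
  obtain ⟨a, rfl⟩ := LinearMap.injective_iff_surjective.1 hinj v
  exact congrArg (fun u : Eu d => (mfderiv (𝓡 d) (𝓡 d) e.symm y u : Eu d)) (mfderiv_comp_mfderiv_symm he hy a)

/-- Expansion of a tangent vector in the coordinate basis. -/
theorem sum_component_smul_coordVec (he : e ∈ 𝒜[d, M]) (hy : y ∈ e.target) (v : TangentSpace (𝓡 d) (e.symm y)) :
    ∑ k, component e k y v • coordVec e k y = v := by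
  conv_rhs => rw [← mfderiv_symm_comp_mfderiv he hy v]
  let u : Eu d := mfderiv (𝓡 d) (𝓡 d) e (e.symm y) v
  let T : Eu d →L[ℝ] Eu d := mfderiv (𝓡 d) (𝓡 d) e.symm y
  have h2 : T u = ∑ k, u k • T (stdVec k) := by
    conv_lhs => rw [sum_stdVec u, map_sum]
    exact sum_congr rfl fun k _ => T.map_smul _ _
  exact h2.symm

theorem gram_posDef (he : e ∈ 𝒜[d, M]) (hy : y ∈ e.target) : (gram g e y).PosDef := by
  refine Matrix.PosDef.of_dotProduct_mulVec_pos ?_ fun v hv => ?_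
  · ext i j
    exact gram_symm g e y j i
  · have hne : (∑ i, v i • coordVec e i y) ≠ 0 := by
      intro h0
      apply hv
      have h1 := congrArg (mfderiv (𝓡 d) (𝓡 d) e (e.symm y)) h0
      rw [map_sum, map_zero] at h1
      have h2 : ∑ i, v i • (stdVec i : Eu d) = 0 := by
        refine Eq.trans (sum_congr rfl fun i _ => ?_) h1
        rw [ContinuousLinearMap.map_smul, coordVec, mfderiv_comp_mfderiv_symm he hy]
        rfl
      ext k
      have h3 := congrArg (fun u : Eu d => u k) h2
      simpa [stdVec, Pi.single_apply] using h3
    refine lt_of_lt_of_eq (g.pos _ _ hne) ?_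
    simp only [map_sum, map_smul, sum_apply, smul_apply, dotProduct,
      Matrix.mulVec, star_trivial, mul_sum, smul_eq_mul, gram, Matrix.of_apply]
    refine sum_congr rfl fun i _ => sum_congr rfl fun j _ => ?_
    rw [g.symm (e.symm y) (coordVec e i y)]
    ring

theorem chartGeometry (he : e ∈ 𝒜[d, M]) : ChartGeometry e.target (gramInv g e) (christoffel g e) (sqrtDet g e) :=
  ChartGeometry.of_gram e.open_target (contDiffOn_gram g he) (fun _ hy => (gram_posDef g he hy).det_pos) (gram_symm g e)

/-- The components of the diffusion matrix in terms of its square root. -/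
theorem hasDerivAt_tensComp (he : e ∈ 𝒜[d, M]) (hy : y ∈ e.target) {A σ : EndFam d M}
    (hA : ∀ (x : M) (ξ : ℝ) (v w : TangentSpace (𝓡 d) x),
      HasDerivAt (fun s : ℝ => g.inner x (A x s v) w) (g.inner x (σ x ξ v) (σ x ξ w)) ξ)
    (k i : Fin d) (ξ : ℝ) :
    HasDerivAt (fun s => tensComp e (fun x => A x s) k i y)
      (∑ l, gramInv g e k l y * ∑ a, ∑ b, tensComp e (fun x => σ x ξ) a i y
        * tensComp e (fun x => σ x ξ) b l y * gram g e y a b) ξ := by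
  have h1 : ∀ v : TangentSpace (𝓡 d) (e.symm y), component e k y v
      = ∑ l, gramInv g e k l y * g.inner (e.symm y) v (coordVec e l y) := by
    intro v
    have h2 : ∀ l, g.inner (e.symm y) v (coordVec e l y) = ∑ m, component e m y v * gram g e y m l := by
      intro l
      conv_lhs => rw [← sum_component_smul_coordVec he hy v]
      simp only [map_sum, map_smul, sum_apply, smul_apply, smul_eq_mul, gram, Matrix.of_apply]
    have h3 : ∀ m, ∑ l, gramInv g e k l y * gram g e y l m = (1 : Matrix (Fin d) (Fin d) ℝ) k m := fun m => by
      rw [← Matrix.nonsing_inv_mul (gram g e y) (gram_posDef g he hy).det_pos.ne'.isUnit, Matrix.mul_apply]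
      rfl
    simp only [h2, mul_sum]
    rw [sum_comm]
    have h4 : ∀ m, ∑ l, gramInv g e k l y * (component e m y v * gram g e y m l)
        = component e m y v * (1 : Matrix (Fin d) (Fin d) ℝ) k m := fun m => by
      rw [← h3, mul_sum]
      refine sum_congr rfl fun l _ => ?_
      rw [gram_symm g e y m l]
      ring
    simp only [h4, Matrix.one_apply]
    simp
  have h5 : ∀ v w : TangentSpace (𝓡 d) (e.symm y), g.inner (e.symm y) v w
      = ∑ a, ∑ b, component e a y v * component e b y w * gram g e y a b := by
    intro v w
    conv_lhs => rw [← sum_component_smul_coordVec he hy v, ← sum_component_smul_coordVec he hy w]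
    simp only [map_sum, map_smul, sum_apply, smul_apply, smul_eq_mul, gram, Matrix.of_apply, mul_sum]
    rw [sum_comm]
    exact sum_congr rfl fun a _ => sum_congr rfl fun b _ => by ring
  have h6 : (fun s => tensComp e (fun x => A x s) k i y)
      = fun s => ∑ l, gramInv g e k l y * g.inner (e.symm y) (A (e.symm y) s (coordVec e i y))
        (coordVec e l y) := funext fun s => h1 _
  rw [h6]
  refine (HasDerivAt.fun_sum fun l _ => (hA (e.symm y) ξ (coordVec e i y) (coordVec e l y)).const_mul
    (gramInv g e k l y)).congr_deriv ?_
  exact sum_congr rfl fun l _ => by rw [h5]; rfl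

end Components

/-! ### The coefficients of the localized equation -/

section ParametricIntegrals

theorem continuous_mul_of_tsupport (hU : IsOpen U) {E : Type*} [TopologicalSpace E] {a : Eu d × E → ℝ}
    (ha : ContinuousOn a (U ×ˢ univ)) {b : Eu d → ℝ} (hb : Continuous b) (hbU : tsupport b ⊆ U) :
    Continuous (fun p : Eu d × E => a p * b p.1) := by
  rw [continuous_iff_continuousAt]
  intro p
  by_cases hp : p.1 ∈ U
  · exact (ha.continuousAt ((hU.prod isOpen_univ).mem_nhds ⟨hp, mem_univ _⟩)).mul (hb.comp continuous_fst).continuousAt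
  · have h1 : ∀ᶠ q in 𝓝 p, b q.1 = 0 := by
      have h2 := notMem_tsupport_iff_eventuallyEq.1 fun h => hp (hbU h)
      exact (continuous_fst.tendsto p).eventually h2
    refine continuousAt_const.congr_of_eventuallyEq (f := fun _ => 0) ?_
    filter_upwards [h1] with q hq
    rw [hq, mul_zero]

theorem continuous_mul_of_tsupport' (hU : IsOpen U) {a : Eu d → ℝ}
    (ha : ContinuousOn a U) {b : Eu d → ℝ} (hb : Continuous b) (hbU : tsupport b ⊆ U) :
    Continuous (fun y => a y * b y) := by
  rw [continuous_iff_continuousAt]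
  intro p
  by_cases hp : p ∈ U
  · exact (ha.continuousAt (hU.mem_nhds hp)).mul hb.continuousAt
  · refine continuousAt_const.congr_of_eventuallyEq (f := fun _ => 0) ?_
    filter_upwards [notMem_tsupport_iff_eventuallyEq.1 fun h => hp (hbU h)] with q hq
    rw [hq]
    simp

theorem integrable_mul_of_tsupport (hU : IsOpen U) {a : Eu d → ℝ}
    (ha : ContinuousOn a U) {b : Eu d → ℝ} (hb : Continuous b) (hbU : tsupport b ⊆ U)
    (hbc : HasCompactSupport b) : Integrable (fun y => a y * b y) :=
  (continuous_mul_of_tsupport' hU ha hb hbU).integrable_of_hasCompactSupport hbc.mul_left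

/-- Differentiation under the integral sign against a weight with compact support. -/
theorem hasDerivAt_integral_mul (hU : IsOpen U) {a a' : Eu d → ℝ → ℝ}
    (ha : ∀ ξ, ContinuousOn (fun y => a y ξ) U) (hd : ∀ y ∈ U, ∀ ξ, HasDerivAt (a y) (a' y ξ) ξ)
    (ha' : ContinuousOn (fun p : Y[d] => a' p.1 p.2) (U ×ˢ univ)) {b : Eu d → ℝ}
    (hb : Continuous b) (hbc : HasCompactSupport b) (hbU : tsupport b ⊆ U) (ξ0 : ℝ) :
    HasDerivAt (fun ξ => ∫ y, a y ξ * b y) (∫ y, a' y ξ0 * b y) ξ0 := by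
  have hc := continuous_mul_of_tsupport hU ha' hb hbU
  obtain ⟨S, hS⟩ := (hbc.isCompact.prod (isCompact_Icc (a := ξ0 - 1) (b := ξ0 + 1))
    ).exists_bound_of_continuousOn hc.continuousOn
  refine (hasDerivAt_integral_of_dominated_loc_of_deriv_le (s := Icc (ξ0 - 1) (ξ0 + 1))
    (bound := (tsupport b).indicator fun _ => S)
    (F' := fun ξ y => a' y ξ * b y) (Icc_mem_nhds (by linarith) (by linarith)) ?_ ?_ ?_ ?_ ?_ ?_).2
  · exact Eventually.of_forall fun ξ => (integrable_mul_of_tsupport hU (ha ξ) hb hbU hbc).aestronglyMeasurable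
  · exact integrable_mul_of_tsupport hU (ha ξ0) hb hbU hbc
  · exact (hc.comp (continuous_id.prodMk continuous_const)).aestronglyMeasurable
  · refine ae_of_all _ fun y ξ hξ => ?_
    by_cases hy : y ∈ tsupport b
    · rw [indicator_of_mem hy]
      exact hS (y, ξ) ⟨hy, hξ⟩
    · rw [indicator_of_notMem hy, eq_zero_off_tsupport hy]
      simp
  · rw [integrable_indicator_iff (isClosed_tsupport b).measurableSet]
    exact integrableOn_const hbc.isCompact.measure_lt_top.ne
  · refine ae_of_all _ fun y ξ _ => ?_
    by_cases hy : y ∈ tsupport b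
    · exact (hd y (hbU hy) ξ).mul_const _
    · rw [eq_zero_off_tsupport hy]
      simpa using hasDerivAt_const ξ 0

theorem contDiffOn_pd_fst {P : Type*} [NormedAddCommGroup P] [NormedSpace ℝ P] (hU : IsOpen U)
    {n m : WithTop ℕ∞} {a : Eu d → P → ℝ}
    (ha : ContDiffOn ℝ n (fun p : Eu d × P => a p.1 p.2) (U ×ˢ univ)) (hmn : m + 1 ≤ n) (k : Fin d) :
    ContDiffOn ℝ m (fun p : Eu d × P => pd k (fun z => a z p.2) p.1) (U ×ˢ univ) := by
  have hO := hU.prod (isOpen_univ (X := P))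
  refine ((ha.fderiv_of_isOpen hO hmn).clm_apply
    (contDiffOn_const (c := ((stdVec k : Eu d), (0 : P))))).congr fun p hp => ?_
  have h1 : HasFDerivAt (fun p : Eu d × P => a p.1 p.2) (fderiv ℝ (fun p : Eu d × P => a p.1 p.2) p) p :=
    ((ha.contDiffAt (hO.mem_nhds hp)).differentiableAt (by intro h0; simp [h0] at hmn)).hasFDerivAt
  have h2 : HasFDerivAt (fun z => a z p.2) _ p.1 :=
    HasFDerivAt.comp (𝕜 := ℝ) (g := fun p : Eu d × P => a p.1 p.2) p.1 h1 (hasFDerivAt_prodMk_left p.1 p.2)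
  rw [pd, h2.fderiv]
  simp

theorem contDiffOn_slice {n : WithTop ℕ∞} {a : Eu d → ℝ → ℝ}
    (ha : ContDiffOn ℝ n (fun p : Y[d] => a p.1 p.2) (U ×ˢ univ)) (ξ : ℝ) :
    ContDiffOn ℝ n (fun y => a y ξ) U :=
  ContDiffOn.comp (g := fun p : Y[d] => a p.1 p.2) (f := fun y => (y, ξ)) ha (by fun_prop) fun y hy => ⟨hy, mem_univ _⟩

end ParametricIntegrals

/-- The flux, the diffusion matrix and its derivative, in a chart with domain `U`. -/
structure ChartCoefficients (U : Set (Eu d)) (G : Mat[d]) (Γ : Fin d → Mat[d]) (f : VecX[d])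
    (A D : MatX[d]) : Prop where
  flux : ∀ k, ContDiffOn ℝ 1 (fun p : Y[d] => f k p.1 p.2) (U ×ˢ univ)
  diff : ∀ k i ξ, ContDiffOn ℝ 2 (fun y => A k i y ξ) U
  hasDerivAt : ∀ k i, ∀ y ∈ U, ∀ ξ, HasDerivAt (A k i y) (D k i y ξ) ξ
  diff_deriv : ∀ k i, ContDiffOn ℝ 2 (fun p : Y[d] => D k i p.1 p.2) (U ×ˢ univ)
  compat : ∀ ξ, ∀ y ∈ U, divVecOf Γ (fun k y => f k y ξ) y = divFormOf G Γ (divTensorOf Γ (fun k i y => A k i y ξ)) y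

namespace ChartCoefficients

variable (hg : ChartGeometry U G Γ w) (hc : ChartCoefficients U G Γ f A D)

include hg hc

omit hg in
theorem hasDerivAt_flux (hU : IsOpen U) (k : Fin d) (hy : y ∈ U) (ξ : ℝ) : HasDerivAt (f k y) (deriv (f k y) ξ) ξ ∧
      deriv (f k y) ξ = fderiv ℝ (fun p : Y[d] => f k p.1 p.2) (y, ξ) (0, 1) := by
  have hO := hU.prod (isOpen_univ (X := ℝ))
  have h1 := (((hc.flux k).contDiffAt (hO.mem_nhds (x := (y, ξ)) ⟨hy, mem_univ _⟩)).differentiableAt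
    (by simp)).hasFDerivAt
  have h2 : HasFDerivAt (f k y) _ ξ :=
    HasFDerivAt.comp (𝕜 := ℝ) (g := fun p : Y[d] => f k p.1 p.2) ξ h1 (hasFDerivAt_prodMk_right y ξ)
  have h3 := h2.hasDerivAt
  exact ⟨h3.differentiableAt.hasDerivAt, by rw [h3.deriv]; simp⟩

omit hg in
theorem continuousOn_deriv_flux (hU : IsOpen U) (k : Fin d) :
    ContinuousOn (fun p : Y[d] => deriv (f k p.1) p.2) (U ×ˢ univ) := by
  have hO := hU.prod (isOpen_univ (X := ℝ))
  refine (((hc.flux k).continuousOn_fderiv_of_isOpen hO le_rfl).clm_apply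
    (continuousOn_const (c := ((0 : Eu d), 1)))).congr fun p hp => ?_
  exact (hc.hasDerivAt_flux hU k hp.1 p.2).2

omit hc in
theorem continuous_hessOf_mul (hψ : ContDiff ℝ 2 ψ) (hψU : tsupport ψ ⊆ U) (i k : Fin d) :
    Continuous (hessOf G Γ ψ i k) ∧ tsupport (hessOf G Γ ψ i k) ⊆ tsupport ψ := by
  have hgs := fun i => ChartGeometry.tsupport_gradOf (G := G) ψ i
  have hz : ∀ y ∉ tsupport ψ, hessOf G Γ ψ i k y = 0 := by
    intro y hy
    have b1 : ∀ i, gradOf G ψ i y = 0 := fun i => eq_zero_off_tsupport fun h => hy (hgs i h)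
    have b2 : ∀ i k, pd k (gradOf G ψ i) y = 0 := fun i k => pd_eq_zero_of_notMem k fun h => hy (hgs i h)
    simp [hessOf, b1, b2]
  have hs : tsupport (hessOf G Γ ψ i k) ⊆ tsupport ψ := by
    refine closure_minimal (fun y hy => ?_) (isClosed_tsupport _)
    by_contra h
    exact hy (hz y h)
  refine ⟨contDiff_zero.1 (contDiff_of_contDiffOn_of_tsupport hg.isOpen (contDiffOn_zero.2 ?_) (hs.trans hψU)), hs⟩
  have hgr : ∀ i, ContDiffOn ℝ 1 (gradOf G ψ i) U := fun i =>
    hg.contDiffOn_gradOf hψ.contDiffOn (by norm_num) (by simp) i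
  exact ContinuousOn.add (ContDiffOn.pd (m := 0) k hg.isOpen (hgr i) (by norm_num)).continuousOn
    (continuousOn_finsetSum _ fun l _ => (hg.smooth_Γ i k l).continuousOn.mul (hgr l).continuousOn)

omit hg hc in
theorem tsupport_pd (k : Fin d) (ψ : Eu d → ℝ) : tsupport (pd k ψ) ⊆ tsupport ψ := by
  refine closure_minimal (fun y hy => ?_) (isClosed_tsupport _)
  by_contra h
  exact hy (pd_eq_zero_of_notMem k h)

/-- The derivative in `ξ` of the geometry compatibility condition, in weak form. -/
theorem integral_compat (hψ : ContDiff ℝ 2 ψ) (hψc : HasCompactSupport ψ) (hψU : tsupport ψ ⊆ U) (ξ : ℝ) :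
    (∫ y, (∑ k, deriv (f k y) ξ * pd k ψ y) * w y) + ∫ y, (∑ k, ∑ i, D k i y ξ * hessOf G Γ ψ i k y) * w y = 0 := by
  have hp : ∀ k, Continuous (pd k ψ) := fun k => (hψ.continuous_fderiv (by simp)).clm_apply continuous_const
  have hps : ∀ k, tsupport (pd k ψ) ⊆ U := fun k => (tsupport_pd k ψ).trans hψU
  have hpw : ∀ k, Continuous (fun y => w y * pd k ψ y) := fun k =>
    continuous_mul_of_tsupport' hg.isOpen hg.smooth_w.continuousOn (hp k) (hps k)
  have hhw : ∀ i k, Continuous (fun y => w y * hessOf G Γ ψ i k y) := fun i k =>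
    continuous_mul_of_tsupport' hg.isOpen hg.smooth_w.continuousOn
      (continuous_hessOf_mul hg hψ hψU i k).1 ((continuous_hessOf_mul hg hψ hψU i k).2.trans hψU)
  have hsr : ∀ b : Eu d → ℝ, tsupport (fun y => w y * b y) ⊆ tsupport b := fun b =>
    closure_mono (support_mul_subset_right _ _)
  have hcs : ∀ b : Eu d → ℝ, tsupport b ⊆ tsupport ψ → HasCompactSupport (fun y => w y * b y) := fun b hb =>
    hψc.of_isClosed_subset (isClosed_tsupport _) ((hsr b).trans hb)
  have h1 : ∀ (a : Fin d → Eu d → ℝ), (∀ k, ContinuousOn (a k) U) →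
      ∫ y, (∑ k, a k y * pd k ψ y) * w y = ∑ k, ∫ y, a k y * (w y * pd k ψ y) := by
    intro a ha
    rw [← integral_finsetSum _ fun k _ => integrable_mul_of_tsupport hg.isOpen (ha k) (hpw k)
      ((hsr _).trans (hps k)) (hcs _ (tsupport_pd k ψ))]
    refine integral_congr_fun fun y => ?_
    simp only [sum_mul]
    exact sum_congr rfl fun k _ => by ring
  have h2 : ∀ (a : Mat[d]), (∀ k i, ContinuousOn (a k i) U) → ∫ y, (∑ k, ∑ i, a k i y * hessOf G Γ ψ i k y) * w y
        = ∑ k, ∑ i, ∫ y, a k i y * (w y * hessOf G Γ ψ i k y) := by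
    intro a ha
    have hi : ∀ k i, Integrable fun y => a k i y * (w y * hessOf G Γ ψ i k y) := fun k i =>
      integrable_mul_of_tsupport hg.isOpen (ha k i) (hhw i k)
      ((hsr _).trans ((continuous_hessOf_mul hg hψ hψU i k).2.trans hψU))
      (hcs _ (continuous_hessOf_mul hg hψ hψU i k).2)
    simp only [← integral_finsetSum Finset.univ fun i _ => hi _ i]
    rw [← integral_finsetSum _ fun k _ => integrable_finsetSum _ fun i _ => hi k i]
    refine integral_congr_fun fun y => ?_
    simp only [sum_mul]
    exact sum_congr rfl fun k _ => sum_congr rfl fun i _ => by ring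
  have hf : ∀ k ξ, ContDiffOn ℝ 1 (fun y => f k y ξ) U := fun k ξ => contDiffOn_slice (hc.flux k) ξ
  have h3 : ∀ ξ, (∑ k, ∫ y, f k y ξ * (w y * pd k ψ y))
      + ∑ k, ∑ i, ∫ y, A k i y ξ * (w y * hessOf G Γ ψ i k y) = 0 := by
    intro ξ
    rw [← h1 (fun k y => f k y ξ) fun k => (hf k ξ).continuousOn,
      ← h2 (fun k i y => A k i y ξ) fun k i => (hc.diff k i ξ).continuousOn,
      hg.integral_hessOf_mul (fun k i => hc.diff k i ξ) hψ hψc hψU]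
    have h4 := hg.integral_divVecOf_mul (fun k => hf k ξ) (hψ.of_le one_le_two) hψc hψU
    rw [← neg_eq_iff_eq_neg.2 h4, neg_add_eq_zero]
    refine integral_congr_fun fun y => ?_
    by_cases hy : y ∈ U
    · simp only [hc.compat ξ y hy]
    · simp only [eq_zero_off_tsupport fun h => hy (hψU h)]
      simp
  have h5 : HasDerivAt (fun ξ => (∑ k, ∫ y, f k y ξ * (w y * pd k ψ y))
      + ∑ k, ∑ i, ∫ y, A k i y ξ * (w y * hessOf G Γ ψ i k y))
      ((∑ k, ∫ y, deriv (f k y) ξ * (w y * pd k ψ y))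
      + ∑ k, ∑ i, ∫ y, D k i y ξ * (w y * hessOf G Γ ψ i k y)) ξ := by
    refine HasDerivAt.add (HasDerivAt.fun_sum fun k _ => ?_)
      (HasDerivAt.fun_sum fun k _ => HasDerivAt.fun_sum fun i _ => ?_)
    · exact hasDerivAt_integral_mul hg.isOpen (fun ξ => (hf k ξ).continuousOn)
        (fun y hy ξ => (hc.hasDerivAt_flux hg.isOpen k hy ξ).1) (hc.continuousOn_deriv_flux hg.isOpen k)
        (hpw k) (hcs _ (tsupport_pd k ψ)) ((hsr _).trans (hps k)) ξ
    · exact hasDerivAt_integral_mul hg.isOpen (fun ξ => (hc.diff k i ξ).continuousOn)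
        (fun y hy ξ => hc.hasDerivAt k i y hy ξ) (hc.diff_deriv k i).continuousOn
        (hhw i k) (hcs _ (continuous_hessOf_mul hg hψ hψU i k).2)
        ((hsr _).trans ((continuous_hessOf_mul hg hψ hψU i k).2.trans hψU)) ξ
  have h6 := h5.unique ((funext h3 : (fun ξ => (∑ k, ∫ y, f k y ξ * (w y * pd k ψ y))
      + ∑ k, ∑ i, ∫ y, A k i y ξ * (w y * hessOf G Γ ψ i k y)) = fun _ => 0) ▸ hasDerivAt_const ξ 0)
  rw [h1 (fun k y => deriv (f k y) ξ) fun k => ?_, h2 (fun k i y => D k i y ξ) fun k i => ?_, h6]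
  · exact (contDiffOn_slice (hc.diff_deriv k i) ξ).continuousOn
  · exact ContinuousOn.comp (g := fun p : Y[d] => deriv (f k p.1) p.2) (f := fun y => (y, ξ))
      (hc.continuousOn_deriv_flux hg.isOpen k) (by fun_prop) fun y hy => ⟨hy, mem_univ _⟩

end ChartCoefficients

theorem two_le_infty : (2 : WithTop ℕ∞) ≤ ∞ := WithTop.coe_le_coe.2 (le_top : (2 : ℕ∞) ≤ ⊤)

theorem one_add_one_le_infty : (1 : WithTop ℕ∞) + 1 ≤ ∞ := by
  rw [one_add_one_eq_two]
  exact two_le_infty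

/-- The cut-off flux. -/
def locFlux (f : VecX[d]) (φ : Eu d → ℝ) (y : Eu d) (ξ : ℝ) : Eu d := WithLp.toLp 2 fun k => φ y * f k y ξ

/-- The first order part of the commutator of the diffusion with a cutoff. -/
def locDrift (G : Mat[d]) (D : MatX[d]) (φ : Eu d → ℝ) (y : Eu d) (ξ : ℝ) : Eu d :=
  WithLp.toLp 2 fun j => (∑ k, ∑ i, D k i y ξ * (pd k φ y * G i j y)) + ∑ i, D j i y ξ * gradOf G φ i y

/-- The transport field of the localized equation. -/
def locField (G : Mat[d]) (f : VecX[d]) (D : MatX[d]) (φ : Eu d → ℝ) (y : Eu d) (ξ : ℝ) : Eu d :=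
  deriv (locFlux f φ y) ξ + locDrift G D φ y ξ

/-- The zeroth order coefficient of the localized equation. -/
def locPot (G : Mat[d]) (Γ : Fin d → Mat[d]) (w : Eu d → ℝ) (f : VecX[d]) (D : MatX[d]) (φ : Eu d → ℝ)
    (y : Eu d) (ξ : ℝ) : ℝ :=
  -(w y * ∑ k, deriv (f k y) ξ * pd k (fun z => φ z / w z) y)
    + (∑ j, locDrift G D φ y ξ j * (pd j w y / w y)) - ∑ k, ∑ i, D k i y ξ * hessOf G Γ φ i k y

theorem contDiff_of_contDiffOn_of_support (hU : IsOpen U) (hK : IsClosed K)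
    (hKU : K ⊆ U) {F : Type*} [NormedAddCommGroup F] [NormedSpace ℝ F] {a : Eu d → ℝ → F}
    {n : WithTop ℕ∞} (ha : ContDiffOn ℝ n (fun p : Y[d] => a p.1 p.2) (U ×ˢ univ))
    (h0 : ∀ y ∉ K, ∀ ξ, a y ξ = 0) : ContDiff ℝ n (uncurry a) := by
  refine contDiff_of_contDiffOn_of_tsupport (hU.prod isOpen_univ) ha ?_
  have h1 : tsupport (uncurry a) ⊆ K ×ˢ univ := by
    refine closure_minimal (fun p hp => ?_) (hK.prod isClosed_univ)
    by_contra h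
    exact hp (h0 p.1 (fun hc => h ⟨hc, mem_univ _⟩) p.2)
  exact h1.trans (prod_mono hKU Subset.rfl)

namespace ChartCoefficients

variable (hg : ChartGeometry U G Γ w) (hc : ChartCoefficients U G Γ f A D) (hφ : ContDiff ℝ ∞ φ) (hφU : tsupport φ ⊆ U)

include hg hc hφ hφU

omit hc in
theorem contDiff_div_density (hψ : ContDiff ℝ ∞ ψ) :
    ContDiff ℝ ∞ (fun z => φ z / w z * ψ z) ∧ tsupport (fun z => φ z / w z * ψ z) ⊆ tsupport φ := by
  have hs : tsupport (fun z => φ z / w z * ψ z) ⊆ tsupport φ := closure_mono fun z hz => by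
    contrapose! hz
    simp [notMem_support.1 hz]
  exact ⟨contDiff_of_contDiffOn_of_tsupport hg.isOpen ((hφ.contDiffOn.div hg.smooth_w fun y hy =>
    (hg.pos y hy).ne').mul hψ.contDiffOn) (hs.trans hφU), hs⟩

omit hc in
theorem contDiff_div_density' : ContDiff ℝ ∞ (fun z => φ z / w z) ∧ tsupport (fun z => φ z / w z) ⊆ tsupport φ := by
  simpa using contDiff_div_density hg hφ hφU (contDiff_const (c := 1))

omit hg hφ hφU hc in
theorem locFlux_eq_zero (hy : y ∉ tsupport φ) (ξ : ℝ) : locFlux f φ y ξ = 0 := by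
  ext k
  simp [locFlux, eq_zero_off_tsupport hy]

omit hg hφ hφU hc in
theorem locDrift_eq_zero (hy : y ∉ tsupport φ) (ξ : ℝ) : locDrift G D φ y ξ = 0 := by
  have h1 : ∀ k, pd k φ y = 0 := fun k => pd_eq_zero_of_notMem k hy
  ext k
  simp [locDrift, gradOf, h1]

omit hg in
theorem contDiff_locFlux (hU : IsOpen U) : ContDiff ℝ 1 (uncurry (locFlux f φ)) := by
  refine contDiff_of_contDiffOn_of_support hU (isClosed_tsupport φ) hφU ?_ fun y hy ξ => locFlux_eq_zero hy ξ
  refine contDiffOn_euclidean.2 fun k => ?_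
  exact ((hφ.of_le (by simp)).comp contDiff_fst).contDiffOn.mul (hc.flux k)

omit hg hc hφ hφU in
theorem contDiffOn_fst_lift {n : WithTop ℕ∞} {a : Eu d → ℝ} (ha : ContDiffOn ℝ n a U) :
    ContDiffOn ℝ n (fun p : Y[d] => a p.1) (U ×ˢ univ) :=
  ha.comp contDiffOn_fst fun _ hp => hp.1

theorem contDiff_locDrift : ContDiff ℝ 1 (uncurry (locDrift G D φ)) := by
  refine contDiff_of_contDiffOn_of_support hg.isOpen (isClosed_tsupport φ) hφU ?_ fun y hy ξ => locDrift_eq_zero hy ξ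
  refine contDiffOn_euclidean.2 fun j => ?_
  have h1 : ∀ k i, ContDiffOn ℝ 1 (fun p => D k i p.1 p.2) (U ×ˢ univ) := fun k i =>
    (hc.diff_deriv k i).of_le one_le_two
  refine (ContDiffOn.sum fun k _ => ContDiffOn.sum fun i _ => (h1 k i).mul ?_).add
    (ContDiffOn.sum fun i _ => (h1 j i).mul ?_)
  · exact (contDiffOn_fst_lift (ContDiffOn.pd k hg.isOpen hφ.contDiffOn one_add_one_le_infty)).mul
      (contDiffOn_fst_lift ((hg.smooth_G i j).of_le (by simp)))
  · exact contDiffOn_fst_lift (hg.contDiffOn_gradOf hφ.contDiffOn one_add_one_le_infty (by simp) i)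

omit hg in
theorem deriv_locFlux (hU : IsOpen U) (hy : y ∈ U) (ξ : ℝ) (k : Fin d) :
    deriv (locFlux f φ y) ξ k = φ y * deriv (f k y) ξ := by
  have h1 := (hasDerivAt_snd (contDiff_locFlux hc hφ hφU hU) y ξ).differentiableAt.hasDerivAt
  have h2 : HasDerivAt (fun s => locFlux f φ y s k) (deriv (locFlux f φ y) ξ k) ξ :=
    ((EuclideanSpace.proj k : Eu d →L[ℝ] ℝ).hasFDerivAt).comp_hasDerivAt ξ h1
  exact h2.unique ((hc.hasDerivAt_flux hU k hy ξ).1.const_mul _)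

/-- The localization of the kinetic equation, tested against a smooth function. -/
theorem transport_identity {ρ : Eu d → ℝ} (hρ : ContDiff ℝ ∞ ρ) (hy : y ∈ U) (ξ : ℝ) :
    - ((∑ k, deriv (f k y) ξ * pd k (fun z => φ z * ρ z / w z) y) * w y)
      - (∑ k, ∑ i, D k i y ξ * hessOf G Γ (fun z => φ z * ρ z / w z) i k y) * w y
      + φ y * ((∑ k, ∑ i, D k i y ξ * hessOf G Γ (fun z => ρ z / w z) i k y) * w y)
    = - fderiv ℝ ρ y (locField G f D φ y ξ) + locPot G Γ w f D φ y ξ * ρ y := by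
  have hw0 := (hg.pos y hy).ne'
  have hr : ContDiffOn ℝ 2 (fun z => ρ z / w z) U :=
    (hρ.contDiffOn.div hg.smooth_w fun y hy => (hg.pos y hy).ne').of_le two_le_infty
  have hrd : DifferentiableAt ℝ (fun z => ρ z / w z) y := ContDiffOn.differentiableAt' hg.isOpen hr (by simp) hy
  have hwd : DifferentiableAt ℝ w y := ContDiffOn.differentiableAt' hg.isOpen hg.smooth_w (by simp) hy
  have hρd : DifferentiableAt ℝ ρ y := hρ.differentiable (by simp) y
  have hφd : DifferentiableAt ℝ (fun z => φ z / w z) y := (contDiff_div_density' hg hφ hφU).1.differentiable (by simp) y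
  have e1 : ∀ k, pd k (fun z => φ z * ρ z / w z) y = pd k (fun z => φ z / w z) y * ρ y + φ y / w y * pd k ρ y := by
    intro k
    rw [← pd_mul k hφd hρd]
    exact congrArg (fun h => pd k h y) (funext fun z => by ring)
  have e2 : ∀ k, w y * pd k (fun z => ρ z / w z) y = pd k ρ y - ρ y / w y * pd k w y := by
    intro k
    have h1 : pd k ρ y = pd k (fun z => ρ z / w z * w z) y := by
      refine pd_congr k ?_
      filter_upwards [hg.isOpen.mem_nhds hy] with z hz
      rw [div_mul_cancel₀ _ (hg.pos z hz).ne']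
    rw [h1, pd_mul k hrd hwd]
    ring
  have e3 : ∀ i k, hessOf G Γ (fun z => φ z * ρ z / w z) i k y
      = φ y * hessOf G Γ (fun z => ρ z / w z) i k y + pd k φ y * gradOf G (fun z => ρ z / w z) i y
        + pd k (fun z => ρ z / w z) y * gradOf G φ i y + ρ y / w y * hessOf G Γ φ i k y := by
    intro i k
    rw [← hg.hessOf_mul (hφ.of_le two_le_infty).contDiffOn hr hy i k]
    exact congrArg (fun h => hessOf G Γ h i k y) (funext fun z => by ring)
  have e4 : fderiv ℝ ρ y (locField G f D φ y ξ) = ∑ k, (φ y * deriv (f k y) ξ + locDrift G D φ y ξ k) * pd k ρ y := by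
    conv_lhs => rw [sum_stdVec (locField G f D φ y ξ), map_sum]
    refine sum_congr rfl fun k _ => ?_
    rw [map_smul, smul_eq_mul, locField, PiLp.add_apply, deriv_locFlux hc hφ hφU hg.isOpen hy]
    rfl
  have e5 : (∑ k, ∑ i, D k i y ξ * (pd k φ y * gradOf G (fun z => ρ z / w z) i y
        + pd k (fun z => ρ z / w z) y * gradOf G φ i y)) * w y
      = ∑ j, locDrift G D φ y ξ j * (pd j ρ y - ρ y / w y * pd j w y) := by
    have h1 : ∀ j, locDrift G D φ y ξ j * (pd j ρ y - ρ y / w y * pd j w y)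
        = (∑ k, ∑ i, D k i y ξ * (pd k φ y * G i j y)) * (w y * pd j (fun z => ρ z / w z) y)
          + (∑ i, D j i y ξ * gradOf G φ i y) * (w y * pd j (fun z => ρ z / w z) y) := by
      intro j
      rw [← e2 j, ← add_mul]
      rfl
    simp only [h1, sum_add_distrib, mul_add, add_mul]
    congr 1
    · simp only [gradOf, mul_sum, sum_mul]
      rw [Finset.sum_comm' (t' := Finset.univ) (s' := fun _ => Finset.univ) (by simp)]
      conv_rhs => rw [sum_comm]
      rw [sum_comm]
      refine sum_congr rfl fun k _ => ?_
      conv_rhs => rw [sum_comm]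
      exact sum_congr rfl fun i _ => sum_congr rfl fun j _ => by ring
    · simp only [sum_mul]
      exact sum_congr rfl fun k _ => sum_congr rfl fun i _ => by ring
  have e6 : (∑ k, ∑ i, D k i y ξ * hessOf G Γ (fun z => φ z * ρ z / w z) i k y) * w y
      = φ y * ((∑ k, ∑ i, D k i y ξ * hessOf G Γ (fun z => ρ z / w z) i k y) * w y)
        + (∑ j, locDrift G D φ y ξ j * (pd j ρ y - ρ y / w y * pd j w y))
        + ρ y * ∑ k, ∑ i, D k i y ξ * hessOf G Γ φ i k y := by
    rw [← e5]
    simp only [e3, mul_sum, sum_mul, ← sum_add_distrib]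
    refine sum_congr rfl fun k _ => sum_congr rfl fun i _ => ?_
    field_simp
    ring
  rw [e6, e4, locPot]
  simp only [e1, add_mul, mul_add, mul_sub, sum_add_distrib, sum_sub_distrib]
  have e7 : (∑ k, deriv (f k y) ξ * (φ y / w y * pd k ρ y)) * w y = ∑ k, φ y * deriv (f k y) ξ * pd k ρ y := by
    rw [sum_mul]
    refine sum_congr rfl fun k _ => ?_
    field_simp
  have e8 : (∑ k, deriv (f k y) ξ * (pd k (fun z => φ z / w z) y * ρ y)) * w y
      = w y * (∑ k, deriv (f k y) ξ * pd k (fun z => φ z / w z) y) * ρ y := by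
    rw [sum_mul, mul_sum, sum_mul]
    exact sum_congr rfl fun k _ => by ring
  have e9 : (∑ j, locDrift G D φ y ξ j * (ρ y / w y * pd j w y))
      = (∑ j, locDrift G D φ y ξ j * (pd j w y / w y)) * ρ y := by
    rw [sum_mul]
    exact sum_congr rfl fun k _ => by ring
  rw [e7, e8, e9]
  ring

omit hc in
theorem locPot_eq_zero (hy : y ∉ tsupport φ) (ξ : ℝ) : locPot G Γ w f D φ y ξ = 0 := by
  have h1 : ∀ k, pd k (fun z => φ z / w z) y = 0 := fun k =>
    pd_eq_zero_of_notMem k fun h => hy ((contDiff_div_density' hg hφ hφU).2 h)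
  have h2 : ∀ i k, hessOf G Γ φ i k y = 0 := fun i k => eq_zero_off_tsupport fun h =>
    hy ((continuous_hessOf_mul hg (hφ.of_le two_le_infty) hφU i k).2 h)
  simp [locPot, h1, h2, locDrift_eq_zero hy]

theorem continuous_locPot : Continuous (uncurry (locPot G Γ w f D φ)) := by
  refine contDiff_zero.1 (contDiff_of_contDiffOn_of_support hg.isOpen (isClosed_tsupport φ) hφU
    (contDiffOn_zero.2 ?_) fun y hy ξ => locPot_eq_zero hg hφ hφU hy ξ)
  have hf : MapsTo Prod.fst (U ×ˢ (univ : Set ℝ)) U := fun p hp => hp.1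
  have hwc : ContinuousOn (fun p : Y[d] => w p.1) (U ×ˢ univ) := hg.smooth_w.continuousOn.comp continuousOn_fst hf
  have hwp : ∀ k, ContinuousOn (fun p : Y[d] => pd k w p.1) (U ×ˢ univ) := fun k =>
    (ContDiffOn.pd (m := 0) k hg.isOpen hg.smooth_w (by simp)).continuousOn.comp continuousOn_fst hf
  have hX := (contDiff_locDrift hg hc hφ hφU).continuous
  refine ContinuousOn.sub (ContinuousOn.add (hwc.mul (continuousOn_finsetSum _ fun k _ =>
    (hc.continuousOn_deriv_flux hg.isOpen k).mul ?_)).neg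
    (continuousOn_finsetSum _ fun j _ => ContinuousOn.mul ?_ ((hwp j).div hwc fun p hp => (hg.pos p.1 hp.1).ne')))
    (continuousOn_finsetSum _ fun k _ => continuousOn_finsetSum _ fun i _ => (hc.diff_deriv k i).continuousOn.mul ?_)
  · exact ((((contDiff_div_density' hg hφ hφU).1.continuous_fderiv (by simp)).clm_apply
      continuous_const).comp continuous_fst).continuousOn
  · exact ((EuclideanSpace.proj j : Eu d →L[ℝ] ℝ).continuous.comp hX).continuousOn
  · exact ((continuous_hessOf_mul hg (hφ.of_le two_le_infty) hφU i k).1.comp continuous_fst).continuousOn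

omit hφ hφU in
/-- `Div Div A'` is continuous. -/
theorem continuousOn_divForm_deriv : ContinuousOn (fun p : Y[d] =>
    divFormOf G Γ (divTensorOf Γ (fun k i y => D k i y p.2)) p.1) (U ×ˢ univ) := by
  have h1 : ∀ k i, ContDiffOn ℝ 1 (fun p => D k i p.1 p.2) (U ×ˢ univ) := fun k i =>
    (hc.diff_deriv k i).of_le one_le_two
  have h2 : ∀ i j k, ContDiffOn ℝ 1 (fun p => Γ i j k p.1) (U ×ˢ univ) := fun i j k =>
    contDiffOn_fst_lift ((hg.smooth_Γ i j k).of_le (by simp))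
  have h3 : ∀ i j, ContinuousOn (fun p => G i j p.1) (U ×ˢ univ) := fun i j =>
    (contDiffOn_fst_lift (hg.smooth_G i j)).continuousOn
  have h4 : ∀ i, ContDiffOn ℝ 1 (fun p => divTensorOf Γ (fun k i y => D k i y p.2) i p.1) (U ×ˢ univ) := fun i =>
    ((ContDiffOn.sum fun j _ => contDiffOn_pd_fst (m := 1) hg.isOpen (hc.diff_deriv j i) (by norm_num) j).add
    (ContDiffOn.sum fun j _ => ContDiffOn.sum fun l _ => (h2 j j l).mul (h1 l i))).sub
    (ContDiffOn.sum fun j _ => ContDiffOn.sum fun l _ => (h2 l j i).mul (h1 j l))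
  refine ContinuousOn.sub (continuousOn_finsetSum _ fun i _ => continuousOn_finsetSum _ fun j _ =>
    (h3 i j).mul ?_) (continuousOn_finsetSum _ fun k _ => continuousOn_finsetSum _ fun i _ =>
    continuousOn_finsetSum _ fun l _ => ((h2 k i l).continuousOn.mul (h3 i l)).mul (h4 k).continuousOn)
  exact (contDiffOn_pd_fst (m := 0) (a := fun y ξ => divTensorOf Γ (fun k i y => D k i y ξ) j y)
    hg.isOpen (h4 j) (by norm_num) i).continuousOn

/-- The field `∂_ξ (φ f)` has bounded divergence. -/
theorem exists_weakDivBound_locFlux (hφc : HasCompactSupport φ) (R : ℝ) :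
    ∃ B, 0 ≤ B ∧ WeakDivBound R B (fun y ξ => deriv (locFlux f φ y) ξ) := by
  have hφw := contDiff_div_density' hg hφ hφU
  set a : Eu d → ℝ → ℝ := fun y ξ => w y * (∑ k, deriv (f k y) ξ * pd k (fun z => φ z / w z) y) with ha
  set b : Eu d → ℝ → ℝ := fun y ξ => divFormOf G Γ (divTensorOf Γ (fun k i y => D k i y ξ)) y * φ y with hb
  have hpd0 : ∀ k, ∀ y ∉ tsupport φ, pd k (fun z => φ z / w z) y = 0 := fun k y hy =>
    pd_eq_zero_of_notMem k fun h => hy (hφw.2 h)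
  have ha0 : ∀ y ∉ tsupport φ, ∀ ξ, a y ξ = 0 := fun y hy ξ => by simp [ha, hpd0 _ y hy]
  have hb0 : ∀ y ∉ tsupport φ, ∀ ξ, b y ξ = 0 := fun y hy ξ => by
    simp [hb, eq_zero_off_tsupport hy]
  have hac : Continuous (uncurry a) := by
    refine contDiff_zero.1 (contDiff_of_contDiffOn_of_support hg.isOpen (isClosed_tsupport φ) hφU
      (contDiffOn_zero.2 ?_) ha0)
    refine ContinuousOn.mul (hg.smooth_w.continuousOn.comp continuousOn_fst fun p hp => hp.1)
      (continuousOn_finsetSum _ fun k _ => (hc.continuousOn_deriv_flux hg.isOpen k).mul ?_)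
    exact (((hφw.1.continuous_fderiv (by simp)).clm_apply continuous_const).comp continuous_fst).continuousOn
  have hbc : Continuous (uncurry b) := by
    refine contDiff_zero.1 (contDiff_of_contDiffOn_of_support hg.isOpen (isClosed_tsupport φ) hφU
      (contDiffOn_zero.2 ?_) hb0)
    exact (continuousOn_divForm_deriv hg hc).mul (hφ.continuous.comp continuous_fst).continuousOn
  obtain ⟨S, hS0, hS⟩ := exists_bound_of_compact_fst (F := fun y ξ => a y ξ + b y ξ) (hac.add hbc) hφc
    (fun y hy ξ => by rw [ha0 y hy, hb0 y hy, add_zero]) 0 R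
  refine ⟨S, hS0, fun ξ hξ ψ hψ hψc => ?_⟩
  have hΨ := contDiff_div_density hg hφ hφU hψ
  set Ψ : Eu d → ℝ := fun z => φ z / w z * ψ z with hΨd
  have hΨc : HasCompactSupport Ψ := hφc.of_isClosed_subset (isClosed_tsupport _) hΨ.2
  have h1 := integral_compat hg hc (hΨ.1.of_le two_le_infty) hΨc (hΨ.2.trans hφU) ξ
  rw [hg.integral_hessOf_mul (fun k i => contDiffOn_slice (hc.diff_deriv k i) ξ) (hΨ.1.of_le two_le_infty) hΨc
    (hΨ.2.trans hφU)] at h1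
  have h2 : ∀ y, (∑ k, deriv (f k y) ξ * pd k Ψ y) * w y = fderiv ℝ ψ y (deriv (locFlux f φ y) ξ) + a y ξ * ψ y := by
    intro y
    by_cases hy : y ∈ U
    · have hw0 := (hg.pos y hy).ne'
      conv_rhs => rw [sum_stdVec (deriv (locFlux f φ y) ξ), map_sum]
      simp only [ha]
      rw [mul_sum, sum_mul, sum_mul, ← sum_add_distrib]
      refine sum_congr rfl fun k _ => ?_
      rw [map_smul, smul_eq_mul, deriv_locFlux hc hφ hφU hg.isOpen hy, hΨd,
        pd_mul k (hφw.1.differentiable (by simp) y) (hψ.differentiable (by simp) y)]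
      simp only [pd]
      field_simp
      ring
    · have hy' : y ∉ tsupport φ := fun h => hy (hφU h)
      have h3 : deriv (locFlux f φ y) ξ = 0 := by
        rw [show locFlux f φ y = fun _ => 0 from funext fun s => locFlux_eq_zero hy' s, deriv_const]
      have h4 : ∀ k, pd k Ψ y = 0 := fun k => pd_eq_zero_of_notMem k fun h => hy' (hΨ.2 h)
      simp [h3, h4, ha0 y hy']
  have h3 : ∀ y, divFormOf G Γ (divTensorOf Γ (fun k i y => D k i y ξ)) y * Ψ y * w y = b y ξ * ψ y := by
    intro y
    by_cases hy : y ∈ U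
    · have hw0 := (hg.pos y hy).ne'
      simp only [hb, hΨd]
      field_simp
    · have hy' : y ∉ tsupport φ := fun h => hy (hφU h)
      simp [hb0 y hy', hΨd, eq_zero_off_tsupport hy']
  simp only [h2, h3] at h1
  have hsl : ∀ c : Eu d → ℝ → ℝ, Continuous (uncurry c) → Integrable (fun y => c y ξ * ψ y) := fun c hc =>
    ((hc.comp (continuous_id.prodMk continuous_const)).mul hψ.continuous).integrable_of_hasCompactSupport hψc.mul_left
  have hi1 : Integrable (fun y => fderiv ℝ ψ y (deriv (locFlux f φ y) ξ)) := by
    refine ((hψ.continuous_fderiv (by simp)).clm_apply ((continuous_deriv_snd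
      (contDiff_locFlux hc hφ hφU hg.isOpen)).comp (continuous_id.prodMk
        continuous_const))).integrable_of_hasCompactSupport ((hψc.fderiv ℝ).mono fun y hy => ?_)
    contrapose! hy
    simp [notMem_support.1 hy]
  rw [integral_add hi1 (hsl a hac), add_assoc, ← integral_add (hsl a hac) (hsl b hbc)] at h1
  rw [eq_neg_of_add_eq_zero_left h1, abs_neg, ← integral_const_mul]
  refine abs_integral_le_integral ((hψ.continuous.integrable_of_hasCompactSupport hψc).abs.const_mul S)
    (ae_of_all _ fun y => ?_)
  rw [← add_mul, abs_mul]
  exact mul_le_mul_of_nonneg_right (hS y ξ hξ) (abs_nonneg _)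

theorem exists_admissibleField_locField (hφc : HasCompactSupport φ) (R : ℝ) :
    ∃ B, 0 ≤ B ∧ AdmissibleField R B (locField G f D φ) := by
  obtain ⟨B1, h1, hB1⟩ := exists_weakDivBound_locFlux hg hc hφ hφU hφc (R + 1)
  obtain ⟨B2, h2, hB₂⟩ := exists_weakDivBound (contDiff_locDrift hg hc hφ hφU) hφc
    (fun y hy ξ => locDrift_eq_zero hy ξ) R
  exact ⟨B1 + B2, add_nonneg h1 h2, admissibleField_deriv_add (contDiff_locFlux hc hφ hφU hg.isOpen)
    (contDiff_locDrift hg hc hφ hφU) hφc (fun y hy ξ => locFlux_eq_zero hy ξ)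
    (fun y hy ξ => locDrift_eq_zero hy ξ) hB1 hB₂⟩

theorem exists_bound_locField (hφc : HasCompactSupport φ) (R : ℝ) :
    ∃ S, ∀ y, ∀ ξ ∈ Icc 0 R, ‖locField G f D φ y ξ‖ ≤ S := by
  obtain ⟨S, -, hS⟩ := exists_bound_of_compact_fst (F := locField G f D φ)
    ((continuous_deriv_snd (contDiff_locFlux hc hφ hφU hg.isOpen)).add
      (contDiff_locDrift hg hc hφ hφU).continuous) hφc (fun y hy ξ => by
      rw [locField, show locFlux f φ y = fun _ => 0 from funext fun s => locFlux_eq_zero hy s, deriv_const,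
        locDrift_eq_zero hy, add_zero]) 0 R
  exact ⟨S, hS⟩

theorem exists_bound_locPot (hφc : HasCompactSupport φ) (R : ℝ) :
    ∃ S, ∀ y, ∀ ξ ∈ Icc 0 R, |locPot G Γ w f D φ y ξ| ≤ S := by
  obtain ⟨S, -, hS⟩ := exists_bound_of_compact_fst (continuous_locPot hg hc hφ hφU) hφc
    (fun y hy ξ => locPot_eq_zero hg hφ hφU hy ξ) 0 R
  exact ⟨S, hS⟩

end ChartCoefficients

/-! ### The operators of the equation, acting on test functions in a chart -/

/-- The operator dual to `h ↦ -Div (h f')`. -/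
def opDiv (w : Eu d → ℝ) (f : VecX[d]) (θ : X[d] → ℝ) (q : X[d]) : ℝ :=
  (∑ k, deriv (f k q.2.1) q.2.2 * pd k (fun y => θ (q.1, y, q.2.2) / w y) q.2.1) * w q.2.1

/-- The operator dual to `h ↦ Div Div (h A')`. -/
def opHess (G : Mat[d]) (Γ : Fin d → Mat[d]) (w : Eu d → ℝ) (D : MatX[d]) (θ : X[d] → ℝ) (q : X[d]) : ℝ :=
  (∑ k, ∑ i, D k i q.2.1 q.2.2 * hessOf G Γ (fun y => θ (q.1, y, q.2.2) / w y) i k q.2.1) * w q.2.1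

/-- The operator dual to `h ↦ -∂_t h`. -/
def opDt (θ : X[d] → ℝ) (q : X[d]) : ℝ := deriv (fun s => θ (s, q.2)) q.1

namespace ChartCoefficients

theorem eventually_slice_eq_zero {θ : X[d] → ℝ} {q : X[d]} (hq : q ∉ tsupport θ) :
    q.2.1 ∉ tsupport (fun y => θ (q.1, y, q.2.2) / w y) := by
  have h1 := notMem_tsupport_iff_eventuallyEq.1 hq
  have h2 : Tendsto (fun y : Eu d => (q.1, y, q.2.2)) (𝓝 q.2.1) (𝓝 q) :=
    (by fun_prop : Continuous (fun y : Eu d => (q.1, y, q.2.2))).tendsto' _ _ rfl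
  refine notMem_tsupport_iff_eventuallyEq.2 ?_
  filter_upwards [h2.eventually h1] with y hy
  simp only [hy, Pi.zero_apply, zero_div]

theorem opDiv_eq_zero {θ : X[d] → ℝ} {q : X[d]} (hq : q ∉ tsupport θ) : opDiv w f θ q = 0 := by
  simp [opDiv, pd_eq_zero_of_notMem _ (eventually_slice_eq_zero (w := w) hq)]

theorem opHess_eq_zero {θ : X[d] → ℝ} {q : X[d]} (hq : q ∉ tsupport θ) : opHess G Γ w D θ q = 0 := by
  have h := eventually_slice_eq_zero (w := w) hq
  have h1 : ∀ i, q.2.1 ∉ tsupport (gradOf G (fun y => θ (q.1, y, q.2.2) / w y) i) := fun i hc =>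
    h (ChartGeometry.tsupport_gradOf _ _ hc)
  simp [opHess, hessOf, pd_eq_zero_of_notMem _ (h1 _), eq_zero_off_tsupport (h1 _)]

theorem hasDerivAt_opDt {θ : X[d] → ℝ} (hθ : ContDiff ℝ ∞ θ) (q : X[d]) : opDt θ q = fderiv ℝ θ q (1, 0) := by
  have h2 : HasFDerivAt (fun s => θ (s, q.2)) _ q.1 :=
    HasFDerivAt.comp (𝕜 := ℝ) (g := θ) q.1 ((hθ.differentiable (by simp) q).hasFDerivAt)
      (hasFDerivAt_prodMk_left q.1 q.2)
  rw [opDt, h2.hasDerivAt.deriv]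
  simp

variable (hg : ChartGeometry U G Γ w) (hc : ChartCoefficients U G Γ f A D)

include hg hc

omit hc in
theorem contDiffOn_slice_div {P : Type*} [NormedAddCommGroup P] [NormedSpace ℝ P] {θ : P → X[d] → ℝ}
    (hθ : ContDiff ℝ ∞ (uncurry θ)) :
    ContDiffOn ℝ ∞ (fun r : Eu d × (P × ℝ × ℝ) => θ r.2.1 (r.2.2.1, r.1, r.2.2.2) / w r.1) (U ×ˢ univ) := by
  refine ContDiffOn.div ?_ (hg.smooth_w.comp contDiffOn_fst fun p hp => hp.1) fun p hp => (hg.pos p.1 hp.1).ne'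
  exact (hθ.comp (f := fun r : Eu d × (P × ℝ × ℝ) => (r.2.1, (r.2.2.1, r.1, r.2.2.2))) (by fun_prop)).contDiffOn

theorem continuousOn_opDiv {θ : X[d] → ℝ} (hθ : ContDiff ℝ ∞ θ) : ContinuousOn (opDiv w f θ) {q | q.2.1 ∈ U} := by
  have h1 := contDiffOn_slice_div hg (P := ℝ) (θ := fun _ => θ) (hθ.comp contDiff_snd)
  refine ContinuousOn.mul (continuousOn_finsetSum _ fun k _ => ContinuousOn.mul ?_ ?_)
    (hg.smooth_w.continuousOn.comp (by fun_prop) fun q hq => hq)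
  · exact ContinuousOn.comp (g := fun p : Y[d] => deriv (f k p.1) p.2) (f := fun q : X[d] => q.2)
      (hc.continuousOn_deriv_flux hg.isOpen k) (by fun_prop) fun q hq => ⟨hq, mem_univ _⟩
  · exact ContinuousOn.comp (f := fun q : X[d] => (q.2.1, (0, q.1, q.2.2)))
      (contDiffOn_pd_fst (m := 0) (a := fun y (r : ℝ × ℝ × ℝ) => θ (r.2.1, y, r.2.2) / w y)
      hg.isOpen h1 (by simp) k).continuousOn (by fun_prop) fun q hq => ⟨hq, mem_univ _⟩

theorem continuousOn_opHess {P : Type*} [NormedAddCommGroup P] [NormedSpace ℝ P] {θ : P → X[d] → ℝ}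
    (hθ : ContDiff ℝ ∞ (uncurry θ)) :
    ContinuousOn (fun r : P × X[d] => opHess G Γ w D (θ r.1) r.2) {r | r.2.2.1 ∈ U} := by
  have h1 := contDiffOn_slice_div hg hθ
  have hG : ∀ i j, ContDiffOn ℝ ∞ (fun r : Eu d × (P × ℝ × ℝ) => G i j r.1) (U ×ˢ univ) := fun i j =>
    (hg.smooth_G i j).comp contDiffOn_fst fun p hp => hp.1
  have hΓ : ∀ i j k, ContDiffOn ℝ ∞ (fun r : Eu d × (P × ℝ × ℝ) => Γ i j k r.1) (U ×ˢ univ) := fun i j k =>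
    (hg.smooth_Γ i j k).comp contDiffOn_fst fun p hp => hp.1
  have h2 : ∀ i, ContDiffOn ℝ ∞ (fun r : Eu d × (P × ℝ × ℝ) =>
      gradOf G (fun y => θ r.2.1 (r.2.2.1, y, r.2.2.2) / w y) i r.1) (U ×ˢ univ) := fun i =>
    ContDiffOn.sum fun j _ => (hG i j).mul (contDiffOn_pd_fst (m := ∞)
      (a := fun y (r : P × ℝ × ℝ) => θ r.1 (r.2.1, y, r.2.2) / w y) hg.isOpen h1 (by simp) j)
  have h3 : ∀ i k, ContDiffOn ℝ ∞ (fun r : Eu d × (P × ℝ × ℝ) =>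
      hessOf G Γ (fun y => θ r.2.1 (r.2.2.1, y, r.2.2.2) / w y) i k r.1) (U ×ˢ univ) := fun i k =>
    (contDiffOn_pd_fst (m := ∞) (a := fun z (r : P × ℝ × ℝ) =>
      gradOf G (fun y => θ r.1 (r.2.1, y, r.2.2) / w y) i z) hg.isOpen (h2 i) (by simp) k).add
    (ContDiffOn.sum fun l _ => (hΓ i k l).mul (h2 l))
  refine ContinuousOn.mul (continuousOn_finsetSum _ fun k _ => continuousOn_finsetSum _ fun i _ =>
    ContinuousOn.mul ?_ ?_) (hg.smooth_w.continuousOn.comp (by fun_prop) fun q hq => hq)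
  · exact ContinuousOn.comp (g := fun p : Y[d] => D k i p.1 p.2) (f := fun r : P × X[d] => r.2.2)
      (hc.diff_deriv k i).continuousOn (by fun_prop) fun q hq => ⟨hq, mem_univ _⟩
  · exact ContinuousOn.comp (f := fun r : P × X[d] => (r.2.2.1, (r.1, r.2.1, r.2.2.2)))
      (h3 i k).continuousOn (by fun_prop) fun q hq => ⟨hq, mem_univ _⟩

omit hg hc in
theorem continuous_of_continuousOn_chart (hU : IsOpen U) {θ c : X[d] → ℝ}
    (hcc : ContinuousOn c {q | q.2.1 ∈ U}) (hs : tsupport θ ⊆ {q | q.2.1 ∈ U})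
    (h0 : ∀ q ∉ tsupport θ, c q = 0) : Continuous c := by
  refine contDiff_zero.1 (contDiff_of_contDiffOn_of_tsupport (V := {q : X[d] | q.2.1 ∈ U})
    (hU.preimage (by fun_prop)) (contDiffOn_zero.2 hcc) (Subset.trans ?_ hs))
  refine closure_minimal (fun q hq => ?_) (isClosed_tsupport _)
  by_contra h
  exact hq (h0 q h)

theorem continuous_ops {θ : X[d] → ℝ} (hθ : ContDiff ℝ ∞ θ) (hs : tsupport θ ⊆ {q | q.2.1 ∈ U}) :
    Continuous (opDt θ) ∧ Continuous (opDiv w f θ) ∧ Continuous (opHess G Γ w D θ) := by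
  refine ⟨?_, ?_, ?_⟩
  · rw [show opDt θ = fun q => fderiv ℝ θ q (1, 0) from funext fun q => hasDerivAt_opDt hθ q]
    exact (hθ.continuous_fderiv (by simp)).clm_apply continuous_const
  · exact continuous_of_continuousOn_chart hg.isOpen (continuousOn_opDiv hg hc hθ) hs fun q hq => opDiv_eq_zero hq
  · refine continuous_of_continuousOn_chart hg.isOpen ?_ hs fun q hq => opHess_eq_zero hq
    exact ContinuousOn.comp (f := fun q : X[d] => (0, q))
      (continuousOn_opHess hg hc (P := ℝ) (θ := fun _ => θ) (hθ.comp contDiff_snd)) (by fun_prop) fun q hq => hq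

omit hg hc in
theorem hasCompactSupport_ops {θ : X[d] → ℝ} (hθ : ContDiff ℝ ∞ θ) (hθc : HasCompactSupport θ) :
    HasCompactSupport (opDt θ) ∧ HasCompactSupport (opDiv w f θ) ∧ HasCompactSupport (opHess G Γ w D θ) := by
  refine ⟨HasCompactSupport.intro hθc fun q hq => ?_, HasCompactSupport.intro hθc fun q hq => opDiv_eq_zero hq,
    HasCompactSupport.intro hθc fun q hq => opHess_eq_zero hq⟩
  rw [hasDerivAt_opDt hθ, eq_zero_off_tsupport (fun h => hq (tsupport_fderiv_subset ℝ h) : q ∉ tsupport (fderiv ℝ θ))]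
  simp

/-- Constants solve the equation. -/
theorem integral_ops_eq_zero {θ : X[d] → ℝ} (hθ : ContDiff ℝ ∞ θ) (hθc : HasCompactSupport θ)
    (hs : tsupport θ ⊆ {q | q.2.1 ∈ U}) :
    (∫ q, opDt θ q = 0) ∧ ∫ q, (opDiv w f θ q + opHess G Γ w D θ q) = 0 := by
  obtain ⟨c1, c2, c3⟩ := continuous_ops hg hc hθ hs
  obtain ⟨s1, s2, s3⟩ := hasCompactSupport_ops (f := f) (G := G) (Γ := Γ) (w := w) (D := D) hθ hθc
  constructor
  · rw [show opDt θ = fun q => fderiv ℝ θ q (1, 0) from funext fun q => hasDerivAt_opDt hθ q]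
    have h1 : vol[Y[d]].IsAddHaarMeasure := inferInstanceAs ((vol[Eu d].prod vol[ℝ]).IsAddHaarMeasure)
    have h2 : vol[X[d]].IsAddHaarMeasure := Measure.prod.instIsAddHaarMeasure vol[ℝ] vol[Y[d]]
    exact integral_fderiv_apply_eq_zero volume (hθ.of_le (by simp)) hθc _
  · have hi : Integrable (fun q => opDiv w f θ q + opHess G Γ w D θ q) :=
      (c2.integrable_of_hasCompactSupport s2).add (c3.integrable_of_hasCompactSupport s3)
    rw [volume_eq_prod] at hi ⊢
    rw [integral_prod _ hi]
    refine integral_eq_zero_of_ae (ae_of_all _ fun t => ?_)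
    have hi2 : Integrable (fun r : Y[d] => opDiv w f θ (t, r) + opHess G Γ w D θ (t, r)) := by
      have hemb : Topology.IsClosedEmbedding (fun r : Y[d] => (t, r)) :=
        Topology.IsClosedEmbedding.of_continuous_injective_isClosedMap (by fun_prop)
          (fun a b h => by simpa using h) (isClosedMap_prodMk_left t)
      exact ((c2.comp (by fun_prop)).integrable_of_hasCompactSupport (s2.comp_isClosedEmbedding hemb)).add
        ((c3.comp (by fun_prop)).integrable_of_hasCompactSupport (s3.comp_isClosedEmbedding hemb))
    rw [volume_eq_prod] at hi2 ⊢
    simp only [Pi.zero_apply]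
    rw [integral_prod_symm _ hi2]
    refine integral_eq_zero_of_ae (ae_of_all _ fun ξ => ?_)
    have hemb : Topology.IsClosedEmbedding (fun y : Eu d => (t, y, ξ)) :=
      Topology.IsClosedEmbedding.of_continuous_injective_isClosedMap (by fun_prop)
        (fun a b h => by simpa using h) ((isClosedMap_prodMk_left t).comp (isClosedMap_prodMk_right ξ))
    have hcomp : ∀ {c : X[d] → ℝ}, Continuous c → HasCompactSupport c →
        Integrable (fun y : Eu d => c (t, y, ξ)) := fun h1 h2 =>
      (h1.comp hemb.continuous).integrable_of_hasCompactSupport (h2.comp_isClosedEmbedding hemb)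
    have hsub : tsupport (fun y => θ (t, y, ξ) / w y) ⊆ U := fun y hy => by
      by_contra hyU
      exact eventually_slice_eq_zero (w := w) (q := (t, y, ξ)) (fun h => hyU (hs h)) hy
    have hsm : ContDiff ℝ 2 (fun y => θ (t, y, ξ) / w y) := by
      refine contDiff_of_contDiffOn_of_tsupport hg.isOpen (ContDiffOn.div ?_
        (hg.smooth_w.of_le two_le_infty) fun y hy => (hg.pos y hy).ne') hsub
      exact ((hθ.of_le two_le_infty).comp (f := fun y : Eu d => (t, y, ξ)) (by fun_prop)).contDiffOn
    have hcs : HasCompactSupport (fun y => θ (t, y, ξ) / w y) := by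
      refine (hθc.comp_isClosedEmbedding hemb).mono fun y hy => ?_
      contrapose! hy
      have : θ (t, y, ξ) = 0 := notMem_support.1 hy
      simp [this]
    exact (integral_add (hcomp c2 s2) (hcomp c3 s3)).trans (integral_compat hg hc hsm hcs hsub ξ)

end ChartCoefficients

/-! ### Representation of the regularised equation -/

theorem hasCompactSupport_reflect (hϖc : HasCompactSupport ϖ) (hδ : 0 < δ) (ξ : ℝ) :
    HasCompactSupport (fun s => ϖ ((ξ - s) / δ)) := by
  refine HasCompactSupport.intro (hϖc.isCompact.image (f := fun u => ξ - δ * u) (by fun_prop)) fun s hs => ?_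
  by_contra h
  refine hs ⟨(ξ - s) / δ, subset_tsupport _ h, ?_⟩
  simp only
  field_simp
  ring

theorem xiReg_kint_eq (hϖ : Continuous ϖ) (hϖc : HasCompactSupport ϖ) (hδ : 0 < δ) (hH : IsDensity H)
    {k : TX d → Den[d]} {c : ℝ} (hk : Continuous (fun p : TX d × TX d × ℝ => k p.1 p.2.1 p.2.2))
    (hs : ∀ x x' ξ, c < dist x' x → k x x' ξ = 0) (p : X[d]) :
    Integrable (fun q : X[d] => H (q.1, q.2.1) q.2.2
      * (δ⁻¹ * ϖ ((p.2.2 - q.2.2) / δ) * k (p.1, p.2.1) (q.1, q.2.1) q.2.2)) ∧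
    xiReg ϖ δ (kint k H) (p.1, p.2.1) p.2.2 = ∫ q : X[d], H (q.1, q.2.1) q.2.2
      * (δ⁻¹ * ϖ ((p.2.2 - q.2.2) / δ) * k (p.1, p.2.1) (q.1, q.2.1) q.2.2) := by
  set x : TX d := (p.1, p.2.1)
  set F : TX d × ℝ → ℝ := fun z => δ⁻¹ * ϖ ((p.2.2 - z.2) / δ) * k x z.1 z.2
  have hF : Continuous F := by
    refine Continuous.mul (by fun_prop) ?_
    exact hk.comp (continuous_const.prodMk (continuous_fst.prodMk continuous_snd))
  have hFc : HasCompactSupport F := by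
    refine HasCompactSupport.intro ((isCompact_closedBall x c).prod
      (hasCompactSupport_reflect hϖc hδ p.2.2).isCompact) fun z hz => ?_
    by_cases h1 : dist z.1 x ≤ c
    · have h2 : ϖ ((p.2.2 - z.2) / δ) = 0 :=
        eq_zero_off_tsupport (f := fun s => ϖ ((p.2.2 - s) / δ)) fun h => hz ⟨h1, h⟩
      simp [F, h2]
    · simp [F, hs x z.1 z.2 (not_le.1 h1)]
  have hi : Integrable (fun z : TX d × ℝ => H z.1 z.2 * F z) (volume.prod volume) :=
    Integrable.bdd_mul (c := 1) (hF.integrable_of_hasCompactSupport hFc) hH.meas.aestronglyMeasurable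
      (ae_of_all _ fun z => hH.abs_le_one _ _)
  have hmp := (measurePreserving_prodAssoc vol[ℝ] vol[Eu d] vol[ℝ]).symm
  have hmp' : MeasurePreserving (MeasurableEquiv.prodAssoc (α := ℝ) (β := Eu d) (γ := ℝ)).symm
    vol[X[d]] (vol[TX d].prod vol[ℝ]) := hmp
  refine ⟨(hmp'.integrable_comp_emb (MeasurableEquiv.measurableEmbedding _)).2 hi, ?_⟩
  have h1 := hmp'.integral_comp' (g := fun z : TX d × ℝ => H z.1 z.2 * F z)
  refine Eq.trans ?_ h1.symm
  rw [integral_prod_symm _ hi, xiReg]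
  refine integral_congr_fun fun s => ?_
  simp only [kint]
  rw [← integral_const_mul]
  refine integral_congr_fun fun x' => ?_
  simp only [F]
  ring

/-- The mollifier in `(t, x, ξ)`. -/
def MollKernel.moll (κ : MollKernel d) (ϖ : ℝ → ℝ) (ε δ : ℝ) (q : X[d]) : ℝ :=
  κ.scaled ε (q.1, q.2.1) * (δ⁻¹ * ϖ (q.2.2 / δ))

theorem contDiff_moll (hϖ : ContDiff ℝ ∞ ϖ) : ContDiff ℝ ∞ (κ.moll ϖ ε δ) := by
  refine ContDiff.mul ((κ.scaled_smooth ε).comp (by fun_prop)) ?_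
  exact contDiff_const.mul (hϖ.comp (contDiff_snd.snd.div_const _))

theorem xiReg_kM_eq (hϖ : Continuous ϖ) (hϖc : HasCompactSupport ϖ) (hε : 0 < ε) (hδ : 0 < δ)
    (hH : IsDensity H) (hφ : Continuous φ) (p : X[d]) :
    xiReg ϖ δ (kint kC[κ, ε, φ] H) (p.1, p.2.1) p.2.2 = ∫ q : X[d], φ q.2.1 * H (q.1, q.2.1) q.2.2
        * κ.moll ϖ ε δ (p ⊖ q) := by
  have hb := MollKernel.kernelBound_kM (κ := κ) (A := 0) (I := ∅) hε
    (c := fun y _ => φ y) (hφ.comp continuous_fst) (by simp)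
  rw [(xiReg_kint_eq hϖ hϖc hδ hH hb.cont hb.supp p).2]
  refine integral_congr_fun fun q => ?_
  simp only [MollKernel.moll, MollKernel.kM, Prod.mk_sub_mk]
  ring

namespace ChartCoefficients

variable (hg : ChartGeometry U G Γ w) (hc : ChartCoefficients U G Γ f A D) (hφ : ContDiff ℝ ∞ φ) (hφU : tsupport φ ⊆ U)

include hg hc hφ hφU

theorem continuous_locField : Continuous (uncurry (locField G f D φ)) :=
  (continuous_deriv_snd (contDiff_locFlux hc hφ hφU hg.isOpen)).add (contDiff_locDrift hg hc hφ hφU).continuous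

/-- The localized equation, tested against the mollifier. -/
theorem ops_moll_eq (p q : X[d]) (hq : q.2.1 ∈ U) : - opDt (fun q => φ q.2.1 * κ.moll ϖ ε δ (p ⊖ q)) q
      - opDiv w f (fun q => φ q.2.1 * κ.moll ϖ ε δ (p ⊖ q)) q
      - opHess G Γ w D (fun q => φ q.2.1 * κ.moll ϖ ε δ (p ⊖ q)) q
      + φ q.2.1 * opHess G Γ w D (fun q => κ.moll ϖ ε δ (p ⊖ q)) q
    = δ⁻¹ * ϖ ((p.2.2 - q.2.2) / δ) * (κ.kT ε φ (p.1, p.2.1) (q.1, q.2.1) q.2.2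
      + (κ.kD ε (locField G f D φ) (p.1, p.2.1) (q.1, q.2.1) q.2.2
        + κ.kM ε (locPot G Γ w f D φ) (p.1, p.2.1) (q.1, q.2.1) q.2.2)) := by
  set x : TX d := (p.1, p.2.1)
  set b := δ⁻¹ * ϖ ((p.2.2 - q.2.2) / δ) with hb
  have e1 : opDt (fun q => φ q.2.1 * κ.moll ϖ ε δ (p ⊖ q)) q = - b * κ.kT ε φ x (q.1, q.2.1) q.2.2 := by
    have h1 : HasFDerivAt (κ.scaled ε) (fderiv ℝ (κ.scaled ε) (x - (q.1, q.2.1))) (x - (q.1, q.2.1)) :=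
      ((κ.scaled_smooth ε).differentiable (by simp) _).hasFDerivAt
    have h2 : HasFDerivAt (fun s : ℝ => x - (s, q.2.1)) (-(ContinuousLinearMap.inl ℝ ℝ (Eu d))) q.1 :=
      (hasFDerivAt_prodMk_left q.1 q.2.1).const_sub x
    have h3 : HasFDerivAt (fun s : ℝ => κ.scaled ε (x - (s, q.2.1))) _ q.1 :=
      HasFDerivAt.comp (𝕜 := ℝ) (g := κ.scaled ε) q.1 h1 h2
    have h4 : HasDerivAt (fun s : ℝ => φ q.2.1 * (κ.scaled ε (x - (s, q.2.1)) * b)) _ q.1 :=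
      (h3.hasDerivAt.mul_const b).const_mul (φ q.2.1)
    refine h4.deriv.trans ?_
    simp only [MollKernel.kT, ContinuousLinearMap.comp_apply, neg_apply, ContinuousLinearMap.inl_apply, map_neg]
    ring
  have hρ := (κ.slice_smooth ε x q.1).mul (contDiff_const (c := b))
  have e2 := transport_identity hg hc hφ hφU hρ hq q.2.2
  have e3 : fderiv ℝ (fun z => κ.scaled ε (x - (q.1, z)) * b) q.2.1 (locField G f D φ q.2.1 q.2.2)
      = - (b * κ.kD ε (locField G f D φ) x (q.1, q.2.1) q.2.2) := by
    rw [fderiv_mul_const ((κ.slice_smooth ε x q.1).differentiable (by simp) _), smul_apply,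
      MollKernel.fderiv_slice, smul_eq_mul, MollKernel.kD]
    ring
  rw [e3] at e2
  rw [e1, show ∀ a b c d : ℝ, -a - b - c + d = -a + (-b - c + d) from fun _ _ _ _ => by ring]
  refine (congrArg (fun r => - (- b * κ.kT ε φ x (q.1, q.2.1) q.2.2) + r) e2).trans ?_
  simp only [MollKernel.kM]
  ring

theorem transport_eq (hϖ : ContDiff ℝ ∞ ϖ) (hϖc : HasCompactSupport ϖ) (hε : 0 < ε) (hδ : 0 < δ)
    (hφc : HasCompactSupport φ) (hH : IsDensity H) (hHU : ∀ x, x.2 ∉ U → ∀ ξ, H x ξ = 0) (p : X[d]) :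
    xiReg ϖ δ (κ.transport ε φ (locField G f D φ) (locPot G Γ w f D φ) H) (p.1, p.2.1) p.2.2
    = ∫ q : X[d], H (q.1, q.2.1) q.2.2 * (- opDt (fun q => φ q.2.1 * κ.moll ϖ ε δ (p ⊖ q)) q
      - opDiv w f (fun q => φ q.2.1 * κ.moll ϖ ε δ (p ⊖ q)) q
      - opHess G Γ w D (fun q => φ q.2.1 * κ.moll ϖ ε δ (p ⊖ q)) q
      + φ q.2.1 * opHess G Γ w D (fun q => κ.moll ϖ ε δ (p ⊖ q)) q) := by
  obtain ⟨a, -, ha⟩ := exists_bound_of_hasCompactSupport hφ.continuous hφc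
  have hT := kernelBound_kT (κ := κ) hε hφ.continuous ha (S := ∅)
  have hD := MollKernel.kernelBound_kD (κ := κ) hε (continuous_locField hg hc hφ hφU) (S := 0) (I := ∅) (by simp)
  have hM := MollKernel.kernelBound_kM (κ := κ) hε (continuous_locPot hg hc hφ hφU) (A := 0) (I := ∅) (by simp)
  have e : κ.transport ε φ (locField G f D φ) (locPot G Γ w f D φ) H
      = kint (fun x x' ξ => κ.kT ε φ x x' ξ + (κ.kD ε (locField G f D φ) x x' ξ
        + κ.kM ε (locPot G Γ w f D φ) x x' ξ)) H := by
    funext x ξ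
    simp only [MollKernel.transport, kint, add_mul]
    have i1 := hT.integrable hH x (ξ := ξ)
    have i2 := hD.integrable hH x (ξ := ξ)
    have i3 := hM.integrable hH x (ξ := ξ)
    exact (congrArg _ (integral_add i2 i3).symm).trans (integral_add i1 (i2.add i3)).symm
  rw [e, (xiReg_kint_eq hϖ.continuous hϖc hδ hH (c := κ.r * ε) (hT.cont.add (hD.cont.add hM.cont)) (fun x x' ξ h => by
      rw [hT.supp _ _ _ h, hD.supp _ _ _ h, hM.supp _ _ _ h]; simp) p).2]
  refine integral_congr_fun fun q => ?_
  by_cases hq : q.2.1 ∈ U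
  · rw [ops_moll_eq hg hc hφ hφU p q hq]
  · simp [hHU (q.1, q.2.1) hq]

/-- The kernel of the regularisation of `h ↦ Div Div (ψ h A')`. -/
def hessKernel (G : Mat[d]) (Γ : Fin d → Mat[d]) (w : Eu d → ℝ)
    (D : MatX[d]) (κ : MollKernel d) (ϖ : ℝ → ℝ) (φ : Eu d → ℝ) (ε δ : ℝ)
    (p q : X[d]) : ℝ :=
  φ q.2.1 * opHess G Γ w D (fun q => κ.moll ϖ ε δ (p ⊖ q)) q

theorem continuous_hessKernel (hϖ : ContDiff ℝ ∞ ϖ) : Continuous (fun r : X[d] × X[d] =>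
    hessKernel G Γ w D κ ϖ φ ε δ r.1 r.2) := by
  have hm : ContDiff ℝ ∞ (uncurry fun p q : X[d] => κ.moll ϖ ε δ (p ⊖ q)) :=
    (contDiff_moll hϖ).comp (by fun_prop : ContDiff ℝ ∞ fun r : X[d] × X[d] =>
      (r.1.1 - r.2.1, r.1.2.1 - r.2.2.1, r.1.2.2 - r.2.2.2))
  have h1 := continuousOn_opHess hg hc hm
  have hcl : IsClosed {r : X[d] × X[d] | r.2.2.1 ∈ tsupport φ} := (isClosed_tsupport φ).preimage (by fun_prop)
  refine contDiff_zero.1 (contDiff_of_contDiffOn_of_tsupport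
    (V := {r : X[d] × X[d] | r.2.2.1 ∈ U}) (hg.isOpen.preimage (by fun_prop))
    (contDiffOn_zero.2 ((hφ.continuous.comp (by fun_prop)).continuousOn.mul h1)) ?_)
  refine (closure_minimal (fun r hr => ?_) hcl).trans fun r hr => hφU hr
  by_contra h
  refine hr ?_
  have h2 : φ r.2.2.1 = 0 := eq_zero_off_tsupport h
  simp [hessKernel, h2]

omit hg hc hφ hφU in
theorem exists_isCompact_hessKernel (hϖc : HasCompactSupport ϖ) (hε : 0 < ε) (hδ : 0 < δ) :
    ∃ B : Set X[d], IsCompact B ∧ ∀ p q, p - q ∉ B → hessKernel G Γ w D κ ϖ φ ε δ p q = 0 := by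
  have hB : IsCompact ((closedBall (0 : ℝ) (κ.r * ε)) ×ˢ ((closedBall (0 : Eu d) (κ.r * ε)) ×ˢ
      ((fun s => δ * s) '' tsupport ϖ))) :=
    (isCompact_closedBall _ _).prod ((isCompact_closedBall _ _).prod (hϖc.isCompact.image (by fun_prop)))
  refine ⟨_, hB, fun p q hpq => ?_⟩
  rw [hessKernel, opHess_eq_zero, mul_zero]
  intro hq
  refine hpq ?_
  have h1 : tsupport (fun q : X[d] => κ.moll ϖ ε δ (p ⊖ q)) ⊆ (fun q => p - q) ⁻¹' ((closedBall (0 : ℝ) (κ.r * ε)) ×ˢ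
        ((closedBall (0 : Eu d) (κ.r * ε)) ×ˢ ((fun s => δ * s) '' tsupport ϖ))) := by
    refine closure_minimal (fun q hq => ?_) (hB.isClosed.preimage (by fun_prop))
    by_contra h
    apply hq
    by_cases h1 : ‖((p.1 - q.1, p.2.1 - q.2.1) : TX d)‖ ≤ κ.r * ε
    · have h2 : ϖ ((p.2.2 - q.2.2) / δ) = 0 := eq_zero_off_tsupport fun h2 => h
        ⟨by simpa using (norm_fst_le _).trans h1, by simpa using (norm_snd_le _).trans h1,
          ⟨_, h2, by simp only [Prod.snd_sub]; field_simp⟩⟩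
      simp [MollKernel.moll, h2]
    · simp [MollKernel.moll, κ.scaled_supp hε (not_le.1 h1)]
  exact h1 hq

end ChartCoefficients

open ChartCoefficients
variable {g : Metric d M} {f : VecFam d M} {A σ : EndFam d M} {ω1 ω2 : ℝ → ℝ} {h : ℝ × M × ℝ → ℝ}

/-! ### The mollifier -/

section Mollifier

variable (hω : IsMollifierPair ω1 ω2)

include hω

theorem exists_mollKernel : ∃ κ : MollKernel d, ∀ x, κ.Φ x = ω1 x.1 * ∏ j, ω2 (x.2 j) := by
  set Φ : TX d → ℝ := fun x => ω1 x.1 * ∏ j, ω2 (x.2 j) with hΦ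
  have hs : ContDiff ℝ ∞ Φ := by
    refine (hω.smooth₁.comp contDiff_fst).mul (contDiff_prod fun j _ => hω.smooth₂.comp ?_)
    exact (EuclideanSpace.proj j : Eu d →L[ℝ] ℝ).contDiff.comp contDiff_snd
  have hc : HasCompactSupport Φ := by
    have hK : IsCompact ((EuclideanSpace.equiv (Fin d) ℝ).symm '' (Set.pi univ fun _ : Fin d => tsupport ω2)) :=
      (isCompact_univ_pi fun _ => hω.compact₂.isCompact).image (EuclideanSpace.equiv (Fin d) ℝ).symm.continuous
    refine HasCompactSupport.intro (hω.compact₁.isCompact.prod hK) fun x hx => ?_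
    by_cases h1 : x.1 ∈ tsupport ω1
    · have h2 : ¬ ∀ j, x.2 j ∈ tsupport ω2 := fun h2 => hx ⟨h1, ⟨fun j => x.2 j, fun j _ => h2 j, rfl⟩⟩
      push Not at h2
      obtain ⟨j, hj⟩ := h2
      simp only [hΦ]
      rw [Finset.prod_eq_zero (Finset.mem_univ j) (eq_zero_off_tsupport (f := ω2) hj), mul_zero]
    · simp [hΦ, eq_zero_off_tsupport h1]
  obtain ⟨C1, h1, hC1⟩ := exists_bound_of_hasCompactSupport hs.continuous hc
  obtain ⟨C2, h2, hC2⟩ := exists_bound_of_hasCompactSupport (hs.continuous_fderiv (by simp)) (hc.fderiv ℝ)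
  obtain ⟨r, hr⟩ := hc.isCompact.isBounded.exists_norm_le
  refine ⟨⟨Φ, max r 1, max C1 C2, hs, fun x => mul_nonneg (hω.nonneg₁ _) (Finset.prod_nonneg fun j _ =>
    hω.nonneg₂ _), by positivity, h1.trans (le_max_left _ _), fun x hx => ?_, fun x => (hC1 x).trans
    (le_max_left _ _), fun x => (hC2 x).trans (le_max_right _ _), ?_⟩, fun x => rfl⟩
  · refine eq_zero_off_tsupport fun h => ?_
    exact absurd (hr x h) (not_le.2 ((le_max_left _ _).trans_lt hx))
  · have h3 : ∫ y : Eu d, ∏ j, ω2 (y j) = 1 := by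
      have h4 := (EuclideanSpace.volume_preserving_symm_measurableEquiv_toLp (Fin d)).integral_comp'
        (g := fun y : Fin d → ℝ => ∏ j, ω2 (y j))
      refine Eq.trans h4 ?_
      rw [integral_fintype_prod_volume_eq_prod (fun _ => ω2)]
      simp [hω.mass₂]
    rw [volume_eq_prod, integral_prod_mul (f := ω1) (g := fun y : Eu d => ∏ j, ω2 (y j)), hω.mass₁, h3, mul_one]

theorem moll_eq_mollifier (hκ : ∀ x, κ.Φ x = ω1 x.1 * ∏ j, ω2 (x.2 j)) (ε δ : ℝ)
    (q : X[d]) : mollifier ω1 ω2 ε δ q = κ.moll ω1 ε δ q := by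
  have h : finrank ℝ (TX d) = d + 1 := by
    simp [TX, Module.finrank_prod, add_comm]
  simp only [mollifier, moll, scaled, hκ, h]
  have e1 : (ε⁻¹ • ((q.1, q.2.1) : TX d)).1 = q.1 / ε := by
    rw [Prod.smul_fst, smul_eq_mul, div_eq_inv_mul]
  have e2 : ∀ j, (ε⁻¹ • ((q.1, q.2.1) : TX d)).2 j = q.2.1 j / ε := fun j => by
    rw [Prod.smul_snd, PiLp.smul_apply, smul_eq_mul, div_eq_inv_mul]
  simp only [e1, e2, one_div, mul_inv]
  ring

theorem forward_mollKernel (hκ : ∀ x, κ.Φ x = ω1 x.1 * ∏ j, ω2 (x.2 j)) (x : TX d) (hx : 0 ≤ x.1) : κ.Φ x = 0 := by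
  rw [hκ, eq_zero_off_tsupport (f := ω1) fun h => absurd (hω.supp₁ h).2 (not_lt.2 hx), zero_mul]

theorem isTest_mollifier (hφ : ContDiff ℝ ∞ φ) (hφc : HasCompactSupport φ)
    (hφU : tsupport φ ⊆ U) (hε : 0 < ε) (hδ : 0 < δ) {p : X[d]} (hp1 : 0 ≤ p.1)
    (hp2 : 0 ≤ p.2.2) : IsTest U (fun q : X[d] => φ q.2.1 * mollifier ω1 ω2 ε δ (p ⊖ q)) := by
  obtain ⟨κ, hκ⟩ := exists_mollKernel (d := d) hω
  set θ : X[d] → ℝ := fun q => φ q.2.1 * mollifier ω1 ω2 ε δ (p ⊖ q) with hθ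
  set C : Set X[d] := tsupport (fun s => ω1 ((p.1 - s) / ε)) ×ˢ tsupport φ ×ˢ tsupport (fun s => ω1 ((p.2.2 - s) / δ))
  have hC : IsCompact C := (hasCompactSupport_reflect hω.compact₁ hε _).isCompact.prod
    (hφc.isCompact.prod (hasCompactSupport_reflect hω.compact₁ hδ _).isCompact)
  have hCs : tsupport θ ⊆ C := by
    refine closure_minimal (fun q hq => ?_) hC.isClosed
    by_contra h
    apply hq
    by_cases h1 : q.1 ∈ tsupport (fun s => ω1 ((p.1 - s) / ε))
    · by_cases h2 : q.2.1 ∈ tsupport φ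
      · have h3 : ω1 ((p.2.2 - q.2.2) / δ) = 0 := eq_zero_off_tsupport
          (f := fun s => ω1 ((p.2.2 - s) / δ)) fun h3 => h ⟨h1, h2, h3⟩
        simp [hθ, mollifier, h3]
      · simp [hθ, eq_zero_off_tsupport h2]
    · have h3 : ω1 ((p.1 - q.1) / ε) = 0 := eq_zero_off_tsupport (f := fun s => ω1 ((p.1 - s) / ε)) h1
      simp [hθ, mollifier, h3]
  have hpos : ∀ {a ξ : ℝ}, 0 < a → 0 ≤ ξ → tsupport (fun s => ω1 ((ξ - s) / a)) ⊆ Ioi 0 := by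
    intro a ξ ha hξ s hs
    have h1 : (ξ - s) / a ∈ tsupport ω1 := tsupport_comp_subset_preimage ω1 (f := fun s => (ξ - s) / a) (by fun_prop) hs
    have h2 := (hω.supp₁ h1).2
    rw [div_lt_iff₀ ha] at h2
    simp only [mem_Ioi]
    linarith
  refine ⟨?_, hC.of_isClosed_subset (isClosed_tsupport _) hCs, hCs.trans ?_⟩
  · simp only [hθ, moll_eq_mollifier hω hκ]
    exact (hφ.comp contDiff_snd.fst).mul ((contDiff_moll hω.smooth₁).comp (by fun_prop))
  · exact prod_mono (hpos hε hp1) (prod_mono hφU (hpos hδ hp2))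

end Mollifier

section Chart

/-- The components of the flux. -/
def fluxComp (e : OpenPartialHomeomorph M (Eu d)) (f : VecFam d M) (k : Fin d) (y : Eu d) (ξ : ℝ) : ℝ :=
  vecComp e (fun x => f x ξ) k y

/-- The components of the `ξ`-derivative of the diffusion tensor. -/
def diffComp (e : OpenPartialHomeomorph M (Eu d)) (A : EndFam d M) (k i : Fin d) (y : Eu d) (ξ : ℝ) : ℝ :=
  deriv (fun s => tensComp e (fun x => A x s) k i y) ξ

/-- The first order coefficients of the localised equation in the chart `e`. -/
notation "chartField[" g ", " e ", " f ", " A "]" => locField (gramInv g e) (fluxComp e f) (diffComp e A)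
notation "chartPot[" g ", " e ", " f ", " A "]" => locPot (gramInv g e) (christoffel g e) (sqrtDet g e) (fluxComp e f) (diffComp e A)

theorem chartCoefficients (hcoeff : IsCoefficients g f A σ) (he : e ∈ 𝒜[d, M]) :
    ChartCoefficients e.target (gramInv g e) (christoffel g e) (fluxComp e f)
      (fun k i y ξ => tensComp e (fun x => A x ξ) k i y) (diffComp e A) := by
  have hd := fun k i y (hy : y ∈ e.target) ξ => hasDerivAt_tensComp g he hy hcoeff.deriv_diff k i ξ
  refine ⟨fun k => contDiffOn_vecComp_prod he (by simp) hcoeff.flux_C1 k,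
    fun k i ξ => (contDiffOn_tensComp he (hcoeff.diff_smooth ξ) k i).of_le two_le_infty,
    fun k i y hy ξ => (hd k i y hy ξ).differentiableAt.hasDerivAt, fun k i => ?_,
    fun ξ y hy => hcoeff.compatible ξ e he y hy⟩
  have hσ : ∀ a b, ContDiffOn ℝ 2 (fun p : Y[d] => tensComp e (fun x => σ x p.2) a b p.1)
      (e.target ×ˢ univ) := fun a b => contDiffOn_tensComp_prod he two_le_infty hcoeff.sigma_C2 a b
  have hG : ∀ a b, ContDiffOn ℝ 2 (fun p : Y[d] => gramInv g e a b p.1) (e.target ×ˢ univ) := fun a b =>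
    (((chartGeometry g he).smooth_G a b).of_le two_le_infty).comp contDiffOn_fst fun p hp => hp.1
  have hgr : ∀ a b, ContDiffOn ℝ 2 (fun p : Y[d] => gram g e p.1 a b) (e.target ×ˢ univ) := fun a b =>
    ((contDiffOn_gram g he a b).of_le two_le_infty).comp contDiffOn_fst fun p hp => hp.1
  refine ContDiffOn.congr (f := fun p : Y[d] => ∑ l, gramInv g e k l p.1 * ∑ a, ∑ b,
    tensComp e (fun x => σ x p.2) a i p.1 * tensComp e (fun x => σ x p.2) b l p.1 * gram g e p.1 a b) ?_
    fun p hp => (hd k i p.1 hp.1 p.2).deriv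
  exact ContDiffOn.sum fun l _ => (hG k l).mul (ContDiffOn.sum fun a _ => ContDiffOn.sum fun b _ =>
    ((hσ a i).mul (hσ b l)).mul (hgr a b))

/-- `H` is the coordinate expression of `h` on the phase space. -/
structure IsLift (e : OpenPartialHomeomorph M (Eu d)) (h : ℝ × M × ℝ → ℝ) (H : Den[d]) : Prop where
  dens : IsDensity H
  eq_zero : ∀ q : X[d], q ∉ phase e.target → H (q.1, q.2.1) q.2.2 = 0
  ae_eq : ∀ᵐ q : X[d], q ∈ phase e.target → H (q.1, q.2.1) q.2.2 = h (q.1, e.symm q.2.1, q.2.2)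

theorem measurableSet_phase {X : Type*} [MeasurableSpace X] {U : Set X} (hU : MeasurableSet U) :
    MeasurableSet (phase U) :=
  measurableSet_Ici.prod (hU.prod measurableSet_Ici)

theorem IsLift.integral_eq (hH : IsLift e h H) (c : X[d] → ℝ) :
    ∫ q in phase e.target, h (q.1, e.symm q.2.1, q.2.2) * c q = ∫ q : X[d], H (q.1, q.2.1) q.2.2 * c q := by
  rw [← setIntegral_eq_integral_of_forall_compl_eq_zero (s := phase e.target)
    (f := fun q : X[d] => H (q.1, q.2.1) q.2.2 * c q) fun q hq => by rw [hH.eq_zero q hq, zero_mul]]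
  refine setIntegral_congr_ae (measurableSet_phase e.open_target.measurableSet) ?_
  filter_upwards [hH.ae_eq] with q hq hqp
  rw [hq hqp]

theorem IsLift.integrable (hH : IsLift e h H) {c : X[d] → ℝ} (hc : Integrable c) :
    Integrable (fun q : X[d] => H (q.1, q.2.1) q.2.2 * c q) := by
  refine hc.bdd_mul (c := 1) (Measurable.aestronglyMeasurable ?_) (ae_of_all _ fun q => hH.dens.abs_le_one _ _)
  exact hH.dens.meas.comp (f := fun q : X[d] => ((q.1, q.2.1), q.2.2)) (by fun_prop)

theorem IsLift.distDt_eq (hH : IsLift e h H) (θ : X[d] → ℝ) :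
    distDt e h θ = - ∫ q : X[d], H (q.1, q.2.1) q.2.2 * opDt θ q :=
  congrArg Neg.neg (hH.integral_eq (opDt θ))

theorem IsLift.distDiv_eq (hH : IsLift e h H) (g : Metric d M) (f : VecFam d M) (θ : X[d] → ℝ) : distDiv g e f h θ
      = - ∫ q : X[d], H (q.1, q.2.1) q.2.2 * opDiv (sqrtDet g e) (fluxComp e f) θ q := by
  rw [← hH.integral_eq, distDiv]
  simp only [mul_assoc]
  rfl

theorem IsLift.distDivDiv_eq (hH : IsLift e h H) (g : Metric d M) (A : EndFam d M)
    (θ : X[d] → ℝ) : distDivDiv g e A h θ = ∫ q : X[d], H (q.1, q.2.1) q.2.2 *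
      opHess (gramInv g e) (christoffel g e) (sqrtDet g e) (diffComp e A) θ q := by
  rw [← hH.integral_eq, distDivDiv]
  simp only [mul_assoc]
  rfl

end Chart

section Representation

theorem integral_neg_sub_sub_add {α : Type*} [MeasurableSpace α] {μ : Measure α} {a b c l : α → ℝ}
    (ha : Integrable a μ) (hb : Integrable b μ) (hc : Integrable c μ) (hl : Integrable l μ) :
    ∫ x, (- a x - b x - c x + l x) ∂μ = - ∫ x, a x ∂μ + - ∫ x, b x ∂μ - ∫ x, c x ∂μ + ∫ x, l x ∂μ := by
  have h1 : Integrable (fun x => - a x) μ := ha.neg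
  have h2 : Integrable (fun x => - a x - b x) μ := h1.sub hb
  have h3 : Integrable (fun x => - a x - b x - c x) μ := h2.sub hc
  rw [integral_add h3 hl, integral_sub h2 hc, integral_sub h1 hb, integral_neg]
  ring

variable {H' : Den[d]} {φ : M → ℝ}

variable (e g A κ) in
/-- The regularisation of `Div Div (φ h A')`, in coordinates. -/
def regHess (ω1 : ℝ → ℝ) (ψ : Eu d → ℝ) (H : Den[d]) (ε δ : ℝ) (p : X[d]) : ℝ := ∫ q : X[d], H (q.1, q.2.1) q.2.2 *
    hessKernel (gramInv g e) (christoffel g e) (sqrtDet g e) (diffComp e A) κ ω1 ψ ε δ p q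

theorem regDivDiv_eq (hω : IsMollifierPair ω1 ω2) (hκ : ∀ x, κ.Φ x = ω1 x.1 * ∏ j, ω2 (x.2 j)) (hH : IsLift e h H) (hψφ : ∀ y ∈ e.target, ψ y = φ (e.symm y)) (p : ℝ × M × ℝ) :
    regDivDiv g ω1 ω2 e A φ h ε δ p = regHess κ e g A ω1 ψ H ε δ (p.1, e p.2.1, p.2.2) := by
  rw [regHess, ← hH.integral_eq, regDivDiv, regularize, distDivDiv]
  refine setIntegral_congr_fun (measurableSet_phase e.open_target.measurableSet) fun q hq => ?_
  rw [hessKernel, opHess, hψφ q.2.1 hq.2.1]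
  simp only [diffComp, mul_assoc, ← moll_eq_mollifier hω hκ]
  rw [mul_left_comm]
  rfl

theorem regFun_eq (hω : IsMollifierPair ω1 ω2) (hκ : ∀ x, κ.Φ x = ω1 x.1 * ∏ j, ω2 (x.2 j))
    (hH : IsLift e h H) (hψ : Continuous ψ) (hψφ : ∀ y ∈ e.target, ψ y = φ (e.symm y)) (hε : 0 < ε) (hδ : 0 < δ)
    (p : ℝ × M × ℝ) : regFun ω1 ω2 e φ h ε δ p = xiReg ω1 δ (kint kC[κ, ε, ψ] H) (p.1, e p.2.1) p.2.2 := by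
  rw [xiReg_kM_eq hω.smooth₁.continuous hω.compact₁ hε hδ hH.dens hψ (p.1, e p.2.1, p.2.2)]
  have h1 : ∀ q : X[d], ψ q.2.1 * H (q.1, q.2.1) q.2.2 * κ.moll ω1 ε δ (p.1 - q.1, e p.2.1 - q.2.1, p.2.2 - q.2.2)
      = H (q.1, q.2.1) q.2.2 * (ψ q.2.1 * κ.moll ω1 ε δ (p.1 - q.1, e p.2.1 - q.2.1, p.2.2 - q.2.2)) :=
    fun q => by ring
  simp only [h1]
  rw [← hH.integral_eq, regFun, regularize, distFun]
  refine setIntegral_congr_fun (measurableSet_phase e.open_target.measurableSet) fun q hq => ?_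
  simp only [hψφ q.2.1 hq.2.1, moll_eq_mollifier hω hκ]
  ring

variable [MeasurableSpace M] [BorelSpace M]

theorem regDxi_eq (hψφ : ∀ y ∈ e.target, ψ y = φ (e.symm y)) (m : Measure (ℝ × M × ℝ)) (p : ℝ × M × ℝ) :
    regDxi g ω1 ω2 e φ m ε δ p = distDxi g e m
      (fun q => ψ q.2.1 * mollifier ω1 ω2 ε δ (p.1 - q.1, e p.2.1 - q.2.1, p.2.2 - q.2.2)) := by
  rw [regDxi, regularize, distDxi, distDxi]
  congr 1
  refine setIntegral_congr_fun (measurableSet_phase e.open_source.measurableSet) fun q hq => ?_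
  simp only [overDensity, hψφ _ (e.map_source hq.2.1)]

variable (hcoeff : IsCoefficients g f A σ) (he : e ∈ 𝒜[d, M]) (hω : IsMollifierPair ω1 ω2)
  (hκ : ∀ x, κ.Φ x = ω1 x.1 * ∏ j, ω2 (x.2 j)) (hψ : ContDiff ℝ ∞ ψ) (hψc : HasCompactSupport ψ)
  (hψU : tsupport ψ ⊆ e.target) (hψφ : ∀ y ∈ e.target, ψ y = φ (e.symm y)) (hε : 0 < ε) (hδ : 0 < δ)

include hcoeff he hω hκ hψ hψc hψU hψφ hε hδ

theorem transport_ops_eq (hH : IsLift e h H) {p : X[d]} (hp1 : 0 ≤ p.1) (hp2 : 0 ≤ p.2.2) :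
    xiReg ω1 δ (κ.transport ε ψ (chartField[g, e, f, A] ψ) (chartPot[g, e, f, A] ψ) H) (p.1, p.2.1) p.2.2 =
    distDt e h (fun q => ψ q.2.1 * mollifier ω1 ω2 ε δ (p ⊖ q))
      + distDiv g e f h (fun q => ψ q.2.1 * mollifier ω1 ω2 ε δ (p ⊖ q))
      - distDivDiv g e A h (fun q => ψ q.2.1 * mollifier ω1 ω2 ε δ (p ⊖ q))
      + regHess κ e g A ω1 ψ H ε δ p := by
  have hg := chartGeometry g he
  have hc := chartCoefficients hcoeff he
  have hθ := isTest_mollifier hω hψ hψc hψU hε hδ hp1 hp2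
  have hs : tsupport (fun q : X[d] => ψ q.2.1 * mollifier ω1 ω2 ε δ (p ⊖ q)) ⊆ {q | q.2.1 ∈ e.target} :=
    fun q hq => (hθ.supp hq).2.1
  rw [transport_eq hg hc hψ hψU hω.smooth₁ hω.compact₁ hε hδ hψc hH.dens
    (fun x hx ξ => hH.eq_zero (x.1, x.2, ξ) fun h => hx h.2.1) p]
  rw [hH.distDt_eq, hH.distDiv_eq g f, hH.distDivDiv_eq g A, regHess]
  simp only [moll_eq_mollifier hω hκ] at hθ hs ⊢
  obtain ⟨c1, c2, c3⟩ := continuous_ops hg hc hθ.smooth hs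
  obtain ⟨s1, s2, s3⟩ := hasCompactSupport_ops (f := fluxComp e f) (G := gramInv g e)
    (Γ := christoffel g e) (w := sqrtDet g e) (D := diffComp e A) hθ.smooth hθ.compact
  have i1 := hH.integrable (c1.integrable_of_hasCompactSupport s1)
  have i2 := hH.integrable (c2.integrable_of_hasCompactSupport s2)
  have i3 := hH.integrable (c3.integrable_of_hasCompactSupport s3)
  have hk := continuous_hessKernel (κ := κ) (ε := ε) (δ := δ) hg hc hψ hψU hω.smooth₁
  obtain ⟨B, hB, hB0⟩ := exists_isCompact_hessKernel (G := gramInv g e) (Γ := christoffel g e)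
    (w := sqrtDet g e) (D := diffComp e A) (φ := ψ) (κ := κ) hω.compact₁ hε hδ
  have i4 := hH.integrable (Continuous.integrable_of_hasCompactSupport
    (hk.comp (continuous_const (y := p) |>.prodMk continuous_id))
    (HasCompactSupport.intro (hB.image (f := fun u => p - u) (by fun_prop)) fun q hq =>
      hB0 p q fun h => hq ⟨p - q, h, sub_sub_cancel p q⟩))
  refine Eq.trans ?_ (integral_neg_sub_sub_add i1 i2 i3 i4)
  refine integral_congr_fun fun q => ?_
  simp only [hessKernel]
  ring

theorem regDxi_add_regDivDiv (K : KineticTuple M) (hK : KineticEquation g f A K) (hH : IsLift e K.χ H)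
    {p : ℝ × M × ℝ} (hp1 : 0 ≤ p.1) (hp2 : 0 ≤ p.2.2) :
    regDxi g ω1 ω2 e φ (K.m + K.n) ε δ p + regHess κ e g A ω1 ψ H ε δ (p.1, e p.2.1, p.2.2)
    = xiReg ω1 δ (κ.transport ε ψ (chartField[g, e, f, A] ψ) (chartPot[g, e, f, A] ψ) H) (p.1, e p.2.1) p.2.2 := by
  rw [transport_ops_eq hcoeff he hω hκ hψ hψc hψU hψφ hε hδ hH (p := (p.1, e p.2.1, p.2.2)) hp1 hp2,
    hK e he _ (isTest_mollifier hω hψ hψc hψU hε hδ (p := (p.1, e p.2.1, p.2.2)) hp1 hp2), regDxi_eq hψφ,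
    add_comm K.m K.n]
  ring

theorem neg_regDxi_add_regDivDiv (K : KineticTuple M) (hK : KineticEquation g f A K) (hH : IsLift e K.χ H)
    (hH' : IsLift e (fun p => 1 - K.χ p) H') {p : ℝ × M × ℝ} (hp1 : 0 ≤ p.1) (hp2 : 0 ≤ p.2.2) :
    - regDxi g ω1 ω2 e φ (K.m + K.n) ε δ p + regHess κ e g A ω1 ψ H' ε δ (p.1, e p.2.1, p.2.2)
    = xiReg ω1 δ (κ.transport ε ψ (chartField[g, e, f, A] ψ) (chartPot[g, e, f, A] ψ) H') (p.1, e p.2.1) p.2.2 := by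
  have hg := chartGeometry g he
  have hc := chartCoefficients hcoeff he
  have hθ := isTest_mollifier hω hψ hψc hψU hε hδ (p := (p.1, e p.2.1, p.2.2)) hp1 hp2
  rw [transport_ops_eq hcoeff he hω hκ hψ hψc hψU hψφ hε hδ hH' (p := (p.1, e p.2.1, p.2.2)) hp1 hp2,
    regDxi_eq hψφ, add_comm K.m K.n]
  have h1 := hK e he _ hθ
  set θ : X[d] → ℝ := fun q => ψ q.2.1 * mollifier ω1 ω2 ε δ (p.1 - q.1, e p.2.1 - q.2.1, p.2.2 - q.2.2)
  have hs : tsupport θ ⊆ {q | q.2.1 ∈ e.target} := fun q hq => (hθ.supp hq).2.1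
  obtain ⟨c1, c2, c3⟩ := continuous_ops hg hc hθ.smooth hs
  obtain ⟨s1, s2, s3⟩ := hasCompactSupport_ops (f := fluxComp e f) (G := gramInv g e)
    (Γ := christoffel g e) (w := sqrtDet g e) (D := diffComp e A) hθ.smooth hθ.compact
  obtain ⟨z1, z2⟩ := integral_ops_eq_zero hg hc hθ.smooth hθ.compact hs
  have hsum : ∀ c : X[d] → ℝ, Integrable c → (∀ q ∉ tsupport θ, c q = 0) → ∫ q : X[d], H' (q.1, q.2.1) q.2.2 * c q
        = (∫ q, c q) - ∫ q : X[d], H (q.1, q.2.1) q.2.2 * c q := by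
    intro c hci hc0
    rw [← integral_sub hci (hH.integrable hci)]
    refine integral_congr_ae ?_
    filter_upwards [hH.ae_eq, hH'.ae_eq] with q h1 h2
    by_cases hq : q ∈ tsupport θ
    · have h3 := hθ.supp hq
      have h4 : q ∈ phase e.target := ⟨(mem_Ioi.1 h3.1).le, h3.2.1, (mem_Ioi.1 h3.2.2).le⟩
      rw [h1 h4, h2 h4]
      ring
    · simp [hc0 q hq]
  have i2 : Integrable _ vol[X[d]] := c2.integrable_of_hasCompactSupport s2
  have i3 : Integrable _ vol[X[d]] := c3.integrable_of_hasCompactSupport s3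
  have o1 : ∀ q ∉ tsupport θ, opDt θ q = 0 := fun q hq => by
    rw [hasDerivAt_opDt hθ.smooth, eq_zero_off_tsupport
      (fun h => hq (tsupport_fderiv_subset ℝ h) : q ∉ tsupport (fderiv ℝ θ))]
    simp
  have e1 := hsum _ (c1.integrable_of_hasCompactSupport s1) o1
  have e2 := hsum _ i2 fun q hq => opDiv_eq_zero hq
  have e3 := hsum _ i3 fun q hq => opHess_eq_zero hq
  rw [integral_add i2 i3] at z2
  rw [hH.distDt_eq, hH.distDiv_eq g f, hH.distDivDiv_eq g A] at h1
  rw [hH'.distDt_eq, hH'.distDiv_eq g f, hH'.distDivDiv_eq g A]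
  linarith

end Representation

/-! ### The Riemannian measure -/

section Measure

variable {e' : OpenPartialHomeomorph M (Eu d)} (g)

theorem differentiableAt_transition (he : e ∈ 𝒜[d, M])
    (he' : e' ∈ 𝒜[d, M]) (hy : y ∈ e'.target) (hys : e'.symm y ∈ e.source) :
    DifferentiableAt ℝ (e ∘ e'.symm) y := by
  have h1 : MDifferentiableAt (𝓡 d) (𝓡 d) e (e'.symm y) :=
    (contMDiffAt_of_mem_maximalAtlas he hys).mdifferentiableAt (by simp)
  have h2 : MDifferentiableAt (𝓡 d) (𝓡 d) e'.symm y :=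
    (contMDiffAt_symm_of_mem_maximalAtlas he' hy).mdifferentiableAt (by simp)
  exact mdifferentiableAt_iff_differentiableAt.1 (h1.comp y h2)

theorem coordVec_transition (he : e ∈ 𝒜[d, M]) (he' : e' ∈ 𝒜[d, M]) (hy : y ∈ e'.target) (hys : e'.symm y ∈ e.source)
    (i : Fin d) : (coordVec e' i y : Eu d)
      = ∑ k, fderiv ℝ (e ∘ e'.symm) y (stdVec i) k • (coordVec e k (e (e'.symm y)) : Eu d) := by
  have h1 : MDifferentiableAt (𝓡 d) (𝓡 d) (e ∘ e'.symm) y :=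
    (differentiableAt_transition he he' hy hys).mdifferentiableAt
  have h2 : MDifferentiableAt (𝓡 d) (𝓡 d) e.symm ((e ∘ e'.symm) y) :=
    (contMDiffAt_symm_of_mem_maximalAtlas he (e.map_source hys)).mdifferentiableAt (by simp)
  have h3 : e'.symm =ᶠ[𝓝 y] e.symm ∘ (e ∘ e'.symm) := by
    have h4 := (e'.continuousAt_symm hy).preimage_mem_nhds (e.open_source.mem_nhds hys)
    filter_upwards [h4] with z hz using (e.left_inv hz).symm
  let T : Eu d →L[ℝ] Eu d := mfderiv (𝓡 d) (𝓡 d) e.symm (e (e'.symm y))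
  have h5 : (coordVec e' i y : Eu d) = T (fderiv ℝ (e ∘ e'.symm) y (stdVec i)) := by
    have h6 : (mfderiv (𝓡 d) (𝓡 d) e'.symm y : Eu d →L[ℝ] Eu d)
        = mfderiv (𝓡 d) (𝓡 d) (e.symm ∘ (e ∘ e'.symm)) y := h3.mfderiv_eq
    have h7 := mfderiv_comp_apply y h2 h1 (stdVec i)
    rw [mfderiv_eq_fderiv] at h7
    exact (congrArg (fun L : Eu d →L[ℝ] Eu d => L (stdVec i)) h6).trans h7
  rw [h5]
  conv_lhs => rw [sum_stdVec (fderiv ℝ (e ∘ e'.symm) y (stdVec i)), map_sum]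
  exact sum_congr rfl fun k _ => T.map_smul _ _

theorem inner_congr_point {x x' : M} (h : x = x') (u v : Eu d) :
    (g.inner x : Eu d →L[ℝ] Eu d →L[ℝ] ℝ) u v = (g.inner x' : Eu d →L[ℝ] Eu d →L[ℝ] ℝ) u v := by
  subst h
  rfl

theorem sqrtDet_transition (he : e ∈ 𝒜[d, M]) (he' : e' ∈ 𝒜[d, M]) (hy : y ∈ e'.target) (hys : e'.symm y ∈ e.source) :
    sqrtDet g e' y = |(fderiv ℝ (e ∘ e'.symm) y).det| * sqrtDet g e (e (e'.symm y)) := by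
  set T := fderiv ℝ (e ∘ e'.symm) y with hT
  set z := e (e'.symm y) with hz
  set J : Matrix (Fin d) (Fin d) ℝ := Matrix.of fun k i => T (stdVec i) k with hJ
  have hJdet : J.det = T.det := by
    have h1 : J = LinearMap.toMatrix (EuclideanSpace.basisFun (Fin d) ℝ).toBasis
        (EuclideanSpace.basisFun (Fin d) ℝ).toBasis (T : Eu d →ₗ[ℝ] Eu d) := by
      ext k i
      simp [LinearMap.toMatrix_apply, hJ, stdVec]
    rw [h1, LinearMap.det_toMatrix]
  have hgr : gram g e' y = J.transpose * gram g e z * J := by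
    ext i j
    have h1 := coordVec_transition he he' hy hys
    let B : Eu d →L[ℝ] Eu d →L[ℝ] ℝ := g.inner (e.symm z)
    let c : Fin d → Eu d := fun k => coordVec e k z
    let G : Fin d → Fin d → ℝ := fun k l => B (c k) (c l)
    have h2 : gram g e' y i j = B (coordVec e' i y : Eu d) (coordVec e' j y : Eu d) :=
      inner_congr_point g (e.left_inv hys).symm _ _
    have h3 : gram g e' y i j = B (∑ k, J k i • c k) (∑ l, J l j • c l) :=
      h2.trans ((congrArg (fun v : Eu d => B v (coordVec e' j y : Eu d)) (h1 i)).trans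
        (congrArg (fun v : Eu d => B (∑ k, J k i • c k) v) (h1 j)))
    have h4 : B (∑ k, J k i • c k) (∑ l, J l j • c l) = ∑ l, (∑ k, J k i * G k l) * J l j := by
      simp only [map_sum, map_smul, FunLike.coe_sum, FunLike.coe_smul, Finset.sum_apply, Pi.smul_apply, smul_eq_mul, sum_mul, mul_sum, G]
      refine sum_congr rfl fun l _ => sum_congr rfl fun k _ => ?_
      ring
    rw [h3, h4]
    simp only [Matrix.mul_apply, Matrix.transpose_apply]
    rfl
  rw [sqrtDet, sqrtDet, hgr, Matrix.det_mul, Matrix.det_mul, Matrix.det_transpose, hJdet,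
    show T.det * (gram g e z).det * T.det = T.det ^ 2 * (gram g e z).det by ring, abs_mul, abs_pow,
    Real.sqrt_mul (by positivity), Real.sqrt_sq (abs_nonneg _)]

variable [MeasurableSpace M] [BorelSpace M]

/-- The Riemannian measure in the coordinates of the chart `e`. -/
def chartMeasure (e : OpenPartialHomeomorph M (Eu d)) : Measure (Eu d) :=
  (volume.restrict e.target).withDensity (fun y => ENNReal.ofReal (sqrtDet g e y))

theorem aemeasurable_sqrtDet (he : e ∈ 𝒜[d, M]) :
    AEMeasurable (fun y => ENNReal.ofReal (sqrtDet g e y)) (volume.restrict e.target) :=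
  ((chartGeometry g he).smooth_w.continuousOn.aemeasurable e.open_target.measurableSet).ennreal_ofReal

theorem ae_chartMeasure : ∀ᵐ y ∂(chartMeasure g e), y ∈ e.target :=
  (withDensity_absolutelyContinuous _ _).ae_le (ae_restrict_mem e.open_target.measurableSet)

theorem aemeasurable_symm : AEMeasurable e.symm (chartMeasure g e) :=
  (e.continuousOn_symm.aemeasurable e.open_target.measurableSet).mono_ac (withDensity_absolutelyContinuous _ _)

theorem measurableSet_target_inter {S : Set M} (hS : MeasurableSet S) : MeasurableSet (e.target ∩ e.symm ⁻¹' S) := by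
  have h1 := (continuousOn_iff_continuous_domRestrict.1 e.continuousOn_symm).measurable hS
  have h2 := e.open_target.measurableSet.subtype_image h1
  rwa [domRestrict_eq, preimage_comp, Subtype.image_preimage_coe] at h2

theorem map_symm_restrict_le (he : e ∈ 𝒜[d, M]) (he' : e' ∈ 𝒜[d, M]) :
    (Measure.map e'.symm (chartMeasure g e')).restrict e.source ≤ Measure.map e.symm (chartMeasure g e) := by
  refine Measure.le_iff.2 fun S hS => ?_
  have hSs := hS.inter e.open_source.measurableSet
  rw [restrict_apply hS, map_apply_of_aemeasurable (aemeasurable_symm g) hSs,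
    map_apply_of_aemeasurable (aemeasurable_symm g) hS]
  set B : Set (Eu d) := e'.target ∩ e'.symm ⁻¹' (S ∩ e.source)
  have hB : MeasurableSet B := measurableSet_target_inter hSs
  have hB2 : MeasurableSet (e.target ∩ e.symm ⁻¹' S) := measurableSet_target_inter hS
  have h1 : chartMeasure g e' (e'.symm ⁻¹' (S ∩ e.source)) = chartMeasure g e' B := by
    refine measure_congr ?_
    filter_upwards [ae_chartMeasure g (e := e')] with y hy
    exact propext ⟨fun h => ⟨hy, h⟩, fun h => h.2⟩
  have h2 : chartMeasure g e (e.symm ⁻¹' S) = chartMeasure g e (e.target ∩ e.symm ⁻¹' S) := by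
    refine measure_congr ?_
    filter_upwards [ae_chartMeasure g (e := e)] with y hy
    exact propext ⟨fun h => ⟨hy, h⟩, fun h => h.2⟩
  rw [h1, h2, chartMeasure, chartMeasure, withDensity_apply _ hB, withDensity_apply _ hB2,
    restrict_restrict hB, restrict_restrict hB2, inter_eq_left.2 inter_subset_left,
    inter_eq_left.2 inter_subset_left]
  have hinj : InjOn (e ∘ e'.symm) B := fun a ha b hb hab => e'.symm.injOn ha.1 hb.1 (e.injOn ha.2.2 hb.2.2 hab)
  calc ∫⁻ y in B, ENNReal.ofReal (sqrtDet g e' y)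
      = ∫⁻ y in B, ENNReal.ofReal |(fderiv ℝ (e ∘ e'.symm) y).det|
          * ENNReal.ofReal (sqrtDet g e ((e ∘ e'.symm) y)) := by
        refine setLIntegral_congr_fun hB fun y hy => ?_
        simp only [Function.comp_apply]
        rw [sqrtDet_transition g he he' hy.1 hy.2.2, ENNReal.ofReal_mul (abs_nonneg _)]
    _ = ∫⁻ y in (e ∘ e'.symm) '' B, ENNReal.ofReal (sqrtDet g e y) :=
        (lintegral_image_eq_lintegral_abs_det_fderiv_mul volume hB (fun y hy =>
          (differentiableAt_transition he he' hy.1 hy.2.2).hasFDerivAt.hasFDerivWithinAt) hinj (fun y => ENNReal.ofReal (sqrtDet g e y))).symm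
    _ ≤ _ := by
        refine lintegral_mono_set ?_
        rintro _ ⟨y, hy, rfl⟩
        refine ⟨e.map_source hy.2.2, ?_⟩
        simp only [mem_preimage, Function.comp_apply, e.left_inv hy.2.2]
        exact hy.2.1

theorem riemMeasure_restrict (he : e ∈ 𝒜[d, M]) :
    (riemMeasure g).restrict e.source = Measure.map e.symm (chartMeasure g e) := by
  have h1 : (Measure.map e.symm (chartMeasure g e)).restrict e.source = Measure.map e.symm (chartMeasure g e) := by
    refine Measure.restrict_eq_self_of_ae_mem ?_
    refine (ae_map_iff (aemeasurable_symm g) e.open_source.measurableSet).2 ?_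
    filter_upwards [ae_chartMeasure g (e := e)] with y hy using e.map_target hy
  refine le_antisymm ?_ ?_
  · have h2 : riemMeasure g ≤ Measure.map e.symm (chartMeasure g e) + (riemMeasure g).restrict e.sourceᶜ := by
      refine iSup₂_le fun e' he' => ?_
      have h3 : Measure.map e'.symm (chartMeasure g e') ≤ riemMeasure g :=
        le_iSup₂ (f := fun (e : OpenPartialHomeomorph M (Eu d)) (_ : e ∈ 𝒜[d, M]) =>
          Measure.map e.symm (chartMeasure g e)) e' he'
      calc Measure.map e'.symm (chartMeasure g e')
          = (Measure.map e'.symm (chartMeasure g e')).restrict e.source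
            + (Measure.map e'.symm (chartMeasure g e')).restrict e.sourceᶜ :=
            (Measure.restrict_add_restrict_compl e.open_source.measurableSet).symm
        _ ≤ _ := add_le_add (map_symm_restrict_le g he he') (restrict_mono_measure h3 _)
    calc (riemMeasure g).restrict e.source
        ≤ (Measure.map e.symm (chartMeasure g e) + (riemMeasure g).restrict e.sourceᶜ).restrict e.source :=
          restrict_mono_measure h2 _
      _ = Measure.map e.symm (chartMeasure g e) := by
          rw [Measure.restrict_add, h1, restrict_restrict e.open_source.measurableSet, inter_compl_self,
            Measure.restrict_empty, add_zero]
  · rw [← h1]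
    exact restrict_mono_measure (le_iSup₂ (f := fun (e : OpenPartialHomeomorph M (Eu d))
      (_ : e ∈ 𝒜[d, M]) => Measure.map e.symm (chartMeasure g e)) e he) _

open Classical in
/-- A measurable extension of the chart `e`. -/
def chartExt (e : OpenPartialHomeomorph M (Eu d)) : M → Eu d := e.source.piecewise e (fun _ => 0)

open Classical in
theorem chartExt_eq {x : M} (hx : x ∈ e.source) : chartExt e x = e x := piecewise_eq_of_mem _ _ _ hx

open Classical in
theorem measurePreserving_chartExt (he : e ∈ 𝒜[d, M]) :
    MeasurePreserving (chartExt e) ((riemMeasure g).restrict e.source) (chartMeasure g e) := by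
  have hm : Measurable (chartExt e) := by
    unfold chartExt
    exact e.continuousOn.measurable_piecewise continuousOn_const e.open_source.measurableSet
  refine ⟨hm, ?_⟩
  rw [riemMeasure_restrict g he, AEMeasurable.map_map_of_aemeasurable hm.aemeasurable (aemeasurable_symm g)]
  refine (Measure.map_congr ?_).trans Measure.map_id
  filter_upwards [ae_chartMeasure g (e := e)] with y hy
  rw [Function.comp_apply, chartExt_eq (e.map_target hy), e.right_inv hy, id]

theorem isLocallyFiniteMeasure_riemMeasure : IsLocallyFiniteMeasure (riemMeasure g) := by
  refine ⟨fun x => ?_⟩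
  have he := IsManifold.chart_mem_maximalAtlas (I := 𝓡 d) (n := ∞) x
  set e := chartAt (Eu d) x
  have hx : x ∈ e.source := mem_chart_source _ x
  obtain ⟨r, hr, hrt⟩ := Metric.nhds_basis_closedBall.mem_iff.1 (e.open_target.mem_nhds (e.map_source hx))
  refine ⟨e.source ∩ e ⁻¹' closedBall (e x) r, ?_, ?_⟩
  · exact Filter.inter_mem (e.open_source.mem_nhds hx)
      ((e.continuousAt hx).preimage_mem_nhds (Metric.closedBall_mem_nhds _ hr))
  · have h1 := (measurePreserving_chartExt g he).measure_preimage
      (isClosed_closedBall (x := e x) (ε := r)).measurableSet.nullMeasurableSet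
    have h2 : (riemMeasure g) (e.source ∩ e ⁻¹' closedBall (e x) r) ≤ chartMeasure g e (closedBall (e x) r) := by
      rw [← h1, restrict_apply ((measurePreserving_chartExt g he).measurable
        (isClosed_closedBall (x := e x) (ε := r)).measurableSet)]
      refine measure_mono fun z hz => ⟨?_, hz.1⟩
      rw [mem_preimage, chartExt_eq hz.1]
      exact hz.2
    refine h2.trans_lt ?_
    rw [chartMeasure, withDensity_apply _ (isClosed_closedBall).measurableSet,
      restrict_restrict (isClosed_closedBall).measurableSet, inter_eq_left.2 hrt]
    obtain ⟨C, hC⟩ := (isCompact_closedBall (e x) r).exists_bound_of_continuousOn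
      ((chartGeometry g he).smooth_w.continuousOn.mono hrt)
    refine (setLIntegral_mono measurable_const fun y hy => ENNReal.ofReal_le_ofReal
      ((le_abs_self _).trans (hC y hy))).trans_lt ?_
    rw [setLIntegral_const]
    exact ENNReal.mul_lt_top ENNReal.ofReal_lt_top (isCompact_closedBall _ _).measure_lt_top

end Measure

variable [CompactSpace M] [MeasurableSpace M] [BorelSpace M]

section Transfer

theorem integral_comp_of_withDensity {α β : Type*} [MeasurableSpace α] [MeasurableSpace β] {Ψ : α → β}
    {μ : Measure α} {ν : Measure β} {w : β → ℝ}
    (hΨ : MeasurePreserving Ψ μ (ν.withDensity fun y => ENNReal.ofReal (w y))) (hw : AEMeasurable w ν)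
    (hw0 : ∀ᵐ y ∂ν, 0 ≤ w y) {F : β → ℝ} (hF : AEStronglyMeasurable F ν) :
    ∫ x, F (Ψ x) ∂μ = ∫ y, w y * F y ∂ν := by
  have h1 : AEStronglyMeasurable F (Measure.map Ψ μ) := by
    rw [hΨ.map_eq]
    exact hF.mono_ac (withDensity_absolutelyContinuous _ _)
  rw [← integral_map hΨ.aemeasurable h1, hΨ.map_eq, integral_withDensity_eq_integral_toReal_smul₀ hw.ennreal_ofReal
    (ae_of_all _ fun _ => ENNReal.ofReal_lt_top)]
  refine integral_congr_ae ?_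
  filter_upwards [hw0] with y hy
  rw [ENNReal.toReal_ofReal hy, smul_eq_mul]

variable (g)

instance isFiniteMeasure_riemMeasure : IsFiniteMeasure (riemMeasure g) := by
  have := isLocallyFiniteMeasure_riemMeasure g
  exact CompactSpace.isFiniteMeasure

variable (he : e ∈ 𝒜[d, M])

include he

theorem aemeasurable_sqrtDet_fst (I : Set ℝ) : AEMeasurable (fun z : Y[d] => sqrtDet g e z.1)
    (volume.restrict (e.target ×ˢ I)) := by
  rw [volume_eq_prod, ← prod_restrict]
  exact ((chartGeometry g he).smooth_w.continuousOn.aemeasurable e.open_target.measurableSet).comp_fst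

theorem measurePreserving_chart_section (I : Set ℝ) :
    MeasurePreserving (Prod.map (chartExt e) id) (μξ[g].restrict (e.source ×ˢ I))
      ((vol[Y[d]].restrict (e.target ×ˢ I)).withDensity fun z => ENNReal.ofReal (sqrtDet g e z.1)) := by
  have h := (measurePreserving_chartExt g he).prod (MeasurePreserving.id (vol[ℝ].restrict I))
  rw [chartMeasure, prod_withDensity_left₀ (aemeasurable_sqrtDet g he), prod_restrict, prod_restrict] at h
  exact h

theorem measurePreserving_chart (J I : Set ℝ) :
    MeasurePreserving (Prod.map id (Prod.map (chartExt e) id)) ((kinMeasure g).restrict (J ×ˢ e.source ×ˢ I))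
      ((vol[X[d]].restrict (J ×ˢ e.target ×ˢ I)).withDensity fun q => ENNReal.ofReal (sqrtDet g e q.2.1)) := by
  have h := (MeasurePreserving.id (vol[ℝ].restrict J)).prod (measurePreserving_chart_section g he I)
  rw [prod_withDensity_right₀ (aemeasurable_sqrtDet_fst g he I).ennreal_ofReal, prod_restrict, prod_restrict] at h
  exact h

theorem aemeasurable_sqrtDet_snd (J : Set ℝ) {I : Set ℝ} :
    AEMeasurable (fun q : X[d] => sqrtDet g e q.2.1) (volume.restrict (J ×ˢ e.target ×ˢ I)) := by
  rw [volume_eq_prod, ← prod_restrict]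
  exact (aemeasurable_sqrtDet_fst g he I).comp_snd

theorem setIntegral_chart_section {I : Set ℝ} (hI : MeasurableSet I) {F : Y[d] → ℝ}
    (hF : AEStronglyMeasurable F (volume.restrict (e.target ×ˢ I))) :
    ∫ z in e.source ×ˢ I, F (e z.1, z.2) ∂μξ[g] = ∫ z in e.target ×ˢ I, sqrtDet g e z.1 * F z := by
  have h := integral_comp_of_withDensity (measurePreserving_chart_section g he I)
    (aemeasurable_sqrtDet_fst g he I) (ae_of_all _ fun z => Real.sqrt_nonneg _) hF
  rw [← h]
  refine setIntegral_congr_fun (e.open_source.measurableSet.prod hI) fun z hz => ?_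
  simp only [Prod.map, chartExt_eq hz.1, id]

theorem setIntegral_chart {J I : Set ℝ} (hJ : MeasurableSet J) (hI : MeasurableSet I) {F : X[d] → ℝ}
    (hF : AEStronglyMeasurable F (volume.restrict (J ×ˢ e.target ×ˢ I))) :
    ∫ p in J ×ˢ e.source ×ˢ I, F (p.1, e p.2.1, p.2.2) ∂(kinMeasure g)
      = ∫ q in J ×ˢ e.target ×ˢ I, sqrtDet g e q.2.1 * F q := by
  have h := integral_comp_of_withDensity (measurePreserving_chart g he J I)
    (aemeasurable_sqrtDet_snd g he J) (ae_of_all _ fun z => Real.sqrt_nonneg _) hF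
  rw [← h]
  refine setIntegral_congr_fun (hJ.prod (e.open_source.measurableSet.prod hI)) fun z hz => ?_
  simp only [Prod.map, chartExt_eq hz.2.1, id]

/-- Lebesgue measure on the coordinate phase space is absolutely continuous with respect to `dt dμ dξ`. -/
theorem volume_absolutelyContinuous_withDensity {J I : Set ℝ} (hJ : MeasurableSet J) (hI : MeasurableSet I) :
    vol[X[d]].restrict (J ×ˢ e.target ×ˢ I) ≪ (vol[X[d]].restrict (J ×ˢ e.target ×ˢ I)).withDensity
        fun q => ENNReal.ofReal (sqrtDet g e q.2.1) := by
  refine withDensity_absolutelyContinuous' (aemeasurable_sqrtDet_snd g he J).ennreal_ofReal ?_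
  filter_upwards [ae_restrict_mem (hJ.prod (e.open_target.measurableSet.prod hI))] with q hq
  exact (ENNReal.ofReal_pos.2 ((chartGeometry g he).pos _ hq.2.1)).ne'

theorem map_symm_withDensity {J I : Set ℝ} (hJ : MeasurableSet J) (hI : MeasurableSet I) :
    AEMeasurable (fun q : X[d] => (q.1, e.symm q.2.1, q.2.2)) (volume.restrict (J ×ˢ e.target ×ˢ I)) ∧
    Measure.map (fun q : X[d] => (q.1, e.symm q.2.1, q.2.2)) ((vol[X[d]].restrict (J ×ˢ e.target ×ˢ I)).withDensity
        fun q => ENNReal.ofReal (sqrtDet g e q.2.1)) = (kinMeasure g).restrict (J ×ˢ e.source ×ˢ I) := by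
  have hS := hJ.prod (e.open_target.measurableSet.prod hI)
  have h1 : AEMeasurable (fun q : X[d] => e.symm q.2.1) (volume.restrict (J ×ˢ e.target ×ˢ I)) :=
    ContinuousOn.aemeasurable (e.continuousOn_symm.comp (by fun_prop) fun q hq => hq.2.1) hS
  have h2 : AEMeasurable (fun q : X[d] => (q.1, e.symm q.2.1, q.2.2)) (volume.restrict (J ×ˢ e.target ×ˢ I)) :=
    measurable_fst.aemeasurable.prodMk (h1.prodMk measurable_snd.snd.aemeasurable)
  refine ⟨h2, ?_⟩
  have hΨ := measurePreserving_chart g he J I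
  rw [← hΨ.map_eq, AEMeasurable.map_map_of_aemeasurable _ hΨ.aemeasurable]
  · refine (Measure.map_congr ?_).trans Measure.map_id
    filter_upwards [ae_restrict_mem (hJ.prod (e.open_source.measurableSet.prod hI))] with p hp
    simp only [Function.comp_apply, Prod.map, id, chartExt_eq hp.2.1, e.left_inv hp.2.1]
  · rw [hΨ.map_eq]
    exact h2.mono_ac (withDensity_absolutelyContinuous _ _)

theorem map_symm_absolutelyContinuous {J I : Set ℝ} (hJ : MeasurableSet J) (hI : MeasurableSet I) :
    Measure.map (fun q : X[d] => (q.1, e.symm q.2.1, q.2.2)) (vol[X[d]].restrict (J ×ˢ e.target ×ˢ I))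
      ≪ (kinMeasure g).restrict (J ×ˢ e.source ×ˢ I) := by
  obtain ⟨h1, h2⟩ := map_symm_withDensity g he hJ hI
  rw [← h2]
  refine Measure.AbsolutelyContinuous.mk fun S hS h0 => ?_
  rw [map_apply_of_aemeasurable (h1.mono_ac (withDensity_absolutelyContinuous _ _)) hS] at h0
  rw [map_apply_of_aemeasurable h1 hS]
  exact volume_absolutelyContinuous_withDensity g he hJ hI h0

end Transfer

section Lift

variable {h' : ℝ × M × ℝ → ℝ} {H' : Den[d]}

theorem exists_isLift (he : e ∈ 𝒜[d, M]) (hm : AEMeasurable h ((kinMeasure g).restrict (phase univ)))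
    (h01 : ∀ p ∈ phase (univ : Set M), h p ∈ Icc 0 1) {Z : Set ℝ} (hZ : MeasurableSet Z)
    (hZ0 : ∀ p ∈ phase (univ : Set M), p.2.2 ∈ Z → h p = 0) :
    ∃ H, IsLift e h H ∧ ∀ x, ∀ ξ ∈ Z, H x ξ = 0 := by
  obtain ⟨h1, -⟩ := map_symm_withDensity g he (measurableSet_Ici (a := 0)) (measurableSet_Ici (a := 0))
  have hsub : phase e.source ⊆ phase (univ : Set M) := prod_mono_right (prod_mono_left (subset_univ _))
  have h2 : AEMeasurable (fun q : X[d] => h (q.1, e.symm q.2.1, q.2.2)) (volume.restrict (phase e.target)) :=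
    AEMeasurable.comp_aemeasurable ((hm.mono_measure (restrict_mono_set _ hsub)).mono_ac
      (map_symm_absolutelyContinuous g he measurableSet_Ici measurableSet_Ici)) h1
  have hP := measurableSet_phase e.open_target.measurableSet
  have hPZ : MeasurableSet (phase e.target ∩ {q : X[d] | q.2.2 ∈ Zᶜ}) := hP.inter (measurable_snd.snd hZ.compl)
  set k : X[d] → ℝ := (phase e.target ∩ {q | q.2.2 ∈ Zᶜ}).indicator fun q => max 0 (min 1 (h2.mk _ q)) with hk
  have hkm : Measurable k := ((measurable_const.max (measurable_const.min h2.measurable_mk))).indicator hPZ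
  refine ⟨fun x ξ => k (x.1, x.2, ξ), ⟨⟨hkm.comp (f := fun z : TX d × ℝ => (z.1.1, z.1.2, z.2)) (by fun_prop),
    fun x ξ => ?_, fun x ξ => ?_⟩, fun q hq => ?_, ?_⟩, fun x ξ hξ => ?_⟩
  · exact indicator_nonneg (fun _ _ => le_max_left _ _) _
  · exact indicator_le' (fun _ _ => max_le zero_le_one (min_le_left _ _)) (fun _ _ => zero_le_one) _
  · exact indicator_of_notMem (fun h => hq h.1) _
  · filter_upwards [(ae_restrict_iff' hP).1 h2.ae_eq_mk] with q hq hqp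
    have hp : (q.1, e.symm q.2.1, q.2.2) ∈ phase (univ : Set M) := ⟨hqp.1, mem_univ _, hqp.2.2⟩
    by_cases hz : q.2.2 ∈ Z
    · rw [hZ0 _ hp hz]
      exact indicator_of_notMem (fun h => h.2 hz) _
    · have hmem : q ∈ phase e.target ∩ {q : X[d] | q.2.2 ∈ Zᶜ} := ⟨hqp, hz⟩
      refine (indicator_of_mem hmem _).trans ?_
      rw [← hq hqp, min_eq_right (h01 _ hp).2, max_eq_right (h01 _ hp).1]
  · exact indicator_of_notMem (fun h => h.2 hξ) _

theorem IsLift.ae_section (hH : IsLift e h H) : ∀ᵐ x : TX d, ∀ᵐ ξ : ℝ, (x.1, x.2, ξ) ∈ phase e.target →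
    H x ξ = h (x.1, e.symm x.2, ξ) := by
  have h1 := (measurePreserving_prodAssoc vol[ℝ] vol[Eu d] vol[ℝ]).quasiMeasurePreserving.ae hH.ae_eq
  exact ae_ae_of_ae_prod h1

theorem IsLift.oppositelyMonotone (hH : IsLift e h H) (hH' : IsLift e h' H')
    (h01 : ∀ p ∈ phase (univ : Set M), h p ∈ Icc 0 1)
    (h01' : ∀ p ∈ phase (univ : Set M), h' p ∈ Icc 0 1)
    (ha : ∀ t ≥ 0, ∀ x : M, AntitoneOn (fun ξ => h (t, x, ξ)) (Ici 0))
    (ha' : ∀ t ≥ 0, ∀ x : M, MonotoneOn (fun ξ => h' (t, x, ξ)) (Ici 0)) : OppositelyMonotone R H H' := by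
  have h1 : ∀ᵐ z ∂(vol[TX d].prod vol[TX d]), _ := (quasiMeasurePreserving_fst).ae hH.ae_section
  have h2 : ∀ᵐ z ∂(vol[TX d].prod vol[TX d]), _ := (quasiMeasurePreserving_snd).ae hH'.ae_section
  filter_upwards [h1, h2] with z h1 h2 b b' η hη hb hb' hbη
  by_cases hz : (0 ≤ z.1.1 ∧ z.1.2 ∈ e.target) ∧ (0 ≤ z.2.1 ∧ z.2.2 ∈ e.target)
  · obtain ⟨⟨c1, c2⟩, c3, c4⟩ := hz
    have h3 : ∫ ξ in Icc 0 R, H z.1 ξ * H' z.2 ξ * b' ξ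
        = ∫ ξ in Icc 0 R, h (z.1.1, e.symm z.1.2, ξ) * h' (z.2.1, e.symm z.2.2, ξ) * b' ξ := by
      refine setIntegral_congr_ae measurableSet_Icc ?_
      filter_upwards [h1, h2] with ξ k1 k2 hξ
      rw [k1 ⟨c1, c2, hξ.1⟩, k2 ⟨c3, c4, hξ.1⟩]
    rw [h3]
    exact abs_setIntegral_monotone_mul_deriv_le hη ((ha _ c1 _).mono Icc_subset_Ici_self)
      ((ha' _ c3 _).mono Icc_subset_Ici_self) (fun ξ hξ => h01 _ ⟨c1, mem_univ _, hξ.1⟩)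
      (fun ξ hξ => h01' _ ⟨c3, mem_univ _, hξ.1⟩) hb hb' hbη
  · have h3 : ∀ ξ, H z.1 ξ * H' z.2 ξ = 0 := fun ξ => by
      rcases not_and_or.1 hz with h | h
      · rw [hH.eq_zero (z.1.1, z.1.2, ξ) fun k => h ⟨k.1, k.2.1⟩, zero_mul]
      · rw [hH'.eq_zero (z.2.1, z.2.2, ξ) fun k => h ⟨k.1, k.2.1⟩, mul_zero]
    simp only [h3, zero_mul, integral_zero, abs_zero]
    linarith

end Lift

/-! ### The bracket in coordinates -/

section Bracket

theorem xiReg_eq_zero (hϖs : tsupport ϖ ⊆ Ioo (-1) 0) (hδ : 0 < δ) {G : Den[d]} {x : TX d} {ξ : ℝ}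
    (h : ∀ s > ξ, G x s = 0) : xiReg ϖ δ G x ξ = 0 := by
  refine integral_eq_zero_of_ae (ae_of_all _ fun s => ?_)
  by_cases hs : (ξ - s) / δ ∈ tsupport ϖ
  · have h1 := (div_lt_iff₀ hδ).1 (hϖs hs).2
    simp [h s (by linarith)]
  · simp [eq_zero_off_tsupport hs]

theorem kint_eq_zero {k : TX d → Den[d]} {x : TX d} {ξ : ℝ} (h : ∀ x', k x x' ξ * H x' ξ = 0) : kint k H x ξ = 0 := by
  simp [kint, h]

theorem transport_eq_zero {x : TX d} {ξ : ℝ} (h : ∀ x', H x' ξ = 0) : κ.transport ε φ W c H x ξ = 0 := by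
  simp [transport, kint, h]

theorem kint_kM_eq_zero (hε : 0 < ε) (hψ : Continuous ψ) (hB : ∀ y, |ψ y| ≤ B) {x : TX d}
    (hx : x.2 ∉ cthickening (κ.r * ε) (tsupport ψ)) (ξ : ℝ) :
    kint kC[κ, ε, ψ] H x ξ = 0 := by
  refine kint_eq_zero fun x' => ?_
  by_cases hd : κ.r * ε < dist x' x
  · rw [(kernelBound_kM (κ := κ) (c := fun y _ => ψ y) hε (hψ.comp continuous_fst) (I := univ)
      fun y _ _ => hB y).supp _ _ _ hd, zero_mul]
  · have h1 : x'.2 ∉ tsupport ψ := fun h => hx (Metric.mem_cthickening_of_dist_le _ x'.2 _ _ h (by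
      rw [dist_comm]
      exact (le_max_right _ _).trans (not_lt.1 hd)))
    rw [kM, eq_zero_off_tsupport h1, mul_zero, zero_mul]

theorem integral_slab_eq (T R : ℝ) (K : Set (Eu d)) (F : X[d] → ℝ) :
    ∫ z, F (z.1.1, z.1.2, z.2) ∂slab T R K = ∫ q in Ico 0 T ×ˢ K ×ˢ Icc 0 R, F q := by
  rw [slab, prod_restrict]
  have h := (measurePreserving_prodAssoc vol[ℝ] vol[Eu d]
    vol[ℝ]).setIntegral_preimage_emb (MeasurableEquiv.measurableEmbedding _) F
    (Ico 0 T ×ˢ K ×ˢ Icc 0 R)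
  have hset : (Ico 0 T ×ˢ K) ×ˢ Icc 0 R
      = MeasurableEquiv.prodAssoc (α := ℝ) (β := Eu d) (γ := ℝ) ⁻¹' (Ico 0 T ×ˢ K ×ˢ Icc 0 R) := by
    ext z
    simp [MeasurableEquiv.prodAssoc, and_assoc]
  rw [hset]
  exact h

theorem integrableOn_mul_mul (hU : MeasurableSet U) (hK : IsCompact K) (hKU : K ⊆ U)
    (hw : ContinuousOn w U) {f g : X[d] → ℝ} (hf : Measurable f) (hg : Measurable g)
    {Cf Cg : ℝ} (hCf : ∀ q ∈ Icc 0 T ×ˢ K ×ˢ Icc 0 R, |f q| ≤ Cf)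
    (hCg : ∀ q ∈ Icc 0 T ×ˢ K ×ˢ Icc 0 R, |g q| ≤ Cg)
    (h0 : ∀ q ∈ Ico 0 T ×ˢ U ×ˢ Ici 0, q.2.1 ∉ K ∨ R < q.2.2 → f q * g q = 0) :
    IntegrableOn (fun q : X[d] => w q.2.1 * (f q * g q)) (Ico 0 T ×ˢ U ×ˢ Ici 0) := by
  obtain ⟨A, hA⟩ := hK.exists_bound_of_continuousOn (hw.mono hKU)
  have hQ : MeasurableSet (Ico 0 T ×ˢ U ×ˢ Ici (0 : ℝ)) := measurableSet_Ico.prod (hU.prod measurableSet_Ici)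
  have hB : MeasurableSet (Icc 0 T ×ˢ K ×ˢ Icc 0 R) :=
    measurableSet_Icc.prod (hK.isClosed.measurableSet.prod measurableSet_Icc)
  have hwm : AEStronglyMeasurable (fun q : X[d] => w q.2.1) (volume.restrict (Ico 0 T ×ˢ U ×ˢ Ici (0 : ℝ))) :=
    (hw.comp (by fun_prop) fun q hq => hq.2.1).aestronglyMeasurable hQ
  have hi : Integrable ((Icc 0 T ×ˢ K ×ˢ Icc 0 R).indicator fun _ : X[d] => A * (Cf * Cg)) :=
    (integrable_indicator_iff hB).2 (integrableOn_const (isCompact_Icc.prod (hK.prod isCompact_Icc)).measure_lt_top.ne)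
  refine hi.restrict.mono' (hwm.mul (hf.mul hg).aestronglyMeasurable) ?_
  filter_upwards [ae_restrict_mem hQ] with q hq
  by_cases hqB : q ∈ Icc 0 T ×ˢ K ×ˢ Icc 0 R
  · rw [indicator_of_mem hqB, norm_mul, norm_mul]
    have h1 := hA _ hqB.2.1
    have h2 := hCf q hqB
    exact mul_le_mul h1 (mul_le_mul h2 (hCg q hqB) (norm_nonneg _) ((abs_nonneg _).trans h2)) (by positivity)
      ((norm_nonneg _).trans h1)
  · rw [indicator_of_notMem hqB, h0 q hq, mul_zero, norm_zero]
    by_contra hcon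
    rw [not_or, not_not, not_lt] at hcon
    exact hqB ⟨⟨hq.1.1, hq.1.2.le⟩, hcon.1, hq.2.2, hcon.2⟩

end Bracket

section Hess

variable (hcoeff : IsCoefficients g f A σ) (he : e ∈ 𝒜[d, M])
  (hω : IsMollifierPair ω1 ω2) (hψ : ContDiff ℝ ∞ ψ) (hψU : tsupport ψ ⊆ e.target)

include hcoeff he hω hψ hψU

theorem measurable_regHess (hH : IsDensity H) : Measurable (regHess κ e g A ω1 ψ H ε δ) := by
  have hk := continuous_hessKernel (κ := κ) (ε := ε) (δ := δ) (chartGeometry g he)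
    (chartCoefficients hcoeff he) hψ hψU hω.smooth₁
  have h1 : Measurable fun q : X[d] => H (q.1, q.2.1) q.2.2 :=
    hH.meas.comp (f := fun q : X[d] => ((q.1, q.2.1), q.2.2)) (by fun_prop)
  exact ((h1.comp measurable_snd).mul hk.measurable).stronglyMeasurable.integral_prod_right.measurable

theorem exists_bound_regHess (hε : 0 < ε) (hδ : 0 < δ) (hH : IsDensity H) {P : Set X[d]}
    (hP : IsCompact P) : ∃ C, ∀ p ∈ P, |regHess κ e g A ω1 ψ H ε δ p| ≤ C := by
  have hk := continuous_hessKernel (κ := κ) (ε := ε) (δ := δ) (chartGeometry g he)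
    (chartCoefficients hcoeff he) hψ hψU hω.smooth₁
  obtain ⟨B, hB, hB0⟩ := exists_isCompact_hessKernel (G := gramInv g e) (Γ := christoffel g e)
    (w := sqrtDet g e) (D := diffComp e A) (φ := ψ) (κ := κ) hω.compact₁ hε hδ
  have hPB : IsCompact ((fun r : X[d] × X[d] => r.1 - r.2) '' (P ×ˢ B)) := (hP.prod hB).image (by fun_prop)
  set PB := (fun r : X[d] × X[d] => r.1 - r.2) '' (P ×ˢ B)
  obtain ⟨C, hC⟩ := (hP.prod hPB).exists_bound_of_continuousOn hk.continuousOn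
  refine ⟨C * volume.real PB, fun p hp => ?_⟩
  rw [regHess, ← setIntegral_eq_integral_of_forall_compl_eq_zero (s := PB) fun q hq => ?_, ← norm_eq_abs]
  · refine norm_setIntegral_le_of_norm_le_const (C := C) hPB.measure_lt_top fun q hq => ?_
    rw [norm_mul]
    exact (mul_le_mul (hH.abs_le_one _ _) (hC (p, q) ⟨hp, hq⟩) (norm_nonneg _) zero_le_one).trans_eq (one_mul C)
  · rw [hB0 p q fun h => hq ⟨(p, p - q), ⟨hp, h⟩, sub_sub_cancel p q⟩, mul_zero]

omit hcoeff he hψ hψU in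
theorem exists_regHess_eq_zero (hε : 0 < ε) (hδ : 0 < δ) (hR : ∀ x, ∀ ξ ∈ Ioi R, H x ξ = 0) :
    ∃ b, 0 ≤ b ∧ ∀ p : X[d], R + b < p.2.2 → regHess κ e g A ω1 ψ H ε δ p = 0 := by
  obtain ⟨B, hB, hB0⟩ := exists_isCompact_hessKernel (G := gramInv g e) (Γ := christoffel g e)
    (w := sqrtDet g e) (D := diffComp e A) (φ := ψ) (κ := κ) hω.compact₁ hε hδ
  obtain ⟨b, hb⟩ := hB.exists_bound_of_continuousOn (f := fun u : X[d] => u.2.2) (by fun_prop)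
  refine ⟨max b 0, le_max_right _ _, fun p hp => integral_eq_zero_of_ae (ae_of_all _ fun q => ?_)⟩
  by_cases h : p - q ∈ B
  · have h1 : p.2.2 - q.2.2 ≤ b := (le_abs_self _).trans (hb _ h)
    have h2 : q.2.2 ∈ Ioi R := by
      rw [mem_Ioi]
      linarith [le_max_left b 0]
    simp [hR _ _ h2]
  · simp [hB0 p q h]

end Hess

variable {K L : KineticTuple M}

section Bracket

variable {φ : M → ℝ}

/-- A smooth, compactly supported version of the density near a compact set. -/
theorem exists_smooth_density (he : e ∈ 𝒜[d, M]) {K0 : Set (Eu d)} (hK0 : IsCompact K0)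
    (hK0U : K0 ⊆ e.target) : ∃ (w : Eu d → ℝ) (K : Set (Eu d)) (ρ : ℝ), ContDiff ℝ ∞ w ∧ IsCompact K ∧
      tsupport w ⊆ K ∧ K ⊆ e.target ∧ 0 < ρ ∧ ∀ y ∈ cthickening ρ K0, y ∈ K ∧ w y = sqrtDet g e y := by
  obtain ⟨K, hK, hK0K, hKU⟩ := exists_compact_between hK0 e.open_target hK0U
  obtain ⟨l, hl1, hl0, -⟩ := exists_contMDiffMap_one_nhds_of_subset_interior (𝓘(ℝ, Eu d)) (n := ⊤) hK0.isClosed hK0K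
  obtain ⟨V, hV, hK0V, hVl⟩ := mem_nhdsSet_iff_exists.1 hl1
  obtain ⟨ρ, hρ, hρV⟩ := hK0.exists_cthickening_subset_open hV hK0V
  have hs : tsupport (fun y => l y * sqrtDet g e y) ⊆ K := closure_minimal (fun y hy => by
    by_contra h
    exact hy (by simp [hl0 y h])) hK.isClosed
  refine ⟨fun y => l y * sqrtDet g e y, K, ρ, ?_, hK, hs, hKU, hρ, fun y hy => ?_⟩
  · exact contDiff_of_contDiffOn_of_tsupport e.open_target
      (l.contMDiff.contDiff.contDiffOn.mul (chartGeometry g he).smooth_w) (hs.trans hKU)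
  · have h1 : l y = 1 := hVl (hρV hy)
    refine ⟨?_, by simp [h1]⟩
    by_contra h
    rw [hl0 y h] at h1
    exact zero_ne_one h1

variable (hcoeff : IsCoefficients g f A σ) (he : e ∈ 𝒜[d, M]) (hω : IsMollifierPair ω1 ω2)
  (hκ : ∀ x, κ.Φ x = ω1 x.1 * ∏ j, ω2 (x.2 j)) (hψ : ContDiff ℝ ∞ ψ) (hψc : HasCompactSupport ψ)
  (hψU : tsupport ψ ⊆ e.target) (hψφ : ∀ y ∈ e.target, ψ y = φ (e.symm y)) (hψ01 : ∀ y, ψ y ∈ Icc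
  0 1)

include hcoeff he hω hκ hψ hψc hψU hψφ hψ01

set_option maxHeartbeats 400000 in
theorem secondOrderBracket_eq {K1 : Set (Eu d)} {ρ : ℝ} (hK1 : IsCompact K1) (hK1U : K1 ⊆ e.target) (hR : 0 ≤ R)
    (hw : ∀ y ∈ cthickening ρ (tsupport ψ), y ∈ K1 ∧ w y = sqrtDet g e y)
    (hKeq : KineticEquation g f A K) (hLeq : KineticEquation g f A L)
    {H2' : Den[d]} (hH1 : IsLift e K.χ H1) (hH2 : IsLift e (fun p => 1 - L.χ p) H2)
    (h2' : IsLift e L.χ H2') (hR1 : ∀ x, ∀ ξ ∈ Ioi R, H1 x ξ = 0) (hε : 0 < ε) (hδ : 0 < δ) (hδ1 : δ ≤ 1)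
    (hερ : κ.r * ε ≤ ρ) (T : ℝ) :
    secondOrderBracket g ω1 ω2 A K L e φ T ε δ = ∫ z, w z.1.2 * (xiReg ω1 δ (κ.transport ε ψ (chartField[g, e, f, A] ψ)
          (chartPot[g, e, f, A] ψ) H1) z.1 z.2
        * xiReg ω1 δ (kint kC[κ, ε, ψ] H2) z.1 z.2
      + xiReg ω1 δ (κ.transport ε ψ (chartField[g, e, f, A] ψ) (chartPot[g, e, f, A] ψ) H2) z.1 z.2
        * xiReg ω1 δ (kint kC[κ, ε, ψ] H1) z.1 z.2) ∂(slab T R K1) := by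
  have hg := chartGeometry g he
  have hc := chartCoefficients hcoeff he
  obtain ⟨b, hb0, hb⟩ := exists_regHess_eq_zero (e := e) (g := g) (A := A) (κ := κ) (ψ := ψ) hω hε hδ hR1
  obtain ⟨S, hS⟩ := exists_bound_locField hg hc hψ hψU hψc (R + b + 1)
  obtain ⟨Sc, hSc⟩ := exists_bound_locPot hg hc hψ hψU hψc (R + b + 1)
  have hψ1 : ∀ y, |ψ y| ≤ 1 := fun y => abs_le_one_of_mem_Icc (hψ01 y)
  set W := chartField[g, e, f, A] ψ
  set c := chartPot[g, e, f, A] ψ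
  have hX : ∀ {G : Den[d]} {C : ℝ}, Measurable (uncurry G) → (∀ x, ∀ ξ ∈ Icc 0 (R + b + 1), |G x ξ| ≤ C) →
      Measurable (fun q : X[d] => xiReg ω1 δ G (q.1, q.2.1) q.2.2) ∧
      ∀ q ∈ Icc 0 T ×ˢ K1 ×ˢ Icc 0 (R + b), |xiReg ω1 δ G (q.1, q.2.1) q.2.2| ≤ C := by
    intro G C hG hGC
    exact ⟨(measurable_xiReg hω.smooth₁.continuous δ hG).comp
      (f := fun q : X[d] => ((q.1, q.2.1), q.2.2)) (by fun_prop), fun q hq =>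
      abs_xiReg_le hω.smooth₁.continuous hω.compact₁ hω.nonneg₁ hω.mass₁ hω.supp₁ hδ hδ1 (hGC (q.1, q.2.1)) hq.2.2⟩
  have htr := fun (H : Den[d]) (hH : IsDensity H) => measurable_transport (κ := κ) (H := H) (R := R + b) hε
    hψ.continuous hψ1 (continuous_locField hg hc hψ hψU) hS
    (continuous_locPot hg hc hψ hψU) hSc (by positivity) hH
  have hmr := fun (H : Den[d]) (hH : IsDensity H) => measurable_kint_kM (κ := κ) (H := H) hε hψ.continuous hψ01 hH
  set T1 : X[d] → ℝ := fun q => xiReg ω1 δ (κ.transport ε ψ W c H1) (q.1, q.2.1) q.2.2 with hT₁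
  set T2 : X[d] → ℝ := fun q => xiReg ω1 δ (κ.transport ε ψ W c H2) (q.1, q.2.1) q.2.2 with hT2
  set r1 : X[d] → ℝ := fun q => xiReg ω1 δ (kint kC[κ, ε, ψ] H1) (q.1, q.2.1) q.2.2 with hr1
  set r2 : X[d] → ℝ := fun q => xiReg ω1 δ (kint kC[κ, ε, ψ] H2) (q.1, q.2.1) q.2.2 with hr2
  set A1 := regHess κ e g A ω1 ψ H1 ε δ with hA₁
  set A2 := regHess κ e g A ω1 ψ H2 ε δ with hA2
  obtain ⟨mT1', CT1, -, bT1'⟩ := htr H1 hH1.dens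
  obtain ⟨mT2', CT2, -, bT2'⟩ := htr H2 hH2.dens
  obtain ⟨mT1, bT1⟩ := hX mT1' bT1'
  obtain ⟨mT2, bT2⟩ := hX mT2' bT2'
  obtain ⟨mr1, br1⟩ := hX (hmr H1 hH1.dens).1 fun x ξ _ => (hmr H1 hH1.dens).2 x ξ
  obtain ⟨mr2, br2⟩ := hX (hmr H2 hH2.dens).1 fun x ξ _ => (hmr H2 hH2.dens).2 x ξ
  have hbox : IsCompact (Icc 0 T ×ˢ K1 ×ˢ Icc 0 (R + b)) := isCompact_Icc.prod (hK1.prod isCompact_Icc)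
  obtain ⟨CA1, bA1⟩ := exists_bound_regHess (κ := κ) hcoeff he hω hψ hψU hε hδ hH1.dens hbox
  obtain ⟨CA2, bA2⟩ := exists_bound_regHess (κ := κ) hcoeff he hω hψ hψU hε hδ hH2.dens hbox
  have mA1 : Measurable A1 := measurable_regHess hcoeff he hω hψ hψU hH1.dens
  have mA2 : Measurable A2 := measurable_regHess hcoeff he hω hψ hψU hH2.dens
  have hry : ∀ {H : Den[d]} {q : X[d]}, q.2.1 ∉ cthickening ρ (tsupport ψ) →
      xiReg ω1 δ (kint kC[κ, ε, ψ] H) (q.1, q.2.1) q.2.2 = 0 := by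
    intro H q hq
    have hx : (q.1, q.2.1).2 ∉ cthickening (κ.r * ε) (tsupport ψ) := fun h =>
      hq (Metric.cthickening_mono hερ (tsupport ψ) h)
    exact xiReg_eq_zero hω.supp₁ hδ fun s _ => kint_kM_eq_zero hε hψ.continuous hψ1 hx s
  have hr1ξ : ∀ {q : X[d]}, R < q.2.2 → r1 q = 0 := fun {q} hq =>
    xiReg_eq_zero hω.supp₁ hδ fun s hs => kint_eq_zero fun x' => by rw [hR1 x' s (hq.trans hs), mul_zero]
  have hT1ξ : ∀ {q : X[d]}, R < q.2.2 → T1 q = 0 := fun {q} hq =>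
    xiReg_eq_zero hω.supp₁ hδ fun s hs => transport_eq_zero fun x' => hR1 x' s (hq.trans hs)
  have hyK : ∀ {y : Eu d}, y ∉ K1 → y ∉ cthickening ρ (tsupport ψ) := fun hy h => hy (hw _ h).1
  have hQ : MeasurableSet (Ico 0 T ×ˢ e.target ×ˢ Ici (0 : ℝ)) :=
    measurableSet_Ico.prod (e.open_target.measurableSet.prod measurableSet_Ici)
  have hQs : MeasurableSet (Ico 0 T ×ˢ e.source ×ˢ Ici (0 : ℝ)) :=
    measurableSet_Ico.prod (e.open_source.measurableSet.prod measurableSet_Ici)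
  have hint : ∀ {a r : X[d] → ℝ} {Ca Cr : ℝ}, Measurable a → Measurable r →
      (∀ q ∈ Icc 0 T ×ˢ K1 ×ˢ Icc 0 (R + b), |a q| ≤ Ca) → (∀ q ∈ Icc 0 T ×ˢ K1 ×ˢ Icc 0 (R + b), |r q| ≤ Cr) →
      (∀ q, q.2.1 ∉ cthickening ρ (tsupport ψ) → r q = 0) → (∀ q, R + b < q.2.2 → a q * r q = 0) →
      IntegrableOn (fun q : X[d] => sqrtDet g e q.2.1 * (a q * r q)) (Ico 0 T ×ˢ e.target ×ˢ Ici (0 : ℝ)) :=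
    fun ma mr ba br h0 h0' => integrableOn_mul_mul e.open_target.measurableSet hK1 hK1U hg.smooth_w.continuousOn
      ma mr ba br fun q _ hq => hq.elim (fun h => by rw [h0 q (hyK h), mul_zero]) (h0' q)
  have i1 := hint (a := T1) (r := r2) mT1 mr2 bT1 br2 (fun q hq => hry hq) fun q hq => by
    rw [hT1ξ (by linarith), zero_mul]
  have i2 := hint (a := T2) (r := r1) mT2 mr1 bT2 br1 (fun q hq => hry hq) fun q hq => by
    rw [hr1ξ (by linarith), mul_zero]
  have i3 := hint (a := A1) (r := r2) mA1 mr2 bA1 br2 (fun q hq => hry hq) fun q hq => by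
    rw [show A1 q = 0 from hb q hq, zero_mul]
  have i4 := hint (a := A2) (r := r1) mA2 mr1 bA2 br1 (fun q hq => hry hq) fun q hq => by
    rw [hr1ξ (by linarith), mul_zero]
  have e1 : ∫ p in Ico 0 T ×ˢ e.source ×ˢ Ici 0,
      (regDxi g ω1 ω2 e φ (K.m + K.n) ε δ p * regFun ω1 ω2 e φ (fun q => 1 - L.χ q) ε δ p
        - regDxi g ω1 ω2 e φ (L.m + L.n) ε δ p * regFun ω1 ω2 e φ K.χ ε δ p) ∂(kinMeasure g)
      = ∫ q in Ico 0 T ×ˢ e.target ×ˢ Ici 0, sqrtDet g e q.2.1 * ((T1 q - A1 q) * r2 q + (T2 q - A2 q) * r1 q) := by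
    refine Eq.trans (setIntegral_congr_fun hQs fun p hp => ?_) (setIntegral_chart g he measurableSet_Ico
      measurableSet_Ici (F := fun q => (T1 q - A1 q) * r2 q + (T2 q - A2 q) * r1 q) (Measurable.aestronglyMeasurable
        (((mT1.sub mA1).mul mr2).add ((mT2.sub mA2).mul mr1))))
    have k1 := regDxi_add_regDivDiv hcoeff he hω hκ hψ hψc hψU hψφ hε hδ K hKeq hH1 hp.1.1 hp.2.2
    have k2 := neg_regDxi_add_regDivDiv hcoeff he hω hκ hψ hψc hψU hψφ hε hδ L hLeq h2' hH2 hp.1.1 hp.2.2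
    simp only [regFun_eq hω hκ hH1 hψ.continuous hψφ hε hδ, regFun_eq hω hκ hH2 hψ.continuous hψφ hε hδ]
    rw [eq_sub_of_add_eq k1, show ∀ x y : ℝ, x - y = x + -y from sub_eq_add_neg, ← neg_mul, eq_sub_of_add_eq k2]
  have e2 : ∫ p in Ico 0 T ×ˢ e.source ×ˢ Ici 0, regDivDiv g ω1 ω2 e A φ K.χ ε δ p
        * regFun ω1 ω2 e φ (fun q => 1 - L.χ q) ε δ p ∂(kinMeasure g)
      = ∫ q in Ico 0 T ×ˢ e.target ×ˢ Ici 0, sqrtDet g e q.2.1 * (A1 q * r2 q) := by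
    refine Eq.trans (setIntegral_congr_fun hQs fun p hp => ?_) (setIntegral_chart g he measurableSet_Ico
      measurableSet_Ici (F := fun q => A1 q * r2 q) (Measurable.aestronglyMeasurable (mA1.mul mr2)))
    simp only [regDivDiv_eq hω hκ hH1 hψφ, regFun_eq hω hκ hH2 hψ.continuous hψφ hε hδ]
    rfl
  have e3 : ∫ p in Ico 0 T ×ˢ e.source ×ˢ Ici 0, regDivDiv g ω1 ω2 e A φ (fun q => 1 - L.χ q) ε δ p
        * regFun ω1 ω2 e φ K.χ ε δ p ∂(kinMeasure g)
      = ∫ q in Ico 0 T ×ˢ e.target ×ˢ Ici 0, sqrtDet g e q.2.1 * (A2 q * r1 q) := by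
    refine Eq.trans (setIntegral_congr_fun hQs fun p hp => ?_) (setIntegral_chart g he measurableSet_Ico
      measurableSet_Ici (F := fun q => A2 q * r1 q) (Measurable.aestronglyMeasurable (mA2.mul mr1)))
    simp only [regDivDiv_eq hω hκ hH2 hψφ, regFun_eq hω hκ hH1 hψ.continuous hψφ hε hδ]
    rfl
  rw [secondOrderBracket, e1, e2, e3]
  have i5 : IntegrableOn (fun q : X[d] =>
      sqrtDet g e q.2.1 * ((T1 q - A1 q) * r2 q + (T2 q - A2 q) * r1 q)) (Ico 0 T ×ˢ e.target ×ˢ Ici (0 : ℝ)) := by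
    refine (((i1.add i2).sub i3).sub i4).congr (ae_of_all _ fun q => ?_)
    simp only [Pi.add_apply, Pi.sub_apply]
    ring
  refine (congrArg (· + _) (integral_add i5 i3).symm).trans ((integral_add (i5.add i3) i4).symm.trans ?_)
  refine Eq.trans ?_ (integral_slab_eq T R K1 fun q => w q.2.1 * (T1 q * r2 q + T2 q * r1 q)).symm
  have hsub : Ico 0 T ×ˢ K1 ×ˢ Icc 0 R ⊆ Ico 0 T ×ˢ e.target ×ˢ Ici (0 : ℝ) :=
    prod_mono_right (prod_mono hK1U Icc_subset_Ici_self)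
  have hwe : ∀ q : X[d], sqrtDet g e q.2.1 * (T1 q * r2 q + T2 q * r1 q)
      = w q.2.1 * (T1 q * r2 q + T2 q * r1 q) := fun q => by
    by_cases hq : q.2.1 ∈ cthickening ρ (tsupport ψ)
    · rw [(hw _ hq).2]
    · rw [show r1 q = 0 from hry hq, show r2 q = 0 from hry hq]
      simp
  rw [← setIntegral_eq_of_subset_of_forall_sdiff_eq_zero hQ hsub]
  · refine setIntegral_congr_fun hQ fun q hq => ?_
    simp only [Pi.add_apply, ← hwe]
    ring
  · rintro q ⟨hq, hq'⟩
    by_cases hy : q.2.1 ∈ K1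
    · have hξ : R < q.2.2 := by
        by_contra h
        exact hq' ⟨hq.1, hy, hq.2.2, not_lt.1 h⟩
      rw [hr1ξ hξ, hT1ξ hξ]
      simp
    · rw [show r1 q = 0 from hry (hyK hy), show r2 q = 0 from hry (hyK hy)]
      simp

end Bracket

section Compare

theorem setIntegral_le_of_withDensity {α β : Type*} [MeasurableSpace α] [MeasurableSpace β] {Ψ : α → β}
    {μ : Measure α} [IsFiniteMeasure μ] {ν : Measure β} {w : β → ℝ}
    (hΨ : MeasurePreserving Ψ μ (ν.withDensity fun y => ENNReal.ofReal (w y))) {B : Set β} (hB : MeasurableSet B)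
    {c : ℝ} (hc : 0 < c) (hcw : ∀ y ∈ B, c ≤ w y) {F : β → ℝ} (hF : Measurable F) (hF0 : ∀ y, 0 ≤ F y)
    (hF1 : ∀ y, F y ≤ 1) : ∫ y in B, F y ∂ν ≤ c⁻¹ * ∫ x, F (Ψ x) ∂μ := by
  set ν' := ν.withDensity fun y => ENNReal.ofReal (w y) with hν'
  have : IsFiniteMeasure ν' := by
    rw [← hΨ.map_eq]
    infer_instance
  have h1 : ENNReal.ofReal c • ν.restrict B ≤ ν' := by
    refine Measure.le_iff.2 fun s hs => ?_
    rw [Measure.smul_apply, restrict_apply hs, smul_eq_mul, hν', withDensity_apply _ hs]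
    refine le_trans ?_ (lintegral_mono_set (inter_subset_left (s := s) (t := B)))
    rw [← setLIntegral_const]
    exact setLIntegral_mono' (hs.inter hB) fun y hy => ENNReal.ofReal_le_ofReal (hcw y hy.2)
  have hi : Integrable F ν' := Integrable.of_bound hF.aestronglyMeasurable 1 (ae_of_all _ fun y => by
    rw [norm_eq_abs, abs_of_nonneg (hF0 y)]
    exact hF1 y)
  have h2 := integral_mono_measure h1 (ae_of_all _ hF0) hi
  rw [integral_smul_measure, ENNReal.toReal_ofReal hc.le, smul_eq_mul, ← hΨ.map_eq,
    integral_map hΨ.aemeasurable hF.aestronglyMeasurable] at h2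
  rwa [le_inv_mul_iff₀ hc]

variable {K0 : Set (Eu d)}

theorem exists_lower_bound_sqrtDet (he : e ∈ 𝒜[d, M]) (hK0 : IsCompact K0)
    (hK0U : K0 ⊆ e.target) : ∃ c, 0 < c ∧ ∀ y ∈ K0, c ≤ sqrtDet g e y := by
  rcases K0.eq_empty_or_nonempty with rfl | hne
  · exact ⟨1, one_pos, by simp⟩
  · obtain ⟨y, hy, hmin⟩ := hK0.exists_isMinOn hne ((chartGeometry g he).smooth_w.continuousOn.mono hK0U)
    exact ⟨_, (chartGeometry g he).pos y (hK0U hy), fun z hz => hmin hz⟩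

theorem IsLift.ae_kinMeasure (hH : IsLift e h H) (he : e ∈ 𝒜[d, M]) :
    ∀ᵐ p ∂((kinMeasure g).restrict (phase e.source)), H (p.1, e p.2.1) p.2.2 = h p := by
  have h1 : ∀ᵐ q ∂(vol[X[d]].restrict (phase e.target)), H (q.1, q.2.1) q.2.2 = h (q.1, e.symm q.2.1, q.2.2) := by
    filter_upwards [ae_restrict_of_ae hH.ae_eq, ae_restrict_mem (measurableSet_phase e.open_target.measurableSet)]
      with q h1 h2 using h1 h2
  have h2 := (measurePreserving_chart g he (Ici 0) (Ici 0)).quasiMeasurePreserving.ae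
    ((withDensity_absolutelyContinuous _ _).ae_le h1)
  filter_upwards [h2, ae_restrict_mem (measurableSet_phase e.open_source.measurableSet)] with p hp hps
  simpa only [Prod.map, id, chartExt_eq hps.2.1, e.left_inv hps.2.1] using hp

theorem kinMeasure_restrict (J I : Set ℝ) (S : Set M) : (kinMeasure g).restrict (J ×ˢ S ×ˢ I)
    = (volume.restrict J).prod (μξ[g].restrict (S ×ˢ I)) := by
  rw [kinMeasure, prod_restrict]

theorem ae_ae_of_ae_kinMeasure {J I : Set ℝ} {S : Set M} {P : ℝ × M × ℝ → Prop}
    (hP : ∀ᵐ p ∂((kinMeasure g).restrict (J ×ˢ S ×ˢ I)), P p) :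
    ∀ᵐ t ∂(volume.restrict J), ∀ᵐ z ∂(μξ[g].restrict (S ×ˢ I)), P (t, z) := by
  rw [kinMeasure_restrict] at hP
  exact ae_ae_of_ae_prod hP

theorem exists_measurable_lift (he : e ∈ 𝒜[d, M]) {u : M → ℝ} (hu : AEMeasurable u (riemMeasure g)) :
    ∃ v : Eu d → ℝ, Measurable v ∧ ∀ᵐ x ∂((riemMeasure g).restrict e.source), v (e x) = u x := by
  have h1 : AEMeasurable (u ∘ e.symm) (chartMeasure g e) :=
    AEMeasurable.comp_aemeasurable (by rw [← riemMeasure_restrict g he]; exact hu.restrict) (aemeasurable_symm g)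
  refine ⟨h1.mk, h1.measurable_mk, ?_⟩
  filter_upwards [(measurePreserving_chartExt g he).quasiMeasurePreserving.ae h1.ae_eq_mk,
    ae_restrict_mem e.open_source.measurableSet] with x hx hxs
  rw [chartExt_eq hxs] at hx
  rw [← hx, Function.comp_apply, e.left_inv hxs]

end Compare

section Initial

theorem measurable_sgnPlus : Measurable sgnPlus :=
  Measurable.ite (measurableSet_lt measurable_const measurable_id) measurable_const measurable_const

theorem sgnPlus_eq (s : ℝ) : sgnPlus s = 0 ∨ sgnPlus s = 1 := by
  rw [sgnPlus]
  split_ifs <;> simp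

variable [T2Space M]

/-- Smooth functions with compact support are dense in `L¹(M × ℝ)`. -/
theorem exists_contMDiff_integral_sub_le {ζ : M × ℝ → ℝ} (hζ : Integrable ζ μξ[g])
    (hη : 0 < η) : ∃ φ : M × ℝ → ℝ, ContMDiff ((𝓡 d).prod 𝓘(ℝ, ℝ)) 𝓘(ℝ, ℝ) ∞ φ ∧ HasCompactSupport φ ∧
      Integrable φ μξ[g] ∧ ∫ z, |ζ z - φ z| ∂μξ[g] ≤ η := by
  have := ChartedSpace.secondCountable_of_sigmaCompact (Eu d) M
  have := ChartedSpace.locallyCompactSpace (Eu d) M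
  have := Manifold.metrizableSpace (𝓡 d) M
  set ν := (riemMeasure g).prod vol[ℝ]
  obtain ⟨k, hkc, hk, hkcont, hki⟩ := hζ.exists_hasCompactSupport_integral_sub_le (half_pos hη)
  set m := ν.real (tsupport k)
  have hm : 0 ≤ m := measureReal_nonneg
  have hε : 0 < η / (2 * (m + 1)) := by positivity
  obtain ⟨φ, hφ, hφs⟩ := hkcont.exists_contMDiff_approx ((𝓡 d).prod 𝓘(ℝ, ℝ)) ⊤
    (continuous_const (y := η / (2 * (m + 1)))) fun _ => hε
  have hφc : HasCompactSupport φ := hkc.mono hφs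
  have hφi : Integrable φ ν := φ.contMDiff.continuous.integrable_of_hasCompactSupport hφc
  refine ⟨φ, φ.contMDiff, hφc, hφi, ?_⟩
  have h1 : ∫ z, |k z - φ z| ∂ν ≤ η / 2 := by
    rw [← setIntegral_eq_integral_of_forall_compl_eq_zero (s := tsupport k)]
    · have h2 := norm_setIntegral_le_of_norm_le_const (f := fun z => |k z - φ z|) (C := η / (2 * (m + 1)))
        (hkc.isCompact.measure_lt_top (μ := ν)) fun z _ => by
          rw [norm_eq_abs, abs_abs, ← Real.dist_eq, dist_comm]
          exact (hφ z).le
      refine (le_abs_self _).trans (h2.trans ?_)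
      rw [div_mul_eq_mul_div, div_le_div_iff₀ (by positivity) two_pos]
      nlinarith
    · intro z hz
      have h3 : k z = 0 := eq_zero_off_tsupport hz
      have h4 : φ z = 0 := by
        by_contra h
        exact hφs h h3
      rw [h3, h4, sub_zero, abs_zero]
  calc ∫ z, |ζ z - φ z| ∂ν ≤ ∫ z, (|ζ z - k z| + |k z - φ z|) ∂ν :=
        integral_mono (hζ.sub hφi).abs ((hζ.sub hki).abs.add (hki.sub hφi).abs) fun z => abs_sub_le _ _ _
    _ = ∫ z, |ζ z - k z| ∂ν + ∫ z, |k z - φ z| ∂ν := integral_add (hζ.sub hki).abs (hki.sub hφi).abs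
    _ ≤ η := by
        simp only [← norm_eq_abs (ζ _ - k _)]
        linarith

theorem abs_setIntegral_mul_sub_le {α : Type*} [MeasurableSpace α] {ν : Measure α} {S : Set α}
    (hS : MeasurableSet S) {h : α → ℝ} (hm : AEStronglyMeasurable h (ν.restrict S)) (h1 : ∀ z ∈ S, |h z| ≤ 1)
    {ζ φ : α → ℝ} (hζ : Integrable ζ ν) (hφ : Integrable φ ν) :
    |(∫ z in S, h z * ζ z ∂ν) - ∫ z in S, h z * φ z ∂ν| ≤ ∫ z, |ζ z - φ z| ∂ν := by
  have hb : ∀ᵐ z ∂(ν.restrict S), ‖h z‖ ≤ 1 := by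
    filter_upwards [ae_restrict_mem hS] with z hz using h1 z hz
  rw [← integral_sub (hζ.restrict.bdd_mul hm hb) (hφ.restrict.bdd_mul hm hb)]
  refine (abs_integral_le_integral (g := fun z => |ζ z - φ z|) (hζ.sub hφ).abs.restrict ?_).trans
    (setIntegral_le_integral (hζ.sub hφ).abs (ae_of_all _ fun z => abs_nonneg _))
  filter_upwards [hb] with z hz
  rw [← mul_sub, abs_mul]
  exact mul_le_of_le_one_left (abs_nonneg _) hz

theorem aemeasurable_sgnPlus_sub {u : M → ℝ} (hu : AEMeasurable u (riemMeasure g)) :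
    AEMeasurable (fun z : M × ℝ => sgnPlus (u z.1 - z.2)) μξ[g] :=
  measurable_sgnPlus.comp_aemeasurable (hu.comp_fst.sub measurable_snd.aemeasurable)

theorem ae_aestronglyMeasurable_section (hK : IsKineticData g K) : ∀ᵐ t ∂vol₊,
    AEStronglyMeasurable (fun z : M × ℝ => K.χ (t, z)) (μξ[g].restrict (univ ×ˢ Ici 0)) := by
  have h := hK.measurable_χ.aestronglyMeasurable
  rw [phase, kinMeasure_restrict] at h
  exact h.prodMk_left

/-- The initial condition holds strongly in `L¹`. -/
theorem tendsto_integral_abs_sub (hK : IsKineticData g K) (hi : InitialCondition g K) (R : ℝ) :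
    Tendsto (fun t => ∫ z in univ ×ˢ Icc 0 R, |K.χ (t, z) - sgnPlus (K.u₀ z.1 - z.2)| ∂μξ[g])
      (𝓝[>] (0 : ℝ) ⊓ ae volume) (𝓝 0) := by
  set ν := (riemMeasure g).prod vol[ℝ]
  set χ0 : M × ℝ → ℝ := fun z => sgnPlus (K.u₀ z.1 - z.2)
  have hχ0 : AEMeasurable χ0 ν := aemeasurable_sgnPlus_sub hK.measurable_u₀
  have hS : MeasurableSet ((univ : Set M) ×ˢ Ici (0 : ℝ)) := MeasurableSet.univ.prod measurableSet_Ici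
  have hSR : MeasurableSet ((univ : Set M) ×ˢ Icc (0 : ℝ) R) := MeasurableSet.univ.prod measurableSet_Icc
  have hν : ν ((univ : Set M) ×ˢ Icc (0 : ℝ) R) < ⊤ := by
    rw [prod_prod]
    exact ENNReal.mul_lt_top (measure_lt_top _ _) measure_Icc_lt_top
  set ζ : M × ℝ → ℝ := ((univ : Set M) ×ˢ Icc (0 : ℝ) R).indicator fun z => 1 - 2 * χ0 z with hζdef
  have hζ : Integrable ζ ν := by
    refine (integrable_indicator_iff hSR).2 ?_
    have : IsFiniteMeasure (ν.restrict ((univ : Set M) ×ˢ Icc (0 : ℝ) R)) := ⟨by rw [restrict_apply_univ]; exact hν⟩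
    refine Integrable.of_bound (C := 1) ((aemeasurable_const.sub (hχ0.const_mul 2)).restrict.aestronglyMeasurable)
      (ae_of_all _ fun z => ?_)
    rcases sgnPlus_eq (K.u₀ z.1 - z.2) with h | h <;> simp only [χ0, h] <;> norm_num
  have hχ01 : ∀ z, |χ0 z| ≤ 1 := fun z => by
    rcases sgnPlus_eq (K.u₀ z.1 - z.2) with h | h <;> simp only [χ0, h] <;> norm_num
  have hgood : ∀ᶠ t in 𝓝[>] (0 : ℝ) ⊓ ae volume, 0 ≤ t ∧
      AEStronglyMeasurable (fun z : M × ℝ => K.χ (t, z)) (ν.restrict (univ ×ˢ Ici 0)) := by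
    have h1 : ∀ᶠ t in 𝓝[>] (0 : ℝ) ⊓ ae volume, 0 < t := Eventually.filter_mono inf_le_left self_mem_nhdsWithin
    have h2 : ∀ᶠ t in 𝓝[>] (0 : ℝ) ⊓ ae volume, t ∈ Ici (0 : ℝ) → _ :=
      Eventually.filter_mono inf_le_right ((ae_restrict_iff' measurableSet_Ici).1 (ae_aestronglyMeasurable_section hK))
    filter_upwards [h1, h2] with t ht h using ⟨ht.le, h ht.le⟩
  have hχ1 : ∀ t, 0 ≤ t → ∀ z ∈ (univ : Set M) ×ˢ Ici (0 : ℝ), |K.χ (t, z)| ≤ 1 := fun t ht z hz => by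
    have := hK.range_χ (t, z) ⟨ht, hz⟩
    rw [abs_of_nonneg this.1]
    exact this.2
  rw [Metric.tendsto_nhds]
  intro η hη
  obtain ⟨φ, hφ, hφc, hφi, hφζ⟩ := exists_contMDiff_integral_sub_le hζ (show 0 < η / 4 by positivity)
  filter_upwards [hgood, (Metric.tendsto_nhds.1 (hi φ hφ hφc)) (η / 4) (by positivity)] with t ht htφ
  have b1 := abs_setIntegral_mul_sub_le hS ht.2 (hχ1 t ht.1) hζ hφi
  have b2 := abs_setIntegral_mul_sub_le hS hχ0.restrict.aestronglyMeasurable (fun z _ => hχ01 z) hζ hφi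
  have hb : ∀ {h : M × ℝ → ℝ}, AEStronglyMeasurable h (ν.restrict (univ ×ˢ Ici 0)) →
      (∀ z ∈ (univ : Set M) ×ˢ Ici (0 : ℝ), |h z| ≤ 1) → IntegrableOn (fun z => h z * ζ z) (univ ×ˢ Ici 0) ν :=
    fun hm h1 => hζ.restrict.bdd_mul (c := 1) hm (by filter_upwards [ae_restrict_mem hS] with z hz using h1 z hz)
  have e1 : ∫ z in univ ×ˢ Icc 0 R, |K.χ (t, z) - χ0 z| ∂ν
      = (∫ z in univ ×ˢ Ici 0, K.χ (t, z) * ζ z ∂ν) - ∫ z in univ ×ˢ Ici 0, χ0 z * ζ z ∂ν := by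
    rw [← integral_sub (hb ht.2 (hχ1 t ht.1)) (hb hχ0.restrict.aestronglyMeasurable fun z _ => hχ01 z)]
    refine Eq.trans ?_ (setIntegral_eq_of_subset_of_forall_sdiff_eq_zero hS
      (s := univ ×ˢ Icc 0 R) (prod_mono_right Icc_subset_Ici_self) ?_).symm
    · refine setIntegral_congr_fun hSR fun z hz => ?_
      have h01 := hK.range_χ (t, z) ⟨ht.1, mem_univ _, hz.2.1⟩
      simp only [hζdef, indicator_of_mem hz]
      rcases sgnPlus_eq (K.u₀ z.1 - z.2) with h | h <;> simp only [χ0, h]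
      · rw [sub_zero, abs_of_nonneg h01.1]
        ring
      · rw [abs_of_nonpos (by linarith [h01.2])]
        ring
    · rintro z ⟨-, hz⟩
      simp only [hζdef, indicator_of_notMem hz, mul_zero, sub_zero]
  rw [Real.dist_eq, abs_lt] at htφ
  rw [abs_le] at b1 b2
  rw [Real.dist_eq, sub_zero, abs_of_nonneg (integral_nonneg fun z => abs_nonneg _), e1]
  linarith [b1.1, b1.2, b2.1, b2.2, htφ.1, htφ.2]

end Initial

variable [T2Space M]

section Chart

theorem exists_mem_Ioo_of_eventually {p : ℝ → Prop} (h : ∀ᶠ t in 𝓝[>] 0 ⊓ ae volume, p t) :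
    ∃ τ > 0, ∀ᵐ s : ℝ, s ∈ Ioo 0 τ → p s := by
  obtain ⟨s, hs, t, ht, hst⟩ := mem_inf_iff_superset.1 h
  obtain ⟨τ, hτ, hτs⟩ := mem_nhdsGT_iff_exists_Ioo_subset.1 hs
  refine ⟨τ, hτ, ?_⟩
  filter_upwards [ht] with x hx hxτ using hst ⟨hτs hxτ, hx⟩

theorem isFiniteMeasure_section (S : Set M) (R : ℝ) :
    IsFiniteMeasure (((riemMeasure g).prod vol[ℝ]).restrict (S ×ˢ Icc 0 R)) := by
  rw [← prod_restrict]
  infer_instance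

theorem sect_eq_volume_restrict (R : ℝ) (K : Set (Eu d)) : sect R K = volume.restrict (K ×ˢ Icc 0 R) := by
  rw [sect, prod_restrict]
  rfl

theorem exists_time_integral_sect_le (he : e ∈ 𝒜[d, M]) {D : ℝ → M × ℝ → ℝ} (hD0 : ∀ t z, 0 ≤ D t z) (hDi : ∀ᵐ t ∂vol₊,
      IntegrableOn (D t) (univ ×ˢ Icc 0 R) μξ[g])
    (hDt : Tendsto (fun t => ∫ z in univ ×ˢ Icc 0 R, D t z ∂μξ[g])
      (𝓝[>] (0 : ℝ) ⊓ ae volume) (𝓝 0)) {G : Den[d]} (hG : IsDensity G)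
    (hGD : ∀ᵐ t ∂vol₊, ∀ᵐ z ∂(μξ[g].restrict (e.source ×ˢ Ici 0)),
      G (t, e z.1) z.2 = D t z) {K0 : Set (Eu d)} (hK0 : IsCompact K0) (hK0U : K0 ⊆ e.target) :
    ∀ η > 0, ∃ τ > 0, ∀ᵐ s : ℝ, s ∈ Ioo 0 τ → ∫ z, G (s, z.1) z.2 ∂(sect R K0) ≤ η := by
  intro η hη
  obtain ⟨c, hc, hcw⟩ := exists_lower_bound_sqrtDet (g := g) he hK0 hK0U
  refine exists_mem_Ioo_of_eventually ?_
  have h1 : ∀ᶠ t in 𝓝[>] (0 : ℝ) ⊓ ae volume, 0 < t := Eventually.filter_mono inf_le_left self_mem_nhdsWithin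
  have h2 := Eventually.filter_mono (f₁ := 𝓝[>] (0 : ℝ) ⊓ ae volume) inf_le_right
    ((ae_restrict_iff' measurableSet_Ici).1 (hDi.and hGD))
  filter_upwards [h1, h2, (tendsto_order.1 hDt).2 (c * η) (by positivity)] with t h0 h2 h3
  obtain ⟨hi, hz⟩ := h2 h0.le
  have := isFiniteMeasure_section (g := g) e.source R
  have hIcc : MeasurableSet (K0 ×ˢ Icc 0 R) := hK0.isClosed.measurableSet.prod measurableSet_Icc
  have h4 := setIntegral_le_of_withDensity (measurePreserving_chart_section g he (Icc 0 R)) hIcc hc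
    (fun y hy => hcw y.1 hy.1) (F := fun z => G (t, z.1) z.2)
    (hG.meas.comp (f := fun z : Y[d] => ((t, z.1), z.2)) (by fun_prop)) (fun z => hG.nonneg _ _)
    fun z => hG.le_one _ _
  rw [restrict_restrict hIcc, inter_eq_left.2 (prod_mono_left hK0U)] at h4
  have h5 : ∫ z in e.source ×ˢ Icc 0 R, G (t, (Prod.map (chartExt e) id z).1) (Prod.map (chartExt e) id z).2
      ∂μξ[g] = ∫ z in e.source ×ˢ Icc 0 R, D t z ∂μξ[g] := by
    refine integral_congr_ae ?_
    filter_upwards [ae_mono (restrict_mono_set _ (prod_mono_right Icc_subset_Ici_self)) hz,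
      ae_restrict_mem (e.open_source.measurableSet.prod measurableSet_Icc)] with z h6 h7
    rw [← h6, Prod.map, chartExt_eq h7.1]
    rfl
  rw [h5] at h4
  have h6 := setIntegral_mono_set hi (ae_of_all _ (hD0 t))
    (prod_mono_left (t := Icc 0 R) (subset_univ e.source)).eventuallyLE
  rw [sect_eq_volume_restrict]
  refine h4.trans ?_
  rw [inv_mul_le_iff₀ hc]
  exact h6.trans h3.le

/-! ### The estimate in a chart -/

theorem integrableOn_overlap (hK : IsKineticData g K) (hL : IsKineticData g L)
    (hR : ∀ p ∈ phase (univ : Set M), R < p.2.2 → K.χ p = 0) (T : ℝ) :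
    IntegrableOn (fun p => K.χ p * (1 - L.χ p)) (Ico 0 T ×ˢ univ ×ˢ Ici 0) (kinMeasure g) := by
  have hsub : Ico 0 T ×ˢ univ ×ˢ Ici 0 ⊆ phase (univ : Set M) := prod_mono_left Ico_subset_Ici_self
  have hQ : MeasurableSet (Ico 0 T ×ˢ (univ : Set M) ×ˢ Ici (0 : ℝ)) :=
    measurableSet_Ico.prod (MeasurableSet.univ.prod measurableSet_Ici)
  have hB : MeasurableSet (Ico 0 T ×ˢ (univ : Set M) ×ˢ Icc (0 : ℝ) R) :=
    measurableSet_Ico.prod (MeasurableSet.univ.prod measurableSet_Icc)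
  have hfin : kinMeasure g (Ico 0 T ×ˢ (univ : Set M) ×ˢ Icc (0 : ℝ) R) ≠ ⊤ := by
    rw [kinMeasure, prod_prod, prod_prod]
    exact (ENNReal.mul_lt_top measure_Ico_lt_top (ENNReal.mul_lt_top (measure_lt_top _ _) measure_Icc_lt_top)).ne
  have hi : Integrable ((Ico 0 T ×ˢ (univ : Set M) ×ˢ Icc (0 : ℝ) R).indicator fun _ => (1 : ℝ)) (kinMeasure g) :=
    (integrable_indicator_iff hB).2 (integrableOn_const hfin)
  have hm := ((hK.measurable_χ.mul ((aemeasurable_const (b := (1 : ℝ))).sub hL.measurable_χ)).mono_measure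
    (restrict_mono_set _ hsub))
  refine hi.restrict.mono' hm.aestronglyMeasurable ?_
  filter_upwards [ae_restrict_mem hQ] with p hp
  have h1 := hK.range_χ p (hsub hp)
  have h2 := hL.range_χ p (hsub hp)
  rw [norm_eq_abs, abs_of_nonneg (mul_nonneg h1.1 (sub_nonneg.2 h2.2))]
  by_cases hpR : R < p.2.2
  · rw [hR p (hsub hp) hpR, zero_mul]
    exact indicator_nonneg (fun _ _ => zero_le_one) _
  · rw [indicator_of_mem (show p ∈ Ico 0 T ×ˢ (univ : Set M) ×ˢ Icc (0 : ℝ) R from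
      ⟨hp.1, mem_univ _, hp.2.2, not_lt.1 hpR⟩)]
    exact mul_le_one₀ h1.2 (sub_nonneg.2 h2.2) (by linarith [h2.1])

theorem integral_slab_le_overlap (he : e ∈ 𝒜[d, M]) (hK : IsKineticData g K)
    (hL : IsKineticData g L) (hR : ∀ p ∈ phase (univ : Set M), R < p.2.2 → K.χ p = 0)
    (hH1 : IsLift e K.χ H1) (hH2 : IsLift e (fun p => 1 - L.χ p) H2) {K1 : Set (Eu d)} (hK1 : IsCompact K1)
    (hK1U : K1 ⊆ e.target) : ∃ c, 0 ≤ c ∧ ∀ T, ∫ z, H1 z.1 z.2 * H2 z.1 z.2 ∂(slab T R K1)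
      ≤ c * ∫ p in Ico 0 T ×ˢ univ ×ˢ Ici 0, K.χ p * (1 - L.χ p) ∂(kinMeasure g) := by
  obtain ⟨c, hc, hcw⟩ := exists_lower_bound_sqrtDet (g := g) he hK1 hK1U
  refine ⟨c⁻¹, by positivity, fun T => ?_⟩
  have hfin : IsFiniteMeasure ((kinMeasure g).restrict (Ico 0 T ×ˢ e.source ×ˢ Icc 0 R)) := by
    have := isFiniteMeasure_section (g := g) e.source R
    rw [kinMeasure_restrict]
    infer_instance
  have hB : MeasurableSet (Ico 0 T ×ˢ K1 ×ˢ Icc 0 R) :=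
    measurableSet_Ico.prod (hK1.isClosed.measurableSet.prod measurableSet_Icc)
  have hsub : Ico 0 T ×ˢ e.source ×ˢ Icc 0 R ⊆ phase e.source := prod_mono Ico_subset_Ici_self
    (prod_mono_right Icc_subset_Ici_self)
  have h4 := setIntegral_le_of_withDensity (measurePreserving_chart g he (Ico 0 T) (Icc 0 R)) hB hc
    (fun y hy => hcw y.2.1 hy.2.1) (F := fun q => H1 (q.1, q.2.1) q.2.2 * H2 (q.1, q.2.1) q.2.2)
    ((hH1.dens.measurable_mul hH2.dens).comp (f := fun q : X[d] => ((q.1, q.2.1), q.2.2)) (by fun_prop))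
    (fun q => mul_nonneg (hH1.dens.nonneg _ _) (hH2.dens.nonneg _ _))
    fun q => mul_le_one₀ (hH1.dens.le_one _ _) (hH2.dens.nonneg _ _) (hH2.dens.le_one _ _)
  rw [restrict_restrict hB, inter_eq_left.2 (prod_mono_right (prod_mono_left hK1U))] at h4
  refine (integral_slab_eq T R K1 fun q => H1 (q.1, q.2.1) q.2.2 * H2 (q.1, q.2.1) q.2.2).trans_le
    (h4.trans (mul_le_mul_of_nonneg_left ?_ (by positivity)))
  have h5 : ∀ᵐ p ∂((kinMeasure g).restrict (Ico 0 T ×ˢ e.source ×ˢ Icc 0 R)), H1 (p.1, e p.2.1) p.2.2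
      * H2 (p.1, e p.2.1) p.2.2 = K.χ p * (1 - L.χ p) := by
    filter_upwards [ae_mono (restrict_mono_set _ hsub) (hH1.ae_kinMeasure (g := g) he),
      ae_mono (restrict_mono_set _ hsub) (hH2.ae_kinMeasure (g := g) he)] with p h1 h2
    rw [h1, h2]
  have hQ : MeasurableSet (Ico 0 T ×ˢ (univ : Set M) ×ˢ Ici (0 : ℝ)) :=
    measurableSet_Ico.prod (MeasurableSet.univ.prod measurableSet_Ici)
  have h6 := setIntegral_mono_set (integrableOn_overlap hK hL hR T) (by
      filter_upwards [ae_restrict_mem hQ] with p hp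
      have hp' : p ∈ phase (univ : Set M) := ⟨hp.1.1, hp.2⟩
      exact mul_nonneg (hK.range_χ p hp').1 (sub_nonneg.2 (hL.range_χ p hp').2))
    (LE.le.eventuallyLE (prod_mono_right (prod_mono (subset_univ e.source) Icc_subset_Ici_self)
      : Ico 0 T ×ˢ e.source ×ˢ Icc 0 R ⊆ Ico 0 T ×ˢ (univ : Set M) ×ˢ Ici (0 : ℝ)))
  refine le_of_eq_of_le (integral_congr_ae ?_) h6
  filter_upwards [h5, ae_restrict_mem (measurableSet_Ico.prod
    (e.open_source.measurableSet.prod measurableSet_Icc))] with p hp hps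
  rw [← hp]
  simp only [Prod.map, id, chartExt_eq hps.2.1]

theorem integral_sect_eq_overlap (he : e ∈ 𝒜[d, M])
    (hH1 : IsDensity H1) (hH2 : IsDensity H2) (hR1 : ∀ x, ∀ ξ ∈ Ioi R, H1 x ξ = 0) {K1 : Set (Eu d)}
    (hK1 : IsCompact K1) (hK1U : K1 ⊆ e.target) {φ : M → ℝ} (hψ : Continuous ψ)
    (hψφ : ∀ y ∈ e.target, ψ y = φ (e.symm y)) (hφ0 : ∀ x ∉ e.source, φ x = 0)
    (hw : ∀ y ∈ tsupport ψ, y ∈ K1 ∧ w y = sqrtDet g e y)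
    (hz1 : ∀ᵐ z ∂(μξ[g].restrict (e.source ×ˢ Ici 0)), H1 (T, e z.1) z.2 = K.χ (T, z))
    (hz2 : ∀ᵐ z ∂(μξ[g].restrict (e.source ×ˢ Ici 0)), H2 (T, e z.1) z.2 = 1 - L.χ (T, z)) :
    ∫ z, w z.1 * (ψ z.1 ^ 2 * (H1 (T, z.1) z.2 * H2 (T, z.1) z.2)) ∂(sect R K1)
      = ∫ z in univ ×ˢ Ici 0, φ z.1 ^ 2 * (K.χ (T, z) * (1 - L.χ (T, z))) ∂μξ[g] := by
  set F : Y[d] → ℝ := fun z => ψ z.1 ^ 2 * (H1 (T, z.1) z.2 * H2 (T, z.1) z.2) with hFdef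
  have hF : Measurable F := ((hψ.measurable.comp measurable_fst).pow_const 2).mul
    ((hH1.measurable_mul hH2).comp (f := fun z : Y[d] => ((T, z.1), z.2)) (by fun_prop))
  have hF0 : ∀ z : Y[d], z.1 ∉ tsupport ψ → F z = 0 := fun z hz => by
    have : ψ z.1 = 0 := eq_zero_off_tsupport hz
    simp [hFdef, this]
  have hS : MeasurableSet ((univ : Set M) ×ˢ Ici (0 : ℝ)) := MeasurableSet.univ.prod measurableSet_Ici
  have hSs : MeasurableSet (e.source ×ˢ Ici (0 : ℝ)) := e.open_source.measurableSet.prod measurableSet_Ici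
  have hSt : MeasurableSet (e.target ×ˢ Ici (0 : ℝ)) := e.open_target.measurableSet.prod measurableSet_Ici
  rw [setIntegral_eq_of_subset_of_forall_sdiff_eq_zero (s := e.source ×ˢ Ici (0 : ℝ)) hS
    (prod_mono_left (subset_univ _)) fun z hz => by
      rw [hφ0 z.1 fun h => hz.2 ⟨h, hz.1.2⟩]
      ring]
  have h1 : ∫ z in e.source ×ˢ Ici 0, φ z.1 ^ 2 * (K.χ (T, z) * (1 - L.χ (T, z))) ∂μξ[g]
      = ∫ z in e.source ×ˢ Ici 0, F (e z.1, z.2) ∂μξ[g] := by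
    refine integral_congr_ae ?_
    filter_upwards [hz1, hz2, ae_restrict_mem hSs] with z k1 k2 hz
    simp only [hFdef, k1, k2, hψφ _ (e.map_source hz.1), e.left_inv hz.1]
  rw [h1, setIntegral_chart_section g he (measurableSet_Ici (a := (0 : ℝ))) hF.aestronglyMeasurable, sect_eq_volume_restrict,
    setIntegral_eq_of_subset_of_forall_sdiff_eq_zero (s := K1 ×ˢ Icc (0 : ℝ) R) hSt
    (prod_mono hK1U Icc_subset_Ici_self) fun z hz => ?_]
  · refine setIntegral_congr_fun (hK1.isClosed.measurableSet.prod measurableSet_Icc) fun z hz => ?_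
    by_cases hy : z.1 ∈ tsupport ψ
    · simp only [(hw _ hy).2, hFdef]
    · have h2 := hF0 z hy
      simp only [hFdef] at h2 ⊢
      rw [h2, mul_zero, mul_zero]
  · by_cases hy : z.1 ∈ tsupport ψ
    · have hξ : z.2 ∈ Ioi R := by
        by_contra h
        exact hz.2 ⟨(hw _ hy).1, hz.1.2, not_lt.1 h⟩
      simp [hFdef, hR1 _ _ hξ]
    · rw [hF0 z hy, mul_zero]

end Chart

section ChartEstimate

/-- The coordinate expression of a smooth function with compact support in the domain of a chart. -/
theorem exists_coordinate_cutoff (he : e ∈ 𝒜[d, M]) {φ : M → ℝ}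
    (hφ : ContMDiff (𝓡 d) 𝓘(ℝ, ℝ) ∞ φ) (hφ01 : ∀ x, φ x ∈ Icc 0 1) (hφc : HasCompactSupport φ)
    (hφs : tsupport φ ⊆ e.source) : ∃ ψ : Eu d → ℝ, ContDiff ℝ ∞ ψ ∧ HasCompactSupport ψ ∧
      tsupport ψ ⊆ e.target ∧ (∀ y ∈ e.target, ψ y = φ (e.symm y)) ∧ ∀ y, ψ y ∈ Icc 0 1 := by
  classical
  set ψ : Eu d → ℝ := e.target.indicator (φ ∘ e.symm) with hψdef
  have hψφ : ∀ y ∈ e.target, ψ y = φ (e.symm y) := fun y hy => indicator_of_mem hy _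
  have hS : IsCompact (e '' tsupport φ) := hφc.isCompact.image_of_continuousOn (e.continuousOn.mono hφs)
  have hsub : tsupport ψ ⊆ e '' tsupport φ := closure_minimal (fun y hy => by
    have hyt : y ∈ e.target := by
      by_contra h
      exact hy (indicator_of_notMem h _)
    refine ⟨e.symm y, subset_tsupport _ ?_, e.right_inv hyt⟩
    rwa [Function.mem_support, ← hψφ y hyt]) hS.isClosed
  have hST : e '' tsupport φ ⊆ e.target := by
    rintro _ ⟨x, hx, rfl⟩
    exact e.map_source (hφs hx)
  refine ⟨ψ, contDiff_of_contDiffOn_of_tsupport e.open_target ?_ (hsub.trans hST),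
    hS.of_isClosed_subset (isClosed_tsupport _) hsub, hsub.trans hST, hψφ, fun y => ?_⟩
  · exact (contMDiffOn_iff_contDiffOn.1 (hφ.comp_contMDiffOn (contMDiffOn_symm_of_mem_maximalAtlas he))).congr hψφ
  · by_cases hy : y ∈ e.target
    · rw [hψφ y hy]
      exact hφ01 _
    · rw [hψdef, indicator_of_notMem hy]
      exact ⟨le_rfl, zero_le_one⟩

theorem ae_integrableOn_abs_sub (hK : IsKineticData g K) : ∀ᵐ t ∂vol₊,
    IntegrableOn (fun z : M × ℝ => |K.χ (t, z) - sgnPlus (K.u₀ z.1 - z.2)|) (univ ×ˢ Icc 0 R) μξ[g] := by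
  have := isFiniteMeasure_section (g := g) univ R
  filter_upwards [ae_aestronglyMeasurable_section hK, ae_restrict_mem measurableSet_Ici] with t ht ht0
  refine Integrable.of_bound (C := 1) ((ht.mono_measure (restrict_mono_set _ (prod_mono_right Icc_subset_Ici_self))).sub
    (aemeasurable_sgnPlus_sub hK.measurable_u₀).restrict.aestronglyMeasurable).norm ?_
  filter_upwards [ae_restrict_mem (MeasurableSet.univ.prod measurableSet_Icc)] with z hz
  have h1 := hK.range_χ (t, z) ⟨ht0, mem_univ _, hz.2.1⟩
  rw [norm_eq_abs, abs_abs, abs_le]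
  rcases sgnPlus_eq (K.u₀ z.1 - z.2) with h | h <;> rw [h] <;> constructor <;> linarith [h1.1, h1.2]

theorem abs_sub_isDensity (hH : IsDensity H) {H0 : Eu d → ℝ → ℝ}
    (hm : Measurable (uncurry H0)) (h01 : ∀ y ξ, H0 y ξ ∈ Icc 0 1) :
    IsDensity fun x ξ => |H x ξ - H0 x.2 ξ| where
  meas := continuous_abs.measurable.comp (hH.meas.sub (hm.comp (f := fun z : TX d × ℝ => (z.1.2, z.2)) (by fun_prop)))
  nonneg _ _ := abs_nonneg _
  le_one x ξ := by
    rw [abs_le]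
    constructor <;> linarith [hH.nonneg x ξ, hH.le_one x ξ, (h01 x.2 ξ).1, (h01 x.2 ξ).2]

theorem exists_chart_estimate (hcoeff : IsCoefficients g f A σ) (he : e ∈ 𝒜[d, M])
    (hω : IsMollifierPair ω1 ω2) (hK : IsKineticData g K) (hL : IsKineticData g L)
    (hKeq : KineticEquation g f A K) (hLeq : KineticEquation g f A L) (hKi : InitialCondition g K)
    (hLi : InitialCondition g L) (h₀ : K.u₀ =ᵐ[riemMeasure g] L.u₀) {φ : M → ℝ}
    (hφ : ContMDiff (𝓡 d) 𝓘(ℝ, ℝ) ∞ φ) (hφ01 : ∀ x, φ x ∈ Icc 0 1) (hφc : HasCompactSupport φ)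
    (hφs : tsupport φ ⊆ e.source) (hest : ∀ᵐ t ∂vol₊, limsup (fun ε : ℝ => limsup (fun δ : ℝ =>
          ((secondOrderBracket g ω1 ω2 A K L e φ t ε δ : ℝ) : EReal)) (𝓝[>] 0)) (𝓝[>] 0)
        ≤ ((C * ∫ p in Ico 0 t ×ˢ univ ×ˢ Ici 0, K.χ p * (1 - L.χ p) ∂(kinMeasure g) : ℝ) : EReal)) :
    ∃ C', ∀ᵐ T ∂vol₊, ∫ z in univ ×ˢ Ici 0, φ z.1 ^ 2 * (K.χ (T, z) * (1 - L.χ (T, z))) ∂μξ[g]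
        ≤ C' * ∫ p in Ico 0 T ×ˢ univ ×ˢ Ici 0, K.χ p * (1 - L.χ p) ∂(kinMeasure g) := by
  obtain ⟨R', hR'⟩ := hK.support_χ
  obtain ⟨R, hR0, hR⟩ : ∃ R, 0 ≤ R ∧ ∀ p ∈ phase (univ : Set M), R < p.2.2 → K.χ p = 0 :=
    ⟨max R' 0, le_max_right _ _, fun p hp h => hR' p hp ((le_max_left _ _).trans_lt h)⟩
  obtain ⟨ψ, hψ, hψc, hψU, hψφ, hψ01⟩ := exists_coordinate_cutoff he hφ hφ01 hφc hφs
  obtain ⟨κ, hκ⟩ := exists_mollKernel (d := d) hω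
  obtain ⟨w, K1, ρ, hw, hK1, hwK, hK1U, hρ, hwρ⟩ := exists_smooth_density (g := g) he hψc.isCompact hψU
  have hL1 : ∀ p ∈ phase (univ : Set M), 1 - L.χ p ∈ Icc 0 1 := fun p hp =>
    ⟨sub_nonneg.2 (hL.range_χ p hp).2, sub_le_self _ (hL.range_χ p hp).1⟩
  obtain ⟨H1, hH1, hR1⟩ := exists_isLift he hK.measurable_χ hK.range_χ (measurableSet_Ioi (a := R)) hR
  obtain ⟨H2, hH2, -⟩ := exists_isLift (h := fun p => 1 - L.χ p) he
    ((aemeasurable_const (b := 1)).sub hL.measurable_χ) hL1 MeasurableSet.empty (by simp)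
  obtain ⟨H2', h2', -⟩ := exists_isLift he hL.measurable_χ hL.range_χ MeasurableSet.empty (by simp)
  have hbv : OppositelyMonotone R H1 H2 := hH1.oppositelyMonotone hH2 hK.range_χ hL1 hK.antitone_χ
    fun t ht x a ha b hb hab => sub_le_sub_left (hL.antitone_χ t ht x ha hb hab) 1
  obtain ⟨v, hv, hvu⟩ := exists_measurable_lift he hK.measurable_u₀
  have hg := chartGeometry g he
  have hc := chartCoefficients hcoeff he
  obtain ⟨B, hB, hW⟩ := exists_admissibleField_locField hg hc hψ hψU hψc R
  obtain ⟨S, hS⟩ := exists_bound_locField hg hc hψ hψU hψc (R + 1)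
  obtain ⟨Sc, hSc⟩ := exists_bound_locPot hg hc hψ hψU hψc (R + 1)
  set H0 : Eu d → ℝ → ℝ := fun y ξ => sgnPlus (v y - ξ) with hH0
  have hm : Measurable (uncurry H0) := measurable_sgnPlus.comp ((hv.comp measurable_fst).sub measurable_snd)
  have h01 : ∀ y ξ, H0 y ξ ∈ Icc 0 1 := fun y ξ => by
    rcases sgnPlus_eq (v y - ξ) with h | h <;> simp only [hH0, h] <;> norm_num
  have hz1 := ae_ae_of_ae_kinMeasure (hH1.ae_kinMeasure (g := g) he)
  have hz2 := ae_ae_of_ae_kinMeasure (hH2.ae_kinMeasure (g := g) he)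
  have hv1 : ∀ᵐ z ∂(((riemMeasure g).prod vol[ℝ]).restrict (e.source ×ˢ Ici 0)),
      v (e z.1) = K.u₀ z.1 ∧ v (e z.1) = L.u₀ z.1 := by
    rw [← prod_restrict]
    refine quasiMeasurePreserving_fst.ae (p := fun x => v (e x) = K.u₀ x ∧ v (e x) = L.u₀ x) ?_
    filter_upwards [hvu, ae_restrict_of_ae h₀] with x h1 h2 using ⟨h1, h1.trans h2⟩
  have hi₁ := exists_time_integral_sect_le he (fun t z => abs_nonneg _) (ae_integrableOn_abs_sub hK)
    (tendsto_integral_abs_sub hK hKi R) (abs_sub_isDensity hH1.dens hm h01) (by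
      filter_upwards [hz1] with t ht
      filter_upwards [ht, hv1] with z h1 h2
      simp only [h1, hH0, h2.1]) hψc.isCompact hψU
  have hm' : Measurable (uncurry fun y ξ => 1 - H0 y ξ) := measurable_const.sub hm
  have hi₂ := exists_time_integral_sect_le he (fun t z => abs_nonneg _) (ae_integrableOn_abs_sub hL)
    (tendsto_integral_abs_sub hL hLi R) (abs_sub_isDensity hH2.dens (H0 := fun y ξ => 1 - H0 y ξ)
      hm' fun y ξ => ⟨sub_nonneg.2 (h01 y ξ).2, sub_le_self _ (h01 y ξ).1⟩) (by
      filter_upwards [hz2] with t ht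
      filter_upwards [ht, hv1] with z h1 h2
      simp only [h1, hH0, h2.2]
      rw [sub_sub_sub_cancel_left, abs_sub_comm]) hψc.isCompact hψU
  obtain ⟨C1, hC1, hfinal⟩ := overlap_le_of_limsup_le (Br := secondOrderBracket g ω1 ω2 A K L e φ) (forward_mollKernel hω hκ) hH1.dens hH2.dens hbv
    hω.smooth₁.continuous hω.compact₁ hω.nonneg₁ hω.mass₁ hω.supp₁ hK1 hB hW hS
    (continuous_locPot hg hc hψ hψU) hSc hψ hψ01 hψc.isCompact
    (fun y hy => eq_zero_off_tsupport (f := ψ) hy) hw hwK hR0 hm (fun y ξ => sgnPlus_eq _) hi₁ hi₂ (by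
      filter_upwards [Ioc_mem_nhdsGT (show 0 < ρ / κ.r from div_pos hρ κ.r_pos)] with ε hε
      filter_upwards [Ioc_mem_nhdsGT one_pos] with δ hδ T _
      exact secondOrderBracket_eq hcoeff he hω hκ hψ hψc hψU hψφ hψ01 hK1 hK1U hR0 hwρ hKeq hLeq hH1 hH2 h2' hR1 hε.1
        hδ.1 hδ.2 (by rw [mul_comm]; exact (le_div_iff₀ κ.r_pos).1 hε.2) T) hest
  obtain ⟨c, hc0, hslab⟩ := integral_slab_le_overlap he hK hL hR hH1 hH2 hK1 hK1U
  refine ⟨C + C1 * c, ?_⟩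
  filter_upwards [hfinal, hz1, hz2] with T hT h1 h2
  rw [integral_sect_eq_overlap he hH1.dens hH2.dens hR1 hK1 hK1U hψ.continuous hψφ
    (fun x hx => eq_zero_off_tsupport fun h => hx (hφs h))
    (fun y hy => hwρ y (Metric.self_subset_cthickening _ hy)) h1 h2] at hT
  refine hT.trans ?_
  have := mul_le_mul_of_nonneg_left (hslab T) hC1
  linarith

end ChartEstimate

section Gronwall

/-- Gronwall's inequality for integrable functions. -/
theorem integral_eq_zero_of_le_integral {θ : ℝ → ℝ} (hC : 0 ≤ C) (hi : ∀ T, IntegrableOn θ (Ico 0 T))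
    (h0 : ∀ᵐ s ∂vol₊, 0 ≤ θ s)
    (hle : ∀ᵐ s ∂vol₊, θ s ≤ C * ∫ r in Ico 0 s, θ r) (T : ℝ) :
    ∫ r in Ico 0 T, θ r = 0 := by
  have hsub : ∀ T : ℝ, ∀ᵐ s ∂(volume.restrict (Ico 0 T)), 0 ≤ θ s := fun T =>
    ae_restrict_of_ae_restrict_of_subset Ico_subset_Ici_self h0
  set G : ℝ → ℝ := fun T => ∫ r in Ico 0 T, θ r with hG
  have hG0 : ∀ s, 0 ≤ G s := fun s => integral_nonneg_of_ae (hsub s)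
  have hmono : ∀ s ≤ T, G s ≤ G T := fun s hs =>
    setIntegral_mono_set (hi T) (hsub T) (Ico_subset_Ico_right hs).eventuallyLE
  have key : ∀ n : ℕ, ∀ s, 0 ≤ s → s ≤ T → G s ≤ G T * ((C * s) ^ n / n.factorial) := by
    intro n
    induction n with
    | zero => intro s _ hs; simpa using hmono s hs
    | succ n ih =>
      intro s h0s hs
      have h1 : G s ≤ ∫ r in Ico 0 s, C * (G T * ((C * r) ^ n / n.factorial)) := by
        refine setIntegral_mono_ae_restrict (hi s) ?_ ?_
        · exact (Continuous.integrableOn_Icc (by fun_prop)).mono_set Ico_subset_Icc_self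
        · filter_upwards [ae_restrict_of_ae_restrict_of_subset (fun _ h => h.1) hle,
            ae_restrict_mem measurableSet_Ico] with r hr hrs
          exact hr.trans (mul_le_mul_of_nonneg_left (ih r hrs.1 (hrs.2.le.trans hs)) hC)
      refine h1.trans_eq ?_
      have h2 : ∀ r : ℝ, C * (G T * ((C * r) ^ n / n.factorial)) = (G T * C ^ (n + 1) / n.factorial) * r ^ n :=
        fun r => by rw [mul_pow]; ring
      simp_rw [h2]
      rw [integral_const_mul, integral_Ico_eq_integral_Ioc, ← intervalIntegral.integral_of_le h0s, integral_pow,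
        Nat.factorial_succ, mul_pow]
      push_cast
      have : (n.factorial : ℝ) ≠ 0 := by positivity
      field_simp
      simp
  rcases le_or_gt T 0 with hT | hT
  · rw [Ico_eq_empty (not_lt.2 hT), setIntegral_empty]
  · refine le_antisymm ?_ (hG0 T)
    have h1 := (FloorSemiring.tendsto_pow_div_factorial_atTop (C * T)).const_mul (G T)
    rw [mul_zero] at h1
    exact ge_of_tendsto' h1 fun n => key n T hT.le le_rfl

end Gronwall

section Uniqueness

theorem overlap_nonneg (hK : IsKineticData g K) (hL : IsKineticData g L) {p : ℝ × M × ℝ}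
    (hp : p ∈ phase (univ : Set M)) : 0 ≤ K.χ p * (1 - L.χ p) :=
  mul_nonneg (hK.range_χ p hp).1 (sub_nonneg.2 (hL.range_χ p hp).2)

theorem overlap_eq_zero (hcoeff : IsCoefficients g f A σ) (hω : IsMollifierPair ω1 ω2)
    (hK : IsKineticData g K) (hL : IsKineticData g L) (hKeq : KineticEquation g f A K)
    (hLeq : KineticEquation g f A L) (hKi : InitialCondition g K) (hLi : InitialCondition g L)
    (h₀ : K.u₀ =ᵐ[riemMeasure g] L.u₀) (hest : SecondOrderEstimate g ω1 ω2 A K L) :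
    ∀ᵐ p ∂((kinMeasure g).restrict (phase univ)), K.χ p * (1 - L.χ p) = 0 := by
  obtain ⟨N, e, φ, C, he, -, hφ, hφ0, hφs, hφ1, hest⟩ := hest
  have hφ01 : ∀ α x, φ α x ∈ Icc (0 : ℝ) 1 := fun α x => by
    refine ⟨hφ0 α x, ?_⟩
    have h1 : φ α x ^ 2 ≤ 1 := by
      rw [← hφ1 x]
      exact Finset.single_le_sum (f := fun α => φ α x ^ 2) (fun i _ => sq_nonneg _) (Finset.mem_univ α)
    exact (sq_le_one_iff₀ (hφ0 α x)).1 h1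
  choose C' hC' using fun α => exists_chart_estimate hcoeff (he α) hω hK hL hKeq hLeq hKi hLi h₀ (hφ α) (hφ01 α)
    (hφs α).1 (hφs α).2 (hest α)
  obtain ⟨R, hR⟩ := hK.support_χ
  set ν := (riemMeasure g).prod vol[ℝ] with hν
  set o : ℝ × M × ℝ → ℝ := fun p => K.χ p * (1 - L.χ p) with ho
  have hQ : ∀ T : ℝ, MeasurableSet (Ico 0 T ×ˢ (univ : Set M) ×ˢ Ici (0 : ℝ)) := fun T =>
    measurableSet_Ico.prod (MeasurableSet.univ.prod measurableSet_Ici)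
  have hsub : ∀ T : ℝ, Ico 0 T ×ˢ (univ : Set M) ×ˢ Ici (0 : ℝ) ⊆ phase univ := fun T =>
    prod_mono_left Ico_subset_Ici_self
  have hint : ∀ T : ℝ, Integrable o ((volume.restrict (Ico 0 T)).prod (ν.restrict (univ ×ˢ Ici 0))) := fun T => by
    have := integrableOn_overlap hK hL hR T
    rwa [IntegrableOn, kinMeasure_restrict] at this
  set Θ : ℝ → ℝ := fun t => ∫ z in univ ×ˢ Ici 0, o (t, z) ∂ν with hΘ
  have hfub : ∀ T : ℝ, ∫ p in Ico 0 T ×ˢ univ ×ˢ Ici 0, o p ∂(kinMeasure g) = ∫ t in Ico 0 T, Θ t := fun T => by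
    rw [kinMeasure_restrict, integral_prod _ (hint T)]
  have hsec : ∀ᵐ t ∂vol₊, IntegrableOn (fun z => o (t, z)) (univ ×ˢ Ici 0) ν := by
    have hU : Ici (0 : ℝ) = ⋃ n : ℕ, Ico (0 : ℝ) n := by
      ext t
      simp only [mem_Ici, mem_iUnion, mem_Ico]
      exact ⟨fun h => (exists_nat_gt t).imp fun n hn => ⟨h, hn⟩, fun ⟨n, h⟩ => h.1⟩
    suffices ∀ᵐ t ∂(volume.restrict (⋃ n : ℕ, Ico (0 : ℝ) n)), IntegrableOn (fun z => o (t, z)) (univ ×ˢ Ici 0) ν by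
      rwa [← hU] at this
    rw [ae_restrict_iUnion_iff]
    exact fun n => (hint n).prod_right_ae
  have hle : ∀ᵐ T ∂vol₊, Θ T ≤ (∑ α, |C' α|) * ∫ t in Ico 0 T, Θ t := by
    filter_upwards [ae_all_iff.2 hC', hsec, ae_restrict_mem measurableSet_Ici] with T hT hTi hT0
    have hG0 : 0 ≤ ∫ t in Ico 0 T, Θ t := by
      rw [← hfub]
      exact setIntegral_nonneg (hQ T) fun p hp => overlap_nonneg hK hL (hsub T hp)
    have h1 : Θ T = ∑ α, ∫ z in univ ×ˢ Ici 0, φ α z.1 ^ 2 * o (T, z) ∂ν := by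
      rw [← integral_finsetSum]
      · refine integral_congr_fun fun z => ?_
        simp only [← sum_mul, hφ1, one_mul]
      · intro α _
        refine hTi.bdd_mul (c := 1) ?_ (ae_of_all _ fun z => ?_)
        · exact (((hφ α).continuous.measurable.comp measurable_fst).pow_const 2).aestronglyMeasurable
        · rw [Real.norm_of_nonneg (sq_nonneg _)]
          exact pow_le_one₀ (hφ01 α z.1).1 (hφ01 α z.1).2
    rw [h1, sum_mul]
    refine Finset.sum_le_sum fun α _ => (hT α).trans ?_
    rw [hfub]
    exact mul_le_mul_of_nonneg_right (le_abs_self _) hG0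
  have hzero : ∀ T, ∫ t in Ico 0 T, Θ t = 0 := by
    refine integral_eq_zero_of_le_integral (Finset.sum_nonneg fun α _ => abs_nonneg (C' α))
      (fun T => (hint T).integral_prod_left) ?_ hle
    filter_upwards [ae_restrict_mem measurableSet_Ici] with t ht
    exact setIntegral_nonneg (MeasurableSet.univ.prod measurableSet_Ici) fun z hz => overlap_nonneg hK hL ⟨ht, hz⟩
  have hU : phase (univ : Set M) = ⋃ n : ℕ, Ico (0 : ℝ) n ×ˢ (univ : Set M) ×ˢ Ici (0 : ℝ) := by
    ext p
    simp only [phase, mem_prod, mem_iUnion, mem_Ico, mem_Ici]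
    exact ⟨fun h => (exists_nat_gt p.1).imp fun n hn => ⟨⟨h.1, hn⟩, h.2⟩, fun ⟨n, h⟩ => ⟨h.1.1, h.2⟩⟩
  rw [hU, ae_restrict_iUnion_iff]
  intro n
  refine (setIntegral_eq_zero_iff_of_nonneg_ae ?_ (integrableOn_overlap hK hL hR n)).1 ((hfub n).trans (hzero n))
  filter_upwards [ae_restrict_mem (hQ n)] with p hp using overlap_nonneg hK hL (hsub n hp)

/-- Comparing `K` with `L` and `L` with `K`, both densities are equal and take only the values `0` and `1`. -/
theorem eq_and_mem_of_overlap {P : Measure (ℝ × M × ℝ)} (h1 : ∀ᵐ p ∂P, K.χ p * (1 - L.χ p) = 0)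
    (h2 : ∀ᵐ p ∂P, L.χ p * (1 - K.χ p) = 0) : ∀ᵐ p ∂P, K.χ p = L.χ p ∧ (K.χ p = 0 ∨ K.χ p = 1) := by
  filter_upwards [h1, h2] with p h1 h2
  have h : K.χ p = L.χ p := by linarith
  refine ⟨h, ?_⟩
  rw [← h] at h1
  exact (mul_eq_zero.1 h1).imp_right fun h => by linarith

end Uniqueness

section Reconstruction

/-- A non-increasing function with values `0` and `1` is the indicator of an interval. -/
theorem ae_eq_sgnPlus {χ : ℝ → ℝ} (hχ : AntitoneOn χ (Ici 0)) (h01 : ∀ ξ ≥ 0, χ ξ ∈ Icc 0 1)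
    (hs : ∀ ξ, R < ξ → χ ξ = 0) (h : ∀ᵐ ξ ∂vol₊, χ ξ = 0 ∨ χ ξ = 1) :
    ∀ᵐ ξ ∂vol₊, χ ξ = sgnPlus ((∫ s in Icc 0 R, χ s) - ξ) ∧ ξ ≠ ∫ s in Icc 0 R, χ s ∧ ξ ≠ 0 := by
  have hint : IntegrableOn χ (Icc 0 R) := (hχ.mono Icc_subset_Ici_self).integrableOn_isCompact isCompact_Icc
  filter_upwards [h, ae_restrict_mem measurableSet_Ici, ae_restrict_of_ae (Measure.ae_ne volume (∫ s in Icc 0 R, χ s)),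
    ae_restrict_of_ae (Measure.ae_ne volume 0)] with ξ hξ hξ0 hne hne0
  refine ⟨?_, hne, hne0⟩
  have hξ0 : 0 ≤ ξ := hξ0
  have hI : ∫ _ in Icc 0 ξ, 1 = ξ := by simp [hξ0]
  rcases hξ with h0 | h1
  · have : ∫ s in Icc 0 R, χ s ≤ ξ := by
      have h2 : ∫ s in Icc 0 R, χ s ≤ ∫ s in Icc 0 R, (Icc 0 ξ).indicator 1 s := by
        refine setIntegral_mono_on hint ((integrable_indicator_iff measurableSet_Icc).2
          (by exact integrableOn_const measure_Icc_lt_top.ne)).integrableOn measurableSet_Icc fun s hs => ?_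
        by_cases h : s ≤ ξ
        · rw [indicator_of_mem (show s ∈ Icc 0 ξ from ⟨hs.1, h⟩)]
          exact (h01 s hs.1).2
        · rw [indicator_of_notMem fun h' => h h'.2, ← h0]
          exact hχ hξ0 hs.1 (not_le.1 h).le
      refine h2.trans ?_
      refine (setIntegral_le_integral ((integrable_indicator_iff measurableSet_Icc).2
          (by exact integrableOn_const measure_Icc_lt_top.ne)) (ae_of_all _ fun s => ?_)).trans_eq ?_
      · exact indicator_nonneg (fun _ _ => zero_le_one) s
      · rw [integral_indicator measurableSet_Icc]
        exact hI
    rw [h0, sgnPlus, if_neg (by linarith)]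
  · have hξR : ξ ≤ R := by
      by_contra! h
      exact one_ne_zero (h1.symm.trans (hs ξ h))
    have h2 : ξ ≤ ∫ s in Icc 0 R, χ s := by
      rw [← hI]
      refine (setIntegral_mono_on (integrableOn_const measure_Icc_lt_top.ne) (hint.mono_set (Icc_subset_Icc_right hξR))
        measurableSet_Icc fun s hs => ?_).trans (setIntegral_mono_set hint ?_ (Icc_subset_Icc_right hξR).eventuallyLE)
      · rw [← h1]
        exact hχ hs.1 hξ0 hs.2
      · filter_upwards [ae_restrict_mem measurableSet_Icc] with s hs using (h01 s hs.1).1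
    rw [h1, sgnPlus, if_pos (sub_pos.2 (lt_of_le_of_ne h2 hne))]

theorem chi_eq_sgnPlus {X : Type*} {u : ℝ × X → ℝ} {p : ℝ × X × ℝ} (h0 : 0 < p.2.2) (hne : p.2.2 ≠ u (p.1, p.2.1)) :
    chi u p = sgnPlus (u (p.1, p.2.1) - p.2.2) := by
  rw [chi, sgnPlus]
  rcases lt_or_gt_of_ne hne with h | h
  · rw [if_pos ⟨h0.le, h.le⟩, if_pos (sub_pos.2 h)]
  · rw [if_neg fun h' => h.not_ge h'.2, if_neg fun h' => h0.not_ge h'.2, if_neg (by linarith)]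

theorem ae_kinMeasure_iff {P : ℝ × M × ℝ → Prop} : (∀ᵐ p ∂((kinMeasure g).restrict (phase univ)), P p) ↔
    ∀ᵐ q ∂((vol₊.prod (riemMeasure g)).prod vol₊), P (q.1.1, q.1.2, q.2) := by
  have h1 := measurePreserving_prodAssoc vol₊ (riemMeasure g) vol₊
  have h2 : (kinMeasure g).restrict (phase univ)
      = (volume.restrict (Ici 0)).prod ((riemMeasure g).prod (volume.restrict (Ici 0))) := by
    rw [phase, kinMeasure_restrict, ← prod_restrict, restrict_univ]
  rw [h2, ← h1.map_eq, MeasurableEquiv.prodAssoc.measurableEmbedding.ae_map_iff]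
  rfl

theorem exists_eq_chi (hK : IsKineticData g K)
    (h : ∀ᵐ p ∂((kinMeasure g).restrict (phase univ)), K.χ p = 0 ∨ K.χ p = 1) :
    ∃ u : ℝ × M → ℝ, MemLp u ⊤ (vol₊.prod (riemMeasure g)) ∧
      ∀ᵐ p ∂((kinMeasure g).restrict (phase univ)), K.χ p = chi u p ∧ chi u p = sgnPlus (u (p.1, p.2.1) - p.2.2) := by
  obtain ⟨R', hR'⟩ := hK.support_χ
  obtain ⟨R, hR0, hR⟩ : ∃ R, 0 ≤ R ∧ ∀ p ∈ phase (univ : Set M), R < p.2.2 → K.χ p = 0 :=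
    ⟨max R' 0, le_max_right _ _, fun p hp h => hR' p hp ((le_max_left _ _).trans_lt h)⟩
  set J := vol₊ with hJ
  obtain ⟨χ, hχ, hχe⟩ := hK.measurable_χ
  have hm : Measurable fun q : (ℝ × M) × ℝ => χ (q.1.1, q.1.2, q.2) := hχ.comp (by fun_prop)
  set u : ℝ × M → ℝ := fun y => ∫ s in Icc 0 R, χ (y.1, y.2, s) with hu
  have hum : Measurable u := (hm.stronglyMeasurable.integral_prod_right (ν := volume.restrict (Icc 0 R))).measurable
  have hae : ∀ᵐ y ∂(J.prod (riemMeasure g)), 0 ≤ y.1 ∧ ∀ᵐ ξ ∂J, K.χ (y.1, y.2, ξ) = χ (y.1, y.2, ξ) ∧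
      (K.χ (y.1, y.2, ξ) = 0 ∨ K.χ (y.1, y.2, ξ) = 1) := by
    have h1 : ∀ᵐ y ∂(J.prod (riemMeasure g)), 0 ≤ y.1 :=
      quasiMeasurePreserving_fst.ae (p := fun t => 0 ≤ t) (ae_restrict_mem measurableSet_Ici)
    exact h1.and (ae_ae_of_ae_prod (ae_kinMeasure_iff.1 (hχe.and h)))
  have hfib : ∀ y : ℝ × M, 0 ≤ y.1 → (∀ᵐ ξ ∂J, K.χ (y.1, y.2, ξ) = χ (y.1, y.2, ξ) ∧
      (K.χ (y.1, y.2, ξ) = 0 ∨ K.χ (y.1, y.2, ξ) = 1)) → u y = ∫ s in Icc 0 R, K.χ (y.1, y.2, s) := by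
    intro y _ hy
    refine integral_congr_ae ?_
    filter_upwards [ae_restrict_of_ae_restrict_of_subset Icc_subset_Ici_self hy] with s hs using hs.1.symm
  refine ⟨u, memLp_top_of_bound hum.aestronglyMeasurable R ?_, ?_⟩
  · filter_upwards [hae] with y hy
    rw [hfib y hy.1 hy.2]
    refine (norm_setIntegral_le_of_norm_le_const (C := 1) measure_Icc_lt_top fun s hs => ?_).trans_eq ?_
    · have := hK.range_χ (y.1, y.2, s) ⟨hy.1, mem_univ _, hs.1⟩
      rw [Real.norm_of_nonneg this.1]
      exact this.2
    · simp [Measure.real, hR0]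
  · have hP : ∀ᵐ q ∂((J.prod (riemMeasure g)).prod J), χ (q.1.1, q.1.2, q.2) = sgnPlus (u q.1 - q.2) ∧
        q.2 ≠ u q.1 ∧ q.2 ≠ 0 := by
      refine (Measure.ae_prod_iff_ae_ae ?_).2 ?_
      · refine (measurableSet_eq_fun hm (measurable_sgnPlus.comp (by fun_prop))).inter
          ((measurableSet_eq_fun measurable_snd (hum.comp measurable_fst)).compl.inter
            (measurableSet_eq_fun measurable_snd measurable_const).compl)
      · filter_upwards [hae] with y hy
        have h1 := ae_eq_sgnPlus (χ := fun ξ => K.χ (y.1, y.2, ξ)) (hK.antitone_χ y.1 hy.1 y.2)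
          (fun ξ hξ => hK.range_χ _ ⟨hy.1, mem_univ _, hξ⟩)
          (fun ξ hξ => hR _ ⟨hy.1, mem_univ _, hR0.trans hξ.le⟩ hξ) (hy.2.mono fun _ h => h.2)
        rw [← hfib y hy.1 hy.2] at h1
        filter_upwards [h1, hy.2] with ξ h1 h2
        exact ⟨h2.1.symm.trans h1.1, h1.2⟩
    have hP' := (ae_kinMeasure_iff (g := g) (P := fun p => χ p = sgnPlus (u (p.1, p.2.1) - p.2.2) ∧
      p.2.2 ≠ u (p.1, p.2.1) ∧ p.2.2 ≠ 0)).2 hP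
    filter_upwards [hP', hχe, ae_restrict_mem (measurableSet_phase MeasurableSet.univ)] with p h1 h2 h3
    have h4 := chi_eq_sgnPlus (lt_of_le_of_ne h3.2.2 h1.2.2.symm) h1.2.1
    exact ⟨by rw [h2, h1.1, h4], h4⟩

end Reconstruction

end KineticManifold

end

theorem mainTheorem1 {d : ℕ} {M : Type*} [TopologicalSpace M] [T2Space M] [CompactSpace M]
    [ChartedSpace (KineticManifold.Eu d) M] [IsManifold (𝓡 d) ∞ M]
    [MeasurableSpace M] [BorelSpace M]
    (g : KineticManifold.Metric d M)
    (f : (x : M) → ℝ → TangentSpace (𝓡 d) x)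
    (A σ : (x : M) → ℝ → (TangentSpace (𝓡 d) x →L[ℝ] TangentSpace (𝓡 d) x))
    (hcoeff : KineticManifold.IsCoefficients g f A σ)
    (ω₁ ω₂ : ℝ → ℝ) (hω : KineticManifold.IsMollifierPair ω₁ ω₂)
    (F : Set (KineticManifold.KineticTuple M))
    (hF : KineticManifold.KineticallyAdmissible g ω₁ ω₂ f A F)
    (K L : KineticManifold.KineticTuple M) (hK : K ∈ F) (hL : L ∈ F)
    (h₀ : K.u₀ =ᵐ[KineticManifold.riemMeasure g] L.u₀) :
    (∀ᵐ p ∂((KineticManifold.kinMeasure g).restrict (KineticManifold.phase univ)),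
      K.χ p = L.χ p) ∧
    ∃ u : ℝ × M → ℝ,
      MemLp u ⊤ ((volume.restrict (Ici (0 : ℝ))).prod (KineticManifold.riemMeasure g)) ∧
      ∀ᵐ p ∂((KineticManifold.kinMeasure g).restrict (KineticManifold.phase univ)),
        K.χ p = KineticManifold.chi u p ∧
        KineticManifold.chi u p = KineticManifold.sgnPlus (u (p.1, p.2.1) - p.2.2) := by
  have h1 := KineticManifold.overlap_eq_zero hcoeff hω (hF.data K hK) (hF.data L hL) (hF.equation K hK)
    (hF.equation L hL) (hF.initial K hK) (hF.initial L hL) h₀ (hF.estimate K hK L hL)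
  have h2 := KineticManifold.overlap_eq_zero hcoeff hω (hF.data L hL) (hF.data K hK) (hF.equation L hL)
    (hF.equation K hK) (hF.initial L hL) (hF.initial K hK) h₀.symm (hF.estimate L hL K hK)
  have h := KineticManifold.eq_and_mem_of_overlap h1 h2
  exact ⟨h.mono fun _ h => h.1, KineticManifold.exists_eq_chi (hF.data K hK) (h.mono fun _ h => h.2)⟩
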